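/- Identify $\mathbb P^4$ with the hyperplane $\sum_{i=0}^5 x_i=0$ of $\mathbb P^5_{\mathbb C}$, and let $\mathcal S=\{G=0\}\subset\mathbb P^4$, $G=\sum_{i=0}^5 x_i^3$, be the Segre primal; it has ten nodes and contains fifteen planes $\Pi_\sigma:\ x_a+x_b=x_c+x_d=x_e+x_f=0$, one for each partition $\sigma=\{ab|cd|ef\}$ of $\{0,\dots,5\}$ into pairs. Let $E$ be a homogeneous cubic form on $\mathbb P^4$ that does not vanish at any node of $\mathcal S$, and let $$\mathcal F=\{(\ell,t)\ :\ \ell\subset\mathbb P^4 \text{ a line},\ t\in\mathbb A^1,\ \ell\subset X_t\},\qquad X_t=\{tE+G=0\},$$ be the family of Fano surfaces of the pencil, embedded by Plücker coordinates in a product of a projective space and $\mathbb A^1$. The central fibre $\mathcal F_0=F(\mathcal S)$ is the union of the fifteen planes $P_\sigma=\{\ell\subset\Pi_\sigma\}$ and of six quintic del Pezzo surfaces $D_T$: here $T$ runs over the six sets of five partitions $\sigma$ of which no two have a pair in common, and $D_T$ is the set of lines on $\mathcal S$ that meet $\Pi_\sigma$ for all $\sigma\in T$. The lines spanned by two nodes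 of $\mathcal S$ are called distinguished; through each of them, as a point of $\mathcal F_0$, pass two of the planes $P_\sigma$ and two of the surfaces $D_T$. Let $\pi:\widetilde{\mathcal F}\to\mathcal F$ be the blow-up of $\mathcal F$ along the fifteen planes $P_\sigma\subset \mathcal F_0$, that is, the closure of the graph of the maps to projective spaces that are defined by generators of the ideals of the $P_\sigma$. Then there is $\varepsilon>0$ such that over the disc $\Delta=\{|t|<\varepsilon\}$ the following holds. (A) $\pi$ consists of 45 small blow-ups, one at each of the 45 distinguished points of $\mathcal F_0$: away from these points $\pi$ is an isomorphism of complex manifolds; the fibre of $\pi$ over each distinguished point is a smooth curve homeomorphic to $\mathbb P^1$. The strict transform $B_\sigma$ of each plane $P_\sigma$ maps onto $P_\sigma$ and contains the exceptional curves over the distinguished points of $P_\sigma$; each $D_T$ is a smooth surface, to which its strict transform $\widetilde D_T$ maps bijectively. (B) $\widetilde{\mathcal F}\to\Delta$ is a semistable degeneration of surfaces: it is proper, $\widetilde{\mathcal F}|_\Delta$ is a complex manifold of dimension $3$, all fibres are connected, $t$ is a submersion at the points where $t\ne0$ (so the fibres over $t\neq0$ are smooth surfaces), and the central fibre is the union of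 the connected smooth compact surfaces $B_\sigma$ and $\widetilde D_T$, which have normal crossings: near each point of the central fibre there are holomorphic coordinates of $\widetilde{\mathcal F}$ in which the surfaces of this list that pass through the point are distinct coordinate planes and $t$ is the product of the corresponding coordinates. Moreover 1. two different components of the central fibre are either disjoint or intersect (transversally) along a smooth irreducible curve; 2. three different components meet in at most one point (where, by the above, they look like three coordinate planes); 3. four different components have empty intersection. -/

import Mathlib

open scoped LinearAlgebra.Projectivization Topology

noncomputable section

/-! ## Complex submanifolds of products of projective spaces -/

/-- The classical topology of a projective space, as a quotient of the non-zero vectors. -/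
instance projectivizationTopology (W : Type*) [AddCommGroup W] [Module ℂ W]
    [TopologicalSpace W] : TopologicalSpace (ℙ ℂ W) :=
  inferInstanceAs (TopologicalSpace (Quotient (projectivizationSetoid ℂ W)))

/-- A family of local holomorphic coordinate functions on a space: pairs `(dom, f)` of a domain
and of a function, to be used on the domain only. It is given below for `ℂ`, for projective spaces,
and for products of such spaces. -/
class LocalCoordinates (X : Type*) where
  coords : Set (Set X × (X → ℂ))

instance : LocalCoordinates ℂ where
  coords := {(Set.univ, id)}

/-- On a projective space the coordinate functions are the quotients of two linear forms. -/
instance (W : Type*) [AddCommGroup W] [Module ℂ W] : LocalCoordinates (ℙ ℂ W) where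
  coords := {c | ∃ lam mu : Module.Dual ℂ W,
    c = ({x | mu x.rep ≠ 0}, fun x => lam x.rep / mu x.rep)}

instance (X Y : Type*) [LocalCoordinates X] [LocalCoordinates Y] : LocalCoordinates (X × Y) where
  coords := (fun c => (Prod.fst ⁻¹' c.1, c.2 ∘ Prod.fst)) '' LocalCoordinates.coords (X := X) ∪
    (fun c => (Prod.snd ⁻¹' c.1, c.2 ∘ Prod.snd)) '' LocalCoordinates.coords (X := Y)

instance (ι X : Type*) [LocalCoordinates X] : LocalCoordinates (ι → X) where
  coords := ⋃ i : ι, (fun c => (Function.eval i ⁻¹' c.1, c.2 ∘ Function.eval i)) ''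
    LocalCoordinates.coords (X := X)

section Submanifolds

variable {X : Type*} [TopologicalSpace X] [LocalCoordinates X]

/-- The map `φ` is holomorphic at `x` (continuity of `φ` is required where this is used). -/
def HolomorphicAt {k : ℕ} (φ : (Fin k → ℂ) → X) (x : Fin k → ℂ) : Prop :=
  ∀ c ∈ LocalCoordinates.coords (X := X), φ x ∈ c.1 → AnalyticAt ℂ (c.2 ∘ φ) x

/-- The differential of `φ` at `x` is injective. -/
def ImmersiveAt {k : ℕ} (φ : (Fin k → ℂ) → X) (x : Fin k → ℂ) : Prop :=
  ∀ v : Fin k → ℂ, (∀ c ∈ LocalCoordinates.coords (X := X), φ x ∈ c.1 →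
    fderiv ℂ (c.2 ∘ φ) x v = 0) → v = 0

/-- `φ`, on the open neighbourhood `U` of `0` in `ℂ^k`, is a holomorphic chart (a local
parametrization) of the subset `Z`, centred at `z`: it is a holomorphic immersion and a topological
embedding, it maps `0` to `z`, and its image is an open subset of `Z`. -/
structure IsHolomorphicChart (k : ℕ) (Z : Set X) (z : X) (φ : (Fin k → ℂ) → X)
    (U : Set (Fin k → ℂ)) : Prop where
  isOpen : IsOpen U
  zero_mem : (0 : Fin k → ℂ) ∈ U
  map_zero : φ 0 = z
  holomorphic : ∀ x ∈ U, HolomorphicAt φ x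
  immersive : ∀ x ∈ U, ImmersiveAt φ x
  isEmbedding : Topology.IsEmbedding (U.domRestrict φ)
  image_open : ∃ O : Set X, IsOpen O ∧ φ '' U = Z ∩ O

/-- `Z` is an embedded complex submanifold, everywhere of dimension `k`. -/
def IsComplexSubmanifold (k : ℕ) (Z : Set X) : Prop :=
  ∀ z ∈ Z, ∃ φ U, IsHolomorphicChart k Z z φ U

/-- `t : Y → {|t| < ε}` is a semistable degeneration of surfaces whose central fibre is the union
of the surfaces `S i`. -/
structure IsSemistableDegeneration {ι : Type*} (ε : ℝ) (Y : Set X) (t : X → ℂ)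
    (S : ι → Set X) : Prop where
  /-- The family lies over the disc of radius `ε`, and it is proper over it. -/
  maps_to : ∀ z ∈ Y, ‖t z‖ < ε
  proper : ∀ K : Set ℂ, IsCompact K → K ⊆ Metric.ball 0 ε → IsCompact (Y ∩ t ⁻¹' K)
  /-- The total space is a complex manifold of dimension three. -/
  smooth_total : IsComplexSubmanifold 3 Y
  /-- Outside of the central fibre `t` is a submersion, hence the fibres are smooth surfaces. -/
  submersion : ∀ z ∈ Y, t z ≠ 0 → ∃ φ U, IsHolomorphicChart 3 Y z φ U ∧
    ∀ x ∈ U, t (φ x) = t z + x 0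
  smooth_fibre : ∀ s : ℂ, s ≠ 0 → ‖s‖ < ε → IsComplexSubmanifold 2 (Y ∩ t ⁻¹' {s})
  connected_fibre : ∀ s : ℂ, ‖s‖ < ε → IsConnected (Y ∩ t ⁻¹' {s})
  /-- The central fibre is the union of the `S i`, which are smooth irreducible surfaces. -/
  central_fibre : Y ∩ t ⁻¹' {0} = ⋃ i, S i
  closed_component : ∀ i, IsClosed (S i)
  connected_component : ∀ i, IsConnected (S i)
  smooth_component : ∀ i, IsComplexSubmanifold 2 (S i)
  /-- Normal crossings: at a point `z` of the central fibre there are coordinates of the total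
  space in which the surfaces `S i` through `z` are distinct coordinate planes, and `t` is the
  product of the corresponding coordinates (in particular the central fibre is reduced). -/
  normal_crossings : ∀ z ∈ Y, t z = 0 → ∃ φ U, IsHolomorphicChart 3 Y z φ U ∧
    ∃ c : {i // z ∈ S i} ↪ Fin 3,
      (∀ x ∈ U, t (φ x) = ∏ᶠ i : {i // z ∈ S i}, x (c i)) ∧
      (∀ x ∈ U, ∀ i : ι, φ x ∈ S i ↔ ∃ h : z ∈ S i, x (c ⟨i, h⟩) = 0)
  /-- Two components are disjoint or meet along a smooth irreducible curve (transversally, by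
  the previous item). -/
  two_components : ∀ i j, i ≠ j → S i ∩ S j = ∅ ∨
    (IsConnected (S i ∩ S j) ∧ IsComplexSubmanifold 1 (S i ∩ S j))
  /-- Three components meet in at most one point. -/
  three_components : ∀ i j k, i ≠ j → i ≠ k → j ≠ k → (S i ∩ S j ∩ S k).Subsingleton
  /-- Four components do not meet. -/
  four_components : ∀ i j k l, i ≠ j → i ≠ k → i ≠ l → j ≠ k → j ≠ l → k ≠ l →
    S i ∩ S j ∩ S k ∩ S l = ∅

end Submanifolds

/-! ## The Segre primal and the pencil of Fano surfaces

The space `ℙ^4` is the hyperplane `∑ x_i = 0` of `ℙ^5`. -/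

namespace Segre

/-- The equation of the Segre primal in the hyperplane `∑ x_i = 0`. -/
def cubic (x : Fin 6 → ℂ) : ℂ := ∑ i, x i ^ 3

/-- `q` represents a singular point of the Segre primal: the differential of the cubic vanishes
at `q` on the hyperplane. -/
def IsNode (q : Fin 6 → ℂ) : Prop :=
  q ≠ 0 ∧ ∑ i, q i = 0 ∧ cubic q = 0 ∧ ∀ v : Fin 6 → ℂ, ∑ i, v i = 0 → ∑ i, 3 * q i ^ 2 * v i = 0

/-- The vector space of Plücker coordinates. -/
abbrev PlückerSpace : Type := Fin 6 → Fin 6 → ℂ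

instance : TopologicalSpace (ℙ ℂ PlückerSpace) := projectivizationTopology _

instance : TopologicalSpace (ℙ ℂ (PlückerSpace × PlückerSpace)) := projectivizationTopology _

/-- The bivector `v ∧ w`; it is non-zero exactly if `v` and `w` are linearly independent. -/
def wedge (v w : Fin 6 → ℂ) : PlückerSpace := fun i j => v i * w j - v j * w i

/-- `l` is the Plücker point of the line spanned by `v` and `w` (in particular `v` and `w` are
linearly independent). -/
def IsLine (l : ℙ ℂ PlückerSpace) (v w : Fin 6 → ℂ) : Prop :=
  ∃ h : wedge v w ≠ 0, l = Projectivization.mk ℂ (wedge v w) h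

/-- The space `ℙ × 𝔸^1` in which the pencil of Fano surfaces lies. -/
abbrev Base : Type := ℙ ℂ PlückerSpace × ℂ

/-- The pencil of Fano surfaces: the pairs of a line `l` of `ℙ^4` and of `t ∈ ℂ` such that `l` lies
on the cubic threefold `t E + G = 0`, where `G` is the cubic form of the Segre primal. -/
def fanoFamily (E : MvPolynomial (Fin 6) ℂ) : Set Base :=
  {b | ∃ v w : Fin 6 → ℂ, ∑ i, v i = 0 ∧ ∑ i, w i = 0 ∧ IsLine b.1 v w ∧
    ∀ a c : ℂ, b.2 * MvPolynomial.eval (a • v + c • w) E + cubic (a • v + c • w) = 0}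

/-- The lines spanned by two nodes of the Segre primal, as points of the central fibre. -/
def distinguished : Set Base :=
  {b | b.2 = 0 ∧ ∃ q r : Fin 6 → ℂ, IsNode q ∧ IsNode r ∧ IsLine b.1 q r}

/-- A partition of `{0, …, 5}` into three pairs, as a fixed point free involution. -/
abbrev Syntheme : Type := {σ : Equiv.Perm (Fin 6) // (∀ i, σ (σ i) = i) ∧ ∀ i, σ i ≠ i}

/-- The linear subspace of the plane `x_a + x_b = x_c + x_d = x_e + x_f = 0` attached to the
partition `ab|cd|ef`; these are the fifteen planes of the Segre primal. -/
def InPlane (σ : Syntheme) (v : Fin 6 → ℂ) : Prop := ∀ i, v i + v (σ.1 i) = 0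

/-- The dual plane of the lines in the plane attached to `σ`, inside of the central fibre. -/
def planeLines (σ : Syntheme) : Set Base :=
  {b | b.2 = 0 ∧ ∃ v w : Fin 6 → ℂ, InPlane σ v ∧ InPlane σ w ∧ IsLine b.1 v w}

/-- The six totals: a total consists of five partitions into three pairs, no two of which have a
pair in common. -/
abbrev Total : Type :=
  {T : Finset Syntheme // T.card = 5 ∧ ∀ σ ∈ T, ∀ τ ∈ T, σ ≠ τ → ∀ i, σ.1 i ≠ τ.1 i}

/-- The del Pezzo component of the central fibre attached to a total: the lines on the Segre
primal that meet each of the five planes of the total. -/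
def delPezzoLines (T : Total) : Set Base :=
  {b | b.2 = 0 ∧ ∃ v w : Fin 6 → ℂ, ∑ i, v i = 0 ∧ ∑ i, w i = 0 ∧ IsLine b.1 v w ∧
    (∀ a c : ℂ, cubic (a • v + c • w) = 0) ∧
    ∀ σ ∈ T.1, ∃ a c : ℂ, a • v + c • w ≠ 0 ∧ InPlane σ (a • v + c • w)}

/-! ## The small blow-up

The linear forms `p i j + p (σ i) j` generate the homogeneous ideal of the lines in the plane
attached to `σ`, hence together with `t` they generate the ideal of `planeLines σ`. The blow-up of
all these planes is the closure of the graph of the maps to projective space that these generators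
define. At a distinguished line, where two of the planes meet and the family has an ordinary double
point, this is the small resolution in which the two planes are blown up. -/

/-- The generators of the ideal of `planeLines σ`, homogeneous of degree one in `p`. -/
def generators (σ : Syntheme) (p : PlückerSpace) (t : ℂ) : PlückerSpace × PlückerSpace :=
  (fun i j => p i j + p (σ.1 i) j, t • p)

/-- The space in which the blow-up lies. -/
abbrev Ambient : Type := Base × (Syntheme → ℙ ℂ (PlückerSpace × PlückerSpace))

/-- The graph of the maps given by the generators, over the points of the family that lie
on none of the planes. -/
def graph (E : MvPolynomial (Fin 6) ℂ) : Set Ambient :=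
  {z | z.1 ∈ fanoFamily E ∧ ∃ (p : PlückerSpace) (hp : p ≠ 0),
    z.1.1 = Projectivization.mk ℂ p hp ∧
    ∀ σ, ∃ h : generators σ p z.1.2 ≠ 0, z.2 σ = Projectivization.mk ℂ (generators σ p z.1.2) h}

/-- The blow-up of the family along the fifteen planes. -/
def blowUp (E : MvPolynomial (Fin 6) ℂ) : Set Ambient := closure (graph E)

/-- The blow-up, over the disc of radius `ε`. -/
def blowUpOver (E : MvPolynomial (Fin 6) ℂ) (ε : ℝ) : Set Ambient :=
  {z ∈ blowUp E | ‖z.1.2‖ < ε}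

/-- The strict transform of a subset of the family. -/
def strictTransform (E : MvPolynomial (Fin 6) ℂ) (C : Set Base) : Set Ambient :=
  closure {z ∈ blowUp E | z.1 ∈ C \ distinguished}

/-- The components of the central fibre of the blow-up: the strict transforms of the fifteen
planes and of the six del Pezzo surfaces. -/
def component (E : MvPolynomial (Fin 6) ℂ) : Syntheme ⊕ Total → Set Ambient
  | Sum.inl σ => strictTransform E (planeLines σ)
  | Sum.inr T => strictTransform E (delPezzoLines T)

/-- Over the disc of radius `ε`, the projection of the blow-up to the family replaces each
distinguished point by a projective line, it is an isomorphism elsewhere, and it blows up the planes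
at the distinguished points while it does not change the del Pezzo surfaces. -/
structure IsSmallBlowUp (E : MvPolynomial (Fin 6) ℂ) (ε : ℝ) : Prop where
  maps_to : ∀ z ∈ blowUpOver E ε, z.1 ∈ fanoFamily E
  /-- Away from the distinguished points: one preimage, and near it the projection carries a chart
  of the blow-up to a chart of the family. -/
  isomorphism : ∀ b ∈ fanoFamily E, ‖b.2‖ < ε → b ∉ distinguished →
    ∃ z ∈ blowUpOver E ε, z.1 = b ∧ (∀ z' ∈ blowUpOver E ε, z'.1 = b → z' = z) ∧
      ∃ φ U, IsHolomorphicChart 3 (blowUpOver E ε) z φ U ∧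
        IsHolomorphicChart 3 (fanoFamily E) b (fun x => (φ x).1) U
  card_distinguished : distinguished.ncard = 45
  /-- The fibre over a distinguished point is a smooth rational curve. -/
  exceptional_line : ∀ b ∈ distinguished,
    IsComplexSubmanifold 1 {z ∈ blowUp E | z.1 = b} ∧
    Nonempty ({z ∈ blowUp E | z.1 = b} ≃ₜ ℙ ℂ (Fin 2 → ℂ))
  /-- The strict transform of a plane maps onto the plane and contains the exceptional lines over
  the distinguished points of the plane. -/
  planes : ∀ σ : Syntheme, Prod.fst '' component E (Sum.inl σ) = planeLines σ ∧
    ∀ z ∈ blowUp E, z.1 ∈ planeLines σ ∩ distinguished → z ∈ component E (Sum.inl σ)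
  /-- The strict transform of a del Pezzo surface maps isomorphically onto it. -/
  delPezzo : ∀ T : Total, IsComplexSubmanifold 2 (delPezzoLines T) ∧
    Set.BijOn Prod.fst (component E (Sum.inr T)) (delPezzoLines T)

end Segre

end

open scoped ContDiff
open MvPolynomial (eval)
open Filter (Tendsto univ_mem inter_mem NeBot comap)
open LocalCoordinates (coords)
open Module (Dual)
open Topology (IsEmbedding)
open Function (Injective)
open Equiv (swap)
open Matrix (cons_val cons_val_zero cons_val_one cons_val_fin_one)

noncomputable section

notation:max "ℂ^" k:max => Fin k → ℂ
notation "ℂ³" => Fin 3 → ℂ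
notation "ℂ⁶" => Fin 6 → ℂ
notation "𝔖₆" => Equiv.Perm (Fin 6)
notation "𝒫₆" => MvPolynomial (Fin 6) ℂ

/-! ## Projective spaces: topology and local sections -/

namespace ProjTop

section Basic

variable {W : Type*} [AddCommGroup W] [Module ℂ W] [TopologicalSpace W]

/-- The point of the projective space spanned by a vector, with a junk value at zero. -/
def proj [Nontrivial W] (v : W) : ℙ ℂ W :=
  open Classical in if h : v ≠ 0 then Projectivization.mk ℂ v h else Classical.arbitrary _

lemma proj_eq [Nontrivial W] {v : W} (h : v ≠ 0) : proj v = Projectivization.mk ℂ v h := by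
  simp [proj, h]

lemma proj_smul [Nontrivial W] {v : W} {r : ℂ} (hr : r ≠ 0) : proj (r • v) = proj v := by
  by_cases h : v = 0
  · simp [h]
  · rw [proj_eq h, proj_eq (smul_ne_zero hr h), Projectivization.mk_eq_mk_iff']; exact ⟨r, rfl⟩

lemma proj_rep [Nontrivial W] (x : ℙ ℂ W) : proj x.rep = x := by
  rw [proj_eq x.rep_nonzero, Projectivization.mk_rep]

lemma exists_rep_eq [Nontrivial W] {v : W} (h : v ≠ 0) : ∃ r : ℂ, r ≠ 0 ∧ (proj v).rep = r • v := by
  rw [proj_eq h]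
  obtain ⟨a, ha⟩ := Projectivization.exists_smul_eq_mk_rep ℂ v h
  exact ⟨a, a.ne_zero, ha.symm⟩

lemma proj_eq_proj_iff [Nontrivial W] {v w : W} (hv : v ≠ 0) (hw : w ≠ 0) :
    proj v = proj w ↔ ∃ r : ℂ, r • w = v := by
  rw [proj_eq hv, proj_eq hw, Projectivization.mk_eq_mk_iff']

lemma isQuotientMap_mk' :
    Topology.IsQuotientMap (fun v : {v : W // v ≠ 0} => Projectivization.mk ℂ v.1 v.2) :=
  isQuotientMap_quotient_mk'

/-- The representative of `x` on which the linear form `μ` takes the value one. -/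
def sect (μ : Dual ℂ W) (x : ℙ ℂ W) : W := (μ x.rep)⁻¹ • x.rep

lemma sect_proj [Nontrivial W] (μ : Dual ℂ W) {v : W} (h : v ≠ 0) :
    sect μ (proj v) = (μ v)⁻¹ • v := by
  obtain ⟨r, hr, h'⟩ := exists_rep_eq h
  rw [sect, h', map_smul, smul_smul, smul_eq_mul, mul_inv, mul_right_comm,
    inv_mul_cancel₀ hr, one_mul]

lemma ratio_proj [Nontrivial W] (lam μ : Dual ℂ W) {v : W} (h : v ≠ 0) :
    lam (proj v).rep / μ (proj v).rep = lam v / μ v := by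
  obtain ⟨r, hr, h'⟩ := exists_rep_eq h
  rw [h', map_smul, map_smul, smul_eq_mul, smul_eq_mul, mul_div_mul_left _ _ hr]

lemma ne_zero_proj [Nontrivial W] (μ : Dual ℂ W) {v : W} (h : v ≠ 0) :
    μ (proj v).rep ≠ 0 ↔ μ v ≠ 0 := by
  obtain ⟨r, hr, h'⟩ := exists_rep_eq h
  rw [h', map_smul, smul_eq_mul, mul_ne_zero_iff]
  exact ⟨fun h => h.2, fun h => ⟨hr, h⟩⟩

lemma dual_sect (μ : Dual ℂ W) {x : ℙ ℂ W} (h : μ x.rep ≠ 0) : μ (sect μ x) = 1 := by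
  rw [sect, map_smul, smul_eq_mul, inv_mul_cancel₀ h]

lemma sect_ne_zero (μ : Dual ℂ W) {x : ℙ ℂ W} (h : μ x.rep ≠ 0) : sect μ x ≠ 0 :=
  smul_ne_zero (inv_ne_zero h) x.rep_nonzero

lemma proj_sect [Nontrivial W] (μ : Dual ℂ W) {x : ℙ ℂ W} (h : μ x.rep ≠ 0) :
    proj (sect μ x) = x := by
  rw [sect, proj_smul (inv_ne_zero h), proj_rep]

end Basic

section Normed

variable {W : Type*} [NormedAddCommGroup W] [NormedSpace ℂ W] [FiniteDimensional ℂ W] [Nontrivial W]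

lemma continuous_dual (μ : Dual ℂ W) : Continuous μ := μ.continuous_of_finiteDimensional

lemma isOpen_dual_ne (μ : Dual ℂ W) : IsOpen {x : ℙ ℂ W | μ x.rep ≠ 0} := by
  rw [← isQuotientMap_mk'.isOpen_preimage]
  have : (fun v : {v : W // v ≠ 0} => Projectivization.mk ℂ v.1 v.2) ⁻¹' {x | μ x.rep ≠ 0} =
      {v | μ v.1 ≠ 0} := by
    ext v
    simp only [Set.mem_preimage, Set.mem_ofPred_eq]
    rw [← proj_eq v.2, ne_zero_proj μ v.2]
  rw [this]
  exact isOpen_ne.preimage ((continuous_dual μ).comp continuous_subtype_val)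

lemma continuousOn_of_proj {Y : Type*} [TopologicalSpace Y] {O : Set (ℙ ℂ W)} (hO : IsOpen O)
    (f : ℙ ℂ W → Y) (hf : ContinuousOn (fun v => f (proj v)) {v : W | v ≠ 0 ∧ proj v ∈ O}) :
    ContinuousOn f O := by
  rw [continuousOn_iff_continuous_domRestrict]
  have hq : Topology.IsQuotientMap (O.restrictPreimage
      (fun v : {v : W // v ≠ 0} => Projectivization.mk ℂ v.1 v.2)) :=
    isQuotientMap_mk'.restrictPreimage_isOpen hO
  rw [hq.continuous_iff]
  rw [continuousOn_iff_continuous_domRestrict] at hf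
  have hg : Continuous (fun v : ((fun v : {v : W // v ≠ 0} =>
      Projectivization.mk ℂ v.1 v.2) ⁻¹' O) =>
      (⟨v.1.1, v.1.2, by rw [proj_eq v.1.2]; exact v.2⟩ : {v : W | v ≠ 0 ∧ proj v ∈ O})) :=
    Continuous.subtype_mk (continuous_subtype_val.comp continuous_subtype_val) _
  refine (hf.comp hg).congr fun v => ?_
  simp only [Function.comp, Set.domRestrict_apply, Set.restrictPreimage_coe]
  rw [proj_eq v.1.2]

lemma continuousOn_sect (μ : Dual ℂ W) : ContinuousOn (sect μ) {x : ℙ ℂ W | μ x.rep ≠ 0} := by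
  refine continuousOn_of_proj (isOpen_dual_ne μ) _ ?_
  have : ContinuousOn (fun v : W => (μ v)⁻¹ • v) {v : W | v ≠ 0 ∧ μ (proj v).rep ≠ 0} := by
    refine ContinuousOn.smul (ContinuousOn.inv₀ (continuous_dual μ).continuousOn ?_) continuousOn_id
    exact fun v hv => (ne_zero_proj μ hv.1).1 hv.2
  exact this.congr fun v hv => sect_proj μ hv.1

lemma continuousAt_sect (μ : Dual ℂ W) {x : ℙ ℂ W} (h : μ x.rep ≠ 0) : ContinuousAt (sect μ) x :=
  (continuousOn_sect μ).continuousAt ((isOpen_dual_ne μ).mem_nhds h)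

lemma continuousOn_proj : ContinuousOn (proj (W := W)) {v | v ≠ 0} := by
  rw [continuousOn_iff_continuous_domRestrict]
  refine isQuotientMap_mk'.continuous.congr fun v => ?_
  rw [Set.domRestrict_apply, proj_eq v.2]

lemma continuousAt_proj {v : W} (h : v ≠ 0) : ContinuousAt (proj (W := W)) v :=
  continuousOn_proj.continuousAt (isOpen_compl_singleton.mem_nhds h)

lemma exists_dual_ne_zero {v : W} (h : v ≠ 0) : ∃ μ : Dual ℂ W, μ v ≠ 0 := by
  by_contra! H
  exact h ((Module.forall_dual_apply_eq_zero_iff ℂ v).1 H)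

lemma exists_dual_ne_zero₂ {v w : W} (hv : v ≠ 0) (hw : w ≠ 0) :
    ∃ μ : Dual ℂ W, μ v ≠ 0 ∧ μ w ≠ 0 := by
  obtain ⟨μ, h1⟩ := exists_dual_ne_zero hv
  obtain ⟨ν, h2⟩ := exists_dual_ne_zero hw
  by_cases h3 : μ w = 0
  · by_cases h4 : ν v = 0; exacts [⟨μ + ν, by simp [h4, h1], by simp [h3, h2]⟩, ⟨ν, h4, h2⟩]
  · exact ⟨μ, h1, h3⟩

instance t2Space_projectivization : T2Space (ℙ ℂ W) := by
  refine ⟨fun x y hxy => ?_⟩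
  obtain ⟨μ, hx, hy⟩ := exists_dual_ne_zero₂ x.rep_nonzero y.rep_nonzero
  have hne : sect μ x ≠ sect μ y := fun h => hxy (by rw [← proj_sect μ hx, h, proj_sect μ hy])
  obtain ⟨A, B, hA, hB, hxA, hyB, hd⟩ := t2_separation hne
  refine ⟨{x | μ x.rep ≠ 0} ∩ sect μ ⁻¹' A, {x | μ x.rep ≠ 0} ∩ sect μ ⁻¹' B,
    (continuousOn_sect μ).isOpen_inter_preimage (isOpen_dual_ne μ) hA,
    (continuousOn_sect μ).isOpen_inter_preimage (isOpen_dual_ne μ) hB, ⟨hx, hxA⟩, ⟨hy, hyB⟩, ?_⟩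
  rw [Set.disjoint_left]
  rintro u ⟨-, h1⟩ ⟨-, h2⟩
  exact Set.disjoint_left.1 hd h1 h2

instance compactSpace_projectivization : CompactSpace (ℙ ℂ W) := by
  have hp : ProperSpace W := FiniteDimensional.proper ℂ W
  have h1 : IsCompact (Metric.sphere (0 : W) 1) := isCompact_sphere _ _
  have h2 : IsCompact (proj '' Metric.sphere (0 : W) 1) := by
    refine h1.image_of_continuousOn (continuousOn_proj.mono fun v hv h => ?_)
    simp [h] at hv
  have h3 : proj '' Metric.sphere (0 : W) 1 = Set.univ := by
    refine Set.eq_univ_of_forall fun x => ⟨((‖x.rep‖⁻¹ : ℝ) : ℂ) • x.rep, ?_, ?_⟩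
    · simp [norm_smul, x.rep_nonzero]
    · rw [proj_smul, proj_rep]; simpa using x.rep_nonzero
  exact ⟨h3 ▸ h2⟩

end Normed

end ProjTop

/-! ## Local coordinates of products -/

/-- The local coordinate functions are continuous on open domains. -/
class ContinuousCoordinates (X : Type*) [TopologicalSpace X] [LocalCoordinates X] : Prop where
  isOpen : ∀ c ∈ coords (X := X), IsOpen c.1
  continuousOn : ∀ c ∈ coords (X := X), ContinuousOn c.2 c.1

instance : ContinuousCoordinates ℂ where
  isOpen := by rintro c rfl; exact isOpen_univ
  continuousOn := by rintro c rfl; exact continuousOn_id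

instance {W : Type*} [NormedAddCommGroup W] [NormedSpace ℂ W] [FiniteDimensional ℂ W]
    [Nontrivial W] : ContinuousCoordinates (ℙ ℂ W) where
  isOpen := by rintro c ⟨lam, μ, rfl⟩; exact ProjTop.isOpen_dual_ne μ
  continuousOn := by
    rintro c ⟨lam, μ, rfl⟩
    refine ((ProjTop.continuous_dual lam).comp_continuousOn
      (ProjTop.continuousOn_sect μ)).congr fun x _ => ?_
    simp [ProjTop.sect, div_eq_inv_mul]

section Products

variable {X Y : Type*} [TopologicalSpace X] [LocalCoordinates X] [TopologicalSpace Y]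
  [LocalCoordinates Y] {k : ℕ}

lemma coords_fst {c : Set X × (X → ℂ)} (hc : c ∈ coords (X := X)) :
    (Prod.fst ⁻¹' c.1, c.2 ∘ Prod.fst) ∈ coords (X := X × Y) := Or.inl ⟨c, hc, rfl⟩

/-- Up to an additive constant, `f` is a coordinate function near `z`. -/
def IsCoordinate (f : X → ℂ) (z : X) : Prop :=
  ∃ c ∈ coords (X := X), z ∈ c.1 ∧ ∃ k, ∀ y, c.2 y = f y + k

lemma IsCoordinate.congr {f f' : X → ℂ} {z : X} (h : IsCoordinate f z) (k : ℂ)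
    (e : ∀ y, f y = f' y + k) : IsCoordinate f' z := by
  obtain ⟨c, hc, hz, m, hm⟩ := h
  exact ⟨c, hc, hz, k + m, fun y => by rw [hm, e, add_assoc]⟩

lemma IsCoordinate.fst {f : X → ℂ} {z : X × Y} (h : IsCoordinate f z.1) :
    IsCoordinate (fun y => f y.1) z := by
  obtain ⟨c, hc, hz, k, hk⟩ := h
  exact ⟨_, coords_fst hc, hz, k, fun y => hk y.1⟩

lemma IsCoordinate.continuousAt [ContinuousCoordinates X] {f : X → ℂ} {z : X}
    (h : IsCoordinate f z) : ContinuousAt f z := by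
  obtain ⟨c, hc, hz, k, hk⟩ := h
  rw [funext fun y => eq_sub_of_add_eq (hk y).symm]
  exact ((ContinuousCoordinates.continuousOn _ hc).continuousAt
    ((ContinuousCoordinates.isOpen _ hc).mem_nhds hz)).sub continuousAt_const

lemma coords_snd {c : Set Y × (Y → ℂ)} (hc : c ∈ coords (X := Y)) :
    (Prod.snd ⁻¹' c.1, c.2 ∘ Prod.snd) ∈ coords (X := X × Y) := Or.inr ⟨c, hc, rfl⟩

lemma coords_eval {ι : Type*} (i : ι) {c : Set Y × (Y → ℂ)} (hc : c ∈ coords (X := Y)) :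
    (Function.eval i ⁻¹' c.1, c.2 ∘ Function.eval i) ∈ coords (X := ι → Y) := Set.mem_iUnion.2 ⟨i, c, hc, rfl⟩

instance [ContinuousCoordinates X] [ContinuousCoordinates Y] : ContinuousCoordinates (X × Y) where
  isOpen := by
    rintro c (⟨d, hd, rfl⟩ | ⟨d, hd, rfl⟩)
    exacts [(ContinuousCoordinates.isOpen d hd).preimage continuous_fst,
      (ContinuousCoordinates.isOpen d hd).preimage continuous_snd]
  continuousOn := by
    rintro c (⟨d, hd, rfl⟩ | ⟨d, hd, rfl⟩)
    exacts [(ContinuousCoordinates.continuousOn d hd).comp continuousOn_fst fun _ h => h,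
      (ContinuousCoordinates.continuousOn d hd).comp continuousOn_snd fun _ h => h]

instance {ι : Type*} [ContinuousCoordinates X] : ContinuousCoordinates (ι → X) where
  isOpen := by
    intro c hc
    obtain ⟨i, d, hd, rfl⟩ := Set.mem_iUnion.1 hc
    exact (ContinuousCoordinates.isOpen d hd).preimage (continuous_apply i)
  continuousOn := by
    intro c hc
    obtain ⟨i, d, hd, rfl⟩ := Set.mem_iUnion.1 hc
    exact (ContinuousCoordinates.continuousOn d hd).comp (continuous_apply i).continuousOn
      fun _ h => h

lemma holomorphicAt_prod {φ : ℂ^k → X × Y} {x : ℂ^k} :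
    HolomorphicAt φ x ↔ HolomorphicAt (fun y => (φ y).1) x ∧ HolomorphicAt (fun y => (φ y).2) x := by
  constructor
  · intro h; exact ⟨fun c hc hx => h _ (coords_fst hc) hx, fun c hc hx => h _ (coords_snd hc) hx⟩
  · rintro ⟨h1, h2⟩ c (⟨d, hd, rfl⟩ | ⟨d, hd, rfl⟩) hx
    exacts [h1 d hd hx, h2 d hd hx]

lemma holomorphicAt_pi {ι : Type*} {φ : ℂ^k → ι → X} {x : ℂ^k} :
    HolomorphicAt φ x ↔ ∀ i, HolomorphicAt (fun y => φ y i) x := by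
  constructor
  · intro h i c hc hx; exact h _ (coords_eval i hc) hx
  · intro h c hc hx; obtain ⟨i, d, hd, rfl⟩ := Set.mem_iUnion.1 hc; exact h i d hd hx

lemma holomorphicAt_complex {φ : ℂ^k → ℂ} {x : ℂ^k} : HolomorphicAt φ x ↔ AnalyticAt ℂ φ x := by
  constructor
  · intro h; exact h (Set.univ, id) rfl trivial
  · rintro h c rfl -; exact h

lemma holomorphicAt_proj {W : Type*} [NormedAddCommGroup W] [NormedSpace ℂ W]
    [FiniteDimensional ℂ W] [Nontrivial W] {f : ℂ^k → W} {x : ℂ^k}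
    (hf : AnalyticAt ℂ f x) (h0 : f x ≠ 0) : HolomorphicAt (fun y => ProjTop.proj (f y)) x := by
  rintro c ⟨lam, μ, rfl⟩ hx
  have hx' : μ (f x) ≠ 0 := (ProjTop.ne_zero_proj μ h0).1 hx
  have hl : ∀ ν : Dual ℂ W, AnalyticAt ℂ (fun y => ν (f y)) x := fun ν =>
    (ν.toContinuousLinearMap.analyticAt _).comp hf
  refine ((hl lam).div (hl μ) hx').congr ?_
  filter_upwards [hf.continuousAt.eventually_ne h0] with y hy
  exact (ProjTop.ratio_proj lam μ hy).symm

end Products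

/-! ## Holomorphic charts -/

lemma analyticAt_coord {k : ℕ} (j : Fin k) (x : ℂ^k) : AnalyticAt ℂ (fun y : ℂ^k => y j) x :=
  (ContinuousLinearMap.proj (R := ℂ) (φ := fun _ : Fin k => ℂ) j).analyticAt x

lemma fderiv_coord {k : ℕ} (j : Fin k) (x v : ℂ^k) : fderiv ℂ (fun y : ℂ^k => y j) x v = v j :=
  congrArg (fun L : ℂ^k →L[ℂ] ℂ => L v)
    (ContinuousLinearMap.proj (R := ℂ) (φ := fun _ : Fin k => ℂ) j).fderiv

lemma analyticAt_vec {k : ℕ} {f g h : ℂ^k → ℂ} {x : ℂ^k} (hf : AnalyticAt ℂ f x)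
    (hg : AnalyticAt ℂ g x) (hh : AnalyticAt ℂ h x) :
    AnalyticAt ℂ (fun y => ![f y, g y, h y]) x :=
  analyticAt_pi_iff.2 fun j => by fin_cases j; exacts [hf, hg, hh]

lemma vec_ext {v w : ℂ³} (h0 : v 0 = w 0) (h1 : v 1 = w 1) (h2 : v 2 = w 2) : v = w := by
  funext j; fin_cases j; exacts [h0, h1, h2]

lemma tendsto_smul_zero {k : ℕ} (v : ℂ^k) : Tendsto (fun s : ℂ => s • v) (𝓝 0) (𝓝 0) := by
  simpa using (by fun_prop : Continuous fun s : ℂ => s • v).tendsto 0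

lemma eq_of_mem_closure {Z Y : Type*} [TopologicalSpace Z] [TopologicalSpace Y] [T2Space Y]
    {Γ : Set Z} {z : Z} (hz : z ∈ closure Γ) {f g : Z → Y} (hf : ContinuousAt f z)
    (hg : ContinuousAt g z) (h : ∀ᶠ y in 𝓝[Γ] z, f y = g y) : f z = g z := by
  have : NeBot (𝓝[Γ] z) := mem_closure_iff_nhdsWithin_neBot.1 hz
  exact tendsto_nhds_unique ((hf.tendsto.mono_left nhdsWithin_le_nhds).congr' h)
    (hg.tendsto.mono_left nhdsWithin_le_nhds)

lemma exists_analytic_localInverse {k : ℕ} {h : ℂ^k → ℂ^k} {x : ℂ^k}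
    (hh : AnalyticAt ℂ h x) (hinj : ∀ v, fderiv ℂ h x v = 0 → v = 0) {N : Set ℂ^k}
    (hN : N ∈ 𝓝 x) :
    ∃ e : OpenPartialHomeomorph ℂ^k ℂ^k, x ∈ e.source ∧ e.source ⊆ N ∧ (∀ y, e y = h y) ∧
      (∀ y ∈ e.source, AnalyticAt ℂ h y ∧ ∀ v, fderiv ℂ h y v = 0 → v = 0) ∧
      (∀ y ∈ e.target, AnalyticAt ℂ e.symm y ∧ ∀ v, fderiv ℂ e.symm y v = 0 → v = 0) := by
  have equiv_of : ∀ y, (∀ v, fderiv ℂ h y v = 0 → v = 0) →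
      ∃ E : ℂ^k ≃L[ℂ] ℂ^k, (E : ℂ^k →L[ℂ] ℂ^k) = fderiv ℂ h y := by
    intro y hy
    have hi : Injective (fderiv ℂ h y).toLinearMap := (injective_iff_map_eq_zero _).2 hy
    exact ⟨(LinearEquiv.ofInjectiveEndo _ hi).toContinuousLinearEquiv, by ext; rfl⟩
  have hinj_of : ∀ y (E : ℂ^k ≃L[ℂ] ℂ^k),
      (E : ℂ^k →L[ℂ] ℂ^k) = fderiv ℂ h y → ∀ v, fderiv ℂ h y v = 0 → v = 0 := by
    intro y E hE v hv
    rw [← hE] at hv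
    exact E.map_eq_zero_iff.1 hv
  obtain ⟨E, hE⟩ := equiv_of x hinj
  have hc : ContDiffAt ℂ ω h x := hh.contDiffAt
  have hf' : HasFDerivAt h (E : ℂ^k →L[ℂ] ℂ^k) x := by
    rw [hE]; exact hh.differentiableAt.hasFDerivAt
  set e₀ := hc.toOpenPartialHomeomorph h hf' (by simp) with he₀
  have hx₀ : x ∈ e₀.source := hc.mem_toOpenPartialHomeomorph_source hf' (by simp)
  have hcont : ContinuousAt (fderiv ℂ h) x := hh.fderiv.continuousAt
  have hev : ∀ᶠ y in 𝓝 x, y ∈ N ∧ AnalyticAt ℂ h y ∧ ∀ v, fderiv ℂ h y v = 0 → v = 0 := by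
    refine Filter.Eventually.and hN (hh.eventually_analyticAt.and ?_)
    have ho : IsOpen (Set.range ((↑) : (ℂ^k ≃L[ℂ] ℂ^k) → (ℂ^k →L[ℂ] ℂ^k))) :=
      ContinuousLinearEquiv.isOpen
    have := hcont.eventually (ho.mem_nhds ⟨E, hE⟩)
    filter_upwards [this] with y ⟨E', hE'⟩
    exact hinj_of y E' hE'
  obtain ⟨O, hO, hOo, hxO⟩ := mem_nhds_iff.1 hev
  refine ⟨e₀.restrOpen O hOo, ⟨hx₀, hxO⟩, fun y hy => (hO hy.2).1, fun y => rfl,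
    fun y hy => (hO hy.2).2, fun y hy => ?_⟩
  have hsrc : e₀.symm y ∈ O ∧ y ∈ e₀.target := by
    simpa [OpenPartialHomeomorph.restrOpen, and_comm] using hy
  obtain ⟨-, ha, hi⟩ := hO hsrc.1
  obtain ⟨E', hE'⟩ := equiv_of _ hi
  have hd' : HasFDerivAt h (E' : ℂ^k →L[ℂ] ℂ^k) (e₀.symm y) := by
    rw [hE']; exact ha.differentiableAt.hasFDerivAt
  have hs : ContDiffAt ℂ ω e₀.symm y := e₀.contDiffAt_symm hsrc.2 hd' ha.contDiffAt
  have hsa : AnalyticAt ℂ e₀.symm y := hs.analyticAt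
  refine ⟨hsa, fun v hv => ?_⟩
  have hcomp : HasFDerivAt (fun z => h (e₀.symm z))
      ((E' : ℂ^k →L[ℂ] ℂ^k).comp (fderiv ℂ e₀.symm y)) y :=
    hd'.comp y hsa.differentiableAt.hasFDerivAt
  have hid : (fun z => h (e₀.symm z)) =ᶠ[𝓝 y] id := by
    filter_upwards [e₀.open_target.mem_nhds hsrc.2] with z hz
    exact e₀.right_inv hz
  have := (hcomp.congr_of_eventuallyEq hid.symm).unique (hasFDerivAt_id y)
  have h2 := congrArg (fun L : ℂ^k →L[ℂ] ℂ^k => L v) this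
  have hv' : fderiv ℂ e₀.symm y v = 0 := hv
  simpa [hv'] using h2.symm

namespace IsHolomorphicChart

variable {X : Type*} [TopologicalSpace X] [LocalCoordinates X] {k : ℕ} {Z : Set X} {z : X}
  {φ : ℂ^k → X} {U : Set ℂ^k}

lemma image_of_open (h : IsHolomorphicChart k Z z φ U) {V : Set ℂ^k} (hV : IsOpen V)
    (hVU : V ⊆ U) : ∃ O : Set X, IsOpen O ∧ φ '' V = Z ∩ O := by
  obtain ⟨O, hO, hOU⟩ := h.image_open
  have h1 : IsOpen ((↑) ⁻¹' V : Set U) := hV.preimage continuous_subtype_val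
  obtain ⟨O', hO', hV'⟩ := h.isEmbedding.isInducing.isOpen_iff.1 h1
  refine ⟨O ∩ O', hO.inter hO', ?_⟩
  have key : ∀ x (hx : x ∈ U), x ∈ V ↔ φ x ∈ O' := fun x hx => by
    have := Set.ext_iff.1 hV' ⟨x, hx⟩
    exact this.symm
  ext y
  constructor
  · rintro ⟨x, hx, rfl⟩
    have : φ x ∈ Z ∩ O := hOU ▸ ⟨x, hVU hx, rfl⟩
    exact ⟨this.1, this.2, (key x (hVU hx)).1 hx⟩
  · rintro ⟨h1, h2, h3⟩
    obtain ⟨x, hx, rfl⟩ : y ∈ φ '' U := hOU ▸ ⟨h1, h2⟩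
    exact ⟨x, (key x hx).2 h3, rfl⟩

lemma continuousOn (h : IsHolomorphicChart k Z z φ U) : ContinuousOn φ U :=
  continuousOn_iff_continuous_domRestrict.2 h.isEmbedding.continuous

lemma continuousAt (h : IsHolomorphicChart k Z z φ U) {x} (hx : x ∈ U) : ContinuousAt φ x :=
  h.continuousOn.continuousAt (h.isOpen.mem_nhds hx)

lemma mapsTo (h : IsHolomorphicChart k Z z φ U) {x} (hx : x ∈ U) : φ x ∈ Z := by
  obtain ⟨O, -, hOU⟩ := h.image_open
  exact (hOU ▸ Set.mem_image_of_mem φ hx : φ x ∈ Z ∩ O).1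

lemma comp_openPartialHomeomorph (h : IsHolomorphicChart k Z z φ U)
    (e : OpenPartialHomeomorph ℂ^k ℂ^k) (h0 : 0 ∈ e.source) (ht : e.target ⊆ U)
    (ha : ∀ y ∈ e.source, AnalyticAt ℂ e y ∧ ∀ v, fderiv ℂ e y v = 0 → v = 0) :
    IsHolomorphicChart k Z (φ (e 0)) (φ ∘ e) e.source where
  isOpen := e.open_source
  zero_mem := h0
  map_zero := rfl
  holomorphic := fun x hx c hc hxc =>
    (h.holomorphic _ (ht (e.map_source hx)) c hc hxc).comp (ha x hx).1
  immersive := by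
    intro x hx v hv
    refine (ha x hx).2 v (h.immersive _ (ht (e.map_source hx)) _ fun c hc hxc => ?_)
    rw [← hv c hc hxc, ← Function.comp_assoc]
    have := fderiv_comp (g := c.2 ∘ φ) x
      (h.holomorphic _ (ht (e.map_source hx)) c hc hxc).differentiableAt (ha x hx).1.differentiableAt
    rw [this]; rfl
  isEmbedding := by
    have h1 : IsEmbedding (e.source.domRestrict e) := e.isOpenEmbedding_restrict.isEmbedding
    exact h.isEmbedding.comp (h1.codRestrict U fun x => ht (e.map_source x.2))
  image_open := by
    rw [Set.image_comp, e.image_source_eq_target]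
    exact h.image_of_open e.open_target ht

lemma translate (h : IsHolomorphicChart k Z z φ U) {x : ℂ^k} {V : Set ℂ^k}
    (hV : IsOpen V) (hVU : V ⊆ U) (hx : x ∈ V) :
    IsHolomorphicChart k Z (φ x) (fun y => φ (x + y)) ((fun y => x + y) ⁻¹' V) := by
  let e₀ := (Homeomorph.addLeft x).toOpenPartialHomeomorph
  have hpre : IsOpen ((fun y => x + y) ⁻¹' V) := hV.preimage (by fun_prop)
  let e := e₀.restrOpen ((fun y => x + y) ⁻¹' V) hpre
  have hs : e.source = (fun y => x + y) ⁻¹' V := by simp [e, e₀]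
  have key := h.comp_openPartialHomeomorph e (by rw [hs]; simpa using hx) (by
      intro y hy
      have h1 := e.map_target hy
      rw [hs] at h1
      have h2 : e (e.symm y) = y := e.right_inv hy
      exact hVU (h2 ▸ h1)) (by
      intro y _
      have : (e : ℂ^k → ℂ^k) = fun y => x + y := rfl
      rw [this]
      refine ⟨by fun_prop, fun v hv => ?_⟩
      rw [fderiv_const_add, fderiv_fun_id] at hv
      exact hv)
  rw [hs] at key
  have h0 : e 0 = x := add_zero x
  rw [h0] at key
  exact key

lemma restrict (h : IsHolomorphicChart k Z z φ U) {V : Set ℂ^k}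
    (hV : IsOpen V) (hVU : V ⊆ U) (h0 : 0 ∈ V) : IsHolomorphicChart k Z z φ V := by
  have := h.translate hV hVU h0
  simpa [h.map_zero] using this

lemma inter_open (h : IsHolomorphicChart k Z z φ U) {O Z' : Set X} (hO : IsOpen O) (hz : z ∈ O)
    (hZ' : Z' = Z ∩ O) : IsHolomorphicChart k Z' z φ (U ∩ φ ⁻¹' O) := by
  have hop := h.continuousOn.isOpen_inter_preimage h.isOpen hO
  have hr := h.restrict hop Set.inter_subset_left ⟨h.zero_mem, by simpa [h.map_zero] using hz⟩
  refine ⟨hop, hr.zero_mem, hr.map_zero, hr.holomorphic, hr.immersive, hr.isEmbedding, ?_⟩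
  obtain ⟨O', hO', h'⟩ := hr.image_open
  refine ⟨O', hO', ?_⟩
  rw [h', hZ', Set.inter_right_comm]
  refine (Set.inter_eq_left.2 ?_).symm
  rw [← h']
  rintro _ ⟨x, hx, rfl⟩
  exact hx.2

lemma slice {m : ℕ} (h : IsHolomorphicChart k Z z φ U) (f : Fin m ↪ Fin k) {S : Set X}
    (hSZ : S ⊆ Z) (hS : ∀ x ∈ U, φ x ∈ S ↔ ∀ i, i ∉ Set.range f → x i = 0) :
    IsHolomorphicChart m S z (fun x => φ (Function.extend f x 0))
      ((fun x => Function.extend f x 0) ⁻¹' U) := by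
  classical
  let L : ℂ^m →L[ℂ] ℂ^k := (Function.ExtendByZero.linearMap ℂ f).toContinuousLinearMap
  have hL : (fun x : ℂ^m => (Function.extend f x 0 : ℂ^k)) = L := rfl
  have hLf : ∀ x j, L x (f j) = x j := fun x j => f.injective.extend_apply _ _ _
  have hL0 : ∀ x i, i ∉ Set.range f → L x i = 0 := fun x i hi =>
    Function.extend_apply' _ _ _ hi
  have hLi : ∀ v, L v = 0 → v = 0 := fun v hv => by funext j; rw [← hLf v j, hv]; rfl
  have hLemb : IsEmbedding L := IsEmbedding.of_leftInverse (f := fun y : ℂ^k => y ∘ f)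
      (fun x => funext fun j => hLf x j) (by fun_prop) L.continuous
  change IsHolomorphicChart m S z (φ ∘ L) (L ⁻¹' U)
  refine ⟨h.isOpen.preimage L.continuous, by simpa using h.zero_mem, by simp [h.map_zero],
    fun x hx c hc hxc => (h.holomorphic _ hx c hc hxc).comp (L.analyticAt x), ?_, ?_, ?_⟩
  · intro x hx v hv
    refine hLi v (h.immersive _ hx _ fun c hc hxc => ?_)
    rw [← hv c hc hxc, ← Function.comp_assoc, fderiv_comp (g := c.2 ∘ φ) x
      (h.holomorphic _ hx c hc hxc).differentiableAt L.differentiableAt]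
    simp
  · exact h.isEmbedding.comp ((hLemb.comp IsEmbedding.subtypeVal).codRestrict U fun x => x.2)
  · obtain ⟨O, hO, hOU⟩ := h.image_open
    refine ⟨O, hO, ?_⟩
    ext y
    constructor
    · rintro ⟨x, hx, rfl⟩
      refine ⟨(hS _ hx).2 (hL0 x), ?_⟩
      exact (hOU ▸ Set.mem_image_of_mem φ hx : φ (L x) ∈ Z ∩ O).2
    · rintro ⟨h1, h2⟩
      obtain ⟨x, hx, rfl⟩ : y ∈ φ '' U := hOU ▸ ⟨hSZ h1, h2⟩
      have hxL : L (x ∘ f) = x := by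
        funext i
        by_cases hi : i ∈ Set.range f
        · obtain ⟨j, rfl⟩ := hi; rw [hLf]; rfl
        · rw [hL0 _ _ hi, (hS x hx).1 h1 i hi]
      exact ⟨x ∘ f, by rwa [Set.mem_preimage, hxL], by simp [hxL]⟩

lemma push {X' : Type*} [TopologicalSpace X'] [LocalCoordinates X'] {p : X → X'} {A : Set X}
    {F : Set X'} (h : IsHolomorphicChart k Z z φ U) (hA : A ⊆ Z) (hUA : ∀ x ∈ U, φ x ∈ A)
    (hp : IsEmbedding (A.domRestrict p)) (hF : ∃ O, IsOpen O ∧ p '' A = F ∩ O)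
    (hhol : ∀ x ∈ U, HolomorphicAt (p ∘ φ) x) (himm : ∀ x ∈ U, ImmersiveAt (p ∘ φ) x) :
    IsHolomorphicChart k F (p z) (p ∘ φ) U where
  isOpen := h.isOpen
  zero_mem := h.zero_mem
  map_zero := by simp [h.map_zero]
  holomorphic := hhol
  immersive := himm
  isEmbedding := hp.comp (h.isEmbedding.codRestrict A fun x => hUA x x.2)
  image_open := by
    obtain ⟨O, hO, hOU⟩ := h.image_open
    obtain ⟨O', hO', hF'⟩ := hF
    have h1 : IsOpen ((↑) ⁻¹' O : Set A) := hO.preimage continuous_subtype_val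
    obtain ⟨O'', hO'', h''⟩ := hp.isInducing.isOpen_iff.1 h1
    have key : ∀ y (hy : y ∈ A), y ∈ O ↔ p y ∈ O'' := fun y hy =>
      (Set.ext_iff.1 h'' ⟨y, hy⟩).symm
    refine ⟨O' ∩ O'', hO'.inter hO'', ?_⟩
    rw [Set.image_comp, ← Set.inter_assoc, ← hF']
    ext y
    constructor
    · rintro ⟨u, ⟨x, hx, rfl⟩, rfl⟩
      exact ⟨⟨_, hUA x hx, rfl⟩, (key _ (hUA x hx)).1
        (hOU ▸ Set.mem_image_of_mem φ hx : φ x ∈ Z ∩ O).2⟩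
    · rintro ⟨⟨u, hu, rfl⟩, h2⟩; exact ⟨u, hOU ▸ ⟨hA hu, (key u hu).2 h2⟩, rfl⟩

lemma exists_submersion_chart {n : ℕ} {Z : Set X} {φ : (Fin (n + 1) → ℂ) → X}
    {U : Set (Fin (n + 1) → ℂ)} (h : IsHolomorphicChart (n + 1) Z z φ U)
    {f : (Fin (n + 1) → ℂ) → ℂ} {x : Fin (n + 1) → ℂ} (hx : x ∈ U)
    (hf : AnalyticAt ℂ f x) (hdf : fderiv ℂ f x ≠ 0) :
    ∃ φ' U', IsHolomorphicChart (n + 1) Z (φ x) φ' U' ∧ ∀ y ∈ U', ∃ w ∈ U, φ' y = φ w ∧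
      f w = f x + y 0 := by
  obtain ⟨i, hi⟩ : ∃ i, fderiv ℂ f x (Pi.single i 1) ≠ 0 := by
    by_contra! H
    apply hdf
    refine ContinuousLinearMap.coe_injective ((Pi.basisFun ℂ (Fin (n + 1))).ext fun i => ?_)
    simpa using H i
  let Ψ : (Fin (n + 1) → ℂ) → (Fin (n + 1) → ℂ) := fun y j =>
    if j = 0 then f y - f x else (y - x) (swap 0 i j)
  have hΨa : AnalyticAt ℂ Ψ x := by
    rw [analyticAt_pi_iff]
    intro j
    by_cases hj : j = 0
    · simp only [Ψ, hj, if_true]; exact hf.sub analyticAt_const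
    · simp only [Ψ, hj, if_false, Pi.sub_apply]; exact (analyticAt_coord _ x).sub analyticAt_const
  have hΨd : ∀ v, fderiv ℂ Ψ x v = 0 → v = 0 := by
    intro v hv
    have hcomp : ∀ j, fderiv ℂ (fun y => Ψ y j) x v = 0 := by
      intro j
      have h1 := (hasFDerivAt_pi'.1 hΨa.differentiableAt.hasFDerivAt j).fderiv
      rw [h1, ContinuousLinearMap.comp_apply, hv]; rfl
    have hne : ∀ l, l ≠ i → v l = 0 := by
      intro l hl
      have hj : swap 0 i l ≠ 0 := by
        intro hh
        rw [Equiv.swap_apply_eq_iff, Equiv.swap_apply_left] at hh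
        exact hl hh
      have := hcomp (swap 0 i l)
      simp only [Ψ, hj, if_false, Pi.sub_apply, Equiv.swap_apply_self] at this
      rw [fderiv_sub_const] at this
      exact (fderiv_coord l x v).symm.trans this
    have hv1 : v = v i • Pi.single i 1 := by
      funext l
      by_cases hl : l = i
      · subst hl; simp
      · simp [hne l hl, hl]
    have h0 := hcomp 0
    simp only [Ψ, if_true] at h0
    rw [fderiv_sub_const, hv1, map_smul, smul_eq_mul] at h0
    have : v i = 0 := (mul_eq_zero.1 h0).resolve_right hi
    rw [hv1, this, zero_smul]
  obtain ⟨e, hxe, hsub, hee, -, hsymm⟩ :=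
    exists_analytic_localInverse hΨa hΨd (h.isOpen.mem_nhds hx)
  have hΨx : Ψ x = 0 := by funext j; simp [Ψ]
  have h0 : (0 : Fin (n + 1) → ℂ) ∈ e.target := by rw [← hΨx, ← hee]; exact e.map_source hxe
  have hs0 : e.symm 0 = x := by rw [← hΨx, ← hee]; exact e.left_inv hxe
  have key := h.comp_openPartialHomeomorph e.symm h0 (by simpa using hsub) (by simpa using hsymm)
  rw [hs0] at key
  refine ⟨_, _, key, fun y hy => ⟨e.symm y, hsub (e.map_target hy), rfl, ?_⟩⟩
  have : Ψ (e.symm y) = y := by rw [← hee]; exact e.right_inv hy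
  have := congrFun this 0
  simp only [Ψ, if_true] at this
  rw [← this]; ring

end IsHolomorphicChart

/-- Restrictions of `φ` to arbitrarily small neighbourhoods of `0` are charts of `Z` at `z`. -/
def IsChartAt {X : Type*} [TopologicalSpace X] [LocalCoordinates X] (k : ℕ) (Z : Set X) (z : X)
    (φ : ℂ^k → X) : Prop :=
  ∀ N ∈ 𝓝 0, ∃ U, U ⊆ N ∧ IsHolomorphicChart k Z z φ U

lemma exists_isHolomorphicChart {X : Type*} [TopologicalSpace X] [LocalCoordinates X]
    [ContinuousCoordinates X] [T2Space X] {k : ℕ} {Z Γ : Set X} {z : X} {φ : ℂ^k → X}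
    (hΓ : Z ⊆ closure Γ) (c : Fin k → Set X × (X → ℂ))
    (hc : ∀ j, c j ∈ coords (X := X)) (hdom : ∀ j, z ∈ (c j).1)
    (hφ : ∀ᶠ x in 𝓝 0, HolomorphicAt φ x ∧ ContinuousAt φ x ∧ φ x ∈ Z) (h0 : φ 0 = z)
    (hinj : ∀ v, (∀ j, fderiv ℂ ((c j).2 ∘ φ) 0 v = 0) → v = 0)
    (hsurj : ∀ N ∈ 𝓝 (0 : ℂ^k), ∀ᶠ y in 𝓝[Γ] z, y ∈ φ '' N) :
    IsChartAt k Z z φ := by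
  intro N hN
  set ψ : X → ℂ^k := fun y j => (c j).2 y with hψ
  set D : Set X := ⋂ j, (c j).1 with hD
  have hDo : IsOpen D := isOpen_iInter_of_finite fun j => ContinuousCoordinates.isOpen _ (hc j)
  have hzD : z ∈ D := Set.mem_iInter.2 hdom
  have hψc : ContinuousOn ψ D := continuousOn_pi.2 fun j =>
    (ContinuousCoordinates.continuousOn _ (hc j)).mono (Set.iInter_subset _ j)
  have hφ0 := hφ.self_of_nhds
  have hhj : ∀ j, AnalyticAt ℂ ((c j).2 ∘ φ) 0 := fun j =>
    hφ0.1 _ (hc j) (by rw [h0]; exact hdom j)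
  have hha : AnalyticAt ℂ (ψ ∘ φ) 0 := analyticAt_pi_iff.2 hhj
  have hhd : ∀ v, fderiv ℂ (ψ ∘ φ) 0 v = 0 → v = 0 := by
    intro v hv
    refine hinj v fun j => ?_
    have h1 := (hasFDerivAt_pi'.1 hha.differentiableAt.hasFDerivAt j).fderiv
    have h2 : (fun x => (ψ ∘ φ) x j) = (c j).2 ∘ φ := rfl
    rw [← h2, h1, ContinuousLinearMap.comp_apply, hv]; rfl
  have hφD : ∀ᶠ x in 𝓝 0, φ x ∈ D := hφ0.2.1.eventually (hDo.mem_nhds (by rwa [h0]))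
  obtain ⟨e, h0e, hsub, hee, hea, -⟩ := exists_analytic_localInverse hha hhd
    (inter_mem hN (inter_mem hφ hφD))
  have hcφ : ContinuousOn φ e.source := fun x hx => (hsub hx).2.1.2.1.continuousWithinAt
  -- the coordinates as a function on `X`
  have hN₁ : ∀ᶠ y in 𝓝 z, (y ∈ D ∧ ψ y ∈ e.target) ∧ (y ∈ Γ → y = φ (e.symm (ψ y))) := by
    have h1 : ∀ᶠ y in 𝓝 z, y ∈ D := hDo.mem_nhds hzD
    have hzt : ψ z ∈ e.target := by have := e.map_source h0e; rwa [hee, Function.comp, h0] at this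
    have h2 : ∀ᶠ y in 𝓝 z, ψ y ∈ e.target :=
      (hψc.continuousAt (hDo.mem_nhds hzD)).eventually (e.open_target.mem_nhds hzt)
    have h3 := hsurj e.source (e.open_source.mem_nhds h0e)
    rw [eventually_nhdsWithin_iff] at h3
    filter_upwards [h1, h2, h3] with y hy1 hy2 hy3
    refine ⟨⟨hy1, hy2⟩, fun hyΓ => ?_⟩
    obtain ⟨x, hx, rfl⟩ := hy3 hyΓ
    have : e.symm (ψ (φ x)) = x := by have := e.left_inv hx; rwa [hee] at this
    rw [this]
  obtain ⟨O, hO, hOo, hzO⟩ := mem_nhds_iff.1 hN₁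
  have hξc : ContinuousOn (fun y => e.symm (ψ y)) O :=
    e.continuousOn_symm.comp (hψc.mono fun y hy => (hO hy).1.1) fun y hy => (hO hy).1.2
  have hZO : ∀ y ∈ Z ∩ O, y = φ (e.symm (ψ y)) := fun y ⟨hyZ, hyO⟩ =>
    eq_of_mem_closure (hΓ hyZ) continuousAt_id ((hcφ.comp hξc fun y hy =>
      e.map_target (hO hy).1.2).continuousAt (hOo.mem_nhds hyO)) (by
      filter_upwards [self_mem_nhdsWithin, nhdsWithin_le_nhds (hOo.mem_nhds hyO)] with w h1 h2
      exact (hO h2).2 h1)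
  have hUo : IsOpen (e.source ∩ φ ⁻¹' O) := hcφ.isOpen_inter_preimage e.open_source hOo
  have hleft : ∀ x ∈ e.source ∩ φ ⁻¹' O, e.symm (ψ (φ x)) = x := fun x hx => by
    have := e.left_inv hx.1
    rwa [hee] at this
  refine ⟨e.source ∩ φ ⁻¹' O, fun x hx => (hsub hx.1).1, hUo, ⟨h0e, by simpa [h0] using hzO⟩, h0,
    fun x hx => (hsub hx.1).2.1.1, ?_, ?_, ?_⟩
  · intro x hx v hv
    refine (hea x hx.1).2 v ?_
    have h1 := hasFDerivAt_pi'.1 (hea x hx.1).1.differentiableAt.hasFDerivAt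
    funext j
    have h2 := (h1 j).fderiv
    have h3 : (fun x => (ψ ∘ φ) x j) = (c j).2 ∘ φ := rfl
    have h4 := hv (c j) (hc j) (Set.mem_iInter.1 (hsub hx.1).2.2 j)
    rw [← h3, h2, ContinuousLinearMap.comp_apply] at h4
    exact h4
  · have h1 : Continuous fun y : O => e.symm (ψ y) := continuousOn_iff_continuous_domRestrict.1 hξc
    have h2 : Continuous fun x : ↥(e.source ∩ φ ⁻¹' O) => (⟨φ x, x.2.2⟩ : O) :=
      (continuousOn_iff_continuous_domRestrict.1 (hcφ.mono Set.inter_subset_left)).subtype_mk _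
    refine IsEmbedding.subtypeVal.comp (.of_comp h2 h1 ?_)
    convert! IsEmbedding.subtypeVal using 1
    exact funext fun x => hleft x x.2
  · refine ⟨O, hOo, ?_⟩
    ext y
    constructor
    · rintro ⟨x, hx, rfl⟩; exact ⟨(hsub hx.1).2.1.2.2, hx.2⟩
    · rintro hy
      have h1 := hZO y hy
      exact ⟨e.symm (ψ y), ⟨e.map_target (hO hy.2).1.2, by
        rw [Set.mem_preimage, ← h1]; exact hy.2⟩, h1.symm⟩

lemma eq_of_mem_image_of_nhds {X : Type*} [TopologicalSpace X] [T2Space X] {k : ℕ} {Γ : Set X}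
    {z : X} {φ : ℂ^k → X} (hz : z ∈ closure Γ) (hφ : ContinuousAt φ 0)
    (hsurj : ∀ N ∈ 𝓝 (0 : ℂ^k), ∀ᶠ y in 𝓝[Γ] z, y ∈ φ '' N) : φ 0 = z := by
  by_contra hne
  obtain ⟨A, B, hA, hB, hzA, h0B, hd⟩ := t2_separation (Ne.symm hne)
  have h1 := hsurj _ (hφ (hB.mem_nhds h0B))
  have : NeBot (𝓝[Γ] z) := mem_closure_iff_nhdsWithin_neBot.1 hz
  obtain ⟨y, ⟨x, hx, rfl⟩, hy⟩ := (h1.and (nhdsWithin_le_nhds (hA.mem_nhds hzA))).exists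
  exact Set.disjoint_left.1 hd hy hx

/-! ## Semistable degenerations from local data along the central fibre -/

namespace CoordinateProduct

variable {k : ℕ} (K : Finset (Fin k))

lemma isPreconnected_fibre (hK : K.Nonempty) {r : ℝ} (hr : 0 < r) {s : ℂ} (hs : s ≠ 0) :
    IsPreconnected {x : ℂ^k | x ∈ Metric.ball 0 r ∧ ∏ i ∈ K, x i = s} := by
  classical
  obtain ⟨i₀, hi₀⟩ := hK
  set J := K.erase i₀ with hJ
  have hi₀J : i₀ ∉ J := by simp [hJ]
  have hprod : ∀ x : ℂ^k, ∏ i ∈ K, x i = x i₀ * ∏ i ∈ J, x i := fun x =>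
    (Finset.mul_prod_erase K x hi₀).symm
  let C : Set ℂ^k := {w | (∀ i ∈ J, (w i).re < Real.log r) ∧
    (∀ i, i ∉ K → w i ∈ Metric.ball 0 r) ∧ Real.log (‖s‖ / r) < (∑ i ∈ J, w i).re}
  let Φ : ℂ^k → ℂ^k := fun w i =>
    if i = i₀ then s * Complex.exp (-∑ i ∈ J, w i) else if i ∈ J then Complex.exp (w i) else w i
  have hC : Convex ℝ C := by
    simp only [C, Set.setOf_and, Set.setOf_forall]
    exact (convex_iInter₂ fun i _ => convex_halfSpace_lt (f := fun w : ℂ^k => (w i).re)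
      ⟨by simp, by simp⟩ _).inter ((convex_iInter₂ fun i _ => (convex_ball _ _).linear_preimage
        (LinearMap.proj (R := ℝ) (φ := fun _ : Fin k => ℂ) i)).inter (convex_halfSpace_gt
      (f := fun w : ℂ^k => (∑ i ∈ J, w i).re)
      ⟨by simp [Finset.sum_add_distrib], by simp [Finset.mul_sum]⟩ _))
  have hΦ : Continuous Φ := by
    refine continuous_pi fun i => ?_
    simp only [Φ]
    split_ifs <;> fun_prop
  have himg : {x : ℂ^k | x ∈ Metric.ball 0 r ∧ ∏ i ∈ K, x i = s} = Φ '' C := by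
    ext x
    constructor
    · rintro ⟨hx, hp⟩
      rw [mem_ball_zero_iff, pi_norm_lt_iff hr] at hx
      rw [hprod] at hp
      have hx0 : ∀ i ∈ J, x i ≠ 0 := fun i hi h0 => hs (by
        rw [← hp, Finset.prod_eq_zero hi h0, mul_zero])
      have hsum : Complex.exp (∑ i ∈ J, Complex.log (x i)) = ∏ i ∈ J, x i := by
        rw [Complex.exp_sum]
        exact Finset.prod_congr rfl fun i hi => Complex.exp_log (hx0 i hi)
      have hP0 : ∏ i ∈ J, x i ≠ 0 := Finset.prod_ne_zero_iff.2 hx0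
      refine ⟨fun i => if i ∈ J then Complex.log (x i) else x i, ⟨?_, ?_, ?_⟩, ?_⟩
      · intro i hi
        simp only [hi, if_true, Complex.log_re]
        exact Real.log_lt_log (norm_pos_iff.2 (hx0 i hi)) (hx i)
      · intro i hi
        have : i ∉ J := fun h => hi (Finset.mem_of_mem_erase h)
        simp only [this, if_false]
        simpa using hx i
      · rw [Finset.sum_congr rfl (fun i hi => if_pos hi)]
        have h1 : ‖∏ i ∈ J, x i‖ = Real.exp (∑ i ∈ J, Complex.log (x i)).re := by
          rw [← hsum, Complex.norm_exp]
        rw [Real.log_lt_iff_lt_exp (div_pos (norm_pos_iff.2 hs) hr), ← h1, div_lt_iff₀ hr, ← hp,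
          norm_mul, mul_comm]
        exact mul_lt_mul_of_pos_left (hx i₀) (norm_pos_iff.2 hP0)
      · funext i
        simp only [Φ]
        rw [Finset.sum_congr rfl (fun i hi => if_pos hi)]
        split_ifs with h1 h2
        · subst h1; rw [Complex.exp_neg, hsum, ← hp, mul_assoc, mul_inv_cancel₀ hP0, mul_one]
        · exact Complex.exp_log (hx0 i h2)
        · rfl
    · rintro ⟨w, ⟨h1, h2, h3⟩, rfl⟩
      have hne : ∀ i ∈ J, i ≠ i₀ := fun i hi h => hi₀J (h ▸ hi)
      constructor
      · rw [mem_ball_zero_iff, pi_norm_lt_iff hr]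
        intro i
        simp only [Φ]
        split_ifs with h4 h5
        · rw [norm_mul, Complex.norm_exp, Complex.neg_re, Real.exp_neg,
            mul_inv_lt_iff₀ (Real.exp_pos _)]
          rw [Real.log_lt_iff_lt_exp (div_pos (norm_pos_iff.2 hs) hr), div_lt_iff₀ hr] at h3
          linarith
        · rw [Complex.norm_exp]; exact (Real.lt_log_iff_exp_lt hr).1 (h1 i h5)
        · have : i ∉ K := fun h => h5 (Finset.mem_erase.2 ⟨h4, h⟩); simpa using h2 i this
      · rw [hprod]
        have : ∏ i ∈ J, Φ w i = Complex.exp (∑ i ∈ J, w i) := by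
          rw [Complex.exp_sum]
          refine Finset.prod_congr rfl fun i hi => ?_
          simp [Φ, hne i hi, hi]
        rw [this]
        simp only [Φ, if_true]
        rw [mul_assoc, ← Complex.exp_add, neg_add_cancel, Complex.exp_zero, mul_one]
  rw [himg]
  exact hC.isPreconnected.image _ hΦ.continuousOn

lemma exists_mem_fibre (hK : K.Nonempty) {r : ℝ} (hr : 0 < r) :
    ∃ ε > 0, ∀ s : ℂ, ‖s‖ < ε → ∃ x ∈ Metric.ball (0 : ℂ^k) r, ∏ i ∈ K, x i = s := by
  classical
  obtain ⟨i₀, hi₀⟩ := hK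
  set n := (K.erase i₀).card
  refine ⟨(r / 2) ^ n * r, by positivity, fun s hs => ?_⟩
  refine ⟨fun i => if i = i₀ then s / ((r / 2 : ℝ) : ℂ) ^ n else ((r / 2 : ℝ) : ℂ), ?_, ?_⟩
  · rw [mem_ball_zero_iff, pi_norm_lt_iff hr]
    intro i
    split_ifs
    · rw [norm_div, norm_pow, Complex.norm_real, Real.norm_of_nonneg (by positivity),
        div_lt_iff₀ (by positivity)]
      linarith
    · rw [Complex.norm_real, Real.norm_of_nonneg (by positivity)]; linarith
  · rw [← Finset.mul_prod_erase K _ hi₀, if_pos rfl,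
      Finset.prod_congr rfl (fun i hi => if_neg (Finset.ne_of_mem_erase hi)), Finset.prod_const]
    have : ((r / 2 : ℝ) : ℂ) ≠ 0 := by exact_mod_cast (by positivity : (r / 2) ≠ 0)
    change s / _ * _ ^ n = s
    field_simp

lemma fderiv_ne_zero {x : ℂ^k} (hK : K.Nonempty) (hx : ∏ i ∈ K, x i ≠ 0) :
    fderiv ℂ (fun y : ℂ^k => ∏ i ∈ K, y i) x ≠ 0 := by
  intro h
  have hd : DifferentiableAt ℂ (fun y : ℂ^k => ∏ i ∈ K, y i) x := by fun_prop
  have h1 : HasFDerivAt (fun y : ℂ^k => ∏ i ∈ K, y i) (0 : ℂ^k →L[ℂ] ℂ) ((1 : ℂ) • x) := by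
    rw [one_smul ℂ x]; exact h ▸ hd.hasFDerivAt
  have h2 : HasDerivAt (fun s : ℂ => s • x) ((1 : ℂ) • x) 1 := (hasDerivAt_id (1 : ℂ)).smul_const x
  have h3 := h1.comp_hasDerivAt (1 : ℂ) h2
  have h4 : ((fun y : ℂ^k => ∏ i ∈ K, y i) ∘ fun s : ℂ => s • x) =
      fun s => s ^ K.card * ∏ i ∈ K, x i := by
    funext s
    simp [Finset.prod_mul_distrib]
  rw [h4] at h3
  have h5 := ((hasDerivAt_pow K.card (1 : ℂ)).mul_const (∏ i ∈ K, x i)).unique h3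
  simp [hx, hK.ne_empty] at h5

end CoordinateProduct

section Abstract

variable {X : Type*} [TopologicalSpace X] [LocalCoordinates X] {ι : Type*}

/-- A chart of `Y` centred at the point `z` of the fibre `t = 0`, with arbitrarily small domains,
in which `t` is a product of coordinates whose zero sets are the surfaces `S i` through `z`. -/
def HasNormalCrossingChart (Y : Set X) (t : X → ℂ) (S : ι → Set X) (z : X) : Prop :=
  ∃ φ : ℂ³ → X, IsChartAt 3 Y z φ ∧
    ∃ c : {i // z ∈ S i} ↪ Fin 3, (∀ᶠ x in 𝓝 0, t (φ x) = ∏ᶠ i : {i // z ∈ S i}, x (c i)) ∧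
      ∀ᶠ x in 𝓝 0, ∀ i, φ x ∈ S i ↔ ∃ h : z ∈ S i, x (c ⟨i, h⟩) = 0

variable {Y : Set X} {t : X → ℂ} {S : ι → Set X} {z : X}

lemma HasNormalCrossingChart.exists_ball
    (h : HasNormalCrossingChart Y t S z) {N : Set X} (hN : N ∈ 𝓝 z) :
    ∃ φ : ℂ³ → X, ∃ r > 0, IsHolomorphicChart 3 Y z φ (Metric.ball 0 r) ∧
      (∀ x ∈ Metric.ball 0 r, φ x ∈ N) ∧
      ∃ c : {i // z ∈ S i} ↪ Fin 3,
        (∀ x ∈ Metric.ball 0 r, t (φ x) = ∏ᶠ i : {i // z ∈ S i}, x (c i)) ∧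
        ∀ x ∈ Metric.ball 0 r, ∀ i, φ x ∈ S i ↔ ∃ h : z ∈ S i, x (c ⟨i, h⟩) = 0 := by
  obtain ⟨φ, hφ, c, h1, h2⟩ := h
  have hcont : ∀ᶠ x in 𝓝 0, φ x ∈ N := by
    obtain ⟨U, -, hU⟩ := hφ Set.univ univ_mem
    exact (hU.continuousAt hU.zero_mem).eventually (by rwa [hU.map_zero])
  obtain ⟨U, hUN, hU⟩ := hφ _ (hcont.and (h1.and h2))
  obtain ⟨r, hr, hball⟩ := Metric.isOpen_iff.1 hU.isOpen 0 hU.zero_mem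
  exact ⟨φ, r, hr, hU.restrict Metric.isOpen_ball hball (Metric.mem_ball_self hr),
    fun x hx => (hUN (hball hx)).1, c, fun x hx => (hUN (hball hx)).2.1,
    fun x hx => (hUN (hball hx)).2.2⟩

lemma exists_finset_of_embedding {α : Type*} {k : ℕ} (c : α ↪ Fin k) :
    ∃ K : Finset (Fin k), (∀ a, c a ∈ K) ∧ (∀ i ∈ K, ∃ a, c a = i) ∧
      ∀ x : ℂ^k, ∏ᶠ a, x (c a) = ∏ i ∈ K, x i := by
  classical
  refine ⟨Finset.univ.filter (· ∈ Set.range c), by simp, by simp, fun x => ?_⟩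
  rw [← finprod_mem_range (f := x) c.injective, ← finprod_mem_coe_finset]
  simp

lemma hasNormalCrossingChart_of_imp {φ : ℂ³ → X} (hφ : IsChartAt 3 Y z φ)
    (hS : ∀ i, IsClosed (S i)) (hY : Y ∩ t ⁻¹' {0} = ⋃ i, S i)
    (c : {i // z ∈ S i} ↪ Fin 3)
    (h1 : ∀ᶠ x in 𝓝 0, t (φ x) = ∏ᶠ i : {i // z ∈ S i}, x (c i))
    (h2 : ∀ᶠ x in 𝓝 0, ∀ i, φ x ∈ S i → ∃ h : z ∈ S i, x (c ⟨i, h⟩) = 0) :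
    HasNormalCrossingChart Y t S z := by
  classical
  refine ⟨φ, hφ, c, h1, ?_⟩
  obtain ⟨U, hUN, hU⟩ := hφ _ (h1.and h2)
  obtain ⟨K, hK1, -, hK⟩ := exists_finset_of_embedding c
  filter_upwards [hU.isOpen.mem_nhds hU.zero_mem] with x hx i
  refine ⟨(hUN hx).2 i, ?_⟩
  rintro ⟨hi, hxi⟩
  -- approach `x` by points where no other coordinate vanishes
  let e : ℂ³ := fun j => if j = c ⟨i, hi⟩ then 0 else 1
  have hseq : Tendsto (fun s : ℂ => x + s • e) (𝓝[≠] 0) (𝓝 x) := by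
    have : Continuous (fun s : ℂ => x + s • e) := by fun_prop
    have := this.tendsto 0
    simp only [zero_smul, add_zero] at this
    exact this.mono_left nhdsWithin_le_nhds
  have hne : ∀ᶠ s : ℂ in 𝓝[≠] 0, ∀ j, j ≠ c ⟨i, hi⟩ → (x + s • e) j ≠ 0 := by
    rw [Filter.eventually_all]
    intro j
    by_cases hxj : x j = 0
    · filter_upwards [self_mem_nhdsWithin] with s hs hj; simpa [e, hj, hxj] using hs
    · have : ∀ᶠ y : ℂ³ in 𝓝 x, y j ≠ 0 := ((continuous_apply j).tendsto x).eventually_ne hxj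
      filter_upwards [hseq.eventually this] with s hs _
      exact hs
  have hU' := hseq.eventually (hU.isOpen.mem_nhds hx)
  have hmem : ∀ᶠ s : ℂ in 𝓝[≠] 0, φ (x + s • e) ∈ S i := by
    filter_upwards [hne, hU'] with s hs hsU
    have ht : t (φ (x + s • e)) = 0 := by
      rw [(hUN hsU).1, hK]
      exact Finset.prod_eq_zero (hK1 ⟨i, hi⟩) (by simp [e, hxi])
    have hin : φ (x + s • e) ∈ ⋃ i, S i := hY ▸ ⟨hU.mapsTo hsU, ht⟩
    obtain ⟨j, hj⟩ := Set.mem_iUnion.1 hin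
    obtain ⟨hzj, h0⟩ := (hUN hsU).2 j hj
    by_cases hij : c ⟨j, hzj⟩ = c ⟨i, hi⟩
    · have := c.injective hij; rw [Subtype.mk.injEq] at this; rwa [← this]
    · exact absurd h0 (hs _ hij)
  exact (hS i).mem_of_tendsto ((hU.continuousAt hx).tendsto.comp hseq) hmem

lemma exists_fin_three_other {a b : Fin 3} (h : a ≠ b) :
    ∃ k : Fin 3, ∀ l, l ≠ k ↔ (l = a ∨ l = b) := by
  revert a b; decide

lemma isComplexSubmanifold_component (hY : Y ∩ t ⁻¹' {0} = ⋃ i, S i)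
    (hnc : ∀ z ∈ Y, t z = 0 → HasNormalCrossingChart Y t S z) (i : ι) :
    IsComplexSubmanifold 2 (S i) := by
  intro z hz
  have hzY : ∀ w ∈ S i, w ∈ Y ∩ t ⁻¹' {0} := fun w hw => hY ▸ Set.mem_iUnion.2 ⟨i, hw⟩
  obtain ⟨φ, r, hr, hφ, -, c, -, h2⟩ := (hnc z (hzY z hz).1 (hzY z hz).2).exists_ball univ_mem
  refine ⟨_, _, hφ.slice (Fin.succAboveEmb (c ⟨i, hz⟩)) (fun w hw => (hzY w hw).1) fun x hx => ?_⟩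
  rw [h2 x hx i]
  constructor
  · rintro ⟨h, hxi⟩ j hj
    have : j = c ⟨i, hz⟩ := by simpa using hj
    rw [this]; exact hxi
  · intro h; exact ⟨hz, h _ (by simp)⟩

lemma isComplexSubmanifold_inter (hY : Y ∩ t ⁻¹' {0} = ⋃ i, S i)
    (hnc : ∀ z ∈ Y, t z = 0 → HasNormalCrossingChart Y t S z) {i j : ι} (hij : i ≠ j) :
    IsComplexSubmanifold 1 (S i ∩ S j) := by
  rintro z ⟨hz, hz'⟩
  have hzY : ∀ w ∈ S i, w ∈ Y ∩ t ⁻¹' {0} := fun w hw => hY ▸ Set.mem_iUnion.2 ⟨i, hw⟩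
  obtain ⟨φ, r, hr, hφ, -, c, -, h2⟩ := (hnc z (hzY z hz).1 (hzY z hz).2).exists_ball univ_mem
  have hc : c ⟨i, hz⟩ ≠ c ⟨j, hz'⟩ := fun h => hij (by simpa using c.injective h)
  obtain ⟨k, hk⟩ := exists_fin_three_other hc
  refine ⟨_, _, hφ.slice (⟨fun _ => k, fun a b _ => Subsingleton.elim a b⟩ : Fin 1 ↪ Fin 3)
    (fun w hw => (hzY w hw.1).1) fun x hx => ?_⟩
  rw [Set.mem_inter_iff, h2 x hx i, h2 x hx j]
  have hr : ∀ l, l ∉ Set.range (⟨fun _ => k, fun a b _ => Subsingleton.elim a b⟩ :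
      Fin 1 ↪ Fin 3) ↔ (l = c ⟨i, hz⟩ ∨ l = c ⟨j, hz'⟩) := by
    intro l
    rw [← hk l]
    exact ⟨fun h hl => h ⟨0, hl.symm⟩, fun h ⟨_, hl⟩ => h hl.symm⟩
  simp only [hr]
  constructor
  · rintro ⟨⟨_, h1⟩, ⟨_, h2⟩⟩ l (rfl | rfl)
    exacts [h1, h2]
  · intro h; exact ⟨⟨hz, h _ (Or.inl rfl)⟩, ⟨hz', h _ (Or.inr rfl)⟩⟩

lemma HasNormalCrossingChart.exists_fibre_point (h : HasNormalCrossingChart Y t S z)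
    (hne : ∃ i, z ∈ S i) {N : Set X} (hN : N ∈ 𝓝 z) :
    ∀ᶠ s in 𝓝 (0 : ℂ), ∃ w ∈ Y, w ∈ N ∧ t w = s := by
  obtain ⟨φ, r, hr, hφ, hφN, c, h1, -⟩ := h.exists_ball hN
  obtain ⟨K, hK1, -, hK⟩ := exists_finset_of_embedding c
  obtain ⟨i, hi⟩ := hne
  obtain ⟨ε, hε, H⟩ := CoordinateProduct.exists_mem_fibre K ⟨_, hK1 ⟨i, hi⟩⟩ hr
  filter_upwards [Metric.ball_mem_nhds 0 hε] with s hs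
  obtain ⟨x, hx, hxs⟩ := H s (by simpa using hs)
  exact ⟨φ x, hφ.mapsTo hx, hφN x hx, by rw [h1 x hx, hK, hxs]⟩

lemma exists_isSemistableDegeneration (ht : Continuous t)
    (hproper : ∀ K : Set ℂ, IsCompact K → IsCompact (Y ∩ t ⁻¹' K))
    (hY : Y ∩ t ⁻¹' {0} = ⋃ i, S i) (hY0 : IsConnected (Y ∩ t ⁻¹' {0}))
    (hS : ∀ i, IsClosed (S i)) (hSc : ∀ i, IsConnected (S i))
    (hnc : ∀ z ∈ Y, t z = 0 → HasNormalCrossingChart Y t S z)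
    (h2 : ∀ i j, i ≠ j → S i ∩ S j = ∅ ∨ IsConnected (S i ∩ S j))
    (h3 : ∀ i j k, i ≠ j → i ≠ k → j ≠ k → (S i ∩ S j ∩ S k).Subsingleton)
    (h4 : ∀ i j k l, i ≠ j → i ≠ k → i ≠ l → j ≠ k → j ≠ l → k ≠ l →
      S i ∩ S j ∩ S k ∩ S l = ∅) :
    ∃ ε₀ > 0, ∀ ε, 0 < ε → ε ≤ ε₀ → IsSemistableDegeneration ε {z ∈ Y | ‖t z‖ < ε} t S := by
  have hex : ∀ z ∈ Y, t z = 0 → ∃ i, z ∈ S i := fun z hz h0 =>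
    Set.mem_iUnion.1 (hY ▸ (⟨hz, h0⟩ : z ∈ Y ∩ t ⁻¹' {0}))
  -- polydisc charts at the points of the central fibre
  have hchart : ∀ z : (Y ∩ t ⁻¹' {0} : Set X), ∃ φ : ℂ³ → X, ∃ r > 0, ∃ O : Set X,
      ∃ K : Finset (Fin 3), IsHolomorphicChart 3 Y z φ (Metric.ball 0 r) ∧ IsOpen O ∧ z.1 ∈ O ∧
      φ '' Metric.ball 0 r = Y ∩ O ∧ K.Nonempty ∧
      ∀ x ∈ Metric.ball 0 r, t (φ x) = ∏ i ∈ K, x i := by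
    rintro ⟨z, hz, h0⟩
    obtain ⟨φ, r, hr, hφ, -, c, h1, -⟩ := (hnc z hz h0).exists_ball univ_mem
    obtain ⟨K, hK1, -, hK⟩ := exists_finset_of_embedding c
    obtain ⟨O, hO, hOφ⟩ := hφ.image_open
    obtain ⟨i, hi⟩ := hex z hz h0
    exact ⟨φ, r, hr, O, K, hφ, hO, (hOφ ▸ ⟨0, hφ.zero_mem, hφ.map_zero⟩ : z ∈ Y ∩ O).2, hOφ,
      ⟨_, hK1 ⟨i, hi⟩⟩, fun x hx => by rw [h1 x hx, hK]⟩
  choose φ r hr O K hφ hO hzO hOφ hKne hKt using hchart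
  obtain ⟨F, hF⟩ := (hproper {0} isCompact_singleton).elim_finite_subcover O hO
    (fun z hz => Set.mem_iUnion.2 ⟨⟨z, hz⟩, hzO ⟨z, hz⟩⟩)
  have hcl : IsClosed (t '' ((Y ∩ t ⁻¹' Metric.closedBall 0 1) \ ⋃ i ∈ F, O i)) :=
    (((hproper _ (isCompact_closedBall 0 1)).diff
      (isOpen_biUnion fun i _ => hO i)).image ht).isClosed
  -- the polydiscs cover the fibres over a small disc, and their intersections meet these fibres
  have hev : ∀ᶠ s in 𝓝 (0 : ℂ), (∀ z ∈ Y, t z = s → ∃ i ∈ F, z ∈ O i) ∧ ∀ i ∈ F, ∀ j ∈ F,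
      (Y ∩ t ⁻¹' {0} ∩ (O i ∩ O j)).Nonempty → (Y ∩ t ⁻¹' {s} ∩ (O i ∩ O j)).Nonempty := by
    refine .and ?_ ((Filter.eventually_all_finset F).2 fun i _ =>
      (Filter.eventually_all_finset F).2 fun j _ => Filter.eventually_imp_distrib_left.2 ?_)
    · filter_upwards [hcl.isOpen_compl.mem_nhds fun ⟨z, hz, h0⟩ => hz.2 (hF ⟨hz.1.1, h0⟩),
        Metric.closedBall_mem_nhds 0 one_pos] with s hs hs1 z hz hzs
      by_contra hcon
      exact hs ⟨z, ⟨⟨hz, by rwa [Set.mem_preimage, hzs]⟩, by simpa using hcon⟩, hzs⟩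
    · rintro ⟨z, ⟨hz, h0⟩, hzO'⟩
      filter_upwards [(hnc z hz h0).exists_fibre_point (hex z hz h0)
        (((hO i).inter (hO j)).mem_nhds hzO')] with s ⟨w, hw, hwO, hwt⟩
      exact ⟨w, ⟨hw, hwt⟩, hwO⟩
  obtain ⟨ε₀, hε₀, hev⟩ := Metric.eventually_nhds_iff_ball.1 hev
  refine ⟨ε₀, hε₀, fun ε hε hle => ?_⟩
  replace hev := fun s (hs : ‖s‖ < ε) => hev s (by simpa using hs.trans_le hle)
  change IsSemistableDegeneration ε (Y ∩ {z | ‖t z‖ < ε}) t S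
  set O' : Set X := {z | ‖t z‖ < ε}
  have hO' : IsOpen O' := isOpen_lt ht.norm continuous_const
  have hYO : ∀ C ⊆ Metric.ball 0 ε, Y ∩ O' ∩ t ⁻¹' C = Y ∩ t ⁻¹' C := fun C hC => Set.ext fun z =>
    ⟨fun h => ⟨h.1.1, h.2⟩, fun h => ⟨⟨h.1, by simpa [O'] using hC h.2⟩, h.2⟩⟩
  have hncO : ∀ z ∈ Y, t z = 0 → ∃ φ U, IsHolomorphicChart 3 (Y ∩ O') z φ U ∧
      ∃ c : {i // z ∈ S i} ↪ Fin 3,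
      (∀ x ∈ U, t (φ x) = ∏ᶠ i : {i // z ∈ S i}, x (c i)) ∧
      (∀ x ∈ U, ∀ i : ι, φ x ∈ S i ↔ ∃ h : z ∈ S i, x (c ⟨i, h⟩) = 0) := by
    intro z hz h0
    obtain ⟨φ, r, hr, hφ, -, c, h1, h2⟩ := (hnc z hz h0).exists_ball univ_mem
    exact ⟨φ, _, hφ.inter_open hO' (by simpa [O', h0] using hε) rfl, c,
      fun x hx => h1 x hx.1, fun x hx => h2 x hx.1⟩
  have hsub : ∀ z ∈ Y ∩ O', t z ≠ 0 → ∃ φ U, IsHolomorphicChart 3 (Y ∩ O') z φ U ∧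
      ∀ x ∈ U, t (φ x) = t z + x 0 := by
    rintro z ⟨hz, hlt⟩ h0
    obtain ⟨i, hi, hzi⟩ := (hev _ hlt).1 z hz rfl
    obtain ⟨x, hx, rfl⟩ := ((hOφ i).symm ▸ ⟨hz, hzi⟩ : z ∈ φ i '' Metric.ball 0 (r i))
    rw [hKt i x hx] at h0
    obtain ⟨φ', U', h', hU'⟩ := (hφ i).exists_submersion_chart
      (f := fun y : ℂ³ => ∏ j ∈ K i, y j) hx
      (Finset.analyticAt_fun_prod _ fun j _ => analyticAt_coord j x)
      (CoordinateProduct.fderiv_ne_zero (K i) (hKne i) h0)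
    refine ⟨φ', _, h'.inter_open hO' hlt rfl, fun y hy => ?_⟩
    obtain ⟨w, hw, h1, h2⟩ := hU' y hy.1
    rw [h1, hKt i w hw, h2, hKt i x hx]
  refine
    { maps_to := fun z hz => hz.2
      proper := fun C hC hCb => by rw [hYO C hCb]; exact hproper C hC
      smooth_total := fun z hz => ?_
      submersion := hsub
      smooth_fibre := ?_
      connected_fibre := fun s hs => ?_
      central_fibre := by rw [hYO _ (by simpa using hε), hY]
      closed_component := hS
      connected_component := hSc
      smooth_component := isComplexSubmanifold_component hY hnc
      normal_crossings := fun z hz => hncO z hz.1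
      two_components := fun i j hij => (h2 i j hij).imp_right fun h =>
        ⟨h, isComplexSubmanifold_inter hY hnc hij⟩
      three_components := h3
      four_components := h4 }
  · by_cases h0 : t z = 0
    · exact (hncO z hz.1 h0).imp fun φ => .imp fun U h => h.1
    · exact (hsub z hz h0).imp fun φ => .imp fun U h => h.1
  · rintro _ hs - z ⟨hz, rfl⟩
    obtain ⟨φ, U, h, hU⟩ := hsub z hz hs
    refine ⟨_, _, h.slice (Fin.succAboveEmb 0) (S := Y ∩ O' ∩ t ⁻¹' {t z})
      Set.inter_subset_left fun x hx => ?_⟩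
    have hm : φ x ∈ Y ∩ O' ∩ t ⁻¹' {t z} ↔ x 0 = 0 := by
      rw [Set.mem_inter_iff, Set.mem_preimage, Set.mem_singleton_iff, hU x hx]
      simp [h.mapsTo hx]
    simp [hm]
  rw [hYO _ (by simpa using hs)]
  by_cases h0 : s = 0
  · rwa [h0]
  -- the pieces of the fibre in the polydiscs
  let P : F → Set X := fun i => Y ∩ t ⁻¹' {s} ∩ O i
  have hP : Y ∩ t ⁻¹' {s} = ⋃ i, P i := by
    refine Set.Subset.antisymm (fun z hz => ?_) (Set.iUnion_subset fun i z hz => hz.1)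
    obtain ⟨i, hi, hzi⟩ := (hev s hs).1 z hz.1 hz.2
    exact Set.mem_iUnion.2 ⟨⟨i, hi⟩, hz, hzi⟩
  have hmeet : ∀ i j : F, (Y ∩ t ⁻¹' {0} ∩ (O i ∩ O j)).Nonempty → (P i ∩ P j).Nonempty :=
    fun i j hij => ((hev s hs).2 i i.2 j j.2 hij).imp fun w h => ⟨⟨h.1, h.2.1⟩, ⟨h.1, h.2.2⟩⟩
  have hPc : ∀ i, IsConnected (P i) := by
    refine fun i => ⟨(hmeet i i ⟨i.1, i.1.2, hzO i, hzO i⟩).mono Set.inter_subset_left, ?_⟩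
    have himg : P i = φ i '' {x | x ∈ Metric.ball 0 (r i) ∧ ∏ j ∈ K i, x j = s} := by
      refine Set.Subset.antisymm ?_ ?_
      · rintro z ⟨⟨hz, hzs⟩, hzi⟩
        obtain ⟨x, hx, rfl⟩ := ((hOφ i).symm ▸ ⟨hz, hzi⟩ : z ∈ φ i '' Metric.ball 0 (r i))
        exact ⟨x, ⟨hx, (hKt i x hx).symm.trans hzs⟩, rfl⟩
      · rintro _ ⟨x, ⟨hx, hxs⟩, rfl⟩
        have : φ i x ∈ Y ∩ O i := hOφ i ▸ ⟨x, hx, rfl⟩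
        exact ⟨⟨this.1, (hKt i x hx).trans hxs⟩, this.2⟩
    rw [himg]
    exact (CoordinateProduct.isPreconnected_fibre (K i) (hKne i) (hr i) h0).image _
      ((hφ i).continuousOn.mono fun x hx => hx.1)
  have hcov : ∀ z ∈ Y ∩ t ⁻¹' {0}, ∃ i : F, z ∈ O i := fun z hz => by
    simpa using hF hz
  have hFne : Nonempty F := hY0.nonempty.elim fun z hz => (hcov z hz).nonempty
  rw [hP]
  refine IsConnected.iUnion_of_reflTransGen hPc fun i j => ?_
  by_contra hcon
  let A : Set F := {l | Relation.ReflTransGen (fun i j => (P i ∩ P j).Nonempty) i l}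
  obtain ⟨z, hz, hz1, hz2⟩ := hY0.isPreconnected (⋃ l ∈ A, O l) (⋃ l ∈ Aᶜ, O l)
    (isOpen_biUnion fun l _ => hO l) (isOpen_biUnion fun l _ => hO l) (fun z hz => by
      obtain ⟨l, hzl⟩ := hcov z hz
      by_cases hlA : l ∈ A
      · exact Or.inl (Set.mem_biUnion hlA hzl)
      · exact Or.inr (Set.mem_biUnion (show l ∈ Aᶜ from hlA) hzl))
    ⟨i.1, i.1.2, Set.mem_biUnion (show i ∈ A from .refl) (hzO i)⟩
    ⟨j.1, j.1.2, Set.mem_biUnion (show j ∈ Aᶜ from hcon) (hzO j)⟩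
  obtain ⟨l, hl, hzl⟩ := Set.mem_iUnion₂.1 hz1
  obtain ⟨m, hm, hzm⟩ := Set.mem_iUnion₂.1 hz2
  exact hm (hl.tail (hmeet l m ⟨z, hz, hzl, hzm⟩))

end Abstract

namespace Segre

open ProjTop

/-! ## Lines and their Plücker coordinates -/

/-- The contraction of a bivector with a linear form. -/
def contract (c : ℂ⁶) : PlückerSpace →ₗ[ℂ] ℂ⁶ where
  toFun p i := ∑ j, c j * p i j
  map_add' p q := by ext i; simp [mul_add, Finset.sum_add_distrib]
  map_smul' r p := by
    ext i
    simp only [Pi.smul_apply, smul_eq_mul, RingHom.id_apply, Finset.mul_sum]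
    exact Finset.sum_congr rfl fun j _ => by ring

lemma contract_apply (c : ℂ⁶) (p : PlückerSpace) (i : Fin 6) :
    contract c p i = ∑ j, c j * p i j := rfl

/-- The pairing with a linear form, as a linear form. -/
def dotL (a : ℂ⁶) : Dual ℂ ℂ⁶ where
  toFun v := ∑ i, a i * v i
  map_add' p q := by simp [mul_add, Finset.sum_add_distrib]
  map_smul' r p := by
    simp only [Pi.smul_apply, smul_eq_mul, RingHom.id_apply, Finset.mul_sum]
    exact Finset.sum_congr rfl fun j _ => by ring

lemma dotL_apply (a v : ℂ⁶) : dotL a v = ∑ i, a i * v i := rfl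

/-- The pairing of a bivector with a pair of linear forms. -/
def bracket (a c : ℂ⁶) : Dual ℂ PlückerSpace := dotL a ∘ₗ contract c

lemma contract_wedge (c v w : ℂ⁶) : contract c (wedge v w) = dotL c w • v - dotL c v • w := by
  funext i
  simp only [contract_apply, wedge, dotL_apply, Pi.sub_apply, Pi.smul_apply, smul_eq_mul,
    Finset.sum_mul, ← Finset.sum_sub_distrib]
  exact Finset.sum_congr rfl fun j _ => by ring

lemma bracket_wedge (a c v w : ℂ⁶) :
    bracket a c (wedge v w) = dotL a v * dotL c w - dotL a w * dotL c v := by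
  simp only [bracket, LinearMap.comp_apply, contract_wedge, map_sub, map_smul, smul_eq_mul]
  ring

lemma wedge_combo (v w : ℂ⁶) (a b c d : ℂ) :
    wedge (a • v + b • w) (c • v + d • w) = (a * d - b * c) • wedge v w := by
  funext i j
  simp only [wedge, Pi.add_apply, Pi.smul_apply, smul_eq_mul]
  ring

lemma wedge_zero_left (v : ℂ⁶) : wedge 0 v = 0 := by funext i j; simp [wedge]

lemma exists_bracket_ne_zero (l : ℙ ℂ PlückerSpace) : ∃ a c, bracket a c l.rep ≠ 0 := by
  by_contra! H
  apply l.rep_nonzero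
  funext i j
  have := H (Pi.single i 1) (Pi.single j 1)
  simpa [bracket, dotL_apply, contract_apply, Pi.single_apply] using this

def lineFst (a c : ℂ⁶) (l : ℙ ℂ PlückerSpace) : ℂ⁶ := contract c (sect (bracket a c) l)

def lineSnd (a c : ℂ⁶) (l : ℙ ℂ PlückerSpace) : ℂ⁶ := -contract a (sect (bracket a c) l)

lemma isLine_iff {l : ℙ ℂ PlückerSpace} {v w : ℂ⁶} :
    IsLine l v w ↔ wedge v w ≠ 0 ∧ l = proj (wedge v w) := by
  constructor
  · rintro ⟨h, rfl⟩; exact ⟨h, (proj_eq h).symm⟩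
  · rintro ⟨h, rfl⟩; exact ⟨h, proj_eq h⟩

lemma continuousAt_lineFst {a c : ℂ⁶} {l : ℙ ℂ PlückerSpace}
    (h : bracket a c l.rep ≠ 0) : ContinuousAt (lineFst a c) l :=
  (LinearMap.continuous_of_finiteDimensional (contract c)).continuousAt.comp (continuousAt_sect _ h)

lemma continuousAt_lineSnd {a c : ℂ⁶} {l : ℙ ℂ PlückerSpace}
    (h : bracket a c l.rep ≠ 0) : ContinuousAt (lineSnd a c) l :=
  ((LinearMap.continuous_of_finiteDimensional (contract a)).continuousAt.comp
    (continuousAt_sect _ h)).neg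

section Line

variable {l : ℙ ℂ PlückerSpace} {v w a c : ℂ⁶}

lemma IsLine.bracket_ne_zero (h : IsLine l v w) :
    bracket a c l.rep ≠ 0 ↔ dotL a v * dotL c w - dotL a w * dotL c v ≠ 0 := by
  obtain ⟨h0, rfl⟩ := isLine_iff.1 h
  rw [ne_zero_proj _ h0, bracket_wedge]

lemma IsLine.lineFst_eq (h : IsLine l v w) :
    lineFst a c l = (dotL a v * dotL c w - dotL a w * dotL c v)⁻¹ •
      (dotL c w • v - dotL c v • w) := by
  obtain ⟨h0, rfl⟩ := isLine_iff.1 h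
  rw [lineFst, sect_proj _ h0, map_smul, contract_wedge, bracket_wedge]

lemma IsLine.lineSnd_eq (h : IsLine l v w) :
    lineSnd a c l = (dotL a v * dotL c w - dotL a w * dotL c v)⁻¹ •
      (dotL a v • w - dotL a w • v) := by
  obtain ⟨h0, rfl⟩ := isLine_iff.1 h
  rw [lineSnd, sect_proj _ h0, map_smul, contract_wedge, bracket_wedge, ← smul_neg, neg_sub]

lemma IsLine.eq_combo (h : IsLine l v w) (hb : bracket a c l.rep ≠ 0) :
    v = dotL a v • lineFst a c l + dotL c v • lineSnd a c l ∧
    w = dotL a w • lineFst a c l + dotL c w • lineSnd a c l := by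
  have hD := h.bracket_ne_zero.1 hb
  rw [h.lineFst_eq, h.lineSnd_eq]
  constructor <;>
  · funext i; simp only [Pi.add_apply, Pi.smul_apply, Pi.sub_apply, smul_eq_mul]; field_simp; ring

lemma IsLine.dual (h : IsLine l v w) (hb : bracket a c l.rep ≠ 0) :
    dotL a (lineFst a c l) = 1 ∧ dotL c (lineFst a c l) = 0 ∧
    dotL a (lineSnd a c l) = 0 ∧ dotL c (lineSnd a c l) = 1 := by
  have hD := h.bracket_ne_zero.1 hb
  rw [h.lineFst_eq, h.lineSnd_eq]
  simp only [map_smul, map_sub, smul_eq_mul]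
  refine ⟨?_, ?_, ?_, ?_⟩ <;> field_simp <;> ring

lemma IsLine.normalized (h : IsLine l v w) (hb : bracket a c l.rep ≠ 0) :
    IsLine l (lineFst a c l) (lineSnd a c l) := by
  have hD := h.bracket_ne_zero.1 hb
  obtain ⟨h0, hl⟩ := isLine_iff.1 h
  have h1 : wedge v w = (dotL a v * dotL c w - dotL c v * dotL a w) •
      wedge (lineFst a c l) (lineSnd a c l) := by
    rw [← wedge_combo, ← (h.eq_combo hb).1, ← (h.eq_combo hb).2]
  have hD' : dotL a v * dotL c w - dotL c v * dotL a w ≠ 0 := by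
    convert! hD using 1; ring
  rw [isLine_iff]
  refine ⟨fun h2 => h0 (by rw [h1, h2, smul_zero]), ?_⟩
  rw [hl]; conv_lhs => rw [h1]
  rw [proj_smul hD', ← hl]

lemma IsLine.eq_normalized (h : IsLine l v w) (hb : bracket a c l.rep ≠ 0)
    (h1 : dotL a v = 1) (h2 : dotL c v = 0) (h3 : dotL a w = 0) (h4 : dotL c w = 1) :
    lineFst a c l = v ∧ lineSnd a c l = w := by
  obtain ⟨e1, e2⟩ := h.eq_combo hb
  rw [h1, h2, one_smul, zero_smul, add_zero] at e1
  rw [h3, h4, one_smul, zero_smul, zero_add] at e2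
  exact ⟨e1.symm, e2.symm⟩

/-- The vector `x` lies in the plane of vectors attached to the line `l`. -/
def OnLine (l : ℙ ℂ PlückerSpace) (x : ℂ⁶) : Prop :=
  ∃ v w, IsLine l v w ∧ ∃ α γ : ℂ, x = α • v + γ • w

lemma IsLine.onLine_iff (h : IsLine l v w) {x : ℂ⁶} :
    OnLine l x ↔ ∃ α γ : ℂ, x = α • v + γ • w := by
  refine ⟨?_, fun hx => ⟨v, w, h, hx⟩⟩
  rintro ⟨v', w', h', α, γ, rfl⟩
  obtain ⟨a, c, hb⟩ := exists_bracket_ne_zero l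
  obtain ⟨e1, e2⟩ := h'.eq_combo hb
  rw [e1, e2, h.lineFst_eq, h.lineSnd_eq]
  set D := (dotL a v * dotL c w - dotL a w * dotL c v)⁻¹
  refine ⟨α * (dotL a v' * (D * dotL c w) - dotL c v' * (D * dotL a w)) +
    γ * (dotL a w' * (D * dotL c w) - dotL c w' * (D * dotL a w)),
    α * (-dotL a v' * (D * dotL c v) + dotL c v' * (D * dotL a v)) +
    γ * (-dotL a w' * (D * dotL c v) + dotL c w' * (D * dotL a v)), ?_⟩
  funext i
  simp only [Pi.add_apply, Pi.smul_apply, Pi.sub_apply, smul_eq_mul]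
  ring

lemma IsLine.combo_eq_zero (h : IsLine l v w) {α γ : ℂ} (h0 : α • v + γ • w = 0) :
    α = 0 ∧ γ = 0 := by
  obtain ⟨hw, -⟩ := isLine_iff.1 h
  have h1 : wedge (α • v + γ • w) ((0 : ℂ) • v + (1 : ℂ) • w) = α • wedge v w := by
    rw [wedge_combo]; simp
  have h2 : wedge (α • v + γ • w) ((1 : ℂ) • v + (0 : ℂ) • w) = (-γ) • wedge v w := by
    rw [wedge_combo]; simp
  rw [h0, wedge_zero_left] at h1 h2
  exact ⟨(smul_eq_zero.1 h1.symm).resolve_right hw,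
    neg_eq_zero.1 ((smul_eq_zero.1 h2.symm).resolve_right hw)⟩

lemma IsLine.onLine_left (h : IsLine l v w) : OnLine l v := ⟨v, w, h, 1, 0, by simp⟩

lemma IsLine.onLine_right (h : IsLine l v w) : OnLine l w := ⟨v, w, h, 0, 1, by simp⟩

lemma OnLine.combo {x y : ℂ⁶} (hx : OnLine l x) (hy : OnLine l y) (α γ : ℂ) :
    OnLine l (α • x + γ • y) := by
  obtain ⟨v, w, h, a, c, rfl⟩ := hx
  obtain ⟨a', c', rfl⟩ := h.onLine_iff.1 hy
  refine ⟨v, w, h, α * a + γ * a', α * c + γ * c', ?_⟩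
  funext i
  simp only [Pi.add_apply, Pi.smul_apply, smul_eq_mul]
  ring

lemma OnLine.isLine {x y : ℂ⁶} (hx : OnLine l x) (hy : OnLine l y)
    (hxy : wedge x y ≠ 0) : IsLine l x y := by
  obtain ⟨v, w, h, a, c, rfl⟩ := hx
  obtain ⟨a', c', rfl⟩ := h.onLine_iff.1 hy
  obtain ⟨h0, rfl⟩ := isLine_iff.1 h
  rw [isLine_iff]
  refine ⟨hxy, ?_⟩
  rw [wedge_combo] at hxy ⊢
  rw [proj_smul]
  rintro h1
  exact hxy (by rw [h1, zero_smul])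

end Line

lemma wedge_eq_zero_of_smul {x y : ℂ⁶} (h : wedge x y = 0) (hx : x ≠ 0) : ∃ r : ℂ, y = r • x := by
  obtain ⟨i, hi⟩ := Function.ne_iff.1 hx
  refine ⟨y i / x i, ?_⟩
  funext j
  have := congrFun (congrFun h i) j
  simp only [wedge, Pi.zero_apply] at this hi
  simp only [Pi.smul_apply, smul_eq_mul]
  field_simp
  grind

lemma mem_fanoFamily {E : 𝒫₆} {b : Base} :
    b ∈ fanoFamily E ↔ (∃ v w, IsLine b.1 v w) ∧ ∀ x, OnLine b.1 x →
      ∑ i, x i = 0 ∧ b.2 * eval x E + cubic x = 0 := by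
  constructor
  · rintro ⟨v, w, hv, hw, h, hc⟩
    refine ⟨⟨v, w, h⟩, fun x hx => ?_⟩
    obtain ⟨α, γ, rfl⟩ := h.onLine_iff.1 hx
    refine ⟨?_, hc α γ⟩
    simp [Finset.sum_add_distrib, ← Finset.mul_sum, hv, hw]
  · rintro ⟨⟨v, w, h⟩, H⟩
    exact ⟨v, w, (H v h.onLine_left).1, (H w h.onLine_right).1, h, fun α γ =>
      (H _ (h.onLine_iff.2 ⟨α, γ, rfl⟩)).2⟩

lemma InPlane.combo {σ : Syntheme} {x y : ℂ⁶} (hx : InPlane σ x) (hy : InPlane σ y)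
    (α γ : ℂ) : InPlane σ (α • x + γ • y) := by
  intro i
  simp only [Pi.add_apply, Pi.smul_apply, smul_eq_mul]
  linear_combination α * hx i + γ * hy i

lemma mem_planeLines {σ : Syntheme} {b : Base} :
    b ∈ planeLines σ ↔ b.2 = 0 ∧ (∃ v w, IsLine b.1 v w) ∧ ∀ x, OnLine b.1 x → InPlane σ x := by
  constructor
  · rintro ⟨hb, v, w, hv, hw, h⟩
    refine ⟨hb, ⟨v, w, h⟩, fun x hx => ?_⟩
    obtain ⟨α, γ, rfl⟩ := h.onLine_iff.1 hx
    exact hv.combo hw α γ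
  · rintro ⟨hb, ⟨v, w, h⟩, H⟩; exact ⟨hb, v, w, H v h.onLine_left, H w h.onLine_right, h⟩

lemma mem_delPezzoLines {T : Total} {b : Base} :
    b ∈ delPezzoLines T ↔ b.2 = 0 ∧ (∃ v w, IsLine b.1 v w) ∧
      (∀ x, OnLine b.1 x → ∑ i, x i = 0 ∧ cubic x = 0) ∧
      ∀ σ ∈ T.1, ∃ x, x ≠ 0 ∧ OnLine b.1 x ∧ InPlane σ x := by
  constructor
  · rintro ⟨hb, v, w, hv, hw, h, hc, hT⟩
    refine ⟨hb, ⟨v, w, h⟩, fun x hx => ?_, fun σ hσ => ?_⟩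
    · obtain ⟨α, γ, rfl⟩ := h.onLine_iff.1 hx
      refine ⟨?_, hc α γ⟩
      simp [Finset.sum_add_distrib, ← Finset.mul_sum, hv, hw]
    · obtain ⟨α, γ, h1, h2⟩ := hT σ hσ; exact ⟨_, h1, h.onLine_iff.2 ⟨α, γ, rfl⟩, h2⟩
  · rintro ⟨hb, ⟨v, w, h⟩, H, hT⟩
    refine ⟨hb, v, w, (H v h.onLine_left).1, (H w h.onLine_right).1, h, fun α γ =>
      (H _ (h.onLine_iff.2 ⟨α, γ, rfl⟩)).2, fun σ hσ => ?_⟩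
    obtain ⟨x, h1, h2, h3⟩ := hT σ hσ
    obtain ⟨α, γ, rfl⟩ := h.onLine_iff.1 h2
    exact ⟨α, γ, h1, h3⟩

/-! ## Binary cubic forms -/

/-- A function of two variables that is a cubic form. -/
def IsBinaryCubic (f : ℂ → ℂ → ℂ) : Prop :=
  ∃ e₀ e₁ e₂ e₃ : ℂ, ∀ α γ, f α γ = e₀ * α ^ 3 + e₁ * α ^ 2 * γ + e₂ * α * γ ^ 2 + e₃ * γ ^ 3

lemma IsBinaryCubic.eq_zero {f : ℂ → ℂ → ℂ} (hf : IsBinaryCubic f) (h1 : f 1 0 = 0)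
    (h2 : f 0 1 = 0) (h3 : f 1 1 = 0) (h4 : f 1 (-1) = 0) (α γ : ℂ) : f α γ = 0 := by
  obtain ⟨e₀, e₁, e₂, e₃, h⟩ := hf
  rw [h] at h1 h2 h3 h4
  rw [h]
  have z0 : e₀ = 0 := by grind
  have z3 : e₃ = 0 := by grind
  have z1 : e₁ = 0 := by grind
  have z2 : e₂ = 0 := by grind
  rw [z0, z1, z2, z3]; ring

lemma IsBinaryCubic.add {f g : ℂ → ℂ → ℂ} (hf : IsBinaryCubic f) (hg : IsBinaryCubic g) :
    IsBinaryCubic fun α γ => f α γ + g α γ := by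
  obtain ⟨a, b, c, d, hf⟩ := hf
  obtain ⟨a', b', c', d', hg⟩ := hg
  exact ⟨a + a', b + b', c + c', d + d', fun α γ => by simp only [hf, hg]; ring⟩

lemma IsBinaryCubic.const_mul {f : ℂ → ℂ → ℂ} (hf : IsBinaryCubic f) (r : ℂ) :
    IsBinaryCubic fun α γ => r * f α γ := by
  obtain ⟨a, b, c, d, hf⟩ := hf
  exact ⟨r * a, r * b, r * c, r * d, fun α γ => by simp only [hf]; ring⟩

lemma IsBinaryCubic.sum {ι : Type*} {s : Finset ι} {f : ι → ℂ → ℂ → ℂ}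
    (hf : ∀ i ∈ s, IsBinaryCubic (f i)) : IsBinaryCubic fun α γ => ∑ i ∈ s, f i α γ := by
  classical
  induction s using Finset.induction_on with
  | empty => exact ⟨0, 0, 0, 0, by simp⟩
  | insert a s ha ih =>
    have := (hf a (Finset.mem_insert_self a s)).add
      (ih fun i hi => hf i (Finset.mem_insert_of_mem hi))
    simpa [Finset.sum_insert ha] using this

lemma isBinaryCubic_mul₃ (a b a' b' a'' b'' : ℂ) : IsBinaryCubic fun α γ =>
    (α * a + γ * b) * ((α * a' + γ * b') * (α * a'' + γ * b'')) :=
  ⟨a * a' * a'', a * a' * b'' + a * b' * a'' + b * a' * a'',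
    a * b' * b'' + b * a' * b'' + b * b' * a'', b * b' * b'', fun α γ => by ring⟩

lemma isBinaryCubic_eval {E : 𝒫₆} (hE : E.IsHomogeneous 3)
    (v w : ℂ⁶) : IsBinaryCubic fun α γ => eval (α • v + γ • w) E := by
  let g : Fin 6 → MvPolynomial (Fin 2) ℂ := fun i =>
    MvPolynomial.C (v i) * MvPolynomial.X 0 + MvPolynomial.C (w i) * MvPolynomial.X 1
  have hg : ∀ i, (g i).IsHomogeneous 1 := fun i =>
    (MvPolynomial.isHomogeneous_C_mul_X _ _).add (MvPolynomial.isHomogeneous_C_mul_X _ _)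
  have hF : (MvPolynomial.aeval g E).IsHomogeneous (1 * 3) := hE.aeval g hg
  have hev : ∀ α γ : ℂ, eval (α • v + γ • w) E = eval ![α, γ] (MvPolynomial.aeval g E) := by
    intro α γ
    have h1 : (eval ![α, γ]).comp MvPolynomial.C = RingHom.id ℂ := RingHom.ext fun r => by simp
    have h2 : (fun s => eval ![α, γ] (g s)) = α • v + γ • w := by funext i; simp [g, mul_comm]
    rw [MvPolynomial.aeval_def, MvPolynomial.algebraMap_eq, MvPolynomial.eval_eval₂, h1, h2]
    rfl
  simp only [hev]
  simp only [MvPolynomial.eval_eq']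
  refine IsBinaryCubic.sum fun d hd => ?_
  have hdeg := hF.degree_eq_sum_deg_support hd
  have hsum : ∑ i ∈ d.support, d i = d 0 + d 1 := by
    rw [← Fin.sum_univ_two (f := fun i => d i)]
    exact Finset.sum_subset (Finset.subset_univ _) (by simp)
  simp only [Fin.prod_univ_two, cons_val_zero, cons_val_one]
  refine IsBinaryCubic.const_mul ?_ _
  rw [hsum] at hdeg
  have : d 0 ≤ 3 := by omega
  have h1 : d 1 = 3 - d 0 := by omega
  rw [h1]
  interval_cases d 0
  exacts [⟨0, 0, 0, 1, fun α γ => by ring⟩, ⟨0, 0, 1, 0, fun α γ => by ring⟩,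
    ⟨0, 1, 0, 0, fun α γ => by ring⟩, ⟨1, 0, 0, 0, fun α γ => by ring⟩]

lemma isBinaryCubic_cubic (v w : ℂ⁶) : IsBinaryCubic fun α γ => cubic (α • v + γ • w) := by
  unfold cubic
  refine IsBinaryCubic.sum fun i _ => ?_
  simp only [Pi.add_apply, Pi.smul_apply, smul_eq_mul]
  simpa [pow_succ, mul_assoc] using isBinaryCubic_mul₃ (v i) (w i) (v i) (w i) (v i) (w i)

/-! ## The generators of the ideals of the planes -/

/-- The sums of coordinates over the pairs of a syntheme. -/
def symm (σ : Syntheme) (v : ℂ⁶) : ℂ⁶ := fun i => v i + v (σ.1 i)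

lemma inPlane_iff {σ : Syntheme} {v : ℂ⁶} : InPlane σ v ↔ symm σ v = 0 :=
  ⟨fun h => funext h, fun h i => congrFun h i⟩

/-- The values of the generators, up to a scalar. -/
def redGen (v w A B : ℂ⁶) (t : ℂ) : (PlückerSpace × PlückerSpace) :=
  (fun i j => A i * w j - B i * v j, t • wedge v w)

lemma generators_wedge (σ : Syntheme) (v w : ℂ⁶) (t : ℂ) :
    generators σ (wedge v w) t = redGen v w (symm σ v) (symm σ w) t := by
  refine Prod.ext ?_ rfl
  funext i j
  simp only [generators, redGen, wedge, symm]
  ring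

lemma generators_smul (σ : Syntheme) (r : ℂ) (p : PlückerSpace) (t : ℂ) :
    generators σ (r • p) t = r • generators σ p t := by
  refine Prod.ext ?_ ?_
  · funext i j; simp only [generators, Pi.smul_apply, smul_eq_mul, Prod.smul_mk]; ring
  · simp only [generators, Prod.smul_mk]; exact smul_comm _ _ _

lemma redGen_smul (v w A B : ℂ⁶) (t r : ℂ) :
    redGen v w (r • A) (r • B) (r * t) = r • redGen v w A B t := by
  refine Prod.ext ?_ ?_
  · funext i j; simp only [redGen, Pi.smul_apply, smul_eq_mul, Prod.smul_mk]; ring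
  · simp only [redGen, Prod.smul_mk, mul_smul]

/-- The components along the first basis vector of a value of the generators. -/
def readFst (c : ℂ⁶) : (PlückerSpace × PlückerSpace) →ₗ[ℂ] ℂ⁶ := contract c ∘ₗ LinearMap.fst ℂ _ _

/-- The components along the second basis vector of a value of the generators. -/
def readSnd (a : ℂ⁶) : (PlückerSpace × PlückerSpace) →ₗ[ℂ] ℂ⁶ :=
  -(contract a ∘ₗ LinearMap.fst ℂ _ _)

/-- The component in the direction of the parameter of a value of the generators. -/
def readPar (a c : ℂ⁶) : Dual ℂ (PlückerSpace × PlückerSpace) := bracket a c ∘ₗ LinearMap.snd ℂ _ _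

section Read

variable {a c v w : ℂ⁶} (h1 : dotL a v = 1) (h2 : dotL c v = 0) (h3 : dotL a w = 0)
  (h4 : dotL c w = 1) (A B : ℂ⁶) (t : ℂ)

include h2 h4 in
lemma readFst_redGen : readFst c (redGen v w A B t) = A := by
  rw [dotL_apply] at h2 h4
  funext i
  simp only [readFst, redGen, LinearMap.comp_apply, LinearMap.fst_apply, contract_apply]
  calc ∑ j, c j * (A i * w j - B i * v j)
      = A i * ∑ j, c j * w j - B i * ∑ j, c j * v j := by
        rw [Finset.mul_sum, Finset.mul_sum, ← Finset.sum_sub_distrib]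
        exact Finset.sum_congr rfl fun j _ => by ring
    _ = A i := by rw [h2, h4]; ring

include h1 h3 in
lemma readSnd_redGen : readSnd a (redGen v w A B t) = B := by
  rw [dotL_apply] at h1 h3
  funext i
  simp only [readSnd, redGen, LinearMap.neg_apply, LinearMap.comp_apply, LinearMap.fst_apply,
    contract_apply, Pi.neg_apply]
  calc -∑ j, a j * (A i * w j - B i * v j)
      = -(A i * ∑ j, a j * w j - B i * ∑ j, a j * v j) := by
        rw [Finset.mul_sum, Finset.mul_sum, ← Finset.sum_sub_distrib]
        congr 1
        exact Finset.sum_congr rfl fun j _ => by ring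
    _ = B i := by rw [h1, h3]; ring

include h1 h2 h3 h4 in
lemma readPar_redGen : readPar a c (redGen v w A B t) = t := by
  simp only [readPar, redGen, LinearMap.comp_apply, LinearMap.snd_apply, map_smul, bracket_wedge,
    h1, h2, h3, h4, smul_eq_mul]
  ring

end Read

lemma redGen_eq_zero {l : ℙ ℂ PlückerSpace} {v w A B : ℂ⁶} {t : ℂ} (h : IsLine l v w) :
    redGen v w A B t = 0 ↔ A = 0 ∧ B = 0 ∧ t = 0 := by
  constructor
  · intro h0
    have hw := (isLine_iff.1 h).1
    have ht : t = 0 := by have := congrArg Prod.snd h0; exact (smul_eq_zero.1 this).resolve_right hw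
    have key : ∀ i, A i = 0 ∧ B i = 0 := fun i => by
      have : A i • w + (-B i) • v = 0 := by
        funext j
        have := congrFun (congrFun (congrArg Prod.fst h0) i) j
        simp only [redGen, Prod.fst_zero, Pi.zero_apply] at this
        simp only [Pi.add_apply, Pi.smul_apply, smul_eq_mul, Pi.zero_apply]
        grind
      have := h.combo_eq_zero (α := -B i) (γ := A i) (by rw [add_comm]; exact this)
      exact ⟨this.2, neg_eq_zero.1 this.1⟩
    exact ⟨funext fun i => (key i).1, funext fun i => (key i).2, ht⟩
  · rintro ⟨rfl, rfl, rfl⟩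
    refine Prod.ext ?_ ?_
    · funext i j; simp [redGen]
    · simp [redGen]

lemma generators_ne_zero_iff {σ : Syntheme} {l : ℙ ℂ PlückerSpace} {v w : ℂ⁶} {t : ℂ}
    (h : IsLine l v w) : generators σ (wedge v w) t ≠ 0 ↔ (l, t) ∉ planeLines σ := by
  rw [generators_wedge, ne_eq, redGen_eq_zero h, ← inPlane_iff, ← inPlane_iff, mem_planeLines]
  refine not_congr ⟨?_, ?_⟩
  · rintro ⟨h1, h2, h3⟩
    refine ⟨h3, ⟨v, w, h⟩, fun x hx => ?_⟩
    obtain ⟨α, γ, rfl⟩ := h.onLine_iff.1 hx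
    exact h1.combo h2 α γ
  · rintro ⟨h3, -, H⟩; exact ⟨H v h.onLine_left, H w h.onLine_right, h3⟩

/-! ## The reduced cubic equation -/

/-- The quadratic forms by which the sums of pairs of coordinates are multiplied in the cubic. -/
def quad (σ : Syntheme) (x : ℂ⁶) (i : Fin 6) : ℂ := x i ^ 2 - x i * x (σ.1 i) + x (σ.1 i) ^ 2

/-- The equation of the family after division by a common factor of the generators. -/
def redCubic (E : 𝒫₆) (σ : Syntheme) (s : ℂ⁶) (t : ℂ) (x : ℂ⁶) :
    ℂ := (1 / 2) * ∑ i, s i * quad σ x i + t * eval x E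

lemma cubic_eq (σ : Syntheme) (x : ℂ⁶) : cubic x = (1 / 2) * ∑ i, symm σ x i * quad σ x i := by
  have h1 : ∑ i, x (σ.1 i) ^ 3 = ∑ i, x i ^ 3 := Equiv.sum_comp σ.1 fun i => x i ^ 3
  have h2 : ∑ i, symm σ x i * quad σ x i = ∑ i, (x i ^ 3 + x (σ.1 i) ^ 3) :=
    Finset.sum_congr rfl fun i _ => by simp only [symm, quad]; ring
  rw [h2, Finset.sum_add_distrib, h1, cubic]; ring

lemma redCubic_smul (E : 𝒫₆) (σ : Syntheme) (s : ℂ⁶) (t r : ℂ)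
    (x : ℂ⁶) : redCubic E σ (r • s) (r * t) x = r * redCubic E σ s t x := by
  simp only [redCubic, Pi.smul_apply, smul_eq_mul, mul_assoc, ← Finset.mul_sum]
  ring

lemma redCubic_symm (E : 𝒫₆) (σ : Syntheme) (t : ℂ) (x : ℂ⁶) :
    redCubic E σ (symm σ x) t x = t * eval x E + cubic x := by
  rw [redCubic, cubic_eq σ]; ring

lemma symm_combo (σ : Syntheme) (v w : ℂ⁶) (α γ : ℂ) :
    symm σ (α • v + γ • w) = α • symm σ v + γ • symm σ w := by
  funext i
  simp only [symm, Pi.add_apply, Pi.smul_apply, smul_eq_mul]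
  ring

/-! ## Closedness -/

lemma eventually_bracket {Z : Type*} [TopologicalSpace Z] {f : Z → ℙ ℂ PlückerSpace} {z : Z}
    (hf : ContinuousAt f z) {a c : ℂ⁶} (hb : bracket a c (f z).rep ≠ 0) :
    ∀ᶠ y in 𝓝 z, bracket a c (f y).rep ≠ 0 :=
  hf.eventually ((isOpen_dual_ne (bracket a c)).mem_nhds hb)

lemma continuous_wedge : Continuous fun p : ℂ⁶ × ℂ⁶ => wedge p.1 p.2 := by unfold wedge; fun_prop

lemma isClosed_lines : IsClosed {l : ℙ ℂ PlückerSpace | ∃ v w, IsLine l v w} := by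
  refine isClosed_of_closure_subset fun l hl => ?_
  obtain ⟨a, c, hb⟩ := exists_bracket_ne_zero l
  have key : sect (bracket a c) l = wedge (lineFst a c l) (lineSnd a c l) := by
    refine eq_of_mem_closure hl (continuousAt_sect _ hb) (continuous_wedge.continuousAt.comp
        ((continuousAt_lineFst hb).prodMk (continuousAt_lineSnd hb))) ?_
    filter_upwards [self_mem_nhdsWithin,
      nhdsWithin_le_nhds (eventually_bracket continuousAt_id hb)] with y hy hby
    obtain ⟨v, w, h⟩ := hy
    have hn := h.normalized hby
    obtain ⟨d1, d2, d3, d4⟩ := h.dual hby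
    obtain ⟨h0, h1⟩ := isLine_iff.1 hn
    conv_lhs => rw [h1]
    rw [sect_proj _ h0, bracket_wedge]
    rw [d1, d2, d3, d4]
    simp
  refine ⟨lineFst a c l, lineSnd a c l, isLine_iff.2 ⟨?_, ?_⟩⟩
  · rw [← key]; exact sect_ne_zero _ hb
  · rw [← key, proj_sect _ hb]

lemma continuous_cubic : Continuous cubic := by unfold cubic; fun_prop

lemma continuous_eval (E : 𝒫₆) : Continuous fun x : ℂ⁶ => eval x E := by
  simp only [MvPolynomial.eval_eq']; fun_prop

lemma continuous_symm (σ : Syntheme) : Continuous (symm σ) := by unfold symm; fun_prop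

lemma isClosed_of_forall_onLine {Y : Type*} [TopologicalSpace Y] [T2Space Y] [Zero Y]
    (f : ℂ → ℂ⁶ → Y) (hf : Continuous fun p : ℂ × ℂ⁶ => f p.1 p.2) :
    IsClosed {b : Base | (∃ v w, IsLine b.1 v w) ∧ ∀ x, OnLine b.1 x → f b.2 x = 0} := by
  refine isClosed_of_closure_subset fun b hb => ?_
  have hl : ∃ v w, IsLine b.1 v w := by
    have : b ∈ closure (Prod.fst ⁻¹' {l : ℙ ℂ PlückerSpace | ∃ v w, IsLine l v w}) :=
      closure_mono (fun b hb => hb.1) hb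
    rwa [(isClosed_lines.preimage continuous_fst).closure_eq] at this
  obtain ⟨a, c, hbr⟩ := exists_bracket_ne_zero b.1
  have hn : IsLine b.1 (lineFst a c b.1) (lineSnd a c b.1) := by
    obtain ⟨v, w, h⟩ := hl
    exact h.normalized hbr
  refine ⟨hl, fun x hx => ?_⟩
  obtain ⟨α, γ, rfl⟩ := hn.onLine_iff.1 hx
  have c1 : ContinuousAt (fun y : Base => lineFst a c y.1) b :=
    ContinuousAt.comp (f := Prod.fst) (continuousAt_lineFst hbr) continuousAt_fst
  have c2 : ContinuousAt (fun y : Base => lineSnd a c y.1) b :=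
    ContinuousAt.comp (f := Prod.fst) (continuousAt_lineSnd hbr) continuousAt_fst
  refine eq_of_mem_closure hb (f := fun y : Base =>
    f y.2 (α • lineFst a c y.1 + γ • lineSnd a c y.1)) (g := fun _ => 0) ?_
    continuousAt_const ?_
  · exact hf.continuousAt.comp (f := fun y : Base =>
      (y.2, α • lineFst a c y.1 + γ • lineSnd a c y.1))
      (continuousAt_snd.prodMk ((c1.const_smul α).add (c2.const_smul γ)))
  · filter_upwards [self_mem_nhdsWithin,
      nhdsWithin_le_nhds (eventually_bracket continuousAt_fst hbr)] with y hy hby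
    obtain ⟨⟨v, w, h⟩, H⟩ := hy
    exact H _ ((h.normalized hby).onLine_iff.2 ⟨α, γ, rfl⟩)

lemma isClosed_fanoFamily (E : 𝒫₆) : IsClosed (fanoFamily E) := by
  have := isClosed_of_forall_onLine (Y := ℂ × ℂ) (fun t x => (∑ i, x i, t * eval x E + cubic x)) (by
      have h1 := (continuous_eval E).comp (continuous_snd (X := ℂ))
      have h2 := continuous_cubic.comp (continuous_snd (X := ℂ))
      exact Continuous.prodMk (by fun_prop) ((continuous_fst.mul h1).add h2))
  convert! this using 1
  ext b
  rw [mem_fanoFamily]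
  simp [Prod.ext_iff]

lemma isClosed_planeLines (σ : Syntheme) : IsClosed (planeLines σ) := by
  have := (isClosed_of_forall_onLine (Y := ℂ⁶) (fun _ x => symm σ x)
    ((continuous_symm σ).comp continuous_snd)).inter
    (isClosed_singleton.preimage (continuous_snd : Continuous (Prod.snd : Base → ℂ)) : IsClosed
      (Prod.snd ⁻¹' {(0 : ℂ)} : Set Base))
  convert! this using 1
  ext b
  rw [mem_planeLines]
  simp only [inPlane_iff, Set.mem_inter_iff, Set.mem_preimage, Set.mem_singleton_iff]
  exact ⟨fun h => ⟨h.2, h.1⟩, fun h => ⟨h.2, h.1⟩⟩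

lemma IsLine.meets_iff {l : ℙ ℂ PlückerSpace} {v w : ℂ⁶} (h : IsLine l v w)
    (σ : Syntheme) : (∃ x, x ≠ 0 ∧ OnLine l x ∧ InPlane σ x) ↔ wedge (symm σ v) (symm σ w) = 0 := by
  constructor
  · rintro ⟨x, hx0, hx, hxσ⟩
    obtain ⟨α, γ, rfl⟩ := h.onLine_iff.1 hx
    rw [inPlane_iff, symm_combo] at hxσ
    by_contra hne
    have h1 : wedge (α • symm σ v + γ • symm σ w) ((0 : ℂ) • symm σ v + (1 : ℂ) • symm σ w) =
        α • wedge (symm σ v) (symm σ w) := by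
      rw [wedge_combo]; simp
    have h2 : wedge (α • symm σ v + γ • symm σ w) ((1 : ℂ) • symm σ v + (0 : ℂ) • symm σ w) =
        (-γ) • wedge (symm σ v) (symm σ w) := by
      rw [wedge_combo]; simp
    rw [hxσ, wedge_zero_left] at h1 h2
    have hα := (smul_eq_zero.1 h1.symm).resolve_right hne
    have hγ := (smul_eq_zero.1 h2.symm).resolve_right hne
    rw [neg_eq_zero] at hγ
    exact hx0 (by simp [hα, hγ])
  · intro h0
    by_cases hv : symm σ v = 0
    · refine ⟨v, ?_, h.onLine_left, inPlane_iff.2 hv⟩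
      rintro rfl
      exact (isLine_iff.1 h).1 (wedge_zero_left _)
    · obtain ⟨r, hr⟩ := wedge_eq_zero_of_smul h0 hv
      refine ⟨(-r) • v + (1 : ℂ) • w, fun h1 => ?_, h.onLine_iff.2 ⟨_, _, rfl⟩, ?_⟩
      · exact one_ne_zero (h.combo_eq_zero h1).2
      · rw [inPlane_iff, symm_combo, hr]; simp

lemma isClosed_delPezzoLines (T : Total) : IsClosed (delPezzoLines T) := by
  have h1 := (isClosed_of_forall_onLine (Y := ℂ × ℂ) (fun _ x => (∑ i, x i, cubic x)) (by
      have h2 := continuous_cubic.comp (continuous_snd (X := ℂ))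
      exact Continuous.prodMk (by fun_prop) h2)).inter
    (isClosed_singleton.preimage (continuous_snd : Continuous (Prod.snd : Base → ℂ)) : IsClosed
      (Prod.snd ⁻¹' {(0 : ℂ)} : Set Base))
  refine isClosed_of_closure_subset fun b hb => ?_
  have hb1 := closure_minimal (s := delPezzoLines T) (fun y hy => by
    rw [mem_delPezzoLines] at hy
    refine ⟨⟨hy.2.1, fun x hx => ?_⟩, hy.1⟩
    simpa [Prod.ext_iff] using hy.2.2.1 x hx) h1 hb
  obtain ⟨⟨⟨v, w, h⟩, H⟩, ht⟩ := hb1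
  rw [mem_delPezzoLines]
  refine ⟨ht, ⟨v, w, h⟩, fun x hx => by simpa [Prod.ext_iff] using H x hx, fun σ hσ => ?_⟩
  obtain ⟨a, c, hbr⟩ := exists_bracket_ne_zero b.1
  rw [(h.normalized hbr).meets_iff σ]
  have c1 : ContinuousAt (fun y : Base => lineFst a c y.1) b :=
    ContinuousAt.comp (f := Prod.fst) (continuousAt_lineFst hbr) continuousAt_fst
  have c2 : ContinuousAt (fun y : Base => lineSnd a c y.1) b :=
    ContinuousAt.comp (f := Prod.fst) (continuousAt_lineSnd hbr) continuousAt_fst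
  refine eq_of_mem_closure hb (f := fun y : Base =>
    wedge (symm σ (lineFst a c y.1)) (symm σ (lineSnd a c y.1))) (g := fun _ => 0) ?_
    continuousAt_const ?_
  · exact continuous_wedge.continuousAt.comp (f := fun y : Base =>
      (symm σ (lineFst a c y.1), symm σ (lineSnd a c y.1)))
      (((continuous_symm σ).continuousAt.comp c1).prodMk ((continuous_symm σ).continuousAt.comp c2))
  · filter_upwards [self_mem_nhdsWithin,
      nhdsWithin_le_nhds (eventually_bracket continuousAt_fst hbr)] with y hy hby
    rw [mem_delPezzoLines] at hy
    obtain ⟨-, ⟨v', w', h'⟩, -, hm⟩ := hy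
    exact ((h'.normalized hby).meets_iff σ).1 (hm σ hσ)

/-! ## The blow-up -/

lemma mem_graph_iff {E : 𝒫₆} {y : Ambient} {v w : ℂ⁶}
    (h : IsLine y.1.1 v w) : y ∈ graph E ↔ y.1 ∈ fanoFamily E ∧
      ∀ κ, y.1 ∉ planeLines κ ∧ y.2 κ = proj (generators κ (wedge v w) y.1.2) := by
  obtain ⟨h0, hl⟩ := isLine_iff.1 h
  constructor
  · rintro ⟨hF, p, hp, hyp, H⟩
    refine ⟨hF, fun κ => ?_⟩
    obtain ⟨hg, hκ⟩ := H κ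
    rw [← proj_eq hp] at hyp
    rw [hl] at hyp
    obtain ⟨r, hr⟩ := (proj_eq_proj_iff h0 hp).1 hyp
    have hr0 : r ≠ 0 := by rintro rfl; exact h0 (by rw [← hr, zero_smul])
    have hgr : generators κ (wedge v w) y.1.2 = r • generators κ p y.1.2 := by
      rw [← hr, generators_smul]
    refine ⟨(generators_ne_zero_iff h).1 (by rw [hgr]; exact smul_ne_zero hr0 hg), ?_⟩
    rw [hκ, hgr, proj_smul hr0, proj_eq hg]
  · rintro ⟨hF, H⟩
    refine ⟨hF, wedge v w, h0, by rw [hl, proj_eq h0], fun κ => ?_⟩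
    have hg := (generators_ne_zero_iff h).2 (H κ).1
    exact ⟨hg, by rw [(H κ).2, proj_eq hg]⟩

lemma graph_isLine {E : 𝒫₆} {y : Ambient} (h : y ∈ graph E) :
    ∃ v w, IsLine y.1.1 v w := (mem_fanoFamily.1 h.1).1

lemma isClosed_blowUp (E : 𝒫₆) : IsClosed (blowUp E) := isClosed_closure

lemma blowUp_fst {E : 𝒫₆} {z : Ambient} (hz : z ∈ blowUp E) : z.1 ∈ fanoFamily E :=
  closure_minimal (fun _ hy => hy.1) ((isClosed_fanoFamily E).preimage continuous_fst) hz

lemma blowUp_isLine {E : 𝒫₆} {z : Ambient} (hz : z ∈ blowUp E)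
    {a c : ℂ⁶} (hb : bracket a c z.1.1.rep ≠ 0) :
    IsLine z.1.1 (lineFst a c z.1.1) (lineSnd a c z.1.1) := by
  obtain ⟨v, w, h⟩ := (mem_fanoFamily.1 (blowUp_fst hz)).1
  exact h.normalized hb

lemma continuous_generators (σ : Syntheme) :
    Continuous fun p : PlückerSpace × ℂ => generators σ p.1 p.2 := by
  unfold generators
  fun_prop

lemma continuousAt_lineFst' {a c : ℂ⁶} {z : Ambient} (hb : bracket a c z.1.1.rep ≠ 0) :
    ContinuousAt (fun y : Ambient => lineFst a c y.1.1) z :=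
  ContinuousAt.comp (f := fun y : Ambient => y.1.1) (continuousAt_lineFst hb)
    (continuous_fst.comp continuous_fst).continuousAt

lemma continuousAt_lineSnd' {a c : ℂ⁶} {z : Ambient} (hb : bracket a c z.1.1.rep ≠ 0) :
    ContinuousAt (fun y : Ambient => lineSnd a c y.1.1) z :=
  ContinuousAt.comp (f := fun y : Ambient => y.1.1) (continuousAt_lineSnd hb)
    (continuous_fst.comp continuous_fst).continuousAt

lemma eventually_bracket' {a c : ℂ⁶} {z : Ambient} (hb : bracket a c z.1.1.rep ≠ 0) :
    ∀ᶠ y : Ambient in 𝓝 z, bracket a c y.1.1.rep ≠ 0 :=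
  eventually_bracket (f := fun y : Ambient => y.1.1)
    (continuous_fst.comp continuous_fst).continuousAt hb

lemma blowUp_snd {E : 𝒫₆} {z : Ambient} (hz : z ∈ blowUp E) {κ : Syntheme}
    (hκ : z.1 ∉ planeLines κ) {v w : ℂ⁶} (h : IsLine z.1.1 v w) :
    z.2 κ = proj (generators κ (wedge v w) z.1.2) := by
  obtain ⟨a, c, hb⟩ := exists_bracket_ne_zero z.1.1
  have hn := h.normalized hb
  have hg := (generators_ne_zero_iff (σ := κ) hn).2 hκ
  have hcw : ContinuousAt (fun y : Ambient =>
      generators κ (wedge (lineFst a c y.1.1) (lineSnd a c y.1.1)) y.1.2) z := by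
    refine (continuous_generators κ).continuousAt.comp (f := fun y : Ambient =>
      (wedge (lineFst a c y.1.1) (lineSnd a c y.1.1), y.1.2)) (ContinuousAt.prodMk ?_ ?_)
    · exact continuous_wedge.continuousAt.comp (f := fun y : Ambient =>
        (lineFst a c y.1.1, lineSnd a c y.1.1))
        ((continuousAt_lineFst' hb).prodMk (continuousAt_lineSnd' hb))
    · exact (continuous_snd.comp continuous_fst).continuousAt
  have key : z.2 κ = proj (generators κ (wedge (lineFst a c z.1.1) (lineSnd a c z.1.1)) z.1.2) := by
    refine eq_of_mem_closure hz (f := fun y : Ambient => y.2 κ) (g := fun y : Ambient =>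
      proj (generators κ (wedge (lineFst a c y.1.1) (lineSnd a c y.1.1)) y.1.2))
      ((continuous_apply κ).comp continuous_snd).continuousAt
      ((continuousAt_proj hg).comp (f := fun y : Ambient =>
        generators κ (wedge (lineFst a c y.1.1) (lineSnd a c y.1.1)) y.1.2) hcw) ?_
    filter_upwards [self_mem_nhdsWithin, nhdsWithin_le_nhds (eventually_bracket' hb)] with y hy hby
    obtain ⟨v', w', h'⟩ := graph_isLine hy
    exact (((mem_graph_iff (h'.normalized hby)).1 hy).2 κ).2
  obtain ⟨e1, e2⟩ := h.eq_combo hb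
  have hr : wedge v w = (dotL a v * dotL c w - dotL c v * dotL a w) •
      wedge (lineFst a c z.1.1) (lineSnd a c z.1.1) := by
    rw [← wedge_combo, ← e1, ← e2]
  have hr0 : (dotL a v * dotL c w - dotL c v * dotL a w) ≠ 0 := by
    intro h0
    exact (isLine_iff.1 h).1 (by rw [hr, h0, zero_smul])
  rw [hr, generators_smul, proj_smul hr0, key]

lemma exists_graph {E : 𝒫₆} {b : Base} (hb : b ∈ fanoFamily E)
    (h : ∀ κ, b ∉ planeLines κ) : ∃ z ∈ graph E, z.1 = b := by
  obtain ⟨v, w, hl⟩ := (mem_fanoFamily.1 hb).1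
  exact ⟨(b, fun κ => proj (generators κ (wedge v w) b.2)),
    (mem_graph_iff (y := (b, _)) hl).2 ⟨hb, fun κ => ⟨h κ, rfl⟩⟩, rfl⟩

section Reading

variable (a c : ℂ⁶) (N : Dual ℂ (PlückerSpace × PlückerSpace)) (κ : Syntheme)

/-- The component along the first basis vector of the point of the blow-up. -/
def ambFst (y : Ambient) : ℂ⁶ := readFst c (sect N (y.2 κ))

/-- The component along the second basis vector of the point of the blow-up. -/
def ambSnd (y : Ambient) : ℂ⁶ := readSnd a (sect N (y.2 κ))

/-- The component in the direction of the parameter of the point of the blow-up. -/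
def ambPar (y : Ambient) : ℂ := readPar a c (sect N (y.2 κ))

variable {a c N κ} {z : Ambient} (hN : N (z.2 κ).rep ≠ 0)

include hN in
lemma continuousAt_amb : ContinuousAt (ambFst c N κ) z ∧ ContinuousAt (ambSnd a N κ) z ∧
    ContinuousAt (ambPar a c N κ) z := by
  have h : ContinuousAt (fun y : Ambient => sect N (y.2 κ)) z :=
    ContinuousAt.comp (f := fun y : Ambient => y.2 κ) (continuousAt_sect N hN)
      ((continuous_apply κ).comp continuous_snd).continuousAt
  exact ⟨(LinearMap.continuous_of_finiteDimensional (readFst c)).continuousAt.comp h,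
    (LinearMap.continuous_of_finiteDimensional (readSnd a)).continuousAt.comp h,
    (LinearMap.continuous_of_finiteDimensional (readPar a c)).continuousAt.comp h⟩

include hN in
lemma eventually_dual_ne_zero : ∀ᶠ y : Ambient in 𝓝 z, N (y.2 κ).rep ≠ 0 :=
  ((continuous_apply κ).comp continuous_snd).continuousAt.eventually
    ((isOpen_dual_ne N).mem_nhds hN)

lemma amb_graph {E : 𝒫₆} {y : Ambient} (hy : y ∈ graph E)
    (hb : bracket a c y.1.1.rep ≠ 0) (hNy : N (y.2 κ).rep ≠ 0) :
    ∃ r : ℂ, r ≠ 0 ∧ ambFst c N κ y = r • symm κ (lineFst a c y.1.1) ∧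
      ambSnd a N κ y = r • symm κ (lineSnd a c y.1.1) ∧ ambPar a c N κ y = r * y.1.2 ∧
      sect N (y.2 κ) = redGen (lineFst a c y.1.1) (lineSnd a c y.1.1) (ambFst c N κ y)
        (ambSnd a N κ y) (ambPar a c N κ y) := by
  obtain ⟨v, w, h⟩ := graph_isLine hy
  have hn := h.normalized hb
  obtain ⟨d1, d2, d3, d4⟩ := h.dual hb
  have h2 := (((mem_graph_iff hn).1 hy).2 κ)
  have hg := (generators_ne_zero_iff (σ := κ) hn).2 h2.1
  have hNg : N (generators κ (wedge (lineFst a c y.1.1) (lineSnd a c y.1.1)) y.1.2) ≠ 0 := by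
    rw [h2.2] at hNy
    exact (ne_zero_proj N hg).1 hNy
  set r := (N (generators κ (wedge (lineFst a c y.1.1) (lineSnd a c y.1.1)) y.1.2))⁻¹ with hr
  have hs : sect N (y.2 κ) = redGen (lineFst a c y.1.1) (lineSnd a c y.1.1)
      (r • symm κ (lineFst a c y.1.1)) (r • symm κ (lineSnd a c y.1.1)) (r * y.1.2) := by
    rw [h2.2, sect_proj N hg, ← hr, generators_wedge, redGen_smul]
  have e1 : ambFst c N κ y = r • symm κ (lineFst a c y.1.1) := by
    rw [ambFst, hs, readFst_redGen d2 d4]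
  have e2 : ambSnd a N κ y = r • symm κ (lineSnd a c y.1.1) := by
    rw [ambSnd, hs, readSnd_redGen d1 d3]
  have e3 : ambPar a c N κ y = r * y.1.2 := by rw [ambPar, hs, readPar_redGen d1 d2 d3 d4]
  exact ⟨r, inv_ne_zero hNg, e1, e2, e3, by rw [e1, e2, e3]; exact hs⟩

lemma continuous_redGen : Continuous fun p : (ℂ⁶ × ℂ⁶) ×
    (ℂ⁶ × ℂ⁶) × ℂ => redGen p.1.1 p.1.2 p.2.1.1 p.2.1.2 p.2.2 := by
  unfold redGen wedge
  fun_prop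

lemma continuous_redCubic (E : 𝒫₆) (σ : Syntheme) :
    Continuous fun p : ℂ⁶ × ℂ × ℂ⁶ => redCubic E σ p.1 p.2.1 p.2.2 := by
  unfold redCubic quad
  have := (continuous_eval E).comp
    (continuous_snd.comp continuous_snd : Continuous fun p : ℂ⁶ × ℂ × ℂ⁶ => p.2.2)
  have h2 : Continuous fun p : ℂ⁶ × ℂ × ℂ⁶ => p.2.1 := by fun_prop
  exact Continuous.add (by fun_prop) (h2.mul this)

lemma symm_sum (σ : Syntheme) (v : ℂ⁶) : ∑ i, symm σ v i = 2 * ∑ i, v i := by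
  simp only [symm, Finset.sum_add_distrib, Equiv.sum_comp σ.1 v]
  ring

lemma symm_apply_self (σ : Syntheme) (v : ℂ⁶) (i : Fin 6) : symm σ v (σ.1 i) = symm σ v i := by
  simp only [symm, σ.2.1 i]
  ring

include hN in
lemma amb_blowUp {E : 𝒫₆} (hz : z ∈ blowUp E) (hb : bracket a c z.1.1.rep ≠ 0) :
    sect N (z.2 κ) = redGen (lineFst a c z.1.1) (lineSnd a c z.1.1) (ambFst c N κ z)
        (ambSnd a N κ z) (ambPar a c N κ z) ∧
      (∀ α γ : ℂ, redCubic E κ (α • ambFst c N κ z + γ • ambSnd a N κ z) (ambPar a c N κ z)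
        (α • lineFst a c z.1.1 + γ • lineSnd a c z.1.1) = 0) ∧
      (∀ i, ambFst c N κ z (κ.1 i) = ambFst c N κ z i ∧ ambSnd a N κ z (κ.1 i) = ambSnd a N κ z i) ∧
      ∑ i, ambFst c N κ z i = 0 ∧ ∑ i, ambSnd a N κ z i = 0 := by
  obtain ⟨c1, c2, c3⟩ := continuousAt_amb (a := a) (c := c) hN
  have hs : ContinuousAt (fun y : Ambient => sect N (y.2 κ)) z :=
    ContinuousAt.comp (f := fun y : Ambient => y.2 κ) (continuousAt_sect N hN)
      ((continuous_apply κ).comp continuous_snd).continuousAt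
  have cv := continuousAt_lineFst' hb
  have cw := continuousAt_lineSnd' hb
  have hev : ∀ᶠ y in 𝓝[graph E] z, y ∈ graph E ∧ bracket a c y.1.1.rep ≠ 0 ∧ N (y.2 κ).rep ≠ 0 :=
    Filter.Eventually.and self_mem_nhdsWithin
      (nhdsWithin_le_nhds ((eventually_bracket' hb).and (eventually_dual_ne_zero hN)))
  have capp : ∀ {f : Ambient → ℂ⁶} (i : Fin 6), ContinuousAt f z →
      ContinuousAt (fun y => f y i) z := fun i hf => (continuous_apply i).continuousAt.comp hf
  refine ⟨?_, fun α γ => ?_, fun i => ⟨?_, ?_⟩, ?_, ?_⟩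
  · refine eq_of_mem_closure hz (f := fun y : Ambient => sect N (y.2 κ)) (g := fun y : Ambient =>
      redGen (lineFst a c y.1.1) (lineSnd a c y.1.1) (ambFst c N κ y) (ambSnd a N κ y)
        (ambPar a c N κ y)) hs
      (continuous_redGen.continuousAt.comp (f := fun y : Ambient => ((lineFst a c y.1.1,
        lineSnd a c y.1.1), (ambFst c N κ y, ambSnd a N κ y), ambPar a c N κ y))
        ((cv.prodMk cw).prodMk ((c1.prodMk c2).prodMk c3))) ?_
    filter_upwards [hev] with y hy
    obtain ⟨r, -, -, -, -, h⟩ := amb_graph (N := N) (κ := κ) hy.1 hy.2.1 hy.2.2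
    exact h
  · refine eq_of_mem_closure hz (f := fun y : Ambient =>
      redCubic E κ (α • ambFst c N κ y + γ • ambSnd a N κ y) (ambPar a c N κ y)
        (α • lineFst a c y.1.1 + γ • lineSnd a c y.1.1)) (g := fun _ => 0)
      ((continuous_redCubic E κ).continuousAt.comp (f := fun y : Ambient =>
        (α • ambFst c N κ y + γ • ambSnd a N κ y, ambPar a c N κ y,
          α • lineFst a c y.1.1 + γ • lineSnd a c y.1.1))
        (((c1.const_smul α).add (c2.const_smul γ)).prodMk
          (c3.prodMk ((cv.const_smul α).add (cw.const_smul γ))))) continuousAt_const ?_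
    filter_upwards [hev] with y hy
    obtain ⟨r, -, h1, h2, h3, -⟩ := amb_graph (N := N) (κ := κ) hy.1 hy.2.1 hy.2.2
    obtain ⟨v, w, hl⟩ := graph_isLine hy.1
    have hn := hl.normalized hy.2.1
    have hF := ((mem_fanoFamily.1 hy.1.1).2 _ (hn.onLine_iff.2 ⟨α, γ, rfl⟩)).2
    rw [h1, h2, h3, smul_comm α r, smul_comm γ r, ← smul_add, ← symm_combo, redCubic_smul,
      redCubic_symm, hF, mul_zero]
  · refine eq_of_mem_closure hz (capp _ c1) (capp _ c1) ?_
    filter_upwards [hev] with y hy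
    obtain ⟨r, -, h1, h2, h3, -⟩ := amb_graph (N := N) (κ := κ) hy.1 hy.2.1 hy.2.2
    rw [h1]
    simp only [Pi.smul_apply, symm_apply_self]
  · refine eq_of_mem_closure hz (capp _ c2) (capp _ c2) ?_
    filter_upwards [hev] with y hy
    obtain ⟨r, -, h1, h2, h3, -⟩ := amb_graph (N := N) (κ := κ) hy.1 hy.2.1 hy.2.2
    rw [h2]
    simp only [Pi.smul_apply, symm_apply_self]
  · refine eq_of_mem_closure hz (f := fun y => ∑ i, ambFst c N κ y i)
      (tendsto_finsetSum _ fun i _ => capp i c1) continuousAt_const ?_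
    filter_upwards [hev] with y hy
    obtain ⟨r, -, h1, h2, h3, -⟩ := amb_graph (N := N) (κ := κ) hy.1 hy.2.1 hy.2.2
    obtain ⟨v, w, hl⟩ := graph_isLine hy.1
    have hF := ((mem_fanoFamily.1 hy.1.1).2 _ (hl.normalized hy.2.1).onLine_left).1
    rw [h1]
    simp only [Pi.smul_apply, smul_eq_mul, ← Finset.mul_sum, symm_sum, hF, mul_zero]
  · refine eq_of_mem_closure hz (f := fun y => ∑ i, ambSnd a N κ y i)
      (tendsto_finsetSum _ fun i _ => capp i c2) continuousAt_const ?_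
    filter_upwards [hev] with y hy
    obtain ⟨r, -, h1, h2, h3, -⟩ := amb_graph (N := N) (κ := κ) hy.1 hy.2.1 hy.2.2
    obtain ⟨v, w, hl⟩ := graph_isLine hy.1
    have hF := ((mem_fanoFamily.1 hy.1.1).2 _ (hl.normalized hy.2.1).onLine_right).1
    rw [h2]
    simp only [Pi.smul_apply, smul_eq_mul, ← Finset.mul_sum, symm_sum, hF, mul_zero]

end Reading

end Segre

/-! ## Implicit functions -/

lemma exists_analytic_implicit {k m : ℕ} {F : ℂ^k × ℂ^m → ℂ^m}
    {u₀ : ℂ^m} (hF : ContDiff ℂ ω F) (h0 : F (0, u₀) = 0)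
    (hinj : ∀ w, (∀ j, HasDerivAt (fun ε : ℂ => F (0, u₀ + ε • w) j) 0 0) → w = 0) :
    ∃ g : ℂ^k → ℂ^m, AnalyticAt ℂ g 0 ∧ g 0 = u₀ ∧ (∀ᶠ x in 𝓝 0, F (x, g x) = 0) ∧
      ∀ᶠ p in 𝓝 ((0 : ℂ^k), u₀), F p = 0 → p.2 = g p.1 := by
  have cdf : ContDiffAt ℂ ω F (0, u₀) := hF.contDiffAt
  have hd : DifferentiableAt ℂ F (0, u₀) := cdf.differentiableAt (by simp)
  have hinv : (fderiv ℂ F (0, u₀) ∘L .inr ℂ ℂ^k ℂ^m).IsInvertible := by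
    have hi : Injective (fderiv ℂ F (0, u₀) ∘L .inr ℂ ℂ^k ℂ^m).toLinearMap := by
      refine (injective_iff_map_eq_zero _).2 fun w hw => hinj w fun j => ?_
      have h1 : HasDerivAt (fun ε : ℂ => ((0 : ℂ^k), u₀ + ε • w)) (0, w) 0 := by
        refine (hasDerivAt_const _ _).prodMk ?_
        simpa using ((hasDerivAt_id (0 : ℂ)).smul_const w).const_add u₀
      have h2 : HasFDerivAt F (fderiv ℂ F (0, u₀)) ((0 : ℂ^k), u₀ + (0 : ℂ) • w) := by
        simpa using hd.hasFDerivAt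
      have h3 := hasDerivAt_pi.1 (h2.comp_hasDerivAt (0 : ℂ) h1) j
      have h4 : fderiv ℂ F (0, u₀) ((0 : ℂ^k), w) = 0 := hw
      rw [h4] at h3
      exact h3
    exact ⟨(LinearEquiv.ofInjectiveEndo _ hi).toContinuousLinearEquiv, by ext; rfl⟩
  refine ⟨cdf.implicitFunction (by simp) hinv, ?_, cdf.implicitFunction_apply_self (by simp) hinv,
    ?_, ?_⟩
  · exact (cdf.contDiffAt_implicitFunction (by simp) hinv).analyticAt
  · filter_upwards [cdf.eventually_apply_implicitFunction (by simp) hinv] with x hx; rw [hx, h0]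
  · filter_upwards [cdf.eventually_apply_eq_iff_implicitFunction (by simp) hinv] with p hp h
    exact (hp.1 (by rw [h, h0])).symm

lemma exists_reparametrization {X : Type*} [TopologicalSpace X] [LocalCoordinates X] {k : ℕ}
    {Z : Set X} {z : X} {φ : ℂ^k → X}
    (hφ : IsChartAt k Z z φ) {G : ℂ^k → ℂ^k}
    (hG : AnalyticAt ℂ G 0) (hG0 : G 0 = 0) (hinj : ∀ v, fderiv ℂ G 0 v = 0 → v = 0) :
    ∃ H : ℂ^k → ℂ^k, AnalyticAt ℂ H 0 ∧ (∀ v, fderiv ℂ H 0 v = 0 → v = 0) ∧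
      H 0 = 0 ∧ (∀ᶠ x in 𝓝 0, G (H x) = x) ∧ (∀ᶠ x in 𝓝 0, H (G x) = x) ∧
      IsChartAt k Z z (φ ∘ H) := by
  obtain ⟨U, -, hU⟩ := hφ Set.univ univ_mem
  obtain ⟨e, h0, hsub, hee, -, hes⟩ := exists_analytic_localInverse hG hinj
    (hU.isOpen.mem_nhds hU.zero_mem)
  have h0t : (0 : ℂ^k) ∈ e.target := by have := e.map_source h0; rwa [hee, hG0] at this
  have hs0 : e.symm 0 = 0 := by have := e.left_inv h0; rwa [hee, hG0] at this
  refine ⟨e.symm, (hes 0 h0t).1, (hes 0 h0t).2, hs0, ?_, ?_, fun N hN => ?_⟩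
  · filter_upwards [e.open_target.mem_nhds h0t] with x hx; rw [← hee, e.right_inv hx]
  · filter_upwards [e.open_source.mem_nhds h0] with x hx; rw [← hee, e.left_inv hx]
  · have key := hU.comp_openPartialHomeomorph e.symm (by simpa using h0t)
      (by simpa using hsub) (by simpa using hes)
    obtain ⟨V, hVN, hV, hV0⟩ := mem_nhds_iff.1 (inter_mem hN (e.open_target.mem_nhds h0t))
    refine ⟨V, fun x hx => (hVN hx).1, ?_⟩
    have := key.restrict hV (fun x hx => by simpa using (hVN hx).2) hV0
    rwa [hs0, hU.map_zero] at this

lemma hasNormalCrossingChart_of_finset {X : Type*} [TopologicalSpace X] [LocalCoordinates X]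
    {ι : Type*} [Finite ι] {Y : Set X} {t : X → ℂ} {S : ι → Set X} {z : X}
    {φ : ℂ³ → X} (hφ : IsChartAt 3 Y z φ)
    (hS : ∀ i, IsClosed (S i)) (K : Finset (Fin 3)) (idx : Fin 3 → ι) (hidx : Set.InjOn idx K)
    (hz : ∀ i, z ∈ S i ↔ ∃ k ∈ K, idx k = i)
    (h1 : ∀ᶠ x in 𝓝 0, t (φ x) = ∏ k ∈ K, x k)
    (h2 : ∀ k ∈ K, ∀ᶠ x in 𝓝 0, φ x ∈ S (idx k) → x k = 0) :
    ∃ c : {i // z ∈ S i} ↪ Fin 3, (∀ i h, c ⟨i, h⟩ ∈ K ∧ idx (c ⟨i, h⟩) = i) ∧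
      (∀ᶠ x in 𝓝 0, t (φ x) = ∏ᶠ i : {i // z ∈ S i}, x (c i)) ∧
      ∀ᶠ x in 𝓝 0, ∀ i, φ x ∈ S i → ∃ h : z ∈ S i, x (c ⟨i, h⟩) = 0 := by
  classical
  choose f hfK hf using fun i : {i // z ∈ S i} => (hz i.1).1 i.2
  let c : {i // z ∈ S i} ↪ Fin 3 := ⟨f, fun i j h => by
    have h1 := hf i
    rw [h, hf j] at h1
    exact Subtype.ext h1.symm⟩
  refine ⟨c, fun i h => ⟨hfK ⟨i, h⟩, hf ⟨i, h⟩⟩, ?_, ?_⟩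
  · filter_upwards [h1] with x hx
    have hK : (K : Set (Fin 3)) = Set.range c := by
      ext k
      constructor
      · intro hk; exact ⟨⟨idx k, (hz _).2 ⟨k, hk, rfl⟩⟩, hidx (hfK _) hk (hf _)⟩
      · rintro ⟨i, rfl⟩; exact hfK i
    rw [hx, ← finprod_mem_range (f := x) c.injective, ← finprod_mem_coe_finset, hK]
  · obtain ⟨U, -, hU⟩ := hφ Set.univ univ_mem
    have hc0 : ContinuousAt φ 0 := hU.continuousAt hU.zero_mem
    have h3 : ∀ i, ∀ᶠ x in 𝓝 0, φ x ∈ S i → z ∈ S i := fun i => by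
      by_cases hi : z ∈ S i
      · exact Filter.Eventually.of_forall fun _ _ => hi
      · have : (S i)ᶜ ∈ 𝓝 (φ 0) := (hS i).isOpen_compl.mem_nhds (by rwa [hU.map_zero])
        filter_upwards [hc0 this] with x hx hx'
        exact (hx hx').elim
    have h4 : ∀ᶠ x in 𝓝 0, ∀ k : {k // k ∈ K}, φ x ∈ S (idx k) → x k = 0 :=
      Filter.eventually_all.2 fun k => h2 k k.2
    filter_upwards [Filter.eventually_all.2 h3, h4] with x h3 h4 i hi
    refine ⟨h3 i hi, h4 ⟨_, hfK ⟨i, h3 i hi⟩⟩ ?_⟩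
    rw [hf]
    exact hi

namespace Segre

open ProjTop

lemma contDiff_eval (E : 𝒫₆) : ContDiff ℂ ω fun x : ℂ⁶ => eval x E := by
  simp only [MvPolynomial.eval_eq']
  refine ContDiff.sum fun d _ => contDiff_const.mul ?_
  refine contDiff_prod fun i _ => ?_
  exact (contDiff_apply ℂ ℂ i).pow _

lemma contDiff_redGen {P : Type*} [NormedAddCommGroup P] [NormedSpace ℂ P]
    {v w A B : P → ℂ⁶} {t : P → ℂ} (hv : ContDiff ℂ ω v) (hw : ContDiff ℂ ω w)
    (hA : ContDiff ℂ ω A) (hB : ContDiff ℂ ω B) (ht : ContDiff ℂ ω t) :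
    ContDiff ℂ ω fun p => redGen (v p) (w p) (A p) (B p) (t p) := by
  unfold redGen wedge
  refine ContDiff.prodMk ?_ (ht.smul ?_)
  · fun_prop
  · fun_prop

lemma coords_sect_base (mu lam : Dual ℂ PlückerSpace) :
    ({b | mu b.1.rep ≠ 0}, fun b => lam (sect mu b.1)) ∈ coords (X := Base) := by
  have := coords_fst (Y := ℂ) (X := ℙ ℂ PlückerSpace)
    (c := ({x | mu x.rep ≠ 0}, fun x => lam x.rep / mu x.rep)) ⟨lam, mu, rfl⟩
  convert! this using 2
  funext b
  simp [sect, div_eq_inv_mul]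

lemma isCoordinate_par (b : Base) : IsCoordinate (fun b : Base => b.2) b :=
  ⟨_, coords_snd (X := ℙ ℂ PlückerSpace) (Y := ℂ) (c := (Set.univ, id)) rfl, trivial, 0,
    fun _ => (add_zero _).symm⟩

lemma isCoordinate_sect {N : Dual ℂ (PlückerSpace × PlückerSpace)} {κ : Syntheme} {z : Ambient}
    (hN : N (z.2 κ).rep ≠ 0) (lam : Dual ℂ (PlückerSpace × PlückerSpace)) :
    IsCoordinate (fun y : Ambient => lam (sect N (y.2 κ))) z :=
  ⟨_, coords_snd (X := Base) (Y := Syntheme → ℙ ℂ (PlückerSpace × PlückerSpace))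
    (coords_eval κ (c := ({x : ℙ ℂ (PlückerSpace × PlückerSpace) | N x.rep ≠ 0},
      fun x => lam x.rep / N x.rep)) ⟨lam, N, rfl⟩), hN, 0,
    fun b => by simp [sect, div_eq_inv_mul]⟩

lemma isCoordinate_line {a c : ℂ⁶} {b : Base} (hb : bracket a c b.1.rep ≠ 0) (f g : Dual ℂ ℂ⁶) :
    IsCoordinate (fun b : Base => f (lineFst a c b.1) + g (lineSnd a c b.1)) b :=
  ⟨_, coords_sect_base (bracket a c) (f ∘ₗ contract c - g ∘ₗ contract a), hb, 0, fun b => by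
    simp [lineFst, lineSnd, sub_eq_add_neg]⟩

/-- The parameters and the unknowns of a family of lines. -/
abbrev Par (m : ℕ) : Type := ℂ³ × ℂ^m

/-- Equations for the lines of the family, and for their generators, near a point of the
blow-up: the lines are spanned by `V` and `W`, and the generators at `κ` are `lam κ` times the
reduced generators. -/
structure ChartData (E : 𝒫₆) (m : ℕ) where
  a : ℂ⁶
  c : ℂ⁶
  V : Par m → ℂ⁶
  W : Par m → ℂ⁶
  T : Par m → ℂ
  A : Syntheme → Par m → ℂ⁶
  B : Syntheme → Par m → ℂ⁶
  S : Syntheme → Par m → ℂ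
  lam : Syntheme → ℂ³ → ℂ
  F : Par m → ℂ^m
  u₀ : ℂ^m
  contDiff_V : ContDiff ℂ ω V
  contDiff_W : ContDiff ℂ ω W
  contDiff_T : ContDiff ℂ ω T
  contDiff_A : ∀ κ, ContDiff ℂ ω (A κ)
  contDiff_B : ∀ κ, ContDiff ℂ ω (B κ)
  contDiff_S : ∀ κ, ContDiff ℂ ω (S κ)
  contDiff_F : ContDiff ℂ ω F
  dual : ∀ p, dotL a (V p) = 1 ∧ dotL c (V p) = 0 ∧ dotL a (W p) = 0 ∧ dotL c (W p) = 1
  sum_eq : ∀ p, ∑ i, V p i = 0 ∧ ∑ i, W p i = 0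
  symm_V : ∀ κ p, symm κ (V p) = lam κ p.1 • A κ p
  symm_W : ∀ κ p, symm κ (W p) = lam κ p.1 • B κ p
  T_eq : ∀ κ p, T p = lam κ p.1 * S κ p
  ne_zero : ∀ κ, ¬ (A κ (0, u₀) = 0 ∧ B κ (0, u₀) = 0 ∧ S κ (0, u₀) = 0)
  lam_ne : ∀ κ x, (∀ j, x j ≠ 0) → lam κ x ≠ 0
  family : ∀ p, F p = 0 → ∀ α γ : ℂ,
    T p * eval (α • V p + γ • W p) E + cubic (α • V p + γ • W p) = 0
  F_zero : F (0, u₀) = 0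
  F_inj : ∀ w, (∀ j, HasDerivAt (fun ε : ℂ => F (0, u₀ + ε • w) j) 0 0) → w = 0

namespace ChartData

variable {E : 𝒫₆} {m : ℕ} (D : ChartData E m)

/-- The reduced generators. -/
def gen (κ : Syntheme) (p : Par m) : (PlückerSpace × PlückerSpace) :=
  redGen (D.V p) (D.W p) (D.A κ p) (D.B κ p) (D.S κ p)

/-- The point of the blow-up with the given parameters. -/
def point (p : Par m) : Ambient :=
  ((proj (wedge (D.V p) (D.W p)), D.T p), fun κ => proj (D.gen κ p))

lemma bracket_eq (p : Par m) : bracket D.a D.c (wedge (D.V p) (D.W p)) = 1 := by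
  obtain ⟨h1, h2, h3, h4⟩ := D.dual p
  rw [bracket_wedge, h1, h2, h3, h4]; ring

lemma wedge_ne (p : Par m) : wedge (D.V p) (D.W p) ≠ 0 := fun h => by
  have := D.bracket_eq p
  rw [h, map_zero] at this
  exact zero_ne_one this

lemma isLine (p : Par m) : IsLine (D.point p).1.1 (D.V p) (D.W p) :=
  isLine_iff.2 ⟨D.wedge_ne p, rfl⟩

lemma bracket_ne (p : Par m) : bracket D.a D.c (D.point p).1.1.rep ≠ 0 := by
  rw [(D.isLine p).bracket_ne_zero, ← bracket_wedge, D.bracket_eq]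
  exact one_ne_zero

lemma line_point (p : Par m) : lineFst D.a D.c (D.point p).1.1 = D.V p ∧
    lineSnd D.a D.c (D.point p).1.1 = D.W p := by
  obtain ⟨h1, h2, h3, h4⟩ := D.dual p
  exact (D.isLine p).eq_normalized (D.bracket_ne p) h1 h2 h3 h4

lemma generators_eq (κ : Syntheme) (p : Par m) :
    generators κ (wedge (D.V p) (D.W p)) (D.T p) = D.lam κ p.1 • D.gen κ p := by
  rw [generators_wedge, D.symm_V, D.symm_W, D.T_eq κ, redGen_smul, gen]

lemma contDiff_gen (κ : Syntheme) : ContDiff ℂ ω (D.gen κ) :=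
  contDiff_redGen D.contDiff_V D.contDiff_W (D.contDiff_A κ) (D.contDiff_B κ) (D.contDiff_S κ)

lemma gen_ne_zero_iff (κ : Syntheme) (p : Par m) :
    D.gen κ p ≠ 0 ↔ ¬ (D.A κ p = 0 ∧ D.B κ p = 0 ∧ D.S κ p = 0) :=
  not_congr (redGen_eq_zero (D.isLine p))

lemma eventually_gen_ne : ∀ᶠ p in 𝓝 (0, D.u₀), ∀ κ, D.gen κ p ≠ 0 :=
  Filter.eventually_all.2 fun κ => (D.contDiff_gen κ).continuous.continuousAt.eventually_ne
    ((D.gen_ne_zero_iff κ _).2 (D.ne_zero κ))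

lemma point_mem_family {p : Par m} (hF : D.F p = 0) : (D.point p).1 ∈ fanoFamily E :=
  ⟨D.V p, D.W p, (D.sum_eq p).1, (D.sum_eq p).2, D.isLine p, D.family p hF⟩

lemma notMem_planeLines {p : Par m} {κ : Syntheme} (hl : D.lam κ p.1 ≠ 0) (hg : D.gen κ p ≠ 0) :
    (D.point p).1 ∉ planeLines κ := by
  have h := (generators_ne_zero_iff (σ := κ) (t := D.T p) (D.isLine p)).1
  rw [D.generators_eq] at h
  exact h (smul_ne_zero hl hg)

lemma mem_planeLines {p : Par m} {κ : Syntheme} (hl : D.lam κ p.1 = 0) :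
    (D.point p).1 ∈ planeLines κ := by
  have h := (generators_ne_zero_iff (σ := κ) (t := D.T p) (D.isLine p)).2
  rw [D.generators_eq, hl, zero_smul] at h
  by_contra h'
  exact h h' rfl

lemma point_mem_graph {p : Par m} (hF : D.F p = 0) (hl : ∀ κ, D.lam κ p.1 ≠ 0)
    (hg : ∀ κ, D.gen κ p ≠ 0) : D.point p ∈ graph E := by
  refine (mem_graph_iff (D.isLine p)).2 ⟨D.point_mem_family hF, fun κ =>
    ⟨D.notMem_planeLines (hl κ) (hg κ), ?_⟩⟩
  change proj (D.gen κ p) = proj (generators κ (wedge (D.V p) (D.W p)) (D.T p))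
  rw [D.generators_eq, proj_smul (hl κ)]

lemma continuousAt_point {p : Par m} (hg : ∀ κ, D.gen κ p ≠ 0) : ContinuousAt D.point p := by
  refine ContinuousAt.prodMk (ContinuousAt.prodMk ?_ D.contDiff_T.continuous.continuousAt)
    (continuousAt_pi.2 fun κ => ?_)
  · exact (continuousAt_proj (D.wedge_ne p)).comp (f := fun p => wedge (D.V p) (D.W p))
      (continuous_wedge.comp (D.contDiff_V.continuous.prodMk D.contDiff_W.continuous)).continuousAt
  · exact (continuousAt_proj (hg κ)).comp (D.contDiff_gen κ).continuous.continuousAt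

lemma holomorphicAt_point {g : ℂ³ → ℂ^m} {x : ℂ³}
    (h : AnalyticAt ℂ g x) (hg : ∀ κ, D.gen κ (x, g x) ≠ 0) :
    HolomorphicAt (fun x => D.point (x, g x)) x := by
  have hc : AnalyticAt ℂ (fun x => (x, g x)) x := analyticAt_id.prod h
  have hV : AnalyticAt ℂ (fun x => wedge (D.V (x, g x)) (D.W (x, g x))) x := by
    have : ContDiff ℂ ω fun p => wedge (D.V p) (D.W p) := by
      have h1 := D.contDiff_V
      have h2 := D.contDiff_W
      unfold wedge
      fun_prop
    exact this.contDiffAt.analyticAt.comp hc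
  refine holomorphicAt_prod.2 ⟨holomorphicAt_prod.2
    ⟨holomorphicAt_proj hV (D.wedge_ne _), holomorphicAt_complex.2 ?_⟩,
    holomorphicAt_pi.2 fun κ => holomorphicAt_proj ?_ (hg κ)⟩
  exacts [D.contDiff_T.contDiffAt.analyticAt.comp hc,
    (D.contDiff_gen κ).contDiffAt.analyticAt.comp hc]

lemma dense_coordinates_ne : Dense {x : ℂ³ | ∀ j, x j ≠ 0} := by
  have := dense_pi (Set.univ : Set (Fin 3)) (s := fun _ => {(0 : ℂ)}ᶜ)
    fun _ _ => dense_compl_singleton 0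
  convert! this using 1
  ext x
  simp

/-- The solution of the equations, as a function of the parameters. -/
def IsSolution (g : ℂ³ → ℂ^m) : Prop :=
  AnalyticAt ℂ g 0 ∧ g 0 = D.u₀ ∧ (∀ᶠ x in 𝓝 0, D.F (x, g x) = 0) ∧
    (∀ᶠ p in 𝓝 ((0 : ℂ³), D.u₀), D.F p = 0 → p.2 = g p.1)

lemma exists_solution : ∃ g, D.IsSolution g :=
  exists_analytic_implicit D.contDiff_F D.F_zero D.F_inj

variable {D} {g : ℂ³ → ℂ^m} (hg : D.IsSolution g)
include hg

lemma IsSolution.tendsto : Tendsto (fun x => (x, g x)) (𝓝 0) (𝓝 (0, D.u₀)) := by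
  have : ContinuousAt (fun x => (x, g x)) 0 := continuousAt_id.prodMk hg.1.continuousAt
  simpa [ContinuousAt, hg.2.1] using this

lemma IsSolution.eventually : ∀ᶠ x in 𝓝 0, D.F (x, g x) = 0 ∧ AnalyticAt ℂ g x ∧
    ∀ κ, D.gen κ (x, g x) ≠ 0 :=
  hg.2.2.1.and (hg.1.eventually_analyticAt.and (hg.tendsto.eventually D.eventually_gen_ne))

lemma IsSolution.point : ∀ᶠ x in 𝓝 0, HolomorphicAt (fun x => D.point (x, g x)) x ∧
    ContinuousAt (fun x => D.point (x, g x)) x ∧ D.point (x, g x) ∈ blowUp E := by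
  filter_upwards [hg.eventually.eventually_nhds] with x hx
  have hx0 := hx.self_of_nhds
  have hcx : ContinuousAt (fun x => D.point (x, g x)) x :=
    ContinuousAt.comp (f := fun x => (x, g x)) (D.continuousAt_point hx0.2.2)
      (continuousAt_id.prodMk hx0.2.1.continuousAt)
  refine ⟨D.holomorphicAt_point hx0.2.1 hx0.2.2, hcx, ?_⟩
  have hne : NeBot (𝓝[{x : ℂ³ | ∀ j, x j ≠ 0}] x) :=
    mem_closure_iff_nhdsWithin_neBot.1 (dense_coordinates_ne x)
  refine mem_closure_of_tendsto (hcx.tendsto.mono_left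
    (nhdsWithin_le_nhds (s := {x : ℂ³ | ∀ j, x j ≠ 0}))) ?_
  filter_upwards [self_mem_nhdsWithin, nhdsWithin_le_nhds hx] with y hy hy'
  exact D.point_mem_graph hy'.1 (fun κ => D.lam_ne κ _ hy) hy'.2.2

lemma IsSolution.point_zero : D.point (0, D.u₀) ∈ blowUp E := by
  have := hg.point.self_of_nhds.2.2
  rwa [hg.2.1] at this

lemma IsSolution.chart {z : Ambient} (hz : z ∈ blowUp E) {X : Ambient → ℂ³}
    {U : Ambient → ℂ^m} (hX0 : X z = 0) (hU : Tendsto U (𝓝[graph E] z) (𝓝 D.u₀))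
    (hXc : ∀ j, IsCoordinate (fun y => X y j) z)
    (hrec : ∀ᶠ y in 𝓝[graph E] z, bracket D.a D.c y.1.1.rep ≠ 0 ∧
      lineFst D.a D.c y.1.1 = D.V (X y, U y) ∧
      lineSnd D.a D.c y.1.1 = D.W (X y, U y) ∧ y.1.2 = D.T (X y, U y) ∧ D.F (X y, U y) = 0)
    (hsec : ∀ᶠ p in 𝓝 (0, D.u₀), D.F p = 0 → X (D.point p) = p.1) :
    D.point (0, D.u₀) = z ∧ IsChartAt 3 (blowUp E) z (fun x => D.point (x, g x)) := by
  have hX : Tendsto X (𝓝[graph E] z) (𝓝 0) := tendsto_pi_nhds.2 fun j => by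
    have h := (hXc j).continuousAt.tendsto.mono_left (nhdsWithin_le_nhds (s := graph E))
    rwa [hX0] at h
  have hXU : Tendsto (fun y => (X y, U y)) (𝓝[graph E] z) (𝓝 (0, D.u₀)) := by
    rw [nhds_prod_eq]
    exact hX.prodMk hU
  have hsurj : ∀ N ∈ 𝓝 (0 : ℂ³), ∀ᶠ y in 𝓝[graph E] z, y ∈ (fun x => D.point (x, g x)) '' N := by
    intro N hN
    filter_upwards [hX hN, hrec, hXU.eventually hg.2.2.2, hXU.eventually D.eventually_gen_ne,
      self_mem_nhdsWithin] with y hyN hy hyg hgen hyG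
    refine ⟨X y, hyN, ?_⟩
    have hu : g (X y) = U y := (hyg hy.2.2.2.2).symm
    have hpt : D.point (X y, U y) = y := by
      obtain ⟨v, w, hl⟩ := graph_isLine hyG
      have hn := hl.normalized hy.1
      rw [hy.2.1, hy.2.2.1] at hn
      have h1 : (D.point (X y, U y)).1 = y.1 := Prod.ext (isLine_iff.1 hn).2.symm hy.2.2.2.1.symm
      refine Prod.ext h1 (funext fun κ => ?_)
      obtain ⟨h2, h3⟩ := ((mem_graph_iff hn).1 hyG).2 κ
      have hl0 : D.lam κ (X y) ≠ 0 := fun h0 => h2 (h1 ▸ D.mem_planeLines h0)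
      rw [h3, hy.2.2.2.1, D.generators_eq, proj_smul hl0]
      rfl
    simpa only [hu] using hpt
  have hφ0 := hg.point.self_of_nhds
  have h0 : D.point (0, g 0) = z := eq_of_mem_image_of_nhds hz hφ0.2.1 hsurj
  choose c hc hdom k hk using hXc
  refine ⟨by rwa [hg.2.1] at h0, exists_isHolomorphicChart subset_rfl c hc hdom
    hg.point h0 (fun v hv => funext fun j => ?_) hsurj⟩
  have h1 : (c j).2 ∘ (fun x => D.point (x, g x)) =ᶠ[𝓝 0] fun x => x j + k j := by
    filter_upwards [hg.tendsto.eventually hsec, hg.eventually] with x hx hx'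
    simp [hk, hx hx'.1]
  have h2 := hv j
  rw [h1.fderiv_eq, fderiv_add_const] at h2
  exact (fderiv_coord j 0 v).symm.trans h2

end ChartData

/-! ## Coordinates adapted to a partition -/

/-- Permutation of the coordinates. -/
def place (π : 𝔖₆) (x : ℂ⁶) : ℂ⁶ := fun i => x (π.symm i)

/-- The point with half sums `s` and half differences `d` of the pairs of coordinates. -/
def vec (s d : ℂ³) : ℂ⁶ := ![s 0 + d 0, s 0 - d 0, s 1 + d 1, s 1 - d 1, s 2 + d 2, s 2 - d 2]

/-- The involution with the pairs `01`, `23`, `45`. -/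
def swp : Fin 6 → Fin 6 := ![1, 0, 3, 2, 5, 4]

def evn : Fin 3 → Fin 6 := ![0, 2, 4]

def odd : Fin 3 → Fin 6 := ![1, 3, 5]

def halfSum (π : 𝔖₆) (x : ℂ⁶) (k : Fin 3) : ℂ := (x (π (evn k)) + x (π (odd k))) / 2

def halfDiff (π : 𝔖₆) (x : ℂ⁶) (k : Fin 3) : ℂ := (x (π (evn k)) - x (π (odd k))) / 2

section Place

variable (π : 𝔖₆)

@[simp] lemma place_apply (x : ℂ⁶) (j : Fin 6) : place π x (π j) = x j := by simp [place]

lemma place_ext {x y : ℂ⁶} (h : ∀ j, x (π j) = y (π j)) : x = y :=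
  funext fun i => by simpa using h (π.symm i)

lemma sum_perm {M : Type*} [AddCommMonoid M] (f : Fin 6 → M) : ∑ i, f i = ∑ j, f (π j) :=
  (Equiv.sum_comp π f).symm

lemma cubic_place (x : ℂ⁶) : cubic (place π x) = cubic x := by unfold cubic; rw [sum_perm π]; simp

lemma sum_place (x : ℂ⁶) : ∑ i, place π x i = ∑ i, x i := by rw [sum_perm π]; simp

lemma place_combo (x y : ℂ⁶) (α γ : ℂ) :
    α • place π x + γ • place π y = place π (α • x + γ • y) := rfl

lemma place_smul (x : ℂ⁶) (α : ℂ) : α • place π x = place π (α • x) := rfl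

lemma place_eq_zero {x : ℂ⁶} : place π x = 0 ↔ x = 0 := by
  constructor
  · intro h; funext j; simpa using congrFun h (π j)
  · rintro rfl; rfl

lemma symm_place {σ : Syntheme} {f : Fin 6 → Fin 6} (hπ : ∀ i, σ.1 (π i) = π (f i))
    (x : ℂ⁶) : symm σ (place π x) = place π (fun j => x j + x (f j)) :=
  place_ext π fun j => by simp [symm, hπ]

lemma contDiff_place {P : Type*} [NormedAddCommGroup P] [NormedSpace ℂ P] {f : P → ℂ⁶}
    (hf : ∀ j, ContDiff ℂ ω fun p => f p j) : ContDiff ℂ ω fun p => place π (f p) :=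
  contDiff_pi.2 fun i => hf (π.symm i)

lemma contDiff_vec {P : Type*} [NormedAddCommGroup P] [NormedSpace ℂ P] {s d : P → ℂ³}
    (hs : ∀ k, ContDiff ℂ ω fun p => s p k) (hd : ∀ k, ContDiff ℂ ω fun p => d p k) (j : Fin 6) :
    ContDiff ℂ ω fun p => vec (s p) (d p) j := by
  have h0 := hs 0
  have h1 := hs 1
  have h2 := hs 2
  have h3 := hd 0
  have h4 := hd 1
  have h5 := hd 2
  fin_cases j <;> simp only [vec] <;> dsimp <;> fun_prop

lemma vec_combo (s d s' d' : ℂ³) (α γ : ℂ) :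
    α • vec s d + γ • vec s' d' = vec (α • s + γ • s') (α • d + γ • d') := by
  funext j
  fin_cases j <;> simp [vec] <;> ring

lemma vec_smul (s d : ℂ³) (α : ℂ) : α • vec s d = vec (α • s) (α • d) := by
  funext j
  fin_cases j <;> simp [vec] <;> ring

lemma sum_vec (s d : ℂ³) : ∑ i, vec s d i = 2 * (s 0 + s 1 + s 2) := by
  simp [Fin.sum_univ_six, vec]; ring

lemma cubic_vec {s d : ℂ³} (hs : s 0 + s 1 + s 2 = 0) : cubic (vec s d) =
    6 * (s 0 * s 1 * s 2 + (s 0 * d 0 ^ 2 + s 1 * d 1 ^ 2 + s 2 * d 2 ^ 2)) := by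
  have h : s 2 = -s 0 - s 1 := by grind
  simp [cubic, Fin.sum_univ_six, vec, h]; ring

lemma vec_swp (s d : ℂ³) : (fun j => vec s d j + vec s d (swp j)) = vec (2 • s) 0 := by
  funext j
  fin_cases j <;> simp [vec, swp] <;> ring

lemma vec_eq_zero {s d : ℂ³} : vec s d = 0 ↔ s = 0 ∧ d = 0 := by
  constructor
  · intro h
    have h0 := congrFun h 0
    have h1 := congrFun h 1
    have h2 := congrFun h 2
    have h3 := congrFun h 3
    have h4 := congrFun h 4
    have h5 := congrFun h 5
    simp only [vec, Pi.zero_apply] at h0 h1 h2 h3 h4 h5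
    dsimp at h0 h1 h2 h3 h4 h5
    constructor <;> funext k <;> fin_cases k <;> dsimp
    · grind
    · grind
    · grind
    · grind
    · grind
    · grind
  · rintro ⟨rfl, rfl⟩; funext j; fin_cases j <;> simp [vec]

lemma eq_place_vec (x : ℂ⁶) : x = place π (vec (halfSum π x) (halfDiff π x)) :=
  place_ext π fun j => by
    rw [place_apply]
    fin_cases j <;> simp [vec, halfSum, halfDiff, evn, odd] <;> ring

@[simp] lemma halfSum_place (s d : ℂ³) : halfSum π (place π (vec s d)) = s := by
  funext k
  simp only [halfSum, place_apply]
  fin_cases k <;> simp [vec, evn, odd]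

@[simp] lemma halfDiff_place (s d : ℂ³) : halfDiff π (place π (vec s d)) = d := by
  funext k
  simp only [halfDiff, place_apply]
  fin_cases k <;> simp [vec, evn, odd]

lemma sum_halfSum (x : ℂ⁶) : 2 * (halfSum π x 0 + halfSum π x 1 + halfSum π x 2) = ∑ i, x i := by
  conv_rhs => rw [eq_place_vec π x, sum_place, sum_vec]

def sumVec (k : Fin 3) : ℂ⁶ := Pi.single (π (evn k)) (1 / 2) + Pi.single (π (odd k)) (1 / 2)

def diffVec (k : Fin 3) : ℂ⁶ := Pi.single (π (evn k)) (1 / 2) - Pi.single (π (odd k)) (1 / 2)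

@[simp] lemma dotL_sumVec (k : Fin 3) (x : ℂ⁶) : dotL (sumVec π k) x = halfSum π x k := by
  simp [sumVec, halfSum, dotL_apply, add_mul, Finset.sum_add_distrib, Pi.single_apply]
  ring

@[simp] lemma dotL_diffVec (k : Fin 3) (x : ℂ⁶) : dotL (diffVec π k) x = halfDiff π x k := by
  simp [diffVec, halfDiff, dotL_apply, sub_mul, Finset.sum_sub_distrib, Pi.single_apply]
  ring

variable {π} {σ : Syntheme} (hπ : ∀ i, σ.1 (π i) = π (swp i))
include hπ

lemma symm_place_vec (s d : ℂ³) : symm σ (place π (vec s d)) = place π (vec (2 • s) 0) := by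
  rw [symm_place π hπ, vec_swp]

lemma inPlane_place_vec {s d : ℂ³} : InPlane σ (place π (vec s d)) ↔ s = 0 := by
  rw [inPlane_iff, symm_place_vec hπ, place_eq_zero, vec_eq_zero]
  constructor
  · rintro ⟨h, -⟩; funext k; simpa using congrFun h k
  · rintro rfl; simp

lemma symm_eq_halfSum (x : ℂ⁶) : symm σ x = place π (vec (2 • halfSum π x) 0) := by
  conv_lhs => rw [eq_place_vec π x, symm_place_vec hπ]

lemma redCubic_place (E : 𝒫₆) (s' d : ℂ³) (t : ℂ) :
    redCubic E σ (place π (vec (2 • s') 0)) t (place π (vec 0 d)) =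
      6 * (s' 0 * d 0 ^ 2 + s' 1 * d 1 ^ 2 + s' 2 * d 2 ^ 2) + t * eval (place π (vec 0 d)) E := by
  rw [redCubic, sum_perm π]
  congr 1
  simp only [quad, hπ, place_apply]
  simp [Fin.sum_univ_six, vec, swp]
  ring

lemma eq_place_of_symm {x : ℂ⁶} (h : ∀ i, x (σ.1 i) = x i) : x = place π (vec (halfSum π x) 0) := by
  conv_lhs => rw [eq_place_vec π x]
  congr 2
  funext k
  have := h (π (evn k))
  rw [hπ] at this
  have h2 : swp (evn k) = odd k := by fin_cases k <;> rfl
  rw [h2] at this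
  simp [halfDiff, this]

end Place

/-! ## Charts at the lines in one plane -/

namespace PlaneChart

/-- The half sums of the first basis vector, divided by the first parameter. -/
def sA (u : ℂ^5) : ℂ³ := ![u 0, u 1, -u 0 - u 1]

/-- The half sums of the second basis vector, divided by the first parameter. -/
def sB (u : ℂ^5) : ℂ³ := ![u 2, u 3, -u 2 - u 3]

/-- The normalization of the unknowns. -/
def nrm (par : Bool) (u : ℂ^5) : ℂ := if par then u 4 else u 0 + u 1

variable (E : 𝒫₆) (π : 𝔖₆) (g₁ g₂ : ℂ) (par : Bool)

def vV (p : Par 5) : ℂ⁶ := place π (vec (p.1 0 • sA p.2) ![1, 0, g₁ + p.1 1])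

def vW (p : Par 5) : ℂ⁶ := place π (vec (p.1 0 • sB p.2) ![0, 1, g₂ + p.1 2])

/-- The equation of the family on the line, divided by the first parameter. -/
def form (p : Par 5) (α γ : ℂ) : ℂ :=
  6 * (p.1 0 ^ 2 * ((α * p.2 0 + γ * p.2 2) * (α * p.2 1 + γ * p.2 3) *
      (-(α * p.2 0 + γ * p.2 2) - (α * p.2 1 + γ * p.2 3))) +
    ((α * p.2 0 + γ * p.2 2) * α ^ 2 + (α * p.2 1 + γ * p.2 3) * γ ^ 2 -
      (α * p.2 0 + γ * p.2 2 + (α * p.2 1 + γ * p.2 3)) *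
        (α * (g₁ + p.1 1) + γ * (g₂ + p.1 2)) ^ 2)) +
    p.2 4 * eval (α • vV π g₁ p + γ • vW π g₂ p) E

def eqs (p : Par 5) : ℂ^5 :=
  ![form E π g₁ g₂ p 1 0, form E π g₁ g₂ p 0 1, form E π g₁ g₂ p 1 1, form E π g₁ g₂ p 1 (-1),
    nrm par p.2 - 1]

variable {E π g₁ g₂ par}

lemma contDiff_symm {P : Type*} [NormedAddCommGroup P] [NormedSpace ℂ P] (κ : Syntheme)
    {v : P → ℂ⁶} (hv : ContDiff ℂ ω v) : ContDiff ℂ ω fun p => symm κ (v p) := by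
  unfold symm
  fun_prop

lemma form_spec (p : Par 5) (α γ : ℂ) : (p.1 0 * p.2 4) * eval (α • vV π g₁ p + γ • vW π g₂ p) E +
      cubic (α • vV π g₁ p + γ • vW π g₂ p) = p.1 0 * form E π g₁ g₂ p α γ := by
  have h : cubic (α • vV π g₁ p + γ • vW π g₂ p) = 6 * p.1 0 * (p.1 0 ^ 2 *
      ((α * p.2 0 + γ * p.2 2) * (α * p.2 1 + γ * p.2 3) *
      (-(α * p.2 0 + γ * p.2 2) - (α * p.2 1 + γ * p.2 3))) +
    ((α * p.2 0 + γ * p.2 2) * α ^ 2 + (α * p.2 1 + γ * p.2 3) * γ ^ 2 -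
      (α * p.2 0 + γ * p.2 2 + (α * p.2 1 + γ * p.2 3)) *
        (α * (g₁ + p.1 1) + γ * (g₂ + p.1 2)) ^ 2)) := by
    rw [vV, vW, place_combo, vec_combo, cubic_place, cubic_vec]
    · simp [sA, sB]; ring
    · simp [sA, sB]; ring
  rw [h, form]
  ring

lemma isBinaryCubic_form (hE : E.IsHomogeneous 3) (p : Par 5) :
    IsBinaryCubic (form E π g₁ g₂ p) := by
  unfold form
  refine IsBinaryCubic.add ?_ ((isBinaryCubic_eval hE _ _).const_mul _)
  refine IsBinaryCubic.const_mul (IsBinaryCubic.add (IsBinaryCubic.const_mul ?_ _) ?_) _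
  · refine ⟨p.2 0 * p.2 1 * (-p.2 0 - p.2 1), p.2 0 * p.2 1 * (-p.2 2 - p.2 3) +
      (p.2 0 * p.2 3 + p.2 2 * p.2 1) * (-p.2 0 - p.2 1), p.2 2 * p.2 3 * (-p.2 0 - p.2 1) +
      (p.2 0 * p.2 3 + p.2 2 * p.2 1) * (-p.2 2 - p.2 3), p.2 2 * p.2 3 * (-p.2 2 - p.2 3),
      fun α γ => ?_⟩
    ring
  · refine ⟨p.2 0 - (p.2 0 + p.2 1) * (g₁ + p.1 1) ^ 2, p.2 2 - (p.2 2 + p.2 3) * (g₁ + p.1 1) ^ 2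
      - 2 * (p.2 0 + p.2 1) * (g₁ + p.1 1) * (g₂ + p.1 2), p.2 1 - (p.2 0 + p.2 1) *
      (g₂ + p.1 2) ^ 2 - 2 * (p.2 2 + p.2 3) * (g₁ + p.1 1) * (g₂ + p.1 2),
      p.2 3 - (p.2 2 + p.2 3) * (g₂ + p.1 2) ^ 2, fun α γ => ?_⟩
    ring

lemma eqs_eq_zero (hE : E.IsHomogeneous 3) (p : Par 5) : eqs E π g₁ g₂ par p = 0 ↔
    (∀ α γ, form E π g₁ g₂ p α γ = 0) ∧ nrm par p.2 = 1 := by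
  constructor
  · intro h
    refine ⟨(isBinaryCubic_form hE p).eq_zero (congrFun h 0) (congrFun h 1) (congrFun h 2)
      (congrFun h 3), ?_⟩
    exact sub_eq_zero.1 (congrFun h 4)
  · rintro ⟨h1, h2⟩; funext j; fin_cases j <;> simp [eqs, h1, h2]

lemma vV_zero (u : ℂ^5) : vV π g₁ (0, u) = place π (vec 0 ![1, 0, g₁]) := by simp [vV]

lemma vW_zero (u : ℂ^5) : vW π g₂ (0, u) = place π (vec 0 ![0, 1, g₂]) := by simp [vW]

lemma form_zero (u : ℂ^5) (α γ : ℂ) : form E π g₁ g₂ (0, u) α γ =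
    6 * ((α * u 0 + γ * u 2) * α ^ 2 + (α * u 1 + γ * u 3) * γ ^ 2 -
      (α * u 0 + γ * u 2 + (α * u 1 + γ * u 3)) * (α * g₁ + γ * g₂) ^ 2) +
    u 4 * eval (place π (vec 0 ![α, γ, α * g₁ + γ * g₂])) E := by
  rw [form, vV_zero, vW_zero, place_combo, vec_combo]
  simp [Matrix.smul_cons]

lemma contDiff_vV : ContDiff ℂ ω (vV π g₁) := by
  refine contDiff_place π (contDiff_vec (fun k => ?_) fun k => ?_) <;>
    fin_cases k <;> simp [sA] <;> fun_prop

lemma contDiff_vW : ContDiff ℂ ω (vW π g₂) := by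
  refine contDiff_place π (contDiff_vec (fun k => ?_) fun k => ?_) <;>
    fin_cases k <;> simp [sB] <;> fun_prop

lemma contDiff_form (α γ : ℂ) : ContDiff ℂ ω fun p => form E π g₁ g₂ p α γ := by
  have h1 : ContDiff ℂ ω fun p : Par 5 => eval (α • vV π g₁ p + γ • vW π g₂ p) E :=
    (contDiff_eval E).comp ((contDiff_vV.const_smul α).add (contDiff_vW.const_smul γ))
  unfold form
  fun_prop

variable (E π g₁ g₂ par) in
/-- The equations at the centre, as a linear map. -/
def eqsL : ℂ^5 →ₗ[ℂ] ℂ^5 where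
  toFun u := ![form E π g₁ g₂ (0, u) 1 0, form E π g₁ g₂ (0, u) 0 1, form E π g₁ g₂ (0, u) 1 1,
    form E π g₁ g₂ (0, u) 1 (-1), nrm par u]
  map_add' u v := by
    funext j
    fin_cases j <;> simp [form_zero, nrm]
    all_goals (try split_ifs)
    all_goals ring
  map_smul' r u := by
    funext j
    fin_cases j <;> simp [form_zero, nrm]
    all_goals (try split_ifs)
    all_goals ring

lemma eqs_zero (u : ℂ^5) : eqs E π g₁ g₂ par (0, u) = eqsL E π g₁ g₂ par u - ![0, 0, 0, 0, 1] := by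
  funext j
  fin_cases j <;> simp [eqs, eqsL]

lemma injective_eqsL (hE : E.IsHomogeneous 3)
    (hL : ∀ u, (∀ α γ, form E π g₁ g₂ (0, u) α γ = 0) → nrm par u = 0 → u = 0) (u : ℂ^5)
    (hu : eqsL E π g₁ g₂ par u = 0) : u = 0 :=
  hL u ((isBinaryCubic_form hE (0, u)).eq_zero (congrFun hu 0) (congrFun hu 1) (congrFun hu 2)
      (congrFun hu 3)) (congrFun hu 4)

lemma exists_unknowns (hE : E.IsHomogeneous 3)
    (hL : ∀ u, (∀ α γ, form E π g₁ g₂ (0, u) α γ = 0) → nrm par u = 0 → u = 0) :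
    ∃ u, eqs E π g₁ g₂ par (0, u) = 0 := by
  have h1 : Injective (eqsL E π g₁ g₂ par) := (injective_iff_map_eq_zero _).2 (injective_eqsL hE hL)
  obtain ⟨u, hu⟩ := LinearMap.surjective_of_injective h1 ![0, 0, 0, 0, 1]
  exact ⟨u, by rw [eqs_zero, hu, sub_self]⟩

end PlaneChart

open PlaneChart in
/-- The chart at a line that lies in one plane. -/
def planeChart {E : 𝒫₆} (hE : E.IsHomogeneous 3) {σ : Syntheme}
    {π : 𝔖₆} (hπ : ∀ i, σ.1 (π i) = π (swp i)) {g₁ g₂ : ℂ} {par : Bool}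
    (hL : ∀ u, (∀ α γ, form E π g₁ g₂ (0, u) α γ = 0) → nrm par u = 0 → u = 0)
    (hk : ∀ κ, κ ≠ σ → ¬ (InPlane κ (place π (vec 0 ![1, 0, g₁])) ∧
      InPlane κ (place π (vec 0 ![0, 1, g₂])))) {u : ℂ^5}
    (hu : eqs E π g₁ g₂ par (0, u) = 0) : ChartData E 5 := open Classical in
  { a := diffVec π 0
    c := diffVec π 1
    V := vV π g₁
    W := vW π g₂
    T := fun p => p.1 0 * p.2 4
    A := fun κ p => if κ = σ then place π (vec (2 • sA p.2) 0) else symm κ (vV π g₁ p)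
    B := fun κ p => if κ = σ then place π (vec (2 • sB p.2) 0) else symm κ (vW π g₂ p)
    S := fun κ p => if κ = σ then p.2 4 else p.1 0 * p.2 4
    lam := fun κ x => if κ = σ then x 0 else 1
    F := eqs E π g₁ g₂ par
    u₀ := u
    contDiff_V := contDiff_vV
    contDiff_W := contDiff_vW
    contDiff_T := by fun_prop
    contDiff_A := by
      intro κ
      by_cases h : κ = σ
      · simp only [h, if_true]
        refine contDiff_place π (contDiff_vec (fun k => ?_) fun k => contDiff_const)
        fin_cases k <;> simp [sA] <;> fun_prop
      · simp only [h, if_false]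
        exact contDiff_symm κ contDiff_vV
    contDiff_B := by
      intro κ
      by_cases h : κ = σ
      · simp only [h, if_true]
        refine contDiff_place π (contDiff_vec (fun k => ?_) fun k => contDiff_const)
        fin_cases k <;> simp [sB] <;> fun_prop
      · simp only [h, if_false]
        exact contDiff_symm κ contDiff_vW
    contDiff_S := by
      intro κ
      by_cases h : κ = σ <;> simp only [h, if_true, if_false] <;> fun_prop
    contDiff_F := by
      refine contDiff_pi.2 fun j => ?_
      fin_cases j
      · exact contDiff_form 1 0
      · exact contDiff_form 0 1
      · exact contDiff_form 1 1
      · exact contDiff_form 1 (-1)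
      · change ContDiff ℂ ω fun p : Par 5 => nrm par p.2 - 1
        unfold nrm
        split_ifs <;> fun_prop
    dual := by
      intro p
      simp [vV, vW]
    sum_eq := by
      intro p
      simp only [vV, vW, sum_place, sum_vec]
      simp [sA, sB]
      constructor <;> ring
    symm_V := by
      intro κ p
      by_cases h : κ = σ
      · subst h
        simp only [if_true, vV, symm_place_vec hπ, place_smul, vec_smul, smul_zero]
        rw [smul_comm]
      · simp [h]
    symm_W := by
      intro κ p
      by_cases h : κ = σ
      · subst h
        simp only [if_true, vW, symm_place_vec hπ, place_smul, vec_smul, smul_zero]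
        rw [smul_comm]
      · simp [h]
    T_eq := by
      intro κ p
      by_cases h : κ = σ <;> simp [h]
    ne_zero := by
      intro κ
      by_cases h : κ = σ
      · simp only [h, if_true]
        rintro ⟨h1, h2, h3⟩
        rw [place_eq_zero, vec_eq_zero] at h1 h2
        have hu0 : u = 0 := by
          have a0 := congrFun h1.1 0
          have a1 := congrFun h1.1 1
          have b0 := congrFun h2.1 0
          have b1 := congrFun h2.1 1
          simp [sA, sB] at a0 a1 b0 b1
          funext j
          fin_cases j <;> simp [a0, a1, b0, b1]
          exact h3
        have := ((eqs_eq_zero hE _).1 hu).2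
        simp [hu0, nrm] at this
      · simp only [h, if_false, vV_zero, vW_zero]
        rintro ⟨h1, h2, -⟩
        exact hk κ h ⟨inPlane_iff.2 h1, inPlane_iff.2 h2⟩
    lam_ne := by
      intro κ x hx
      by_cases h : κ = σ
      · simpa [h] using hx 0
      · simp [h]
    family := by
      intro p hp α γ
      rw [form_spec, ((eqs_eq_zero hE p).1 hp).1, mul_zero]
    F_zero := hu
    F_inj := by
      intro w hw
      refine injective_eqsL hE hL w (funext fun j => ?_)
      have h1 : (fun ε : ℂ => eqs E π g₁ g₂ par (0, u + ε • w) j) =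
          fun ε => ε * eqsL E π g₁ g₂ par w j := by
        funext ε
        have h2 := congrFun hu j
        rw [eqs_zero] at h2 ⊢
        simp only [map_add, map_smul, Pi.add_apply, Pi.sub_apply, Pi.smul_apply, smul_eq_mul,
          Pi.zero_apply] at h2 ⊢
        grind
      have h3 := hw j
      rw [h1] at h3
      have h4 : HasDerivAt (fun ε : ℂ => ε * eqsL E π g₁ g₂ par w j)
          (eqsL E π g₁ g₂ par w j) 0 := by
        simpa using (hasDerivAt_id (0 : ℂ)).mul_const (eqsL E π g₁ g₂ par w j)
      exact h4.unique h3 }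

namespace PlaneChart

variable {E : 𝒫₆} (π : 𝔖₆) (g₁ g₂ : ℂ) (par : Bool)

/-- The unknowns, read from the point of the blow-up. -/
def rd : (PlückerSpace × PlückerSpace) →ₗ[ℂ] ℂ^5 where
  toFun Z := ![halfSum π (readFst (diffVec π 1) Z) 0 / 2, halfSum π (readFst (diffVec π 1) Z) 1 / 2,
    halfSum π (readSnd (diffVec π 0) Z) 0 / 2, halfSum π (readSnd (diffVec π 0) Z) 1 / 2,
    readPar (diffVec π 0) (diffVec π 1) Z]
  map_add' Z Z' := by funext j; fin_cases j <;> simp [halfSum] <;> ring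
  map_smul' r Z := by funext j; fin_cases j <;> simp [halfSum] <;> ring

/-- The normalization of the point of the blow-up. -/
def nrmL : Dual ℂ (PlückerSpace × PlückerSpace) where
  toFun Z := nrm par (rd π Z)
  map_add' Z Z' := by unfold nrm; split_ifs <;> simp; ring
  map_smul' r Z := by unfold nrm; split_ifs <;> simp; ring

/-- The parameters, read from the point of the family. -/
def readX (b : Base) : ℂ³ :=
  ![if par then b.2 else halfSum π (lineFst (diffVec π 0) (diffVec π 1) b.1) 0 +
      halfSum π (lineFst (diffVec π 0) (diffVec π 1) b.1) 1,
    halfDiff π (lineFst (diffVec π 0) (diffVec π 1) b.1) 2 - g₁,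
    halfDiff π (lineSnd (diffVec π 0) (diffVec π 1) b.1) 2 - g₂]

lemma readX_coords {b : Base} (hb : bracket (diffVec π 0) (diffVec π 1) b.1.rep ≠ 0) (j : Fin 3) :
    IsCoordinate (fun b => readX π g₁ g₂ par b j) b := by
  fin_cases j
  · cases par
    · exact (isCoordinate_line hb (dotL (sumVec π 0) + dotL (sumVec π 1)) 0).congr 0 (by simp [readX])
    · exact (isCoordinate_par b).congr 0 (by simp [readX])
  exacts [(isCoordinate_line hb (dotL (diffVec π 2)) 0).congr g₁ (by simp [readX]),
    (isCoordinate_line hb 0 (dotL (diffVec π 2))).congr g₂ (by simp [readX])]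

end PlaneChart

open PlaneChart

section

variable {E : 𝒫₆} (hE : E.IsHomogeneous 3) {σ : Syntheme}
    {π : 𝔖₆} (hπ : ∀ i, σ.1 (π i) = π (swp i)) {g₁ g₂ : ℂ} {par : Bool}
    (hL : ∀ u, (∀ α γ, form E π g₁ g₂ (0, u) α γ = 0) → nrm par u = 0 → u = 0)
    (hk : ∀ κ, κ ≠ σ → ¬ (InPlane κ (place π (vec 0 ![1, 0, g₁])) ∧
      InPlane κ (place π (vec 0 ![0, 1, g₂])))) {u : ℂ^5}
    (hu : eqs E π g₁ g₂ par (0, u) = 0)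
include hE hπ hL hk hu

lemma planeChart_readX (p : Par 5) (hp : eqs E π g₁ g₂ par p = 0) :
    readX π g₁ g₂ par ((planeChart hE hπ hL hk hu).point p).1 = p.1 := by
  obtain ⟨h1, h2⟩ := (planeChart hE hπ hL hk hu).line_point p
  have h3 : lineFst (diffVec π 0) (diffVec π 1) ((planeChart hE hπ hL hk hu).point p).1.1 =
    vV π g₁ p := h1
  have h4 : lineSnd (diffVec π 0) (diffVec π 1) ((planeChart hE hπ hL hk hu).point p).1.1 =
    vW π g₂ p := h2
  have h5 : ((planeChart hE hπ hL hk hu).point p).1.2 = p.1 0 * p.2 4 := rfl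
  have h6 := ((eqs_eq_zero hE p).1 hp).2
  funext j
  fin_cases j
  · simp only [readX, h3, h5]
    cases par
    · simp [nrm] at h6; simp [vV, sA, ← mul_add, h6]
    · simp [nrm] at h6; simp [h6]
  · simp [readX, h3, vV]
  · simp [readX, h4, vW]

lemma planeChart_form {z : Ambient} (hz : z ∈ blowUp E)
    (hzb : z.1 = ((planeChart hE hπ hL hk hu).point (0, u)).1)
    {N : Dual ℂ (PlückerSpace × PlückerSpace)} (hN : N (z.2 σ).rep ≠ 0) :
    (∀ α γ, form E π g₁ g₂ (0, rd π (sect N (z.2 σ))) α γ = 0) ∧ rd π (sect N (z.2 σ)) ≠ 0 := by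
  set D := planeChart hE hπ hL hk hu with hD
  have hb : bracket (diffVec π 0) (diffVec π 1) z.1.1.rep ≠ 0 := by
    rw [hzb]; exact D.bracket_ne (0, u)
  have hV : lineFst (diffVec π 0) (diffVec π 1) z.1.1 = place π (vec 0 ![1, 0, g₁]) := by
    rw [hzb]; exact (D.line_point (0, u)).1.trans (vV_zero u)
  have hW : lineSnd (diffVec π 0) (diffVec π 1) z.1.1 = place π (vec 0 ![0, 1, g₂]) := by
    rw [hzb]; exact (D.line_point (0, u)).2.trans (vW_zero u)
  obtain ⟨h1, h2, h3, h4, h5⟩ := amb_blowUp hN hz hb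
  have hA := eq_place_of_symm hπ fun i => (h3 i).1
  have hB := eq_place_of_symm hπ fun i => (h3 i).2
  have sA0 := sum_halfSum π (ambFst (diffVec π 1) N σ z)
  have sB0 := sum_halfSum π (ambSnd (diffVec π 0) N σ z)
  rw [h4] at sA0
  rw [h5] at sB0
  have e0 : rd π (sect N (z.2 σ)) = ![halfSum π (ambFst (diffVec π 1) N σ z) 0 / 2,
    halfSum π (ambFst (diffVec π 1) N σ z) 1 / 2, halfSum π (ambSnd (diffVec π 0) N σ z) 0 / 2,
    halfSum π (ambSnd (diffVec π 0) N σ z) 1 / 2, ambPar (diffVec π 0) (diffVec π 1) N σ z] := rfl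
  set SA := halfSum π (ambFst (diffVec π 1) N σ z) with hSA
  set SB := halfSum π (ambSnd (diffVec π 0) N σ z) with hSB
  constructor
  · intro α γ
    have h6 := h2 α γ
    have h7 : α • ambFst (diffVec π 1) N σ z + γ • ambSnd (diffVec π 0) N σ z =
        place π (vec (2 • ((α / 2) • SA + (γ / 2) • SB)) 0) := by
      conv_lhs => rw [hA, hB, place_combo, vec_combo]
      congr 2
      · funext k; simp; ring
      · simp
    have h8 : α • place π (vec 0 ![1, 0, g₁]) + γ • place π (vec 0 ![0, 1, g₂]) =
        place π (vec 0 ![α, γ, α * g₁ + γ * g₂]) := by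
      rw [place_combo, vec_combo]; simp
    rw [hV, hW, h7, h8, redCubic_place hπ] at h6
    rw [form_zero, e0]
    simp at h6 ⊢
    grind
  · intro h0
    rw [e0] at h0
    have c0 := congrFun h0 0
    have c1 := congrFun h0 1
    have c2 := congrFun h0 2
    have c3 := congrFun h0 3
    have c4 := congrFun h0 4
    simp at c0 c1 c2 c3 c4
    have hA0 : ambFst (diffVec π 1) N σ z = 0 := by
      rw [hA, place_eq_zero, vec_eq_zero]
      refine ⟨funext fun k => ?_, rfl⟩
      fin_cases k
      · exact c0
      · exact c1
      · simpa [c0, c1] using sA0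
    have hB0 : ambSnd (diffVec π 0) N σ z = 0 := by
      rw [hB, place_eq_zero, vec_eq_zero]
      refine ⟨funext fun k => ?_, rfl⟩
      fin_cases k
      · exact c2
      · exact c3
      · simpa [c2, c3] using sB0
    refine sect_ne_zero N hN ?_
    rw [h1]
    exact (redGen_eq_zero (blowUp_isLine hz hb)).2 ⟨hA0, hB0, c4⟩

lemma planeChart_chart {z : Ambient} (hz : z ∈ blowUp E)
    (hzb : z.1 = ((planeChart hE hπ hL hk hu).point (0, u)).1)
    {g : ℂ³ → ℂ^5} (hg : (planeChart hE hπ hL hk hu).IsSolution g) :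
    (planeChart hE hπ hL hk hu).point (0, u) = z ∧
      IsChartAt 3 (blowUp E) z fun x => (planeChart hE hπ hL hk hu).point (x, g x) := by
  set D := planeChart hE hπ hL hk hu with hD
  have hb : bracket (diffVec π 0) (diffVec π 1) z.1.1.rep ≠ 0 := by
    rw [hzb]; exact D.bracket_ne (0, u)
  have hN : nrmL π par (z.2 σ).rep ≠ 0 := by
    obtain ⟨N₁, hN₁⟩ := exists_dual_ne_zero (z.2 σ).rep_nonzero
    obtain ⟨h1, h2⟩ := planeChart_form hE hπ hL hk hu hz hzb hN₁
    intro h0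
    refine h2 (hL _ h1 ?_)
    have : nrmL π par (sect N₁ (z.2 σ)) = 0 := by rw [sect, map_smul, h0, smul_zero]
    exact this
  have hUz : rd π (sect (nrmL π par) (z.2 σ)) = u := by
    have h1 := (planeChart_form hE hπ hL hk hu hz hzb hN).1
    have h2 : nrm par (rd π (sect (nrmL π par) (z.2 σ))) = 1 := dual_sect (nrmL π par) hN
    have h3 := (eqs_eq_zero hE _).2 ⟨h1, h2⟩
    have h4 := h3.trans hu.symm
    rw [eqs_zero, eqs_zero, sub_left_inj] at h4
    exact (injective_iff_map_eq_zero _).2 (injective_eqsL hE hL) h4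
  refine hg.chart hz (X := fun y => readX π g₁ g₂ par y.1) (U := fun y =>
    rd π (sect (nrmL π par) (y.2 σ))) ?_ ?_ (fun j => (readX_coords π g₁ g₂ par hb j).fst) ?_ ?_
  · rw [hzb, planeChart_readX hE hπ hL hk hu (0, u) hu]
  · have h1 : ContinuousAt (fun y : Ambient => sect (nrmL π par) (y.2 σ)) z :=
      ContinuousAt.comp (f := fun y : Ambient => y.2 σ) (continuousAt_sect _ hN)
        ((continuous_apply σ).comp continuous_snd).continuousAt
    have h2 : ContinuousAt (fun y : Ambient => rd π (sect (nrmL π par) (y.2 σ))) z :=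
      (LinearMap.continuous_of_finiteDimensional (rd π)).continuousAt.comp h1
    have h3 := h2.tendsto.mono_left (nhdsWithin_le_nhds (s := graph E))
    rwa [hUz] at h3
  · filter_upwards [self_mem_nhdsWithin, nhdsWithin_le_nhds (eventually_bracket' hb),
      nhdsWithin_le_nhds (eventually_dual_ne_zero hN)] with y hy hby hNy
    obtain ⟨r, hr, h1, h2, h3, -⟩ := amb_graph (a := diffVec π 0) (c := diffVec π 1) hy hby hNy
    obtain ⟨v', w', hl⟩ := graph_isLine hy
    have hn := hl.normalized hby
    obtain ⟨d1, d2, d3, d4⟩ := hl.dual hby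
    have hfam := (mem_fanoFamily.1 hy.1).2
    have hnrm : nrm par (rd π (sect (nrmL π par) (y.2 σ))) = 1 := dual_sect (nrmL π par) hNy
    have e0 : rd π (sect (nrmL π par) (y.2 σ)) =
      ![halfSum π (ambFst (diffVec π 1) (nrmL π par) σ y) 0 / 2,
        halfSum π (ambFst (diffVec π 1) (nrmL π par) σ y) 1 / 2,
        halfSum π (ambSnd (diffVec π 0) (nrmL π par) σ y) 0 / 2,
        halfSum π (ambSnd (diffVec π 0) (nrmL π par) σ y) 1 / 2,
        ambPar (diffVec π 0) (diffVec π 1) (nrmL π par) σ y] := rfl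
    set U := rd π (sect (nrmL π par) (y.2 σ)) with hU
    set v := lineFst (diffVec π 0) (diffVec π 1) y.1.1 with hv
    set w := lineSnd (diffVec π 0) (diffVec π 1) y.1.1 with hw
    have hs : ∀ x : ℂ⁶, ∀ k, halfSum π (r • symm σ x) k / 2 = r * halfSum π x k := by
      intro x k
      rw [symm_eq_halfSum hπ x, place_smul, vec_smul, halfSum_place]
      simp; ring
    rw [h1, h2, h3, hs, hs, hs, hs] at e0
    have hsv := sum_halfSum π v
    rw [(hfam v hn.onLine_left).1] at hsv
    have hsw := sum_halfSum π w
    rw [(hfam w hn.onLine_right).1] at hsw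
    have hX0 : readX π g₁ g₂ par y.1 0 = r⁻¹ := by
      rw [e0] at hnrm
      cases par
      · simp [nrm] at hnrm
        simp only [readX, ← hv]
        simp
        field_simp
        grind
      · simp [nrm] at hnrm
        simp [readX]
        field_simp
        grind
    rw [dotL_diffVec] at d1 d2 d3 d4
    have hV : v = vV π g₁ (readX π g₁ g₂ par y.1, U) := by
      rw [eq_place_vec π v, vV, show (readX π g₁ g₂ par y.1, U).1 0 = r⁻¹ from hX0]
      congr 2
      · funext k
        fin_cases k
        · simp [sA, e0, hr]
        · simp [sA, e0, hr]
        · simp [sA, e0]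
          field_simp
          grind
      · funext k
        fin_cases k
        · exact d1
        · exact d2
        · simp [readX, ← hv]
    have hW : w = vW π g₂ (readX π g₁ g₂ par y.1, U) := by
      rw [eq_place_vec π w, vW, show (readX π g₁ g₂ par y.1, U).1 0 = r⁻¹ from hX0]
      congr 2
      · funext k
        fin_cases k
        · simp [sB, e0, hr]
        · simp [sB, e0, hr]
        · simp [sB, e0]
          field_simp
          grind
      · funext k
        fin_cases k
        · exact d3
        · exact d4
        · simp [readX, ← hw]
    have hT : y.1.2 = readX π g₁ g₂ par y.1 0 * U 4 := by
      rw [hX0, e0]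
      simp [hr]
    refine ⟨hby, hV, hW, hT, (eqs_eq_zero hE _).2 ⟨fun α γ => ?_, hnrm⟩⟩
    have h6 := (hfam _ (hn.onLine_iff.2 ⟨α, γ, rfl⟩)).2
    rw [hV, hW, hT, form_spec (readX π g₁ g₂ par y.1, U),
      show (readX π g₁ g₂ par y.1, U).1 0 = r⁻¹ from hX0] at h6
    exact (mul_eq_zero.1 h6).resolve_left (inv_ne_zero hr)
  · exact Filter.Eventually.of_forall fun p hp => planeChart_readX hE hπ hL hk hu p hp

end

end Segre

namespace Segre

open ProjTop

/-! ## Charts at the lines that lie in no plane -/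

lemma dotL_add_left (a b x : ℂ⁶) : dotL (a + b) x = dotL a x + dotL b x := by
  simp [dotL_apply, add_mul, Finset.sum_add_distrib]

lemma dotL_sub_left (a b x : ℂ⁶) : dotL (a - b) x = dotL a x - dotL b x := by
  simp [dotL_apply, sub_mul, Finset.sum_sub_distrib]

lemma dotL_smul_left (r : ℂ) (a x : ℂ⁶) : dotL (r • a) x = r * dotL a x := by
  simp [dotL_apply, Finset.mul_sum, mul_assoc]

/-- The point with Cremona coordinates `(U, W)`. -/
def uw (U W : ℂ³) : ℂ⁶ := vec ![U 1 + W 1 - U 2 - W 2, U 2 + W 2 - U 0 - W 0, U 0 + W 0 - U 1 - W 1]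
    ![U 0 - W 0, U 1 - W 1, U 2 - W 2]

lemma cubic_uw (U W : ℂ³) : cubic (uw U W) =
    -24 * (U 0 * W 0 * (U 1 + W 1 - U 2 - W 2) + U 1 * W 1 * (U 2 + W 2 - U 0 - W 0) +
      U 2 * W 2 * (U 0 + W 0 - U 1 - W 1)) := by
  rw [uw, cubic_vec]
  · simp; ring
  · simp; ring

lemma sum_uw (U W : ℂ³) : ∑ i, uw U W i = 0 := by rw [uw, sum_vec]; simp; ring

lemma uw_combo (U W U' W' : ℂ³) (α γ : ℂ) :
    α • uw U W + γ • uw U' W' = uw (α • U + γ • U') (α • W + γ • W') := by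
  rw [uw, uw, vec_combo, uw]
  congr 1 <;> funext k <;> fin_cases k <;> simp <;> ring

def conjPar (ξ : ℂ³) : ℂ³ := ![ξ 1 * ξ 2, ξ 2 * ξ 0, ξ 0 * ξ 1]

/-- The parameters of the lines that lie in no plane. -/
def IsGeneral (ξ : ℂ³) : Prop := (ξ 0 ≠ 0 ∧ ξ 1 ≠ 0 ∧ ξ 2 ≠ 0) ∧ ξ 0 ≠ ξ 1 ∧ ξ 1 ≠ ξ 2 ∧ ξ 2 ≠ ξ 0

namespace GeneralChart

variable (E : 𝒫₆) (π : 𝔖₆) (ξ : ℂ³)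

def vV (p : Par 4) : ℂ⁶ := place π (uw ![ξ 0 + p.1 1, ξ 1 + p.2 0, ξ 2] ![p.2 2, 0, 0])

def vW (p : Par 4) : ℂ⁶ :=
  place π (uw ![p.1 2, p.2 1, 0] ![ξ 1 * ξ 2 + p.2 3, ξ 2 * ξ 0, ξ 0 * ξ 1])

/-- The equation of the family on the line. -/
def form (p : Par 4) (α γ : ℂ) : ℂ :=
  p.1 0 * eval (α • vV π ξ p + γ • vW π ξ p) E + cubic (α • vV π ξ p + γ • vW π ξ p)

def eqs (p : Par 4) : ℂ^4 :=
  ![form E π ξ p 1 0, form E π ξ p 0 1, form E π ξ p 1 1, form E π ξ p 1 (-1)]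

def cVec : ℂ⁶ := (1 / (2 * (ξ 2 * ξ 0 - ξ 0 * ξ 1)) : ℂ) • (sumVec π 0 - diffVec π 1 + diffVec π 2)

def aVec : ℂ⁶ := (1 / ξ 2 : ℂ) • (diffVec π 2 + (ξ 0 * ξ 1) • cVec π ξ)

lemma dotL_cVec (x : ℂ⁶) : dotL (cVec π ξ) x =
    1 / (2 * (ξ 2 * ξ 0 - ξ 0 * ξ 1)) * (halfSum π x 0 - halfDiff π x 1 + halfDiff π x 2) := by
  rw [cVec, dotL_smul_left, dotL_add_left, dotL_sub_left, dotL_sumVec, dotL_diffVec, dotL_diffVec]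

lemma dotL_aVec (x : ℂ⁶) : dotL (aVec π ξ) x =
    1 / ξ 2 * (halfDiff π x 2 + ξ 0 * ξ 1 * dotL (cVec π ξ) x) := by
  rw [aVec, dotL_smul_left, dotL_add_left, dotL_smul_left, dotL_diffVec]

/-- The parameters, read from the point of the family. -/
def readX (b : Base) : ℂ³ := ![b.2, (halfDiff π (lineFst (aVec π ξ) (cVec π ξ) b.1) 0 -
      halfSum π (lineFst (aVec π ξ) (cVec π ξ) b.1) 1 + ξ 2) / 2 - ξ 0,
    (halfDiff π (lineSnd (aVec π ξ) (cVec π ξ) b.1) 0 -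
      halfSum π (lineSnd (aVec π ξ) (cVec π ξ) b.1) 1 + ξ 0 * ξ 1) / 2]

/-- The unknowns, read from the point of the family. -/
def readU (b : Base) : ℂ^4 := ![halfDiff π (lineFst (aVec π ξ) (cVec π ξ) b.1) 1 - ξ 1,
    halfDiff π (lineSnd (aVec π ξ) (cVec π ξ) b.1) 1 + ξ 2 * ξ 0,
    (ξ 2 - halfSum π (lineFst (aVec π ξ) (cVec π ξ) b.1) 1 -
      halfDiff π (lineFst (aVec π ξ) (cVec π ξ) b.1) 0) / 2,
    (ξ 0 * ξ 1 - halfSum π (lineSnd (aVec π ξ) (cVec π ξ) b.1) 1 -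
      halfDiff π (lineSnd (aVec π ξ) (cVec π ξ) b.1) 0) / 2 - ξ 1 * ξ 2]

variable {E π ξ}

lemma contDiff_vV : ContDiff ℂ ω (vV π ξ) := by
  refine contDiff_place π (contDiff_vec (fun k => ?_) fun k => ?_) <;>
    fin_cases k <;> simp <;> fun_prop

lemma contDiff_vW : ContDiff ℂ ω (vW π ξ) := by
  refine contDiff_place π (contDiff_vec (fun k => ?_) fun k => ?_) <;>
    fin_cases k <;> simp <;> fun_prop

lemma contDiff_form (α γ : ℂ) : ContDiff ℂ ω fun p => form E π ξ p α γ := by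
  have h0 : ContDiff ℂ ω fun p : Par 4 => α • vV π ξ p + γ • vW π ξ p :=
    (contDiff_vV.const_smul α).add (contDiff_vW.const_smul γ)
  have h1 := (contDiff_eval E).comp h0
  have h2 : ContDiff ℂ ω cubic := by unfold cubic; fun_prop
  have h3 := h2.comp h0
  have h4 : ContDiff ℂ ω fun p : Par 4 => p.1 0 := by fun_prop
  exact (h4.mul h1).add h3

lemma eqs_eq_zero (hE : E.IsHomogeneous 3) (p : Par 4) : eqs E π ξ p = 0 ↔
    ∀ α γ, form E π ξ p α γ = 0 := by
  constructor
  · intro h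
    have : IsBinaryCubic (form E π ξ p) :=
      ((isBinaryCubic_eval hE _ _).const_mul _).add (isBinaryCubic_cubic _ _)
    exact this.eq_zero (congrFun h 0) (congrFun h 1) (congrFun h 2) (congrFun h 3)
  · intro h; funext j; fin_cases j <;> simp [eqs, h]

def lin (ξ : ℂ³) (w : ℂ^4) (α γ : ℂ) : ℂ :=
  -24 * (α * ξ 0 * (α * w 2 + γ * w 3) * (α * (ξ 1 - ξ 2) + γ * (ξ 2 * ξ 0 - ξ 0 * ξ 1)) +
    γ * (ξ 2 * ξ 0) * (α * w 0 + γ * w 1) * (α * (ξ 2 - ξ 0) + γ * (ξ 0 * ξ 1 - ξ 1 * ξ 2)))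

lemma form_line (w : ℂ^4) (ε α γ : ℂ) : form E π ξ (0, (0 : ℂ^4) + ε • w) α γ =
    ε * lin ξ w α γ + ε ^ 2 * (-24 * ((α * ξ 0 - γ * (ξ 2 * ξ 0)) *
      (α * w 2 + γ * w 3) * (α * w 0 + γ * w 1))) := by
  simp only [form, vV, vW, place_combo, uw_combo, cubic_place, cubic_uw, lin]
  simp
  ring

lemma lin_eq_zero (hξ : IsGeneral ξ) {w : ℂ^4} (h1 : lin ξ w 1 0 = 0) (h2 : lin ξ w 0 1 = 0)
    (h3 : lin ξ w 1 1 = 0) (h4 : lin ξ w 1 (-1) = 0) : w = 0 := by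
  obtain ⟨⟨n0, n1, n2⟩, m0, m1, m2⟩ := hξ
  have d0 := sub_ne_zero.2 m0
  have d1 := sub_ne_zero.2 m1
  have d2 := sub_ne_zero.2 m2
  have w2 : w 2 = 0 := by
    have : (ξ 0 * (ξ 1 - ξ 2)) * w 2 = 0 := by simp only [lin] at h1; grind
    exact (mul_eq_zero.1 this).resolve_left (mul_ne_zero n0 d1)
  have w1 : w 1 = 0 := by
    have : (ξ 2 * ξ 0 * ξ 1 * (ξ 2 - ξ 0)) * w 1 = 0 := by simp only [lin] at h2; grind
    exact (mul_eq_zero.1 this).resolve_left (mul_ne_zero (mul_ne_zero (mul_ne_zero n2 n0) n1) d2)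
  simp only [lin, w1, w2] at h3 h4
  have e1 : (ξ 0 * w 3) * (ξ 1 - ξ 2) + (ξ 2 * ξ 0 * w 0) * (ξ 2 - ξ 0) = 0 := by grind
  have e2 : ξ 0 * ((ξ 0 * w 3) * (ξ 1 - ξ 2)) + ξ 1 * ((ξ 2 * ξ 0 * w 0) * (ξ 2 - ξ 0)) = 0 := by
    grind
  have w3 : w 3 = 0 := by
    have : ((ξ 0 - ξ 1) * ξ 0 * (ξ 1 - ξ 2)) * w 3 = 0 := by grind
    exact (mul_eq_zero.1 this).resolve_left (mul_ne_zero (mul_ne_zero d0 n0) d1)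
  have w0 : w 0 = 0 := by
    have : ((ξ 0 - ξ 1) * (ξ 2 * ξ 0) * (ξ 2 - ξ 0)) * w 0 = 0 := by grind
    exact (mul_eq_zero.1 this).resolve_left (mul_ne_zero (mul_ne_zero d0 (mul_ne_zero n2 n0)) d2)
  funext j
  fin_cases j <;> simp [w0, w1, w2, w3]

lemma vV_zero : vV π ξ (0, 0) = place π (uw ξ 0) := by
  rw [vV]
  congr 2
  · funext k; fin_cases k <;> simp
  · funext k; fin_cases k <;> simp

lemma vW_zero : vW π ξ (0, 0) = place π (uw 0 (conjPar ξ)) := by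
  rw [vW, conjPar]
  congr 2
  · funext k; fin_cases k <;> simp
  · funext k; fin_cases k <;> simp

lemma not_inPlane (hξ : IsGeneral ξ) (κ : Syntheme) :
    ¬ (InPlane κ (place π (uw ξ 0)) ∧ InPlane κ (place π (uw 0 (conjPar ξ)))) := by
  rintro ⟨h1, h2⟩
  obtain ⟨⟨n0, n1, n2⟩, m0, m1, m2⟩ := hξ
  obtain ⟨j, hj⟩ : ∃ j, κ.1 (π 0) = π j := ⟨π.symm (κ.1 (π 0)), by simp⟩
  have hj0 : j ≠ 0 := by
    rintro rfl
    exact κ.2.2 _ hj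
  have e1 := h1 (π 0)
  have e2 := h2 (π 0)
  rw [hj, place_apply, place_apply] at e1 e2
  fin_cases j <;> simp [uw, vec, conjPar] at e1 e2 hj0
  · exact m1 (by grind)
  · exact n1 (by grind)
  · have : ξ 2 * (ξ 0 - ξ 1) = 0 := by grind
    exact (mul_ne_zero n2 (sub_ne_zero.2 m0)) this
  · exact n0 (by grind)
  · exact m2 (by grind)

end GeneralChart

open GeneralChart in
/-- The chart at a line that lies in no plane. -/
def generalChart {E : 𝒫₆} (hE : E.IsHomogeneous 3) (π : 𝔖₆)
    {ξ : ℂ³} (hξ : IsGeneral ξ) : ChartData E 4 where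
  a := aVec π ξ
  c := cVec π ξ
  V := vV π ξ
  W := vW π ξ
  T := fun p => p.1 0
  A := fun κ p => symm κ (vV π ξ p)
  B := fun κ p => symm κ (vW π ξ p)
  S := fun _ p => p.1 0
  lam := fun _ _ => 1
  F := eqs E π ξ
  u₀ := 0
  contDiff_V := contDiff_vV
  contDiff_W := contDiff_vW
  contDiff_T := by fun_prop
  contDiff_A := fun κ => PlaneChart.contDiff_symm κ contDiff_vV
  contDiff_B := fun κ => PlaneChart.contDiff_symm κ contDiff_vW
  contDiff_S := fun _ => by fun_prop
  contDiff_F := by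
    refine contDiff_pi.2 fun j => ?_
    fin_cases j
    exacts [contDiff_form 1 0, contDiff_form 0 1, contDiff_form 1 1, contDiff_form 1 (-1)]
  dual := by
    intro p
    obtain ⟨⟨n0, n1, n2⟩, m0, m1, m2⟩ := hξ
    have hd : ξ 2 * ξ 0 - ξ 0 * ξ 1 ≠ 0 := by
      intro h
      have : ξ 0 * (ξ 1 - ξ 2) = 0 := by grind
      exact mul_ne_zero n0 (sub_ne_zero.2 m1) this
    have c1 : dotL (cVec π ξ) (vV π ξ p) = 0 := by
      rw [dotL_cVec, vV, uw, halfSum_place, halfDiff_place]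
      simp
    have c2 : dotL (cVec π ξ) (vW π ξ p) = 1 := by
      rw [dotL_cVec, vW, uw, halfSum_place, halfDiff_place]
      simp
      field_simp
      ring
    refine ⟨?_, c1, ?_, c2⟩
    · rw [dotL_aVec, c1, vV, uw, halfDiff_place]; simp [n2]
    · rw [dotL_aVec, c2, vW, uw, halfDiff_place]; simp
  sum_eq := fun p => by simp only [vV, vW, sum_place, sum_uw, and_self]
  symm_V := fun κ p => (one_smul _ _).symm
  symm_W := fun κ p => (one_smul _ _).symm
  T_eq := fun κ p => (one_mul _).symm
  ne_zero := by
    rintro κ ⟨h1, h2, -⟩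
    rw [vV_zero] at h1
    rw [vW_zero] at h2
    exact not_inPlane hξ κ ⟨inPlane_iff.2 h1, inPlane_iff.2 h2⟩
  lam_ne := fun _ _ _ => one_ne_zero
  family := fun p hp => (eqs_eq_zero hE p).1 hp
  F_zero := by
    refine (eqs_eq_zero hE _).2 fun α γ => ?_
    have := form_line (E := E) (π := π) (ξ := ξ) 0 0 α γ
    simpa using this
  F_inj := by
    intro w hw
    have key : ∀ α γ, HasDerivAt (fun ε : ℂ => form E π ξ (0, (0 : ℂ^4) + ε • w) α γ)
        (lin ξ w α γ) 0 := by
      intro α γ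
      simp only [form_line]
      have h1 := (hasDerivAt_id (0 : ℂ)).mul_const (lin ξ w α γ)
      have h2 := ((hasDerivAt_id (0 : ℂ)).pow 2).mul_const (-24 * ((α * ξ 0 - γ * (ξ 2 * ξ 0)) *
        (α * w 2 + γ * w 3) * (α * w 0 + γ * w 1)))
      exact (h1.fun_add h2).congr_deriv (by simp)
    exact lin_eq_zero hξ ((key 1 0).unique (hw 0)) ((key 0 1).unique (hw 1))
      ((key 1 1).unique (hw 2)) ((key 1 (-1)).unique (hw 3))

open GeneralChart

section

variable {E : 𝒫₆} (hE : E.IsHomogeneous 3) (π : 𝔖₆) {ξ : ℂ³} (hξ : IsGeneral ξ)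

lemma generalChart_readX (p : Par 4) : readX π ξ ((generalChart hE π hξ).point p).1 = p.1 ∧
    readU π ξ ((generalChart hE π hξ).point p).1 = p.2 := by
  obtain ⟨h1, h2⟩ := (generalChart hE π hξ).line_point p
  have h3 : lineFst (aVec π ξ) (cVec π ξ) ((generalChart hE π hξ).point p).1.1 = vV π ξ p := h1
  have h4 : lineSnd (aVec π ξ) (cVec π ξ) ((generalChart hE π hξ).point p).1.1 = vW π ξ p := h2
  constructor
  · funext j
    fin_cases j
    · rfl
    · simp [readX, h3, vV, uw]; ring
    · simp [readX, h4, vW, uw]; ring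
  · funext j
    fin_cases j
    · simp [readU, h3, vV, uw]
    · simp [readU, h4, vW, uw]
    · simp [readU, h3, vV, uw]; ring
    · simp [readU, h4, vW, uw]; ring

lemma generalChart_coords {b : Base} (hb : bracket (aVec π ξ) (cVec π ξ) b.1.rep ≠ 0)
    (j : Fin 3) : IsCoordinate (fun b => readX π ξ b j) b := by
  fin_cases j
  · exact isCoordinate_par b
  · refine (isCoordinate_line hb (dotL ((1 / 2 : ℂ) • (diffVec π 0 - sumVec π 1))) 0).congr
      (ξ 0 - ξ 2 / 2) fun y => ?_
    simp [readX, dotL_smul_left, dotL_sub_left]; ring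
  · refine (isCoordinate_line hb 0 (dotL ((1 / 2 : ℂ) • (diffVec π 0 - sumVec π 1)))).congr
      (-(ξ 0 * ξ 1) / 2) fun y => ?_
    simp [readX, dotL_smul_left, dotL_sub_left]; ring

lemma continuous_halfSum (k : Fin 3) : Continuous fun x => halfSum π x k := by
  unfold halfSum; fun_prop

lemma continuous_halfDiff (k : Fin 3) : Continuous fun x => halfDiff π x k := by
  unfold halfDiff; fun_prop

include hE in
lemma generalChart_chart {z : Ambient} (hz : z ∈ blowUp E)
    (hzb : z.1 = ((generalChart hE π hξ).point (0, 0)).1)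
    {g : ℂ³ → ℂ^4} (hg : (generalChart hE π hξ).IsSolution g) :
    (generalChart hE π hξ).point (0, 0) = z ∧
      IsChartAt 3 (blowUp E) z fun x => (generalChart hE π hξ).point (x, g x) := by
  set D := generalChart hE π hξ with hD
  have hb : bracket (aVec π ξ) (cVec π ξ) z.1.1.rep ≠ 0 := by rw [hzb]; exact D.bracket_ne (0, 0)
  have hXU := generalChart_readX hE π hξ
  have hUz : readU π ξ z.1 = 0 := by rw [hzb, (hXU _).2]
  refine hg.chart hz (X := fun y => readX π ξ y.1) (U := fun y => readU π ξ y.1) ?_ ?_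
    (fun j => (generalChart_coords π hb j).fst) ?_ ?_
  · rw [hzb, (hXU _).1]
  · have c1 := continuousAt_lineFst' hb
    have c2 := continuousAt_lineSnd' hb
    have cS : ∀ k {f : Ambient → ℂ⁶}, ContinuousAt f z → ContinuousAt (fun y => halfSum π (f y) k) z :=
      fun k _ hf => (continuous_halfSum π k).continuousAt.comp hf
    have cD : ∀ k {f : Ambient → ℂ⁶}, ContinuousAt f z →
      ContinuousAt (fun y => halfDiff π (f y) k) z :=
      fun k _ hf => (continuous_halfDiff π k).continuousAt.comp hf
    have h2 : ContinuousAt (fun y : Ambient => readU π ξ y.1) z := by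
      refine continuousAt_pi.2 fun j => ?_
      fin_cases j
      exacts [(cD 1 c1).sub continuousAt_const, (cD 1 c2).add continuousAt_const,
        ((continuousAt_const.sub (cS 1 c1)).sub (cD 0 c1)).div_const 2,
        (((continuousAt_const.sub (cS 1 c2)).sub (cD 0 c2)).div_const 2).sub continuousAt_const]
    have h3 := h2.tendsto.mono_left (nhdsWithin_le_nhds (s := graph E))
    rwa [hUz] at h3
  · filter_upwards [self_mem_nhdsWithin, nhdsWithin_le_nhds (eventually_bracket' hb)] with y hy hby
    obtain ⟨v', w', hl⟩ := graph_isLine hy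
    have hn := hl.normalized hby
    obtain ⟨d1, d2, d3, d4⟩ := hl.dual hby
    have hfam := (mem_fanoFamily.1 hy.1).2
    set v := lineFst (aVec π ξ) (cVec π ξ) y.1.1 with hv
    set w := lineSnd (aVec π ξ) (cVec π ξ) y.1.1 with hw
    have hsv := sum_halfSum π v
    rw [(hfam v hn.onLine_left).1] at hsv
    have hsw := sum_halfSum π w
    rw [(hfam w hn.onLine_right).1] at hsw
    obtain ⟨⟨n0, n1, n2⟩, m0, m1, m2⟩ := hξ
    have hd : ξ 2 * ξ 0 - ξ 0 * ξ 1 ≠ 0 := by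
      intro h
      have : ξ 0 * (ξ 1 - ξ 2) = 0 := by grind
      exact mul_ne_zero n0 (sub_ne_zero.2 m1) this
    rw [dotL_aVec, d2] at d1
    rw [dotL_aVec, d4] at d3
    rw [dotL_cVec] at d2 d4
    field_simp at d1 d2 d3 d4
    rw [mul_zero, add_zero] at d1
    have hV : v = vV π ξ (readX π ξ y.1, readU π ξ y.1) := by
      rw [eq_place_vec π v, vV, uw]
      congr 2
      · funext k
        fin_cases k
        · simp [readU, readX, ← hv]; grind
        · simp [readU, readX, ← hv]; ring
        · simp [readU, readX, ← hv]; grind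
      · funext k
        fin_cases k
        · simp [readU, readX, ← hv]; ring
        · simp [readU, readX, ← hv]
        · simp; grind
    have hW : w = vW π ξ (readX π ξ y.1, readU π ξ y.1) := by
      rw [eq_place_vec π w, vW, uw]
      congr 2
      · funext k
        fin_cases k
        · simp [readU, readX, ← hw]; grind
        · simp [readU, readX, ← hw]; ring
        · simp [readU, readX, ← hw]; grind
      · funext k
        fin_cases k
        · simp [readU, readX, ← hw]; ring
        · simp [readU, readX, ← hw]
        · simp; grind
    refine ⟨hby, hV, hW, rfl, (eqs_eq_zero hE _).2 fun α γ => ?_⟩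
    have h6 := (hfam _ (hn.onLine_iff.2 ⟨α, γ, rfl⟩)).2
    rw [hV, hW] at h6
    exact h6
  · exact Filter.Eventually.of_forall fun p _ => (hXU p).1

end

end Segre

namespace Segre

open ProjTop

/-! ## Charts at the points over the distinguished lines -/

/-- The involution with the pairs `03`, `12`, `45`. -/
def swp' : Fin 6 → Fin 6 := ![3, 2, 1, 0, 5, 4]

namespace NodeChart

variable (E : 𝒫₆) (π : 𝔖₆) (β : ℂ)

def vV (p : Par 4) : ℂ⁶ := place π (vec
  ![p.1 0 * (p.1 1 * p.2 2 + 1), p.1 0 * (p.1 1 * p.2 2 - 1), p.1 0 * (-2 * (p.1 1 * p.2 2))]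
  ![1 + p.1 1 * p.2 0, 1 - p.1 1 * p.2 0, 1])

def vW (p : Par 4) : ℂ⁶ := place π (vec
  ![p.1 0 * (p.1 1 * p.2 3 + (β + p.1 2)), p.1 0 * (p.1 1 * p.2 3 - (β + p.1 2)),
    p.1 0 * (-2 * (p.1 1 * p.2 3))] ![1 + p.1 1, 1 - p.1 1, -1])

/-- The equation of the family on the line, divided by the first two parameters. -/
def form (p : Par 4) (a c : ℂ) : ℂ :=
  12 * ((a * p.2 2 + c * p.2 3) * (4 * a * c + p.1 1 ^ 2 * (a * p.2 0 + c) ^ 2 +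
      p.1 0 ^ 2 * (a + c * (β + p.1 2)) ^ 2 -
      p.1 0 ^ 2 * p.1 1 ^ 2 * (a * p.2 2 + c * p.2 3) ^ 2) +
    2 * (a + c * (β + p.1 2)) * (a + c) * (a * p.2 0 + c)) +
  p.2 1 * eval (a • vV π p + c • vW π β p) E

def eqs (p : Par 4) : ℂ^4 :=
  ![form E π β p 1 0, form E π β p 0 1, form E π β p 1 1, form E π β p 1 (-1)]

/-- Reduced sums for the second plane. -/
def cross (P e : ℂ) : ℂ⁶ :=
  ![2 * P + 2 * e, 2 * P - 2 * e, 2 * P - 2 * e, 2 * P + 2 * e, -4 * P, -4 * P]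

variable {E π β}

lemma contDiff_vV : ContDiff ℂ ω (vV π) := by
  refine contDiff_place π (contDiff_vec (fun k => ?_) fun k => ?_) <;>
    fin_cases k <;> simp <;> fun_prop

lemma contDiff_vW : ContDiff ℂ ω (vW π β) := by
  refine contDiff_place π (contDiff_vec (fun k => ?_) fun k => ?_) <;>
    fin_cases k <;> simp <;> fun_prop

lemma contDiff_form (a c : ℂ) : ContDiff ℂ ω fun p => form E π β p a c := by
  have h1 : ContDiff ℂ ω fun p : Par 4 => eval (a • vV π p + c • vW π β p) E :=
    (contDiff_eval E).comp ((contDiff_vV.const_smul a).add (contDiff_vW.const_smul c))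
  unfold form
  fun_prop

lemma contDiff_cross {P e : Par 4 → ℂ} (hP : ContDiff ℂ ω P) (he : ContDiff ℂ ω e) (j : Fin 6) :
    ContDiff ℂ ω fun p => cross (P p) (e p) j := by
  fin_cases j <;> simp [cross] <;> fun_prop

lemma form_spec (p : Par 4) (a c : ℂ) :
    (p.1 0 * p.1 1 * p.2 1) * eval (a • vV π p + c • vW π β p) E +
      cubic (a • vV π p + c • vW π β p) = p.1 0 * p.1 1 * form E π β p a c := by
  have h : cubic (a • vV π p + c • vW π β p) = 12 * (p.1 0 * p.1 1) *
      ((a * p.2 2 + c * p.2 3) * (4 * a * c + p.1 1 ^ 2 * (a * p.2 0 + c) ^ 2 +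
      p.1 0 ^ 2 * (a + c * (β + p.1 2)) ^ 2 -
      p.1 0 ^ 2 * p.1 1 ^ 2 * (a * p.2 2 + c * p.2 3) ^ 2) +
    2 * (a + c * (β + p.1 2)) * (a + c) * (a * p.2 0 + c)) := by
    rw [vV, vW, place_combo, vec_combo, cubic_place, cubic_vec]
    · simp; ring
    · simp; ring
  rw [h, form]
  ring

lemma isBinaryCubic_form (hE : E.IsHomogeneous 3) (p : Par 4) : IsBinaryCubic (form E π β p) := by
  have h1 : IsBinaryCubic fun a c => (a * p.2 2 + c * p.2 3) * ((a * 4 + c * 0) * (a * 0 + c * 1)) :=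
    isBinaryCubic_mul₃ _ _ _ _ _ _
  have h2 := (isBinaryCubic_mul₃ (p.2 2) (p.2 3) (p.2 0) 1 (p.2 0) 1).const_mul (p.1 1 ^ 2)
  have h3 := (isBinaryCubic_mul₃ (p.2 2) (p.2 3) 1 (β + p.1 2) 1 (β + p.1 2)).const_mul (p.1 0 ^ 2)
  have h4 := (isBinaryCubic_mul₃ (p.2 2) (p.2 3) (p.2 2) (p.2 3) (p.2 2) (p.2 3)).const_mul
    (-(p.1 0 ^ 2 * p.1 1 ^ 2))
  have h5 := (isBinaryCubic_mul₃ 1 (β + p.1 2) 1 1 (p.2 0) 1).const_mul 2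
  have h6 := (isBinaryCubic_eval hE (vV π p) (vW π β p)).const_mul (p.2 1)
  have h7 := (((((h1.add h2).add h3).add h4).add h5).const_mul 12).add h6
  convert! h7 using 3
  simp only [form]
  ring

lemma eqs_eq_zero (hE : E.IsHomogeneous 3) (p : Par 4) : eqs E π β p = 0 ↔
    ∀ a c, form E π β p a c = 0 := by
  constructor
  · intro h
    exact (isBinaryCubic_form hE p).eq_zero (congrFun h 0) (congrFun h 1) (congrFun h 2)
      (congrFun h 3)
  · intro h; funext j; fin_cases j <;> simp [eqs, h]

def tst : Fin 4 → ℂ × ℂ := ![(1, 0), (0, 1), (1, 1), (1, -1)]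

variable (E) in
/-- The matrix of the linear system for the unknowns. -/
def sysM (β lam : ℂ) (δ P : ℂ × ℂ) (v w : ℂ⁶) : Matrix (Fin 4) (Fin 4) ℂ :=
  Matrix.of fun j => ![24 * ((tst j).1 + (tst j).2 * β) * ((tst j).1 + (tst j).2) * (tst j).1,
    eval ((tst j).1 • v + (tst j).2 • w) E,
    12 * (4 * (tst j).1 * (tst j).2 + ((tst j).1 * δ.1 + (tst j).2 * δ.2) ^ 2 +
      lam ^ 2 * ((tst j).1 + (tst j).2 * β) ^ 2 -
      lam ^ 2 * ((tst j).1 * P.1 + (tst j).2 * P.2) ^ 2) * (tst j).1,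
    12 * (4 * (tst j).1 * (tst j).2 + ((tst j).1 * δ.1 + (tst j).2 * δ.2) ^ 2 +
      lam ^ 2 * ((tst j).1 + (tst j).2 * β) ^ 2 -
      lam ^ 2 * ((tst j).1 * P.1 + (tst j).2 * P.2) ^ 2) * (tst j).2]

def sysR (β : ℂ) : ℂ^4 := fun j =>
  24 * ((tst j).1 + (tst j).2 * β) * ((tst j).1 + (tst j).2) * (tst j).2

lemma sys_apply (β lam : ℂ) (δ P : ℂ × ℂ) (v w : ℂ⁶) (u : ℂ^4) (r : ℂ) (j : Fin 4) :
    (sysM E β lam δ P v w).mulVec u j + r * sysR β j =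
    12 * (((tst j).1 * u 2 + (tst j).2 * u 3) * (4 * (tst j).1 * (tst j).2 +
      ((tst j).1 * δ.1 + (tst j).2 * δ.2) ^ 2 + lam ^ 2 * ((tst j).1 + (tst j).2 * β) ^ 2 -
      lam ^ 2 * ((tst j).1 * P.1 + (tst j).2 * P.2) ^ 2) +
      2 * ((tst j).1 + (tst j).2 * β) * ((tst j).1 + (tst j).2) *
        ((tst j).1 * u 0 + (tst j).2 * r)) +
      u 1 * eval ((tst j).1 • v + (tst j).2 • w) E := by
  simp only [Matrix.mulVec, dotProduct, Fin.sum_univ_four, sysM, sysR, Matrix.of_apply]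
  simp
  ring

def node₁ (π : 𝔖₆) : ℂ⁶ := place π (vec 0 ![1, 1, 1])

def node₂ (π : 𝔖₆) : ℂ⁶ := place π (vec 0 ![1, 1, -1])

lemma sysM_det_ne (h1 : eval (node₁ π) E ≠ 0) (h2 : eval (node₂ π) E ≠ 0) :
    (sysM E β 0 (0, 0) (0, 0) (node₁ π) (node₂ π)).det ≠ 0 := by
  intro h0
  obtain ⟨u, hu, hM⟩ := Matrix.exists_mulVec_eq_zero_iff.2 h0
  apply hu
  have key := fun j => (sys_apply (E := E) β 0 (0, 0) (0, 0) (node₁ π) (node₂ π) u 0 j).symm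
  simp only [hM] at key
  have k0 := key 0
  have k1 := key 1
  have k2 := key 2
  have k3 := key 3
  simp [tst] at k0 k1 k2 k3
  have u1 : u 1 = 0 := k1.resolve_right h2
  simp [u1] at k0 k2 k3
  simp [k0] at k2 k3
  have u2 : u 2 = 0 := by grind
  have u3 : u 3 = 0 := by grind
  funext j
  fin_cases j <;> simp [k0, u1, u2, u3]

lemma vV_zero (u : ℂ^4) (x : ℂ) : vV π (![0, 0, x], u) = node₁ π := by
  rw [vV, node₁]
  congr 2
  · funext k; fin_cases k <;> simp
  · funext k; fin_cases k <;> simp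

lemma vW_zero (u : ℂ^4) (x : ℂ) : vW π β (![0, 0, x], u) = node₂ π := by
  rw [vW, node₂]
  congr 2
  · funext k; fin_cases k <;> simp
  · funext k; fin_cases k <;> simp

lemma eqs_zero (x : ℂ) (u : ℂ^4) : eqs E π β (![0, 0, x], u) =
    (sysM E (β + x) 0 (0, 0) (0, 0) (node₁ π) (node₂ π)).mulVec u + sysR (β + x) := by
  funext j
  have := sys_apply (E := E) (β + x) 0 (0, 0) (0, 0) (node₁ π) (node₂ π) u 1 j
  rw [one_mul] at this
  rw [Pi.add_apply, this]
  fin_cases j <;> simp [eqs, form, tst, vV_zero, vW_zero]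

end NodeChart

open NodeChart

lemma eq_of_swp {κ σ : Syntheme} {π : 𝔖₆} {f : Fin 6 → Fin 6}
    (h1 : ∀ i, κ.1 (π i) = π (f i)) (h2 : ∀ i, σ.1 (π i) = π (f i)) : κ = σ :=
  Subtype.ext (Equiv.ext fun i => by obtain ⟨j, rfl⟩ := π.surjective i; grind)

lemma eq_or_eq_of_inPlane_nodes {κ σ σ' : Syntheme} {π : 𝔖₆}
    (hπ : ∀ i, σ.1 (π i) = π (swp i)) (hπ' : ∀ i, σ'.1 (π i) = π (swp' i))
    (h1 : InPlane κ (node₁ π)) (h2 : InPlane κ (node₂ π)) : κ = σ ∨ κ = σ' := by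
  obtain ⟨f, hf⟩ : ∃ f : Fin 6 → Fin 6, ∀ i, κ.1 (π i) = π (f i) :=
    ⟨fun i => π.symm (κ.1 (π i)), fun i => by simp⟩
  have hff : ∀ i, f (f i) = i := fun i => by
    have := κ.2.1 (π i)
    rw [hf, hf] at this
    exact π.injective this
  have hfi : ∀ i, f i ≠ i := fun i h => κ.2.2 (π i) (by rw [hf, h])
  have h1' : ∀ i, vec 0 ![1, 1, 1] i + vec 0 ![1, 1, 1] (f i) = 0 := fun i => by
    have := h1 (π i)
    rwa [hf, node₁, place_apply, place_apply] at this
  have h2' : ∀ i, vec 0 ![1, 1, -1] i + vec 0 ![1, 1, -1] (f i) = 0 := fun i => by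
    have := h2 (π i)
    rwa [hf, node₂, place_apply, place_apply] at this
  have f4 : f 4 = 5 := by
    have e1 := h1' 4
    have e2 := h2' 4
    generalize f 4 = j at e1 e2
    fin_cases j <;> simp [vec] at e1 e2 ⊢
  have f5 : f 5 = 4 := by rw [← f4, hff]
  have f0 : f 0 = 1 ∨ f 0 = 3 := by
    have e1 := h1' 0
    have e2 := h2' 0
    generalize f 0 = j at e1 e2
    fin_cases j <;> simp [vec] at e1 e2 ⊢
  rcases f0 with f0 | f0
  · left
    have f1 : f 1 = 0 := by rw [← f0, hff]
    have f2 : f 2 = 3 := by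
      have e := hff 2
      have e' := hfi 2
      generalize f 2 = j at e e'
      fin_cases j <;> simp_all
    have f3 : f 3 = 2 := by rw [← f2, hff]
    refine eq_of_swp (fun i => ?_) hπ
    rw [hf]
    fin_cases i <;> simp [f0, f1, f2, f3, f4, f5, swp]
  · right
    have f3 : f 3 = 0 := by rw [← f0, hff]
    have f2 : f 2 = 1 := by
      have e := hff 2
      have e' := hfi 2
      generalize f 2 = j at e e'
      fin_cases j <;> simp_all
    have f1 : f 1 = 2 := by rw [← f2, hff]
    refine eq_of_swp (fun i => ?_) hπ'
    rw [hf]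
    fin_cases i <;> simp [f0, f1, f2, f3, f4, f5, swp']

def NodeChart.unk (E : 𝒫₆) (π : 𝔖₆) (β : ℂ) : ℂ^4 :=
  -((sysM E β 0 (0, 0) (0, 0) (node₁ π) (node₂ π))⁻¹.mulVec (sysR β))

lemma NodeChart.eqs_unk {E : 𝒫₆} {π : 𝔖₆} {β : ℂ}
    (h1 : eval (node₁ π) E ≠ 0) (h2 : eval (node₂ π) E ≠ 0) :
    eqs E π β (0, unk E π β) = 0 := by
  have h := eqs_zero (E := E) (π := π) (β := β) 0 (unk E π β)
  have h0 : (![0, 0, 0] : ℂ³) = 0 := by funext k; fin_cases k <;> rfl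
  rw [h0, add_zero] at h
  rw [h, unk, Matrix.mulVec_neg, Matrix.mulVec_mulVec, Matrix.mul_nonsing_inv _
    (isUnit_iff_ne_zero.2 (sysM_det_ne h1 h2)), Matrix.one_mulVec]
  simp

/-- The chart at a point over a distinguished line. -/
def nodeChart {E : 𝒫₆} (hE : E.IsHomogeneous 3) {σ σ' : Syntheme}
    {π : 𝔖₆} (hπ : ∀ i, σ.1 (π i) = π (swp i)) (hπ' : ∀ i, σ'.1 (π i) = π (swp' i))
    (h1 : eval (node₁ π) E ≠ 0) (h2 : eval (node₂ π) E ≠ 0) (β : ℂ) :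
    ChartData E 4 := open Classical in
  { a := (1 / 4 : ℂ) • (diffVec π 0 + diffVec π 1) + (1 / 2 : ℂ) • diffVec π 2
    c := (1 / 4 : ℂ) • (diffVec π 0 + diffVec π 1) - (1 / 2 : ℂ) • diffVec π 2
    V := vV π
    W := vW π β
    T := fun p => p.1 0 * p.1 1 * p.2 1
    A := fun κ p => if κ = σ then
        place π (vec (2 • ![p.1 1 * p.2 2 + 1, p.1 1 * p.2 2 - 1, -2 * (p.1 1 * p.2 2)]) 0)
      else if κ = σ' then place π (cross (p.1 0 * p.2 2) (p.2 0)) else symm κ (vV π p)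
    B := fun κ p => if κ = σ then
        place π (vec (2 • ![p.1 1 * p.2 3 + (β + p.1 2), p.1 1 * p.2 3 - (β + p.1 2),
          -2 * (p.1 1 * p.2 3)]) 0)
      else if κ = σ' then place π (cross (p.1 0 * p.2 3) 1) else symm κ (vW π β p)
    S := fun κ p => if κ = σ then p.1 1 * p.2 1 else if κ = σ' then p.1 0 * p.2 1 else
      p.1 0 * p.1 1 * p.2 1
    lam := fun κ x => if κ = σ then x 0 else if κ = σ' then x 1 else 1
    F := eqs E π β
    u₀ := unk E π β
    contDiff_V := contDiff_vV
    contDiff_W := contDiff_vW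
    contDiff_T := by fun_prop
    contDiff_A := by
      intro κ
      by_cases h : κ = σ
      · simp only [h, if_true]
        refine contDiff_place π (contDiff_vec (fun k => ?_) fun k => contDiff_const)
        fin_cases k <;> simp <;> fun_prop
      · by_cases h' : κ = σ'
        · subst h'
          simp only [h, if_true, if_false]
          exact contDiff_place π (contDiff_cross (P := fun p => p.1 0 * p.2 2)
            (e := fun p => p.2 0) (by fun_prop) (by fun_prop))
        · simp only [h, h', if_false]; exact PlaneChart.contDiff_symm κ contDiff_vV
    contDiff_B := by
      intro κ
      by_cases h : κ = σ
      · simp only [h, if_true]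
        refine contDiff_place π (contDiff_vec (fun k => ?_) fun k => contDiff_const)
        fin_cases k <;> simp <;> fun_prop
      · by_cases h' : κ = σ'
        · subst h'
          simp only [h, if_true, if_false]
          exact contDiff_place π (contDiff_cross (P := fun p => p.1 0 * p.2 3)
            (e := fun _ => 1) (by fun_prop) (by fun_prop))
        · simp only [h, h', if_false]; exact PlaneChart.contDiff_symm κ contDiff_vW
    contDiff_S := by
      intro κ
      by_cases h : κ = σ
      · simp only [h, if_true]; fun_prop
      · by_cases h' : κ = σ'
        · subst h'; simp only [h, if_true, if_false]; fun_prop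
        · simp only [h, h', if_false]; fun_prop
    contDiff_F := by
      refine contDiff_pi.2 fun j => ?_
      fin_cases j
      exacts [contDiff_form 1 0, contDiff_form 0 1, contDiff_form 1 1, contDiff_form 1 (-1)]
    dual := by
      intro p
      simp only [dotL_add_left, dotL_sub_left, dotL_smul_left, dotL_diffVec, vV, vW, halfDiff_place]
      refine ⟨?_, ?_, ?_, ?_⟩ <;> simp <;> ring
    sum_eq := by intro p; simp only [vV, vW, sum_place, sum_vec]; constructor <;> simp <;> ring
    symm_V := by
      intro κ p
      by_cases h : κ = σ
      · subst h
        simp only [if_true, vV, symm_place_vec hπ, place_smul, vec_smul, smul_zero]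
        congr 2
        funext k; fin_cases k <;> simp <;> ring
      · by_cases h' : κ = σ'
        · subst h'
          simp only [h, if_true, if_false, vV, symm_place π hπ', place_smul]
          congr 1
          funext k; fin_cases k <;> simp [vec, cross, swp'] <;> ring
        · simp [h, h']
    symm_W := by
      intro κ p
      by_cases h : κ = σ
      · subst h
        simp only [if_true, vW, symm_place_vec hπ, place_smul, vec_smul, smul_zero]
        congr 2
        funext k; fin_cases k <;> simp <;> ring
      · by_cases h' : κ = σ'
        · subst h'
          simp only [h, if_true, if_false, vW, symm_place π hπ', place_smul]
          congr 1
          funext k; fin_cases k <;> simp [vec, cross, swp'] <;> ring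
        · simp [h, h']
    T_eq := by
      intro κ p
      by_cases h : κ = σ
      · simp [h]; ring
      · by_cases h' : κ = σ'
        · subst h'; simp only [h, if_true, if_false]; ring
        · simp [h, h']
    ne_zero := by
      intro κ
      have z0 : (0 : ℂ³) = ![0, 0, 0] := by funext k; fin_cases k <;> rfl
      by_cases h : κ = σ
      · simp only [h, if_true]
        rintro ⟨h1, -, -⟩
        rw [place_eq_zero, vec_eq_zero] at h1
        have := congrFun h1.1 0
        simp at this
      · by_cases h' : κ = σ'
        · subst h'
          simp only [h, if_true, if_false]
          rintro ⟨-, h1, -⟩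
          rw [place_eq_zero] at h1
          have := congrFun h1 0
          simp [cross] at this
        · simp only [h, h', if_false, z0, vV_zero, vW_zero]
          rintro ⟨h1, h2, -⟩
          rcases eq_or_eq_of_inPlane_nodes hπ hπ' (inPlane_iff.2 h1) (inPlane_iff.2 h2) with e | e
          exacts [h e, h' e]
    lam_ne := by
      intro κ x hx
      by_cases h : κ = σ
      · simpa [h] using hx 0
      grind
    family := by intro p hp α γ; rw [form_spec, (eqs_eq_zero hE p).1 hp, mul_zero]
    F_zero := eqs_unk h1 h2
    F_inj := by
      intro w hw
      have z0 : (0 : ℂ³) = ![0, 0, 0] := by funext k; fin_cases k <;> rfl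
      by_contra hw0
      refine sysM_det_ne (β := β + 0) h1 h2 (Matrix.exists_mulVec_eq_zero_iff.1 ⟨w, hw0, ?_⟩)
      funext j
      have e1 : (fun ε : ℂ => eqs E π β (0, unk E π β + ε • w) j) = fun ε =>
          ε * ((sysM E (β + 0) 0 (0, 0) (0, 0) (node₁ π) (node₂ π)).mulVec w j) := by
        funext ε
        have h2 := congrFun (eqs_unk (β := β) h1 h2) j
        rw [z0, eqs_zero] at h2 ⊢
        simp only [Matrix.mulVec_add, Matrix.mulVec_smul, Pi.add_apply, Pi.smul_apply, smul_eq_mul,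
          Pi.zero_apply] at h2 ⊢
        grind
      have e2 := hw j
      rw [e1] at e2
      have e3 := (hasDerivAt_id (0 : ℂ)).mul_const
        ((sysM E (β + 0) 0 (0, 0) (0, 0) (node₁ π) (node₂ π)).mulVec w j)
      have e4 := e3.unique e2
      simpa using e4 }

namespace NodeChart

variable (π : 𝔖₆)

def aVec : ℂ⁶ := (1 / 4 : ℂ) • (diffVec π 0 + diffVec π 1) + (1 / 2 : ℂ) • diffVec π 2

def cVec : ℂ⁶ := (1 / 4 : ℂ) • (diffVec π 0 + diffVec π 1) - (1 / 2 : ℂ) • diffVec π 2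

lemma dotL_aVec (x : ℂ⁶) : dotL (aVec π) x =
    (halfDiff π x 0 + halfDiff π x 1) / 4 + halfDiff π x 2 / 2 := by
  simp only [aVec, dotL_add_left, dotL_smul_left, dotL_diffVec]; ring

lemma dotL_cVec (x : ℂ⁶) : dotL (cVec π) x =
    (halfDiff π x 0 + halfDiff π x 1) / 4 - halfDiff π x 2 / 2 := by
  simp only [cVec, dotL_add_left, dotL_sub_left, dotL_smul_left, dotL_diffVec]; ring

def mL : Dual ℂ ℂ⁶ := (1 / 2 : ℂ) • (dotL (sumVec π 0) - dotL (sumVec π 1))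

def dL : Dual ℂ ℂ⁶ := (1 / 2 : ℂ) • (dotL (diffVec π 0) - dotL (diffVec π 1))

lemma mL_apply (x : ℂ⁶) : mL π x = (halfSum π x 0 - halfSum π x 1) / 2 := by simp [mL]; ring

lemma dL_apply (x : ℂ⁶) : dL π x = (halfDiff π x 0 - halfDiff π x 1) / 2 := by simp [dL]; ring

def nA : Dual ℂ (PlückerSpace × PlückerSpace) := (1 / 2 : ℂ) • (mL π ∘ₗ readFst (cVec π))

def nB : Dual ℂ (PlückerSpace × PlückerSpace) := (1 / 2 : ℂ) • (mL π ∘ₗ readSnd (aVec π))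

lemma nA_apply (Z : (PlückerSpace × PlückerSpace)) :
    nA π Z = (halfSum π (readFst (cVec π) Z) 0 - halfSum π (readFst (cVec π) Z) 1) / 4 := by
  simp [nA, mL_apply]; ring

lemma nB_apply (Z : (PlückerSpace × PlückerSpace)) :
    nB π Z = (halfSum π (readSnd (aVec π) Z) 0 - halfSum π (readSnd (aVec π) Z) 1) / 4 := by
  simp [nB, mL_apply]; ring

/-- The parameters, read from the point of the blow-up. -/
def readX (σ : Syntheme) (β : ℂ) (y : Ambient) : ℂ³ :=
  ![mL π (lineFst (aVec π) (cVec π) y.1.1), dL π (lineSnd (aVec π) (cVec π) y.1.1),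
    nB π (sect (nA π) (y.2 σ)) - β]

/-- The matrix of the linear system for the unknowns at a point of the blow-up. -/
def readM (E : 𝒫₆) (σ : Syntheme) (y : Ambient) : Matrix (Fin 4) (Fin 4) ℂ :=
  sysM E (nB π (sect (nA π) (y.2 σ))) (mL π (lineFst (aVec π) (cVec π) y.1.1))
    (dL π (lineFst (aVec π) (cVec π) y.1.1), dL π (lineSnd (aVec π) (cVec π) y.1.1))
    (-halfSum π (ambFst (cVec π) (nA π) σ y) 2 / 4, -halfSum π (ambSnd (aVec π) (nA π) σ y) 2 / 4)
    (lineFst (aVec π) (cVec π) y.1.1) (lineSnd (aVec π) (cVec π) y.1.1)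

/-- The unknowns, read from the point of the blow-up. -/
def readU (E : 𝒫₆) (σ : Syntheme) (y : Ambient) : ℂ^4 :=
  -((readM π E σ y)⁻¹.mulVec (sysR (nB π (sect (nA π) (y.2 σ)))))

end NodeChart

section

variable {E : 𝒫₆} (hE : E.IsHomogeneous 3) {σ σ' : Syntheme}
    {π : 𝔖₆} (hπ : ∀ i, σ.1 (π i) = π (swp i)) (hπ' : ∀ i, σ'.1 (π i) = π (swp' i))
    (h1 : eval (node₁ π) E ≠ 0) (h2 : eval (node₂ π) E ≠ 0) {β : ℂ}
include hE hπ hπ' h1 h2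

lemma nodeChart_readX (p : Par 4) : readX π σ β ((nodeChart hE hπ hπ' h1 h2 β).point p) = p.1 ∧
      nA π (((nodeChart hE hπ hπ' h1 h2 β).point p).2 σ).rep ≠ 0 := by
  set D := nodeChart hE hπ hπ' h1 h2 β with hD
  obtain ⟨h3, h4⟩ := D.line_point p
  change lineFst (aVec π) (cVec π) _ = vV π p at h3
  change lineSnd (aVec π) (cVec π) _ = vW π β p at h4
  obtain ⟨d1, d2, d3, d4⟩ := D.dual p
  change dotL (aVec π) _ = _ at d1
  change dotL (cVec π) _ = _ at d2
  change dotL (aVec π) _ = _ at d3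
  change dotL (cVec π) _ = _ at d4
  have hA : nA π (D.gen σ p) = 1 := by
    rw [nA_apply, ChartData.gen, readFst_redGen d2 d4]
    simp [hD, nodeChart]; ring
  have hB : nB π (D.gen σ p) = β + p.1 2 := by
    rw [nB_apply, ChartData.gen, readSnd_redGen d1 d3]
    simp [hD, nodeChart]; ring
  have hg : D.gen σ p ≠ 0 := fun h0 => by grind
  have hs : sect (nA π) ((D.point p).2 σ) = D.gen σ p := by
    change sect (nA π) (proj (D.gen σ p)) = _
    rw [sect_proj _ hg, hA, inv_one, one_smul]
  refine ⟨funext fun j => ?_, (ne_zero_proj (nA π) hg).2 (by grind)⟩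
  fin_cases j
  · simp [readX, h3, mL_apply, vV]; ring
  · simp [readX, h4, dL_apply, vW]
  · simp [readX, hs, hB]

omit hπ' h1 hE in
lemma nodeChart_fibre {z : Ambient} (hz : z ∈ blowUp E)
    (hb : bracket (aVec π) (cVec π) z.1.1.rep ≠ 0)
    (hV : lineFst (aVec π) (cVec π) z.1.1 = node₁ π)
    (hW : lineSnd (aVec π) (cVec π) z.1.1 = node₂ π)
    {N : Dual ℂ (PlückerSpace × PlückerSpace)} (hN : N (z.2 σ).rep ≠ 0) :
    halfSum π (ambFst (cVec π) N σ z) 2 = 0 ∧ halfSum π (ambSnd (aVec π) N σ z) 2 = 0 ∧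
      ambPar (aVec π) (cVec π) N σ z = 0 ∧
      ¬ (nA π (sect N (z.2 σ)) = 0 ∧ nB π (sect N (z.2 σ)) = 0) := by
  obtain ⟨e1, e2, e3, e4, e5⟩ := amb_blowUp hN hz hb
  have hA := eq_place_of_symm hπ fun i => (e3 i).1
  have hB := eq_place_of_symm hπ fun i => (e3 i).2
  have sA0 := sum_halfSum π (ambFst (cVec π) N σ z)
  have sB0 := sum_halfSum π (ambSnd (aVec π) N σ z)
  rw [e4] at sA0
  rw [e5] at sB0
  have enA : nA π (sect N (z.2 σ)) = (halfSum π (ambFst (cVec π) N σ z) 0 -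
    halfSum π (ambFst (cVec π) N σ z) 1) / 4 := nA_apply π _
  have enB : nB π (sect N (z.2 σ)) = (halfSum π (ambSnd (aVec π) N σ z) 0 -
    halfSum π (ambSnd (aVec π) N σ z) 1) / 4 := nB_apply π _
  set SA := halfSum π (ambFst (cVec π) N σ z) with hSA
  set SB := halfSum π (ambSnd (aVec π) N σ z) with hSB
  have key : ∀ α γ : ℂ, -12 * α * γ * (α * SA 2 + γ * SB 2) + ambPar (aVec π) (cVec π) N σ z *
      eval (α • node₁ π + γ • node₂ π) E = 0 := by
    intro α γ
    have h6 := e2 α γ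
    have h7 : α • ambFst (cVec π) N σ z + γ • ambSnd (aVec π) N σ z =
        place π (vec (2 • ((α / 2) • SA + (γ / 2) • SB)) 0) := by
      conv_lhs => rw [hA, hB, place_combo, vec_combo]
      congr 2
      · funext k; simp; ring
      · simp
    have h8 : α • node₁ π + γ • node₂ π = place π (vec 0 ![α + γ, α + γ, α - γ]) := by
      rw [node₁, node₂, place_combo, vec_combo]; simp [sub_eq_add_neg]
    rw [hV, hW, h7, h8, redCubic_place hπ] at h6
    rw [h8]
    simp at h6 ⊢
    grind
  have k1 := key 0 1
  simp [h2] at k1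
  have k2 := key 1 1
  have k3 := key 1 (-1)
  rw [k1] at k2 k3
  have kA : SA 2 = 0 := by grind
  have kB : SB 2 = 0 := by grind
  refine ⟨kA, kB, k1, fun ⟨h3, h4⟩ => ?_⟩
  rw [enA] at h3
  rw [enB] at h4
  have hA0 : ambFst (cVec π) N σ z = 0 := by
    rw [hA, place_eq_zero, vec_eq_zero]
    refine ⟨funext fun k => ?_, rfl⟩
    fin_cases k
    · change SA 0 = 0; grind
    · change SA 1 = 0; grind
    · exact kA
  have hB0 : ambSnd (aVec π) N σ z = 0 := by
    rw [hB, place_eq_zero, vec_eq_zero]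
    refine ⟨funext fun k => ?_, rfl⟩
    fin_cases k
    · change SB 0 = 0; grind
    · change SB 1 = 0; grind
    · exact kB
  refine sect_ne_zero N hN ?_
  rw [e1]
  exact (redGen_eq_zero (blowUp_isLine hz hb)).2 ⟨hA0, hB0, k1⟩

omit hE hπ' in
lemma nodeChart_readU {z : Ambient} (hz : z ∈ blowUp E)
    (hb : bracket (aVec π) (cVec π) z.1.1.rep ≠ 0)
    (hV : lineFst (aVec π) (cVec π) z.1.1 = node₁ π)
    (hW : lineSnd (aVec π) (cVec π) z.1.1 = node₂ π) (hN : nA π (z.2 σ).rep ≠ 0)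
    (hβ : nB π (sect (nA π) (z.2 σ)) = β) :
    ContinuousAt (readU π E σ) z ∧ readU π E σ z = unk E π β ∧ ∀ᶠ y in 𝓝 z, (readM π E σ y).det ≠ 0 := by
  obtain ⟨f1, f2, f3, -⟩ := nodeChart_fibre hπ h2 hz hb hV hW hN
  have cv := continuousAt_lineFst' hb
  have cw := continuousAt_lineSnd' hb
  obtain ⟨cA, cB, -⟩ := continuousAt_amb (a := aVec π) (c := cVec π) hN
  have cs : ContinuousAt (fun y : Ambient => nB π (sect (nA π) (y.2 σ))) z := by
    have h : ContinuousAt (fun y : Ambient => sect (nA π) (y.2 σ)) z :=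
      ContinuousAt.comp (f := fun y : Ambient => y.2 σ) (continuousAt_sect _ hN)
        ((continuous_apply σ).comp continuous_snd).continuousAt
    exact (LinearMap.continuous_of_finiteDimensional (nB π)).continuousAt.comp h
  have cL : ∀ (L : Dual ℂ ℂ⁶) {f : Ambient → ℂ⁶}, ContinuousAt f z →
      ContinuousAt (fun y => L (f y)) z := fun L f hf =>
    (LinearMap.continuous_of_finiteDimensional L).continuousAt.comp hf
  have cH : ∀ {f : Ambient → ℂ⁶}, ContinuousAt f z →
      ContinuousAt (fun y => halfSum π (f y) 2) z := fun hf =>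
    (continuous_halfSum π 2).continuousAt.comp hf
  have hMz : readM π E σ z = sysM E β 0 (0, 0) (0, 0) (node₁ π) (node₂ π) := by
    simp only [readM, hV, hW, hβ, f1, f2]
    congr 1 <;> simp [mL_apply, dL_apply, node₁, node₂]
  have cM : ContinuousAt (readM π E σ) z := by
    have d1 := cL (mL π) cv
    have d2 := cL (dL π) cv
    have d3 := cL (dL π) cw
    have d4 := (cH cA).neg.div_const 4
    have d5 := (cH cB).neg.div_const 4
    have d6 : ∀ j, ContinuousAt (fun y : Ambient => eval
        ((tst j).1 • lineFst (aVec π) (cVec π) y.1.1 +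
          (tst j).2 • lineSnd (aVec π) (cVec π) y.1.1) E) z := fun j =>
      (continuous_eval E).continuousAt.comp (f := fun y : Ambient =>
        (tst j).1 • lineFst (aVec π) (cVec π) y.1.1 + (tst j).2 • lineSnd (aVec π) (cVec π) y.1.1)
        ((cv.const_smul (tst j).1).add (cw.const_smul (tst j).2))
    refine continuousAt_pi.2 fun j => continuousAt_pi.2 fun k => ?_
    have d7 := d6 j
    fin_cases k <;> simp only [readM, sysM, Matrix.of_apply] <;> simp <;>
      first | exact d7 | fun_prop
  have hdet := sysM_det_ne (β := β) h1 h2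
  have cU : ContinuousAt (readU π E σ) z := by
    have cdet : ContinuousAt (fun y => (readM π E σ y).det) z :=
      (Continuous.matrix_det continuous_id).continuousAt.comp cM
    have cadj : ContinuousAt (fun y => (readM π E σ y).adjugate) z :=
      (Continuous.matrix_adjugate continuous_id).continuousAt.comp cM
    have cinv : ContinuousAt (fun y => (readM π E σ y)⁻¹) z := by
      simp only [Matrix.inv_def, Ring.inverse_eq_inv']
      exact (cdet.inv₀ (by rw [hMz]; exact hdet)).smul cadj
    have cR : ContinuousAt (fun y : Ambient => sysR (nB π (sect (nA π) (y.2 σ)))) z := by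
      refine continuousAt_pi.2 fun j => ?_
      simp only [sysR]
      fun_prop
    have : Continuous fun q : Matrix (Fin 4) (Fin 4) ℂ × ℂ^4 => -(q.1.mulVec q.2) :=
      (Continuous.matrix_mulVec continuous_fst continuous_snd).neg
    exact this.continuousAt.comp (f := fun y => ((readM π E σ y)⁻¹,
      sysR (nB π (sect (nA π) (y.2 σ))))) (cinv.prodMk cR)
  refine ⟨cU, by rw [readU, hMz, hβ, unk], ?_⟩
  filter_upwards [((Continuous.matrix_det continuous_id).continuousAt.comp cM).eventually_ne
    (y := 0) (by simpa [hMz] using hdet)] with y hy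
  exact hy

omit hE h1 h2 in
lemma nodeChart_recover (hE : E.IsHomogeneous 3) {y : Ambient} (hy : y ∈ graph E) (hby : bracket (aVec π) (cVec π) y.1.1.rep ≠ 0)
    (hNy : nA π (y.2 σ).rep ≠ 0) (hdy : (readM π E σ y).det ≠ 0) :
    lineFst (aVec π) (cVec π) y.1.1 = vV π (readX π σ β y, readU π E σ y) ∧
      lineSnd (aVec π) (cVec π) y.1.1 = vW π β (readX π σ β y, readU π E σ y) ∧
      y.1.2 = readX π σ β y 0 * readX π σ β y 1 * readU π E σ y 1 ∧
      eqs E π β (readX π σ β y, readU π E σ y) = 0 := by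
  obtain ⟨r, hr, g1, g2, g3, -⟩ := amb_graph (a := aVec π) (c := cVec π) hy hby hNy
  obtain ⟨v', w', hl⟩ := graph_isLine hy
  have hn := hl.normalized hby
  obtain ⟨d1, d2, d3, d4⟩ := hl.dual hby
  have hfam := (mem_fanoFamily.1 hy.1).2
  have eM : nA π (sect (nA π) (y.2 σ)) = 1 := dual_sect (nA π) hNy
  have eA : nA π (sect (nA π) (y.2 σ)) = (halfSum π (ambFst (cVec π) (nA π) σ y) 0 -
    halfSum π (ambFst (cVec π) (nA π) σ y) 1) / 4 := nA_apply π _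
  have eB : nB π (sect (nA π) (y.2 σ)) = (halfSum π (ambSnd (aVec π) (nA π) σ y) 0 -
    halfSum π (ambSnd (aVec π) (nA π) σ y) 1) / 4 := nB_apply π _
  have hs : ∀ x : ℂ⁶, ∀ k, halfSum π (r • symm σ x) k = 2 * r * halfSum π x k := by
    intro x k
    rw [symm_eq_halfSum hπ x, place_smul, vec_smul, halfSum_place]
    simp; ring
  set v := lineFst (aVec π) (cVec π) y.1.1 with hv
  set w := lineSnd (aVec π) (cVec π) y.1.1 with hw
  set b := nB π (sect (nA π) (y.2 σ)) with hbdef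
  rw [g1, hs, hs, eM] at eA
  rw [g2, hs, hs] at eB
  have hsv := sum_halfSum π v
  rw [(hfam v hn.onLine_left).1] at hsv
  have hsw := sum_halfSum π w
  rw [(hfam w hn.onLine_right).1] at hsw
  rw [dotL_aVec] at d1 d3
  rw [dotL_cVec] at d2 d4
  have eX : readX π σ β y = ![r⁻¹, dL π w, b - β] := by
    funext j
    fin_cases j
    · simp only [readX, ← hv, mL_apply]; grind
    · rfl
    · rfl
  have hmr : (halfSum π v 0 - halfSum π v 1) / 2 = r⁻¹ := by grind
  have hmb : (halfSum π w 0 - halfSum π w 1) / 2 = r⁻¹ * b := by grind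
  have hMy : readM π E σ y = sysM E b r⁻¹ (dL π v, dL π w)
      (-(r * halfSum π v 2) / 2, -(r * halfSum π w 2) / 2) v w := by
    simp only [readM, ← hv, ← hw, ← hbdef, mL_apply, hmr, g1, g2, hs]
    grind
  have hVd : v = place π (vec ![-halfSum π v 2 / 2 + r⁻¹, -halfSum π v 2 / 2 - r⁻¹, halfSum π v 2]
      ![1 + dL π v, 1 - dL π v, 1]) := by
    conv_lhs => rw [eq_place_vec π v]
    congr 2
    · funext k
      fin_cases k
      · change halfSum π v 0 = -halfSum π v 2 / 2 + r⁻¹; grind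
      · change halfSum π v 1 = -halfSum π v 2 / 2 - r⁻¹; grind
      · rfl
    · funext k
      fin_cases k
      · change halfDiff π v 0 = 1 + dL π v; rw [dL_apply]; grind
      · change halfDiff π v 1 = 1 - dL π v; rw [dL_apply]; grind
      · change halfDiff π v 2 = 1; grind
  have hWd : w = place π (vec ![-halfSum π w 2 / 2 + r⁻¹ * b, -halfSum π w 2 / 2 - r⁻¹ * b,
      halfSum π w 2] ![1 + dL π w, 1 - dL π w, -1]) := by
    conv_lhs => rw [eq_place_vec π w]
    congr 2
    · funext k
      fin_cases k
      · change halfSum π w 0 = -halfSum π w 2 / 2 + r⁻¹ * b; grind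
      · change halfSum π w 1 = -halfSum π w 2 / 2 - r⁻¹ * b; grind
      · rfl
    · funext k
      fin_cases k
      · change halfDiff π w 0 = 1 + dL π w; rw [dL_apply]; grind
      · change halfDiff π w 1 = 1 - dL π w; rw [dL_apply]; grind
      · change halfDiff π w 2 = -1; grind
  -- the linear system
  have hcub : ∀ α γ : ℂ, 12 * ((α * (-(r * halfSum π v 2) / 2) + γ * (-(r * halfSum π w 2) / 2)) *
      (4 * α * γ + (α * dL π v + γ * dL π w) ^ 2 + r⁻¹ ^ 2 * (α + γ * b) ^ 2 -
      r⁻¹ ^ 2 * (α * (-(r * halfSum π v 2) / 2) + γ * (-(r * halfSum π w 2) / 2)) ^ 2) +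
      2 * (α + γ * b) * (α + γ) * (α * dL π v + γ * dL π w)) +
      r * y.1.2 * eval (α • v + γ • w) E = 0 := by
    intro α γ
    have h6 := (hfam _ (hn.onLine_iff.2 ⟨α, γ, rfl⟩)).2
    have h7 : cubic (α • v + γ • w) = 12 * ((α * (-(halfSum π v 2) / 2) +
      γ * (-(halfSum π w 2) / 2)) *
      (4 * α * γ + (α * dL π v + γ * dL π w) ^ 2 + r⁻¹ ^ 2 * (α + γ * b) ^ 2 -
      (α * (-(halfSum π v 2) / 2) + γ * (-(halfSum π w 2) / 2)) ^ 2) +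
      r⁻¹ * (2 * (α + γ * b) * (α + γ) * (α * dL π v + γ * dL π w))) := by
      conv_lhs => rw [hVd, hWd, place_combo, vec_combo, cubic_place, cubic_vec (by simp; ring)]
      simp
      ring
    grind
  have hsys : (readM π E σ y).mulVec ![dL π v, r * y.1.2, -(r * halfSum π v 2) / 2,
      -(r * halfSum π w 2) / 2] + dL π w • sysR b = 0 := by
    funext j
    rw [hMy, Pi.add_apply, Pi.smul_apply, smul_eq_mul, sys_apply]
    exact hcub _ _
  have hu : ![dL π v, r * y.1.2, -(r * halfSum π v 2) / 2, -(r * halfSum π w 2) / 2] =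
      dL π w • readU π E σ y := by
    have h3 := congrArg (fun q => (readM π E σ y)⁻¹.mulVec q) hsys
    simp only [Matrix.mulVec_add, Matrix.mulVec_mulVec, Matrix.nonsing_inv_mul _
      (isUnit_iff_ne_zero.2 hdy), Matrix.one_mulVec, Matrix.mulVec_smul, Matrix.mulVec_zero] at h3
    rw [readU, smul_neg]
    grind
  set U := readU π E σ y with hUdef
  have u0 : dL π v = dL π w * U 0 := congrFun hu 0
  have u1 : r * y.1.2 = dL π w * U 1 := congrFun hu 1
  have u2 : -(r * halfSum π v 2) / 2 = dL π w * U 2 := congrFun hu 2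
  have u3 : -(r * halfSum π w 2) / 2 = dL π w * U 3 := congrFun hu 3
  have hrr : r⁻¹ * r = 1 := inv_mul_cancel₀ hr
  have p2 : halfSum π v 2 = -2 * (r⁻¹ * dL π w * U 2) := by grind
  have p3 : halfSum π w 2 = -2 * (r⁻¹ * dL π w * U 3) := by grind
  have pt : y.1.2 = r⁻¹ * dL π w * U 1 := by grind
  have hμ : dL π w ≠ 0 := by
    intro h0
    have hsy := ((mem_graph_iff hn).1 hy).2 σ'
    refine hsy.1 ⟨by grind, v, w, ?_, ?_, hn⟩
    · rw [hVd, inPlane_iff, symm_place π hπ', place_eq_zero, p2, u0, h0]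
      funext k; fin_cases k <;> simp [vec, swp']
    · rw [hWd, inPlane_iff, symm_place π hπ', place_eq_zero, p3, h0]
      funext k; fin_cases k <;> simp [vec, swp']
  have hV' : v = vV π (readX π σ β y, U) := by
    rw [hVd, vV, eX, p2, u0]
    congr 2
    · funext k; fin_cases k <;> simp <;> ring
  have hW' : w = vW π β (readX π σ β y, U) := by
    rw [hWd, vW, eX, p3]
    congr 2
    · funext k; fin_cases k <;> simp <;> ring
  have hT : y.1.2 = readX π σ β y 0 * readX π σ β y 1 * U 1 := by rw [eX]; exact pt
  refine ⟨hV', hW', hT, (eqs_eq_zero hE _).2 fun α γ => ?_⟩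
  have h6 := (hfam _ (hn.onLine_iff.2 ⟨α, γ, rfl⟩)).2
  rw [hV', hW', hT, form_spec (readX π σ β y, U)] at h6
  refine (mul_eq_zero.1 h6).resolve_left ?_
  rw [eX]
  exact mul_ne_zero (inv_ne_zero hr) hμ

lemma nodeChart_chart {z : Ambient} (hz : z ∈ blowUp E)
    (hb : bracket (aVec π) (cVec π) z.1.1.rep ≠ 0)
    (hV : lineFst (aVec π) (cVec π) z.1.1 = node₁ π)
    (hW : lineSnd (aVec π) (cVec π) z.1.1 = node₂ π) (hN : nA π (z.2 σ).rep ≠ 0)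
    (hβ : nB π (sect (nA π) (z.2 σ)) = β)
    {g : ℂ³ → ℂ^4} (hg : (nodeChart hE hπ hπ' h1 h2 β).IsSolution g) :
    (nodeChart hE hπ hπ' h1 h2 β).point (0, unk E π β) = z ∧
      IsChartAt 3 (blowUp E) z fun x => (nodeChart hE hπ hπ' h1 h2 β).point (x, g x) := by
  obtain ⟨cU, hUz, hdet⟩ := nodeChart_readU hπ h1 h2 hz hb hV hW hN hβ
  refine hg.chart hz (X := readX π σ β) (U := readU π E σ) ?_ ?_ (fun j => ?_) ?_
    (Filter.Eventually.of_forall fun p _ => (nodeChart_readX hE hπ hπ' h1 h2 p).1)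
  · funext j
    fin_cases j
    · simp [readX, hV, mL_apply, node₁]
    · simp [readX, hW, dL_apply, node₂]
    · simp [readX, hβ]
  · have h3 := cU.tendsto.mono_left (nhdsWithin_le_nhds (s := graph E)); rw [hUz] at h3; exact h3
  · fin_cases j
    exacts [(isCoordinate_line hb (mL π) 0).fst.congr 0 (by simp [readX]),
      (isCoordinate_line hb 0 (dL π)).fst.congr 0 (by simp [readX]),
      (isCoordinate_sect hN (nB π)).congr β (by simp [readX])]
  · filter_upwards [self_mem_nhdsWithin, nhdsWithin_le_nhds (eventually_bracket' hb),
      nhdsWithin_le_nhds (eventually_dual_ne_zero hN),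
      nhdsWithin_le_nhds hdet] with y hy hby hNy hdy
    exact ⟨hby, nodeChart_recover hπ hπ' hE hy hby hNy hdy⟩
end

end Segre

namespace Segre

/-! ## Synthemes and totals -/

namespace Table

def syn : Fin 15 → Fin 6 → Fin 6 := ![![1,0,3,2,5,4], ![1,0,4,5,2,3], ![1,0,5,4,3,2],
  ![2,3,0,1,5,4], ![2,4,0,5,1,3], ![2,5,0,4,3,1], ![3,2,1,0,5,4], ![3,4,5,0,1,2], ![3,5,4,0,2,1],
  ![4,2,1,5,0,3], ![4,3,5,1,0,2], ![4,5,3,2,0,1], ![5,2,1,4,3,0], ![5,3,4,1,2,0], ![5,4,3,2,1,0]]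

def tot : Fin 6 → List (Fin 15) := ![[0, 4, 8, 10, 12], [0, 5, 7, 9, 13], [1, 3, 7, 11, 12],
  [1, 5, 6, 10, 14], [2, 3, 8, 9, 14], [2, 4, 6, 11, 13]]

def Shares (k l : Fin 15) : Prop := ∃ i, syn k i = syn l i

instance : DecidableRel Shares := fun k l => inferInstanceAs (Decidable (∃ i, syn k i = syn l i))

/-- The vertices of the hexagon formed by two disjoint synthemes. -/
def hexagon (k l : Fin 15) : Fin 6 → Fin 6 := ![0, syn k (syn l (syn k 0)),
  syn l (syn k (syn l (syn k 0))), syn k 0, syn l (syn k 0), syn k (syn l (syn k (syn l (syn k 0))))]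

/-- The vertices of the quadrangle formed by two synthemes that share a pair. -/
def quadrangle (k l : Fin 15) (a i : Fin 6) : Fin 6 → Fin 6 :=
  ![a, syn k a, syn l (syn k a), syn l a, i, syn k i]

lemma syn_involutive : ∀ k i, syn k (syn k i) = i := by decide

lemma syn_ne : ∀ k i, syn k i ≠ i := by decide

set_option maxRecDepth 10000 in
lemma exists_syn : ∀ p : 𝔖₆, (∀ i, p (p i) = i) → (∀ i, p i ≠ i) →
    ∃ k, ∀ i, p i = syn k i := by decide +kernel

lemma shares_of_mem_tot : ∀ q, ∀ k ∈ tot q, ∀ l ∈ tot q, Shares k l → k = l := by decide +kernel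

lemma exists_tot : ∀ a b c d e : Fin 3,
    [a.castAdd 12, (b.natAdd 3).castAdd 9, (c.natAdd 6).castAdd 6, (d.natAdd 9).castAdd 3,
      e.natAdd 12].Pairwise (fun k l : Fin 15 => ¬ Shares k l) →
    ∃ q, tot q = [a.castAdd 12, (b.natAdd 3).castAdd 9, (c.natAdd 6).castAdd 6,
      (d.natAdd 9).castAdd 3, e.natAdd 12] := by decide +kernel

lemma syn_zero : ∀ k, (syn k 0 = 1 → ∃ a : Fin 3, k = a.castAdd 12) ∧
    (syn k 0 = 2 → ∃ a : Fin 3, k = (a.natAdd 3).castAdd 9) ∧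
    (syn k 0 = 3 → ∃ a : Fin 3, k = (a.natAdd 6).castAdd 6) ∧
    (syn k 0 = 4 → ∃ a : Fin 3, k = (a.natAdd 9).castAdd 3) ∧
    (syn k 0 = 5 → ∃ a : Fin 3, k = a.natAdd 12) := by decide +kernel

lemma exists_quadrangle : ∀ k l, k ≠ l → Shares k l → ∃ a i, Injective (quadrangle k l a i) ∧
    ∀ j, syn k (quadrangle k l a i j) = quadrangle k l a i (syn 0 j) ∧
      syn l (quadrangle k l a i j) = quadrangle k l a i (syn 6 j) := by decide +kernel

lemma hexagon_spec : ∀ k l, ¬ Shares k l → Injective (hexagon k l) ∧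
    ∀ j, syn k (hexagon k l j) = hexagon k l (syn 7 j) ∧
      syn l (hexagon k l j) = hexagon k l (syn 12 j) := by decide +kernel

lemma exists_hexagon : ∀ q k, k ∉ tot q → ∃ l ∈ tot q, ∃ m ∈ tot q, ¬ Shares l m ∧
    ∀ j, syn k (hexagon l m j) = hexagon l m (syn 0 j) := by
  decide +kernel

lemma exists_shares : ∀ k, ∃ l, k ≠ l ∧ Shares k l := by decide

lemma exists_notMem_tot : ∀ q q', ∃ k, k ∉ tot q ∧ k ∉ tot q' := by decide

lemma exists_tot_notMem : ∀ k, ∃ q, k ∉ tot q := by decide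

def sharing : Finset (Fin 15 × Fin 15) := Finset.univ.filter fun p => p.1 < p.2 ∧ Shares p.1 p.2

lemma card_sharing : sharing.card = 45 := by decide +kernel

end Table

open Table

/-- The syntheme with a given index, for a numbering of the six elements. -/
def act (π : 𝔖₆) (k : Fin 15) : Syntheme :=
  ⟨⟨fun i => π (syn k (π.symm i)), fun i => π (syn k (π.symm i)),
    fun i => by simp [syn_involutive], fun i => by simp [syn_involutive]⟩,
    fun i => by simp [syn_involutive], fun i h => syn_ne k (π.symm i) (by
      rw [← Equiv.symm_apply_apply π (syn k (π.symm i))]; exact congrArg π.symm h)⟩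

lemma act_apply (π : 𝔖₆) (k : Fin 15) (j : Fin 6) : (act π k).1 (π j) = π (syn k j) := by simp [act]

lemma eq_act {σ : Syntheme} {π : 𝔖₆} {k : Fin 15}
    (h : ∀ j, σ.1 (π j) = π (syn k j)) : σ = act π k := eq_of_swp h (act_apply π k)

lemma exists_act (π : 𝔖₆) (σ : Syntheme) : ∃ k, σ = act π k := by
  obtain ⟨k, hk⟩ := exists_syn ((π.trans σ.1).trans π.symm) (by simp [σ.2.1])
    (fun i h => σ.2.2 (π i) (by simpa [Equiv.symm_apply_eq] using h))
  exact ⟨k, eq_act fun j => by rw [← hk]; simp⟩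

lemma act_injective (π : 𝔖₆) : Injective (act π) := by
  intro k l h
  have h1 : ∀ j, syn k j = syn l j := fun j => π.injective (by rw [← act_apply, ← act_apply, h])
  revert k l
  have : ∀ k l, (∀ j, syn k j = syn l j) → k = l := by decide +kernel
  exact fun k l _ h => this k l h

def Meets (σ τ : Syntheme) : Prop := ∃ i, σ.1 i = τ.1 i

lemma meets_act {π : 𝔖₆} {k l : Fin 15} : Meets (act π k) (act π l) ↔ Shares k l := by
  constructor
  · rintro ⟨i, hi⟩
    obtain ⟨j, rfl⟩ := π.surjective i
    exact ⟨j, π.injective (by rw [← act_apply, ← act_apply, hi])⟩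
  · rintro ⟨j, hj⟩; exact ⟨π j, by rw [act_apply, act_apply, hj]⟩

lemma exists_frame_of_meets {σ σ' : Syntheme} (hne : σ ≠ σ') (h : Meets σ σ') :
    ∃ π, σ = act π 0 ∧ σ' = act π 6 := by
  obtain ⟨k, rfl⟩ := exists_act 1 σ
  obtain ⟨l, rfl⟩ := exists_act 1 σ'
  obtain ⟨a, i, hi, h1⟩ := exists_quadrangle k l (fun e => hne (by rw [e])) (meets_act.1 h)
  exact ⟨Equiv.ofBijective _ (Finite.injective_iff_bijective.1 hi), eq_act fun j => (h1 j).1,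
    eq_act fun j => (h1 j).2⟩

lemma exists_frame_of_not_meets {σ τ : Syntheme} (h : ¬ Meets σ τ) :
    ∃ π, σ = act π 7 ∧ τ = act π 12 := by
  obtain ⟨k, rfl⟩ := exists_act 1 σ
  obtain ⟨l, rfl⟩ := exists_act 1 τ
  obtain ⟨hi, h1⟩ := hexagon_spec k l (fun e => h (meets_act.2 e))
  exact ⟨Equiv.ofBijective _ (Finite.injective_iff_bijective.1 hi), eq_act fun j => (h1 j).1,
    eq_act fun j => (h1 j).2⟩

lemma exists_frame (σ : Syntheme) : ∃ π, σ = act π 0 := by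
  obtain ⟨k, rfl⟩ := exists_act 1 σ
  obtain ⟨l, hl, h⟩ := exists_shares k
  obtain ⟨π, h1, -⟩ := exists_frame_of_meets (fun e => hl (act_injective 1 e)) (meets_act.2 h)
  exact ⟨π, h1⟩

lemma Total.eq_of_meets (T : Total) {σ τ : Syntheme} (hσ : σ ∈ T.1) (hτ : τ ∈ T.1)
    (h : Meets σ τ) : σ = τ := by
  by_contra hne
  obtain ⟨i, hi⟩ := h
  exact T.2.2 σ hσ τ hτ hne i hi

lemma Total.exists_tot (T : Total) (π : 𝔖₆) : ∃ q, ∀ k, act π k ∈ T.1 ↔ k ∈ tot q := by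
  have hinj : Set.InjOn (fun σ : Syntheme => σ.1 (π 0)) T.1 := fun σ hσ τ hτ h =>
    T.eq_of_meets hσ hτ ⟨_, h⟩
  have hsurj : ∀ j, j ≠ π 0 → ∃ σ ∈ T.1, σ.1 (π 0) = j := by
    have h1 : T.1.image (fun σ : Syntheme => σ.1 (π 0)) = Finset.univ.erase (π 0) := by
      refine Finset.eq_of_subset_of_card_le (fun j hj => ?_) ?_
      · obtain ⟨σ, -, rfl⟩ := Finset.mem_image.1 hj; simpa using σ.2.2 (π 0)
      · rw [Finset.card_image_of_injOn hinj, T.2.1]; simp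
    intro j hj
    have : j ∈ T.1.image (fun σ : Syntheme => σ.1 (π 0)) := by rw [h1]; simpa using hj
    simpa using this
  have hget : ∀ j, j ≠ 0 → ∃ k, act π k ∈ T.1 ∧ syn k 0 = j := by
    intro j hj
    obtain ⟨σ, hσ, h⟩ := hsurj (π j) (fun e => hj (π.injective e))
    obtain ⟨k, rfl⟩ := exists_act π σ
    exact ⟨k, hσ, π.injective (by rw [← act_apply, h])⟩
  obtain ⟨k1, m1, h1⟩ := hget 1 (by decide)
  obtain ⟨k2, m2, h2⟩ := hget 2 (by decide)
  obtain ⟨k3, m3, h3⟩ := hget 3 (by decide)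
  obtain ⟨k4, m4, h4⟩ := hget 4 (by decide)
  obtain ⟨k5, m5, h5⟩ := hget 5 (by decide)
  have hd : ∀ {k l}, act π k ∈ T.1 → act π l ∈ T.1 → syn k 0 ≠ syn l 0 → ¬ Shares k l :=
    fun hk hl hne h => hne (by rw [act_injective π (T.eq_of_meets hk hl (meets_act.2 h))])
  have hp : [k1, k2, k3, k4, k5].Pairwise fun k l => ¬ Shares k l := by
    simp only [List.pairwise_cons, List.mem_cons, List.not_mem_nil, or_false, forall_eq_or_imp,
      forall_eq]
    refine ⟨⟨hd m1 m2 ?_, hd m1 m3 ?_, hd m1 m4 ?_, hd m1 m5 ?_⟩, ⟨hd m2 m3 ?_, hd m2 m4 ?_,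
      hd m2 m5 ?_⟩, ⟨hd m3 m4 ?_, hd m3 m5 ?_⟩, hd m4 m5 ?_, by simp, by simp⟩ <;>
    simp [h1, h2, h3, h4, h5]
  obtain ⟨a, ha⟩ := (syn_zero k1).1 h1
  obtain ⟨b, hb⟩ := (syn_zero k2).2.1 h2
  obtain ⟨c, hc⟩ := (syn_zero k3).2.2.1 h3
  obtain ⟨d, hd'⟩ := (syn_zero k4).2.2.2.1 h4
  obtain ⟨e, he⟩ := (syn_zero k5).2.2.2.2 h5
  obtain ⟨q, hq⟩ := Table.exists_tot a b c d e (by rwa [← ha, ← hb, ← hc, ← hd', ← he])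
  rw [← ha, ← hb, ← hc, ← hd', ← he] at hq
  refine ⟨q, fun k => ⟨fun hk => ?_, fun hk => ?_⟩⟩
  · have key : ∀ {l}, act π l ∈ T.1 → syn k 0 = syn l 0 → k = l := fun hl h =>
      act_injective π (T.eq_of_meets hk hl (meets_act.2 ⟨0, h⟩))
    have h0 := syn_ne k 0
    rw [hq]
    simp only [List.mem_cons, List.not_mem_nil, or_false]
    rcases (by revert h0; generalize syn k 0 = j; revert j; decide :
      syn k 0 = 1 ∨ syn k 0 = 2 ∨ syn k 0 = 3 ∨ syn k 0 = 4 ∨ syn k 0 = 5) with h | h | h | h | h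
    exacts [Or.inl (key m1 (h.trans h1.symm)), Or.inr (Or.inl (key m2 (h.trans h2.symm))),
      Or.inr (Or.inr (Or.inl (key m3 (h.trans h3.symm)))),
      Or.inr (Or.inr (Or.inr (Or.inl (key m4 (h.trans h4.symm))))),
      Or.inr (Or.inr (Or.inr (Or.inr (key m5 (h.trans h5.symm)))))]
  · rw [hq] at hk
    simp only [List.mem_cons, List.not_mem_nil, or_false] at hk
    rcases hk with rfl | rfl | rfl | rfl | rfl <;> assumption

lemma Total.ext_tot {T T' : Total} {π : 𝔖₆} {q : Fin 6}
    (h : ∀ k, act π k ∈ T.1 ↔ k ∈ tot q) (h' : ∀ k, act π k ∈ T'.1 ↔ k ∈ tot q) : T = T' :=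
  Subtype.ext (Finset.ext fun σ => by obtain ⟨k, rfl⟩ := exists_act π σ; rw [h, h'])

/-- The total with a given index, for a numbering of the six elements. -/
def actTot (π : 𝔖₆) (q : Fin 6) : Total := ⟨((tot q).toFinset).image (act π), by
    rw [Finset.card_image_of_injective _ (act_injective π)]
    revert q; decide, fun σ hσ τ hτ hne i hi => by
    obtain ⟨k, hk, rfl⟩ := Finset.mem_image.1 hσ
    obtain ⟨l, hl, rfl⟩ := Finset.mem_image.1 hτ
    exact hne (congrArg (act π) (shares_of_mem_tot q k (by simpa using hk) l (by simpa using hl)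
      (meets_act.1 ⟨i, hi⟩)))⟩

lemma mem_actTot {π : 𝔖₆} {q : Fin 6} (k : Fin 15) : act π k ∈ (actTot π q).1 ↔ k ∈ tot q := by
  simp [actTot, (act_injective π).eq_iff]

lemma Total.exists_actTot (T : Total) (π : 𝔖₆) : ∃ q, T = actTot π q := by
  obtain ⟨q, hq⟩ := T.exists_tot π
  exact ⟨q, Total.ext_tot hq mem_actTot⟩

lemma exists_frame_of_notMem {T : Total} {σ : Syntheme} (h : σ ∉ T.1) :
    ∃ π, σ = act π 0 ∧ T = actTot π 2 := by
  obtain ⟨k, rfl⟩ := exists_act 1 σ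
  obtain ⟨q, rfl⟩ := T.exists_actTot 1
  rw [mem_actTot] at h
  obtain ⟨l, hl, m, hm, hs, hk⟩ := exists_hexagon q k h
  obtain ⟨hi, h1⟩ := hexagon_spec l m hs
  let π := Equiv.ofBijective _ (Finite.injective_iff_bijective.1 hi)
  refine ⟨π, eq_act hk, ?_⟩
  have e1 : act 1 l = act π 7 := eq_act fun j => (h1 j).1
  have e2 : act 1 m = act π 12 := eq_act fun j => (h1 j).2
  obtain ⟨q', hq'⟩ := (actTot 1 q).exists_actTot π
  have m1 := (mem_actTot (π := 1) (q := q) l).2 hl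
  have m2 := (mem_actTot (π := 1) (q := q) m).2 hm
  rw [e1, hq', mem_actTot] at m1
  rw [e2, hq', mem_actTot] at m2
  have : ∀ q, 7 ∈ tot q → 12 ∈ tot q → q = 2 := by decide
  rw [hq', this q' m1 m2]

lemma Total.exists_notMem (T T' : Total) : ∃ σ, σ ∉ T.1 ∧ σ ∉ T'.1 := by
  obtain ⟨q, rfl⟩ := T.exists_actTot 1
  obtain ⟨q', rfl⟩ := T'.exists_actTot 1
  obtain ⟨k, h1, h2⟩ := exists_notMem_tot q q'
  exact ⟨act 1 k, fun h => h1 ((mem_actTot k).1 h), fun h => h2 ((mem_actTot k).1 h)⟩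

lemma exists_total_notMem (σ : Syntheme) : ∃ T : Total, σ ∉ T.1 := by
  obtain ⟨k, rfl⟩ := exists_act 1 σ
  obtain ⟨q, hq⟩ := exists_tot_notMem k
  exact ⟨actTot 1 q, fun h => hq ((mem_actTot k).1 h)⟩

open NodeChart

/-! ## Lines on the Segre primal -/

lemma inPlane_act {π : 𝔖₆} {k : Fin 15} {x : ℂ⁶} :
    InPlane (act π k) x ↔ ∀ j, x (π j) + x (π (syn k j)) = 0 := by
  constructor
  · intro h j; have := h (π j); rwa [act_apply] at this
  · intro h i; obtain ⟨j, rfl⟩ := π.surjective i; rw [act_apply]; exact h j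

lemma sum_frame (π : 𝔖₆) (x : ℂ⁶) :
    ∑ i, x i = x (π 0) + x (π 1) + x (π 2) + x (π 3) + x (π 4) + x (π 5) := by
  rw [sum_perm π, Fin.sum_univ_six]

lemma cubic_frame (π : 𝔖₆) (x : ℂ⁶) :
    cubic x = x (π 0) ^ 3 + x (π 1) ^ 3 + x (π 2) ^ 3 + x (π 3) ^ 3 + x (π 4) ^ 3 + x (π 5) ^ 3 := by
  rw [cubic, sum_perm π, Fin.sum_univ_six]

/-- The signs of the coordinates of a node. -/
def sgn : Fin 6 → ℤ := ![1, -1, 1, -1, 1, -1]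

lemma vec_eq_sgn (j : Fin 6) : vec 0 ![1, 1, 1] j = sgn j := by fin_cases j <;> simp [vec, sgn]

/-- The line lies on the Segre primal. -/
def OnSegre (l : ℙ ℂ PlückerSpace) : Prop :=
  (∃ v w, IsLine l v w) ∧ ∀ x, OnLine l x → ∑ i, x i = 0 ∧ cubic x = 0

lemma onSegre_of_mem {E : 𝒫₆} {b : Base} (hb : b ∈ fanoFamily E) (h0 : b.2 = 0) : OnSegre b.1 := by
  obtain ⟨h1, h2⟩ := mem_fanoFamily.1 hb
  refine ⟨h1, fun x hx => ⟨(h2 x hx).1, ?_⟩⟩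
  have := (h2 x hx).2
  rwa [h0, zero_mul, zero_add] at this

lemma OnSegre.mem_fanoFamily {E : 𝒫₆} {l : ℙ ℂ PlückerSpace}
    (h : OnSegre l) : (l, (0 : ℂ)) ∈ fanoFamily E :=
  Segre.mem_fanoFamily.2 ⟨h.1, fun x hx => ⟨(h.2 x hx).1, by simp [(h.2 x hx).2]⟩⟩

def InPl (σ : Syntheme) (l : ℙ ℂ PlückerSpace) : Prop := ∀ x, OnLine l x → InPlane σ x

def MeetsPl (σ : Syntheme) (l : ℙ ℂ PlückerSpace) : Prop := ∃ x, x ≠ 0 ∧ OnLine l x ∧ InPlane σ x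

lemma onSegre_of_inPl {σ : Syntheme} {l : ℙ ℂ PlückerSpace} (hl : ∃ v w, IsLine l v w)
    (h : InPl σ l) : OnSegre l := by
  refine ⟨hl, fun x hx => ?_⟩
  have hs := inPlane_iff.1 (h x hx)
  constructor
  · have := symm_sum σ x; rw [hs] at this; simpa using this
  · rw [cubic_eq σ, hs]; simp

lemma InPlane.smul {σ : Syntheme} {x : ℂ⁶} (h : InPlane σ x) (r : ℂ) : InPlane σ (r • x) := by
  simpa using h.combo h r 0

section

variable {l : ℙ ℂ PlückerSpace} (hS : OnSegre l)
include hS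

lemma OnSegre.polar {x w : ℂ⁶} (hx : OnLine l x) (hw : OnLine l w) : ∑ i, x i ^ 2 * w i = 0 := by
  have h1 := (hS.2 _ (hx.combo hw 1 1)).2
  have h2 := (hS.2 _ (hx.combo hw 1 (-1))).2
  have h3 := (hS.2 w hw).2
  simp only [cubic, Pi.add_apply, Pi.smul_apply, smul_eq_mul, Fin.sum_univ_six] at h1 h2 h3 ⊢
  grind

lemma OnSegre.inPl_of_hyperplane (π : 𝔖₆)
    (h : ∀ x, OnLine l x → x (π 4) + x (π 5) = 0) : ∃ σ, InPl σ l := by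
  obtain ⟨v, w, hl⟩ := hS.1
  have hf : ∀ x, OnLine l x → (x (π 0) + x (π 1)) * (x (π 0) + x (π 2)) * (x (π 0) + x (π 3)) = 0 := by
    intro x hx
    obtain ⟨h1, h2⟩ := hS.2 x hx
    have h3 := h x hx
    rw [sum_frame π] at h1
    rw [cubic_frame π] at h2
    have e5 : x (π 5) = -x (π 4) := by grind
    have e3 : x (π 3) = -(x (π 0) + x (π 1) + x (π 2)) := by grind
    rw [e5, e3] at h2
    rw [e3]
    grind
  have key : ∀ p : Fin 3 → ℂ × ℂ, (∀ a c : ℂ, ∏ k, (a * (p k).1 + c * (p k).2) = 0) → ∃ k, p k = 0 := by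
    intro p hp
    by_contra! hne
    have hfin : (⋃ k, {c : ℂ | (p k).1 + c * (p k).2 = 0}).Finite := by
      refine Set.finite_iUnion fun k => Set.Subsingleton.finite fun c hc c' hc' => ?_
      simp only [Set.mem_ofPred_eq] at hc hc'
      by_cases h2 : (p k).2 = 0
      exacts [(hne k (Prod.ext (by simpa [h2] using hc) h2)).elim, mul_right_cancel₀ h2 (by grind)]
    obtain ⟨c, hc⟩ := hfin.exists_notMem
    obtain ⟨k, -, hk⟩ := Finset.prod_eq_zero_iff.1 (hp 1 c)
    exact hc (Set.mem_iUnion.2 ⟨k, by simpa using hk⟩)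
  obtain ⟨k, hk⟩ := key ![(v (π 0) + v (π 1), w (π 0) + w (π 1)),
    (v (π 0) + v (π 2), w (π 0) + w (π 2)), (v (π 0) + v (π 3), w (π 0) + w (π 3))] (by
      intro a c
      have := hf _ (hl.onLine_iff.2 ⟨a, c, rfl⟩)
      simp only [Pi.add_apply, Pi.smul_apply, smul_eq_mul] at this
      rw [Fin.prod_univ_three]
      change (a * (v (π 0) + v (π 1)) + c * (w (π 0) + w (π 1))) *
        (a * (v (π 0) + v (π 2)) + c * (w (π 0) + w (π 2))) *
        (a * (v (π 0) + v (π 3)) + c * (w (π 0) + w (π 3))) = 0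
      grind)
  refine ⟨act π (![0, 3, 6] k), fun x hx => inPlane_act.2 fun j => ?_⟩
  have h1 := (hS.2 x hx).1
  rw [sum_frame π] at h1
  have h3 := h x hx
  obtain ⟨a, c, rfl⟩ := hl.onLine_iff.1 hx
  simp only [Pi.add_apply, Pi.smul_apply, smul_eq_mul] at h1 h3 ⊢
  fin_cases k <;> simp [Prod.ext_iff] at hk <;> fin_cases j <;> simp [syn] <;>
    first | exact h3 | linear_combination h3 | linear_combination a * hk.1 + c * hk.2 | grind

lemma OnSegre.inPl_of_node {π : 𝔖₆} (hn : OnLine l (node₁ π)) : ∃ σ, InPl σ l := by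
  have hnv : ∀ j, node₁ π (π j) = vec 0 ![1, 1, 1] j := fun j => by rw [node₁, place_apply]
  obtain ⟨v, w, hl⟩ := hS.1
  obtain ⟨y₀, hy₀, hne⟩ : ∃ y, OnLine l y ∧ wedge (node₁ π) y ≠ 0 := by
    by_contra! H
    obtain ⟨α, γ, h⟩ := hl.onLine_iff.1 hn
    have h1 := H v hl.onLine_left
    have h2 := H w hl.onLine_right
    have hw := (isLine_iff.1 hl).1
    rw [h] at h1 h2
    have e1 := wedge_combo v w α γ 1 0
    have e2 := wedge_combo v w α γ 0 1
    simp only [one_smul, zero_smul, add_zero, zero_add] at e1 e2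
    rw [h1] at e1
    rw [h2] at e2
    have g0 : γ = 0 := by simpa [hw] using e1.symm
    have a0 : α = 0 := by simpa [hw] using e2.symm
    rw [a0, g0] at h
    have := congrFun h (π 0)
    rw [hnv] at this
    simp [vec] at this
  let c := (y₀ (π 0) + y₀ (π 2) + y₀ (π 4)) / 3
  set y : ℂ⁶ := y₀ - c • node₁ π with hy
  have hyl : OnLine l y := by have := hy₀.combo hn 1 (-c); simpa [hy, sub_eq_add_neg] using this
  have hly : ∀ x, OnLine l x → ∃ a b : ℂ, x = a • node₁ π + b • y := by
    intro x hx
    obtain ⟨a, b, h⟩ := (hn.isLine hy₀ hne).onLine_iff.1 hx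
    exact ⟨a + b * c, b, by rw [h, hy]; module⟩
  have s0 : y (π 0) + y (π 2) + y (π 4) = 0 := by
    simp only [hy, Pi.sub_apply, Pi.smul_apply, hnv, smul_eq_mul]
    simp [vec, c]
    ring
  have s1 : y (π 1) + y (π 3) + y (π 5) = 0 := by
    have := (hS.2 y hyl).1
    rw [sum_frame π] at this
    grind
  have s2 := hS.polar hyl hn
  rw [sum_perm π, Fin.sum_univ_six] at s2
  simp only [hnv] at s2
  simp [vec] at s2
  have s3 := (hS.2 y hyl).2
  rw [cubic_frame π] at s3
  suffices ∃ k, (∀ j, node₁ π (π j) + node₁ π (π (syn k j)) = 0) ∧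
      ∀ j, y (π j) + y (π (syn k j)) = 0 by
    obtain ⟨k, h1, h2⟩ := this
    refine ⟨act π k, fun x hx => ?_⟩
    obtain ⟨a, b, rfl⟩ := hly x hx
    exact (inPlane_act.2 h1).combo (inPlane_act.2 h2) a b
  simp only [hnv]
  have p : ∀ k : Fin 15, (∀ j, sgn j + sgn (syn k j) = 0) →
      ∀ j, vec 0 ![1, 1, 1] j + vec 0 ![1, 1, 1] (syn k j) = 0 := fun k h j => by
    rw [vec_eq_sgn, vec_eq_sgn]; exact_mod_cast h j
  have q : ∀ i j m : ℂ, i + j + m = 0 → ∀ i' j' m' : ℂ, i' + j' + m' = 0 →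
      j * m - i ^ 2 = j' * m' - i' ^ 2 → i + i' = 0 → (j + j' = 0 ∧ m + m' = 0) ∨
        (j + m' = 0 ∧ m + j' = 0) := by
    intro i j m h i' j' m' h' h2 h3
    have : (j + j') * (j + m') = 0 := by grind
    rcases mul_eq_zero.1 this with h4 | h4
    exacts [Or.inl ⟨h4, by grind⟩, Or.inr ⟨h4, by grind⟩]
  have t : (y (π 0) + y (π 1)) * ((y (π 0) + y (π 3)) * (y (π 0) + y (π 5))) = 0 := by
    have e4 : y (π 4) = -(y (π 0) + y (π 2)) := by grind
    have e5 : y (π 5) = -(y (π 1) + y (π 3)) := by grind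
    rw [e4, e5] at s2 s3
    rw [e5]
    grind
  have r2 : ∀ i j m : ℂ, i + j + m = 0 → j * m - i ^ 2 = -(i ^ 2 + j ^ 2 + m ^ 2) / 2 := by
    intro i j m h
    grind
  have hq : ∀ i' j' m' : ℂ, i' + j' + m' = 0 →
      i' ^ 2 + j' ^ 2 + m' ^ 2 = y (π 1) ^ 2 + y (π 3) ^ 2 + y (π 5) ^ 2 → y (π 0) + i' = 0 →
      (y (π 2) + j' = 0 ∧ y (π 4) + m' = 0) ∨ (y (π 2) + m' = 0 ∧ y (π 4) + j' = 0) :=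
    fun i' j' m' h' h2 h3 => q _ _ _ s0 i' j' m' h' (by rw [r2 _ _ _ s0, r2 _ _ _ h', h2]; grind) h3
  rcases mul_eq_zero.1 t with h | h
  · rcases hq _ _ _ s1 rfl h with ⟨g, g'⟩ | ⟨g, g'⟩
    · exact ⟨0, p 0 (by decide), by intro j; fin_cases j <;> simp [syn] <;>
        first | linear_combination h | linear_combination g | linear_combination g'⟩
    · exact ⟨2, p 2 (by decide), by intro j; fin_cases j <;> simp [syn] <;>
        first | linear_combination h | linear_combination g | linear_combination g'⟩
  rcases mul_eq_zero.1 h with h | h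
  · rcases hq _ (y (π 1)) (y (π 5)) (by grind) (by ring) h with ⟨g, g'⟩ | ⟨g, g'⟩
    · exact ⟨6, p 6 (by decide), by intro j; fin_cases j <;> simp [syn] <;>
        first | linear_combination h | linear_combination g | linear_combination g'⟩
    · exact ⟨7, p 7 (by decide), by intro j; fin_cases j <;> simp [syn] <;>
        first | linear_combination h | linear_combination g | linear_combination g'⟩
  · rcases hq _ (y (π 1)) (y (π 3)) (by grind) (by ring) h with ⟨g, g'⟩ | ⟨g, g'⟩
    · exact ⟨12, p 12 (by decide), by intro j; fin_cases j <;> simp [syn] <;>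
        first | linear_combination h | linear_combination g | linear_combination g'⟩
    · exact ⟨14, p 14 (by decide), by intro j; fin_cases j <;> simp [syn] <;>
        first | linear_combination h | linear_combination g | linear_combination g'⟩

lemma OnSegre.eq_of_meets (hno : ∀ σ, ¬ InPl σ l) {σ τ : Syntheme} (hσ : MeetsPl σ l)
    (hτ : MeetsPl τ l) (hm : Meets σ τ) : σ = τ := by
  by_contra hne
  obtain ⟨π, rfl, rfl⟩ := exists_frame_of_meets hne hm
  obtain ⟨x, hx0, hx, hxσ⟩ := hσ
  obtain ⟨y, hy0, hy, hyτ⟩ := hτ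
  have hxp := inPlane_act.1 hxσ
  have hyp := inPlane_act.1 hyτ
  have x4 := hxp 4
  have y4 := hyp 4
  simp [syn] at x4 y4
  by_cases hw : wedge x y = 0
  · obtain ⟨r, rfl⟩ := wedge_eq_zero_of_smul hw hx0
    have hr : r ≠ 0 := fun h => hy0 (by rw [h, zero_smul])
    have x0 := hxp 0
    have x2 := hxp 2
    have y0 := hyp 0
    have y1 := hyp 1
    simp [syn, ← mul_add, hr] at x0 x2 y0 y1
    have e1 : x (π 1) = -x (π 0) := by grind
    have e3 : x (π 3) = -x (π 0) := by grind
    have e2 : x (π 2) = x (π 0) := by grind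
    have e5 : x (π 5) = -x (π 4) := by grind
    by_cases hq : x (π 0) ^ 2 = x (π 4) ^ 2
    · have hp0 : x (π 0) ≠ 0 := by
        intro h
        have h4 : x (π 4) = 0 := by simpa [h] using hq.symm
        refine hx0 (place_ext π fun j => ?_)
        fin_cases j <;> simp [e1, e2, e3, e5, h, h4]
      have hnode : ∀ ρ : 𝔖₆, x = x (π 0) • node₁ ρ → False := by
        intro ρ h
        obtain ⟨κ, hκ⟩ := hS.inPl_of_node (π := ρ) (by
          have := hx.combo hx (x (π 0))⁻¹ 0
          rw [zero_smul, add_zero] at this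
          rwa [h, smul_smul, ← h, inv_mul_cancel₀ hp0, one_smul] at this)
        exact hno κ hκ
      rcases sq_eq_sq_iff_eq_or_eq_neg.1 hq with h | h
      · refine hnode π (place_ext π fun j => ?_)
        rw [Pi.smul_apply, node₁, place_apply]
        fin_cases j <;> simp [e1, e2, e3, e5, h, vec]
      · refine hnode ((swap 4 5).trans π) (place_ext π fun j => ?_)
        obtain ⟨j, rfl⟩ := (swap (4 : Fin 6) 5).surjective j
        have := place_apply ((swap 4 5).trans π) (vec 0 ![1, 1, 1]) j
        rw [Equiv.trans_apply] at this
        rw [Pi.smul_apply, node₁, this]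
        fin_cases j <;> simp [e1, e2, e3, e5, h, vec, Equiv.swap_apply_def]
    · obtain ⟨κ, hκ⟩ := hS.inPl_of_hyperplane π fun w hw => by
        have h1 := hS.polar hx hw
        have h2 := (hS.2 w hw).1
        rw [sum_frame π] at h2
        rw [sum_perm π, Fin.sum_univ_six, e1, e2, e3, e5] at h1
        have : (x (π 4) ^ 2 - x (π 0) ^ 2) * (w (π 4) + w (π 5)) = 0 := by grind
        exact (mul_eq_zero.1 this).resolve_left (sub_ne_zero.2 (Ne.symm hq))
      exact hno κ hκ
  · have hl := hx.isLine hy hw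
    obtain ⟨κ, hκ⟩ := hS.inPl_of_hyperplane π fun w hw => by
      obtain ⟨a, c, rfl⟩ := hl.onLine_iff.1 hw
      simp only [Pi.add_apply, Pi.smul_apply, smul_eq_mul]
      grind
    exact hno κ hκ

lemma OnSegre.exists_meetsPl (π : 𝔖₆) : ∃ k, syn k 4 = 5 ∧ MeetsPl (act π k) l := by
  obtain ⟨v, w, hl⟩ := hS.1
  obtain ⟨x, hx, hx0, h4⟩ : ∃ x, OnLine l x ∧ x ≠ 0 ∧ x (π 4) + x (π 5) = 0 := by
    by_cases h : w (π 4) + w (π 5) = 0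
    · exact ⟨w, hl.onLine_right, fun h0 => one_ne_zero (hl.combo_eq_zero (α := 0) (γ := 1)
        (by simp [h0])).2, h⟩
    · refine ⟨_, hl.onLine_iff.2 ⟨w (π 4) + w (π 5), -(v (π 4) + v (π 5)), rfl⟩,
        fun h0 => h (hl.combo_eq_zero h0).1, ?_⟩
      simp only [Pi.add_apply, Pi.smul_apply, smul_eq_mul]
      ring
  obtain ⟨h1, h2⟩ := hS.2 x hx
  rw [sum_frame π] at h1
  rw [cubic_frame π] at h2
  have e5 : x (π 5) = -x (π 4) := by grind
  have e3 : x (π 3) = -(x (π 0) + x (π 1) + x (π 2)) := by grind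
  have hf : (x (π 0) + x (π 1)) * ((x (π 0) + x (π 2)) * (x (π 1) + x (π 2))) = 0 := by
    rw [e5, e3] at h2
    grind
  rcases mul_eq_zero.1 hf with h | h
  · exact ⟨0, rfl, x, hx0, hx, inPlane_act.2 fun j => by
      fin_cases j <;> simp [syn, e5, e3] <;> first | linear_combination h | linear_combination -h⟩
  rcases mul_eq_zero.1 h with h | h
  · exact ⟨3, rfl, x, hx0, hx, inPlane_act.2 fun j => by
      fin_cases j <;> simp [syn, e5, e3] <;> first | linear_combination h | linear_combination -h⟩
  · exact ⟨6, rfl, x, hx0, hx, inPlane_act.2 fun j => by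
      fin_cases j <;> simp [syn, e5, e3] <;> first | linear_combination h | linear_combination -h⟩

end

lemma eq_smul_node₁ {π : 𝔖₆} {k l : Fin 15} {x : ℂ⁶}
    (hk : InPlane (act π k) x) (hl : InPlane (act π l) x)
    (h : ∀ j, (sgn j = 1 ∧ (j = 0 ∨ syn k (syn l 0) = j ∨ syn l (syn k 0) = j)) ∨
      (sgn j = -1 ∧ (syn k 0 = j ∨ syn l 0 = j ∨ syn k (syn l (syn k 0)) = j))) :
    x = x (π 0) • node₁ π := by
  have hk' := inPlane_act.1 hk
  have hl' := inPlane_act.1 hl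
  refine place_ext π fun j => ?_
  rw [Pi.smul_apply, node₁, place_apply, vec_eq_sgn]
  rcases h j with ⟨h1, rfl | rfl | rfl⟩ | ⟨h1, rfl | rfl | rfl⟩ <;> rw [h1] <;> simp
  · linear_combination hk' (syn l 0) - hl' 0
  · linear_combination hl' (syn k 0) - hk' 0
  · linear_combination hk' 0
  · linear_combination hl' 0
  · linear_combination hk' (syn l (syn k 0)) - hl' (syn k 0) + hk' 0

lemma eq_smul_node₁_of_inPlane {π : 𝔖₆} {x : ℂ⁶} {k l : Fin 15}
    (hkl : (k = 7 ∧ l = 12) ∨ (k = 0 ∧ l = 7))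
    (hk : InPlane (act π k) x) (hl : InPlane (act π l) x) : x = x (π 0) • node₁ π := by
  rcases hkl with ⟨rfl, rfl⟩ | ⟨rfl, rfl⟩ <;> exact eq_smul_node₁ hk hl (by decide)

lemma onLine_node₁ {l : ℙ ℂ PlückerSpace} {π : 𝔖₆} {x : ℂ⁶}
    (hx : OnLine l x) (h0 : x ≠ 0) (h : x = x (π 0) • node₁ π) : OnLine l (node₁ π) := by
  have hr : x (π 0) ≠ 0 := fun h' => h0 (by rw [h, h', zero_smul])
  have := hx.combo hx (x (π 0))⁻¹ 0
  rw [zero_smul, add_zero] at this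
  rwa [h, smul_smul, ← h, inv_mul_cancel₀ hr, one_smul] at this

section

variable {l : ℙ ℂ PlückerSpace} (hS : OnSegre l) (hno : ∀ σ, ¬ InPl σ l)
include hS hno

lemma OnSegre.exists_general {π : 𝔖₆} (h7 : MeetsPl (act π 7) l)
    (h12 : MeetsPl (act π 12) l) : ∃ ξ, IsGeneral ξ ∧
      IsLine l (place π (uw ξ 0)) (place π (uw 0 (conjPar ξ))) := by
  have hnode : ∀ x, OnLine l x → x ≠ 0 → x ≠ x (π 0) • node₁ π := fun x hx hx0 h => by
    obtain ⟨κ, hκ⟩ := hS.inPl_of_node (onLine_node₁ hx hx0 h)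
    exact hno κ hκ
  obtain ⟨x, hx0, hx, hx7⟩ := id h7
  obtain ⟨y, hy0, hy, hy12⟩ := id h12
  have hxp := inPlane_act.1 hx7
  have hyp := inPlane_act.1 hy12
  have hw : wedge x y ≠ 0 := by
    intro hw
    obtain ⟨r, rfl⟩ := wedge_eq_zero_of_smul hw hx0
    have hr : r ≠ 0 := fun h => hy0 (by rw [h, zero_smul])
    refine hnode x hx hx0 (eq_smul_node₁_of_inPlane (Or.inl ⟨rfl, rfl⟩) hx7 ?_)
    simpa [smul_smul, inv_mul_cancel₀ hr] using hy12.smul r⁻¹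
  have hother : ∀ k, k ≠ 7 → Shares 7 k → ¬ InPlane (act π k) x := fun k hk hs h =>
    hk (act_injective π (hS.eq_of_meets hno h7 ⟨x, hx0, hx, h⟩ (meets_act.2 hs))).symm
  have hl := hx.isLine hy hw
  let ξ : ℂ³ := ![(x (π 0) + x (π 4)) / 2, (x (π 0) + x (π 2)) / 2, (x (π 2) + x (π 4)) / 2]
  let η : ℂ³ := ![(y (π 1) + y (π 5)) / 2, (y (π 1) + y (π 3)) / 2, (y (π 3) + y (π 5)) / 2]
  have x0 := hxp 0
  have x1 := hxp 1
  have x2 := hxp 2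
  have y0 := hyp 0
  have y1 := hyp 1
  have y3 := hyp 3
  simp [syn] at x0 x1 x2 y0 y1 y3
  have ex : x = place π (uw ξ 0) := place_ext π fun j => by
    rw [place_apply, uw]
    fin_cases j <;> simp [vec, ξ]
    · ring
    · linear_combination x1
    · ring
    · linear_combination x0
    · ring
    · linear_combination x2
  have ey : y = place π (uw 0 η) := place_ext π fun j => by
    rw [place_apply, uw]
    fin_cases j <;> simp [vec, η]
    · linear_combination y0
    · ring
    · linear_combination y1
    · ring
    · linear_combination y3
    · ring
  have hξ : IsGeneral ξ := by
    refine ⟨⟨fun h => hother 10 (by decide) (by decide) ?_, fun h => hother 4 (by decide)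
      (by decide) ?_, fun h => hother 8 (by decide) (by decide) ?_⟩, fun h => hother 6 (by decide)
      (by decide) ?_, fun h => hother 2 (by decide) (by decide) ?_, fun h => hother 14 (by decide)
      (by decide) ?_⟩ <;> simp [ξ] at h <;> refine inPlane_act.2 fun j => ?_ <;> fin_cases j <;>
      simp [syn] <;> first | linear_combination h | linear_combination -h | linear_combination 2 * h |
        linear_combination -(2 * h) | linear_combination x0 | linear_combination x0 + h |
        linear_combination x0 - h | linear_combination x0 + 2 * h | linear_combination x0 - 2 * h |
        linear_combination x1 | linear_combination x1 + h | linear_combination x1 - h |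
        linear_combination x1 + 2 * h | linear_combination x1 - 2 * h | linear_combination x2 |
        linear_combination x2 + h | linear_combination x2 - h | linear_combination x2 + 2 * h |
        linear_combination x2 - 2 * h | linear_combination x0 + x1 | linear_combination x0 + x1 + h |
        linear_combination x0 + x1 - h | linear_combination x0 + x1 + 2 * h | linear_combination x0 + x1 - 2 * h |
        linear_combination x0 + x2 | linear_combination x0 + x2 + h | linear_combination x0 + x2 - h |
        linear_combination x0 + x2 + 2 * h | linear_combination x0 + x2 - 2 * h | linear_combination x1 + x2 |
        linear_combination x1 + x2 + h | linear_combination x1 + x2 - h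
  obtain ⟨⟨n0, n1, n2⟩, m0, m1, m2⟩ := id hξ
  -- the line lies on the cubic
  have hcub : ∀ a c : ℂ, cubic (uw (a • ξ) (c • η)) = 0 := by
    intro a c
    have := (hS.2 _ (hx.combo hy a c)).2
    rw [ex, ey, place_combo, cubic_place, uw_combo] at this
    simpa using this
  have c1 := hcub 1 1
  have c2 := hcub 1 (-1)
  rw [cubic_uw] at c1 c2
  simp only [Pi.smul_apply, smul_eq_mul] at c1 c2
  have f1 : ξ 0 * (ξ 1 - ξ 2) * η 0 + ξ 1 * (ξ 2 - ξ 0) * η 1 + ξ 2 * (ξ 0 - ξ 1) * η 2 = 0 := by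
    linear_combination (-1 / 48) * c1 + (1 / 48) * c2
  have f2 : ξ 0 * η 0 * (η 1 - η 2) + ξ 1 * η 1 * (η 2 - η 0) + ξ 2 * η 2 * (η 0 - η 1) = 0 := by
    linear_combination (-1 / 48) * c1 - (1 / 48) * c2
  have g0 := sub_ne_zero.2 m0
  have g1 := sub_ne_zero.2 m1
  have g2 := sub_ne_zero.2 m2
  obtain ⟨q, hq⟩ : ∃ q, η 0 - η 1 = q * (ξ 2 * (ξ 1 - ξ 0)) :=
    ⟨(η 0 - η 1) / (ξ 2 * (ξ 1 - ξ 0)), by field_simp [sub_ne_zero.2 m0.symm]⟩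
  obtain ⟨p, hp⟩ : ∃ p, η 0 = p + q * (ξ 1 * ξ 2) := ⟨η 0 - q * (ξ 1 * ξ 2), by ring⟩
  have h1 : η 1 = p + q * (ξ 2 * ξ 0) := by linear_combination hp - hq
  have h2 : η 2 = p + q * (ξ 0 * ξ 1) := by
    refine mul_left_cancel₀ (mul_ne_zero n2 g0) ?_
    rw [hp, h1] at f1
    linear_combination f1
  have hpq : p * q * ((ξ 0 - ξ 1) * (ξ 1 - ξ 2) * (ξ 2 - ξ 0)) = 0 := by
    rw [hp, h1, h2] at f2
    linear_combination f2
  have hq0 : q ≠ 0 := by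
    rintro rfl
    refine hnode y hy hy0 (place_ext π fun j => ?_)
    rw [Pi.smul_apply, node₁, place_apply, ey, place_apply, place_apply, uw]
    fin_cases j <;> simp [vec, hp, h1, h2]
  have hp0 : p = 0 := (mul_eq_zero.1 ((mul_eq_zero.1 hpq).resolve_right
    (mul_ne_zero (mul_ne_zero g0 g1) g2))).resolve_right hq0
  have ey' : y = q • place π (uw 0 (conjPar ξ)) := by
    rw [ey, place_smul]
    have := uw_combo 0 (conjPar ξ) 0 0 q 0
    simp at this
    rw [this]
    congr 2
    funext j
    fin_cases j
    · simp [hp, hp0, conjPar]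
    · simp [h1, hp0, conjPar]
    · simp [h2, hp0, conjPar]
  refine ⟨ξ, hξ, ex ▸ hx.isLine (y := place π (uw 0 (conjPar ξ))) ?_ fun h => hw ?_⟩
  · have := hy.combo hy q⁻¹ 0
    rw [zero_smul, add_zero] at this
    rwa [ey', smul_smul, inv_mul_cancel₀ hq0, one_smul] at this
  · have := wedge_combo x (place π (uw 0 (conjPar ξ))) 1 0 0 q
    rw [one_smul, zero_smul, zero_smul, add_zero, zero_add, h, smul_zero, ← ey'] at this
    exact this

lemma OnSegre.exists_frame : ∃ π, MeetsPl (act π 7) l ∧ MeetsPl (act π 12) l := by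
  obtain ⟨k, hk, h⟩ := hS.exists_meetsPl 1
  obtain ⟨τ, hτ, hne⟩ : ∃ τ, MeetsPl τ l ∧ τ ≠ act 1 k := by
    obtain ⟨m, hm, h'⟩ := hS.exists_meetsPl (swap 0 4)
    refine ⟨_, h', fun e => ?_⟩
    have e1 := congrArg (fun τ : Syntheme => τ.1 0) e
    have e2 := act_apply (swap 0 4) m 4
    have e3 := act_apply 1 k 5
    rw [hm] at e2
    have e4 : syn k 5 = 4 := by rw [← hk, syn_involutive]
    simp [Equiv.swap_apply_def, e4] at e1 e2 e3
    rw [e2] at e1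
    have e5 := (act 1 k).2.1 0
    rw [← e1, e3] at e5
    exact absurd e5 (by decide)
  obtain ⟨π, h1, h2⟩ := exists_frame_of_not_meets fun hm => hne (hS.eq_of_meets hno h hτ hm).symm
  exact ⟨π, h1 ▸ h, h2 ▸ hτ⟩

lemma OnSegre.eq_actTot {π : 𝔖₆} (h2 : ∀ k ∈ tot 2, MeetsPl (act π k) l)
    {T : Total} (hT : ∀ τ ∈ T.1, MeetsPl τ l) : T = actTot π 2 := by
  obtain ⟨q, rfl⟩ := T.exists_actTot π
  have h3 : ∀ k ∈ tot q, k ∈ tot 2 := by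
    intro k hk
    by_contra h
    have : ∀ k, k ∉ tot 2 → ∃ m ∈ tot 2, Shares k m := by decide
    obtain ⟨m, hm, hs⟩ := this k h
    have := hS.eq_of_meets hno (hT _ ((mem_actTot k).2 hk)) (h2 m hm) (meets_act.2 hs)
    exact h (act_injective π this ▸ hm)
  have : ∀ q, (∀ k ∈ tot q, k ∈ tot 2) → q = 2 := by decide
  rw [this q h3]

end

lemma onSegre_general {l : ℙ ℂ PlückerSpace} {π : 𝔖₆} {ξ : ℂ³}
    (hl : IsLine l (place π (uw ξ 0)) (place π (uw 0 (conjPar ξ)))) : OnSegre l := by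
  refine ⟨⟨_, _, hl⟩, fun x hx => ?_⟩
  obtain ⟨a, c, rfl⟩ := hl.onLine_iff.1 hx
  rw [place_combo, uw_combo, sum_place, cubic_place, sum_uw, cubic_uw]
  refine ⟨rfl, ?_⟩
  simp [conjPar]
  ring

lemma meetsPl_general {l : ℙ ℂ PlückerSpace} {π : 𝔖₆} {ξ : ℂ³}
    (hl : IsLine l (place π (uw ξ 0)) (place π (uw 0 (conjPar ξ)))) :
    ∀ k ∈ tot 2, MeetsPl (act π k) l := by
  have key : ∀ k (a c : ℂ), (a ≠ 0 ∨ c ≠ 0) → InPlane (act π k)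
      (a • place π (uw ξ 0) + c • place π (uw 0 (conjPar ξ))) → MeetsPl (act π k) l :=
    fun k a c h0 h => ⟨_, fun h' => by
      obtain ⟨rfl, rfl⟩ := hl.combo_eq_zero h'
      simp at h0, hl.onLine_iff.2 ⟨a, c, rfl⟩, h⟩
  have hp : ∀ k (a c : ℂ), (∀ j, uw (a • ξ) (c • conjPar ξ) j +
      uw (a • ξ) (c • conjPar ξ) (syn k j) = 0) → InPlane (act π k)
      (a • place π (uw ξ 0) + c • place π (uw 0 (conjPar ξ))) := fun k a c h =>
    inPlane_act.2 fun j => by rw [place_combo, uw_combo, place_apply, place_apply]; simpa using h j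
  intro k hk
  simp only [tot, cons_val, List.mem_cons, List.not_mem_nil, or_false] at hk
  rcases hk with rfl | rfl | rfl | rfl | rfl
  · refine key _ (ξ 0) 1 (by simp) (hp _ _ _ fun j => ?_)
    fin_cases j <;> simp [syn, uw, vec, conjPar] <;> ring
  · refine key _ (ξ 2) 1 (by simp) (hp _ _ _ fun j => ?_)
    fin_cases j <;> simp [syn, uw, vec, conjPar] <;> ring
  · refine key _ 1 0 (by simp) (hp _ _ _ fun j => ?_); fin_cases j <;> simp [syn, uw, vec] <;> ring
  · refine key _ (ξ 1) 1 (by simp) (hp _ _ _ fun j => ?_)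
    fin_cases j <;> simp [syn, uw, vec, conjPar] <;> ring
  · refine key _ 0 1 (by simp) (hp _ _ _ fun j => ?_)
    fin_cases j <;> simp [syn, uw, vec, conjPar] <;> ring

lemma not_inPl_general {l : ℙ ℂ PlückerSpace} {π : 𝔖₆} {ξ : ℂ³}
    (hξ : IsGeneral ξ) (hl : IsLine l (place π (uw ξ 0)) (place π (uw 0 (conjPar ξ)))) (σ : Syntheme) :
    ¬ InPl σ l := fun h =>
  GeneralChart.not_inPlane hξ σ ⟨h _ hl.onLine_left, h _ hl.onLine_right⟩

open ProjTop

/-! ## Lines in the planes -/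

lemma act_mul {π ρ : 𝔖₆} {k l : Fin 15} (h : ∀ j, ρ (syn l j) = syn k (ρ j)) :
    act π k = act (π * ρ) l :=
  eq_act fun j => by rw [Equiv.Perm.mul_apply, act_apply, ← h, Equiv.Perm.mul_apply]

lemma eq_place_of_inPlane {π : 𝔖₆} {x : ℂ⁶} (h : InPlane (act π 0) x) :
    x = place π (vec 0 (halfDiff π x)) := by
  have hp := inPlane_act.1 h
  conv_lhs => rw [eq_place_vec π x]
  congr 2
  funext k
  fin_cases k
  · simpa [halfSum, evn, odd, syn] using hp 0
  · simpa [halfSum, evn, odd, syn] using hp 2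
  · simpa [halfSum, evn, odd, syn] using hp 4

lemma inPlane_vec (π : 𝔖₆) (d : ℂ³) :
    InPlane (act π 0) (place π (vec 0 d)) := (inPlane_place_vec (act_apply π 0)).2 rfl

/-- The points of a plane with one non-zero half difference. -/
def axis (π : 𝔖₆) (k : Fin 3) : ℂ⁶ := place π (vec 0 (Pi.single k 1))

/-- The line of a plane that a linear form cuts out. -/
def dualBivector (π : 𝔖₆) (e : ℂ³) : PlückerSpace :=
  e 0 • wedge (axis π 1) (axis π 2) + e 1 • wedge (axis π 2) (axis π 0) +
    e 2 • wedge (axis π 0) (axis π 1)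

lemma vec_eq_axis (π : 𝔖₆) (d : ℂ³) :
    place π (vec 0 d) = d 0 • axis π 0 + d 1 • axis π 1 + d 2 • axis π 2 :=
  place_ext π fun j => by fin_cases j <;> simp [axis, vec]

lemma wedge_vec (π : 𝔖₆) (d d' : ℂ³) :
    wedge (place π (vec 0 d)) (place π (vec 0 d')) = dualBivector π
      ![d 1 * d' 2 - d 2 * d' 1, d 2 * d' 0 - d 0 * d' 2, d 0 * d' 1 - d 1 * d' 0] := by
  funext i j
  simp only [vec_eq_axis, wedge, dualBivector, Pi.add_apply, Pi.smul_apply, smul_eq_mul, cons_val]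
  ring

section

variable {l : ℙ ℂ PlückerSpace} {π : 𝔖₆}

/-- The line, in the plane with the pairs `01`, `23`, `45`, is the graph of a linear form. -/
def IsGraphLine (π : 𝔖₆) (g₁ g₂ : ℂ) (l : ℙ ℂ PlückerSpace) : Prop :=
  IsLine l (place π (vec 0 ![1, 0, g₁])) (place π (vec 0 ![0, 1, g₂]))

lemma IsGraphLine.onLine_iff {g₁ g₂ : ℂ} (h : IsGraphLine π g₁ g₂ l) {d : ℂ³} :
    OnLine l (place π (vec 0 d)) ↔ d 2 = g₁ * d 0 + g₂ * d 1 := by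
  rw [IsLine.onLine_iff h]
  constructor
  · rintro ⟨α, γ, hx⟩
    rw [place_combo, vec_combo] at hx
    have := congrArg (halfDiff π) hx
    simp only [halfDiff_place] at this
    rw [this]
    simp; ring
  · intro hd
    refine ⟨d 0, d 1, ?_⟩
    rw [place_combo, vec_combo]
    congr 2
    · simp
    · funext k
      fin_cases k
      · simp
      · simp
      · simp [hd]; ring

lemma IsGraphLine.inPl {g₁ g₂ : ℂ} (h : IsGraphLine π g₁ g₂ l) : InPl (act π 0) l := by
  intro x hx
  obtain ⟨α, γ, rfl⟩ := (IsLine.onLine_iff h).1 hx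
  exact (inPlane_vec π _).combo (inPlane_vec π _) α γ

lemma exists_isGraphLine_of_minor {v w : ℂ⁶} (h : IsLine l v w) (hl : InPl (act π 0) l)
    (hD : halfDiff π v 0 * halfDiff π w 1 - halfDiff π w 0 * halfDiff π v 1 ≠ 0) :
    ∃ g₁ g₂, IsGraphLine π g₁ g₂ l := by
  have hb : bracket (diffVec π 0) (diffVec π 1) l.rep ≠ 0 :=
    h.bracket_ne_zero.2 (by simpa only [dotL_diffVec] using hD)
  have hn := h.normalized hb
  obtain ⟨h1, h2, h3, h4⟩ := h.dual hb
  simp only [dotL_diffVec] at h1 h2 h3 h4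
  have e1 := eq_place_of_inPlane (hl _ hn.onLine_left)
  have e2 := eq_place_of_inPlane (hl _ hn.onLine_right)
  refine ⟨halfDiff π (lineFst (diffVec π 0) (diffVec π 1) l) 2,
    halfDiff π (lineSnd (diffVec π 0) (diffVec π 1) l) 2, ?_⟩
  rw [IsGraphLine]
  convert! hn using 1
  · conv_rhs => rw [e1]
    congr 2; funext k; fin_cases k <;> simp [h1, h2]
  · conv_rhs => rw [e2]
    congr 2; funext k; fin_cases k <;> simp [h3, h4]

lemma exists_isGraphLine {σ : Syntheme} (hl : ∃ v w, IsLine l v w) (hσ : InPl σ l) :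
    ∃ π g₁ g₂, σ = act π 0 ∧ IsGraphLine π g₁ g₂ l := by
  obtain ⟨π, rfl⟩ := exists_frame σ
  obtain ⟨v, w, h⟩ := hl
  have key : ∀ ρ : 𝔖₆, (∀ j, ρ (syn 0 j) = syn 0 (ρ j)) →
      halfDiff (π * ρ) v 0 * halfDiff (π * ρ) w 1 - halfDiff (π * ρ) w 0 * halfDiff (π * ρ) v 1 ≠ 0 →
      ∃ π' g₁ g₂, act π 0 = act π' 0 ∧ IsGraphLine π' g₁ g₂ l := fun ρ hρ hD => by
    obtain ⟨g₁, g₂, hg⟩ := exists_isGraphLine_of_minor (π := π * ρ) h (act_mul hρ ▸ hσ) hD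
    exact ⟨_, g₁, g₂, act_mul hρ, hg⟩
  by_contra hne
  have k1 := not_imp_comm.1 (key 1 (by decide)) hne
  have k2 := not_imp_comm.1 (key (swap 2 4 * swap 3 5) (by decide)) hne
  have k3 := not_imp_comm.1 (key (swap 0 4 * swap 1 5) (by decide)) hne
  simp [halfDiff, evn, odd, Equiv.swap_apply_def] at k1 k2 k3
  have e1 := eq_place_of_inPlane (hσ _ h.onLine_left)
  have e2 := eq_place_of_inPlane (hσ _ h.onLine_right)
  refine (isLine_iff.1 h).1 ?_
  rw [e1, e2, wedge_vec]
  simp only [halfDiff, evn, odd, cons_val]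
  rw [dualBivector]
  simp only [cons_val]
  rw [show ∀ a b c : ℂ, a = 0 → b = 0 → c = 0 → a • wedge (axis π 1) (axis π 2) +
    b • wedge (axis π 2) (axis π 0) + c • wedge (axis π 0) (axis π 1) = 0 by rintro _ _ _ rfl rfl rfl; simp]
  · grind
  · linear_combination -k2
  · linear_combination k1

lemma wedge_node_ne (π : 𝔖₆) {d d' : ℂ³}
    (h : d 0 * d' 1 - d 1 * d' 0 ≠ 0 ∨ d 0 * d' 2 - d 2 * d' 0 ≠ 0) :
    wedge (place π (vec 0 d)) (place π (vec 0 d')) ≠ 0 := by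
  intro h0
  have e1 := congrFun (congrFun h0 (π 0)) (π 2)
  have e2 := congrFun (congrFun h0 (π 0)) (π 4)
  simp [wedge, vec] at e1 e2
  rcases h with h | h
  exacts [h (by linear_combination e1), h (by linear_combination e2)]

lemma onLine_of_meetsPl {k : Fin 15} {a b : ℂ} (h0 : InPl (act π 0) l)
    (hk : MeetsPl (act π k) l) (h : ((k = 7 ∨ k = 12) ∧ a = 1 ∧ b = 1) ∨
      ((k = 8 ∨ k = 9) ∧ a = 1 ∧ b = -1) ∨ (k = 10 ∧ a = -1 ∧ b = -1) ∨
      (k = 13 ∧ a = -1 ∧ b = 1)) :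
    OnLine l (place π (vec 0 ![1, a, b])) := by
  obtain ⟨x, hx0, hx, hxk⟩ := hk
  have hd := eq_place_of_inPlane (h0 x hx)
  set d := halfDiff π x
  rw [hd] at hxk hx0 hx
  have hp := inPlane_act.1 hxk
  simp only [place_apply] at hp
  have e : d 1 = a * d 0 ∧ d 2 = b * d 0 := by
    have p0 := hp 0
    have p1 := hp 1
    have p2 := hp 2
    have p3 := hp 3
    rcases h with ⟨rfl | rfl, rfl, rfl⟩ | ⟨rfl | rfl, rfl, rfl⟩ | ⟨rfl, rfl, rfl⟩ | ⟨rfl, rfl, rfl⟩ <;>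
    · simp [syn, vec] at p0 p1 p2 p3
      constructor <;> first | linear_combination p0 | linear_combination -p0 |
        linear_combination p1 | linear_combination -p1 | linear_combination p0 + p1 |
        linear_combination p0 + p2 | linear_combination p2 + p1 | linear_combination p2 - p0 |
        linear_combination -p0 - p1 | linear_combination p2 - p1 | linear_combination p0 - p2 |
        linear_combination p1 - p0 | linear_combination p0 - p1 | linear_combination p3 - p0 |
        linear_combination p1 - p2 | linear_combination p0 + p3 | linear_combination p1 + p3
  have hd0 : d 0 ≠ 0 := fun h => hx0 (by
    rw [place_eq_zero, vec_eq_zero]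
    refine ⟨rfl, ?_⟩
    funext k
    fin_cases k <;> simp [h, e.1, e.2])
  have := hx.combo hx (d 0)⁻¹ 0
  rw [zero_smul, add_zero, place_smul, vec_smul, smul_zero] at this
  convert! this using 3
  funext k
  fin_cases k <;> simp [e.1, e.2] <;> field_simp

lemma node_of_meetsPl (hl : ∃ v w, IsLine l v w) (h0 : InPl (act π 0) l) {q : Fin 6}
    (h : ∀ τ ∈ (actTot π q).1, MeetsPl τ l) :
    (q = 2 ∧ OnLine l (place π (vec 0 ![1, 1, 1]))) ∨
    (q = 4 ∧ OnLine l (place π (vec 0 ![1, 1, -1]))) ∨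
    (q = 3 ∧ OnLine l (place π (vec 0 ![1, -1, -1]))) ∨
    (q = 5 ∧ OnLine l (place π (vec 0 ![1, -1, 1]))) := by
  have hm : ∀ k ∈ tot q, MeetsPl (act π k) l := fun k hk => h _ ((mem_actTot k).2 hk)
  have key : ∀ b : ℂ, OnLine l (place π (vec 0 ![1, 1, 1])) →
      OnLine l (place π (vec 0 ![1, 1, -1])) → ¬ OnLine l (place π (vec 0 ![1, -1, b])) := by
    intro b h1 h2 h3
    obtain ⟨α, γ, e⟩ := (h1.isLine h2 (wedge_node_ne π (Or.inr (by
      simp only [cons_val]; norm_num)))).onLine_iff.1 h3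
    rw [place_combo, vec_combo] at e
    have e1 := congrArg (halfDiff π) e
    simp only [halfDiff_place] at e1
    have e2 := congrFun e1 0
    have e3 := congrFun e1 1
    simp at e2 e3
    rw [← e2] at e3
    norm_num at e3
  fin_cases q
  · exact absurd (onLine_of_meetsPl (k := 10) h0 (hm _ (by decide)) (by simp)) (key (-1)
      (onLine_of_meetsPl (k := 12) h0 (hm _ (by decide)) (by simp))
      (onLine_of_meetsPl (k := 8) h0 (hm _ (by decide)) (by simp)))
  · exact absurd (onLine_of_meetsPl (k := 13) h0 (hm _ (by decide)) (by simp)) (key 1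
      (onLine_of_meetsPl (k := 7) h0 (hm _ (by decide)) (by simp))
      (onLine_of_meetsPl (k := 9) h0 (hm _ (by decide)) (by simp)))
  exacts [Or.inl ⟨rfl, onLine_of_meetsPl (k := 7) h0 (hm _ (by decide)) (by simp)⟩,
    Or.inr (Or.inr (Or.inl ⟨rfl, onLine_of_meetsPl (k := 10) h0 (hm _ (by decide)) (by simp)⟩)),
    Or.inr (Or.inl ⟨rfl, onLine_of_meetsPl (k := 8) h0 (hm _ (by decide)) (by simp)⟩),
    Or.inr (Or.inr (Or.inr ⟨rfl, onLine_of_meetsPl (k := 13) h0 (hm _ (by decide)) (by simp)⟩))]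

lemma exists_frame_of_meetsPl (hl : ∃ v w, IsLine l v w) {σ : Syntheme} (hσ : InPl σ l)
    {T : Total} (hT : ∀ τ ∈ T.1, MeetsPl τ l) :
    ∃ π, σ = act π 0 ∧ T = actTot π 2 ∧ OnLine l (node₁ π) := by
  have hn : σ ∉ T.1 := fun h => by
    obtain ⟨π, rfl⟩ := exists_frame σ
    obtain ⟨q, rfl⟩ := T.exists_actTot π
    rw [mem_actTot] at h
    rcases node_of_meetsPl hl hσ hT with ⟨rfl, -⟩ | ⟨rfl, -⟩ | ⟨rfl, -⟩ | ⟨rfl, -⟩ <;>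
      exact absurd h (by decide)
  obtain ⟨π, rfl, rfl⟩ := exists_frame_of_notMem hn
  refine ⟨π, rfl, rfl, ?_⟩
  rcases node_of_meetsPl hl hσ hT with ⟨-, h⟩ | ⟨h, -⟩ | ⟨h, -⟩ | ⟨h, -⟩
  · exact h
  all_goals exact absurd h (by decide)

end

/-! ## The distinguished lines -/

lemma isNode_vec (π : 𝔖₆) {d : ℂ³} (h : ∀ k, d k ^ 2 = 1) : IsNode (place π (vec 0 d)) := by
  have hsq : ∀ i, place π (vec 0 d) i ^ 2 = 1 := fun i => by
    obtain ⟨j, rfl⟩ := π.surjective i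
    rw [place_apply]
    fin_cases j <;> simp [vec, h]
  refine ⟨fun h0 => ?_, ?_, ?_, fun v hv => ?_⟩
  · have := hsq 0; rw [h0] at this; simp at this
  · rw [sum_place, sum_vec]; simp
  · rw [cubic_place, cubic_vec] <;> simp
  · simp only [hsq, mul_one]; rw [← Finset.mul_sum, hv, mul_zero]

lemma IsNode.eq_sign {q : ℂ⁶} (h : IsNode q) : q 0 ≠ 0 ∧ ∃ s : Fin 6 → Bool, s 0 = true ∧
    ∑ i, (if s i then (1 : ℤ) else -1) = 0 ∧ ∀ i, q i = q 0 * ((if s i then (1 : ℤ) else -1 : ℤ) : ℂ) := by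
  classical
  obtain ⟨hq, hsum, -, hd⟩ := h
  have hsq : ∀ i, q i ^ 2 = q 0 ^ 2 := fun i => by
    have := hd (Pi.single i 1 - Pi.single 0 1) (by simp)
    simp only [Pi.sub_apply, Pi.single_apply, mul_sub, mul_ite, mul_one, mul_zero,
      Finset.sum_sub_distrib, Finset.sum_ite_eq', Finset.mem_univ, if_true] at this
    grind
  have h0 : q 0 ≠ 0 := fun h => hq (funext fun i => by simpa [h] using hsq i)
  have he : ∀ i, q i = q 0 * ((if decide (q i = q 0) then (1 : ℤ) else -1 : ℤ) : ℂ) := fun i => by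
    rcases sq_eq_sq_iff_eq_or_eq_neg.1 (hsq i) with h | h
    · simp [h]
    · have : -q 0 ≠ q 0 := fun h' => h0 (by grind); simp [h, this]
  refine ⟨h0, fun i => decide (q i = q 0), by simp, ?_, he⟩
  rw [Finset.sum_congr rfl fun i _ => he i, ← Finset.mul_sum, ← Int.cast_sum] at hsum
  exact_mod_cast (mul_eq_zero.1 hsum).resolve_left h0

set_option synthInstance.maxSize 1000 in
set_option maxRecDepth 10000 in
lemma Table.exists_common : ∀ s : Fin 6 → Bool, s 0 = true →
    ∑ i, (if s i then (1 : ℤ) else -1) = 0 → ∀ s' : Fin 6 → Bool, s' 0 = true →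
    ∑ i, (if s' i then (1 : ℤ) else -1) = 0 → s ≠ s' → ∃ k l, k ≠ l ∧
      ∀ i, s (syn k i) ≠ s i ∧ s' (syn k i) ≠ s' i ∧ s (syn l i) ≠ s i ∧ s' (syn l i) ≠ s' i := by
  decide +kernel

section

variable {b : Base} {π : 𝔖₆}

lemma exists_planes_of_distinguished (hb : b ∈ distinguished) :
    ∃ σ σ', σ ≠ σ' ∧ b ∈ planeLines σ ∧ b ∈ planeLines σ' := by
  obtain ⟨h0, q, r, hq, hr, hl⟩ := hb
  obtain ⟨hq0, s, hs0, hs, eq⟩ := hq.eq_sign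
  obtain ⟨hr0, s', hs0', hs', er⟩ := hr.eq_sign
  have hne : s ≠ s' := by
    rintro rfl
    refine (isLine_iff.1 hl).1 (funext fun i => funext fun j => ?_)
    rw [wedge, eq i, eq j, er i, er j]
    simp only [Pi.zero_apply]
    ring
  obtain ⟨k, l, hkl, H⟩ := exists_common s hs0 hs s' hs0' hs' hne
  have hin : ∀ (x : ℂ⁶) (u : Fin 6 → Bool) (m : Fin 15), (∀ i, u (syn m i) ≠ u i) →
      (∀ i, x i = x 0 * ((if u i then (1 : ℤ) else -1 : ℤ) : ℂ)) → InPlane (act 1 m) x := by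
    intro x u m hm hx
    refine inPlane_act.2 fun j => ?_
    simp only [Equiv.Perm.one_apply]
    rw [hx j, hx (syn m j)]
    have := hm j
    cases h1 : u j <;> cases h2 : u (syn m j) <;> simp [h1, h2] at this ⊢
  exact ⟨act 1 k, act 1 l, fun h => hkl (act_injective 1 h),
    ⟨h0, q, r, hin q s k (fun i => (H i).1) eq, hin r s' k (fun i => (H i).2.1) er, hl⟩,
    ⟨h0, q, r, hin q s l (fun i => (H i).2.2.1) eq, hin r s' l (fun i => (H i).2.2.2) er, hl⟩⟩

lemma wedge_nodes_ne (π : 𝔖₆) : wedge (node₁ π) (node₂ π) ≠ 0 :=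
  wedge_node_ne π (Or.inr (by simp only [cons_val]; norm_num))

lemma isLine_nodes (h : b ∈ planeLines (act π 0)) (h' : b ∈ planeLines (act π 6)) :
    IsLine b.1 (node₁ π) (node₂ π) := by
  obtain ⟨-, ⟨v, w, hl⟩, hσ⟩ := mem_planeLines.1 h
  obtain ⟨-, -, hσ'⟩ := mem_planeLines.1 h'
  have key : ∀ x, OnLine b.1 x → x = ((halfDiff π x 0 + halfDiff π x 2) / 2) • node₁ π +
      ((halfDiff π x 0 - halfDiff π x 2) / 2) • node₂ π := fun x hx => by
    have e := eq_place_of_inPlane (hσ x hx)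
    have h3 := inPlane_act.1 (hσ' x hx) 0
    conv_lhs => rw [e]
    rw [e] at h3
    simp [syn, vec] at h3
    rw [node₁, node₂, place_combo, vec_combo]
    congr 2
    · simp
    · funext k
      fin_cases k
      · simp; ring
      · simp; grind
      · simp; ring
  obtain ⟨h0, hp⟩ := isLine_iff.1 hl
  have e := wedge_combo (node₁ π) (node₂ π) _ _ _ _ ▸ congrArg₂ wedge (key v hl.onLine_left)
    (key w hl.onLine_right)
  refine isLine_iff.2 ⟨wedge_nodes_ne π, ?_⟩
  rw [hp, e, proj_smul]
  intro hz
  rw [hz, zero_smul] at e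
  exact h0 e

lemma meets_of_mem {σ σ' : Syntheme} (h : b ∈ planeLines σ) (h' : b ∈ planeLines σ') :
    Meets σ σ' := by
  by_contra hm
  obtain ⟨π, rfl, rfl⟩ := exists_frame_of_not_meets hm
  obtain ⟨-, ⟨v, w, hl⟩, hσ⟩ := mem_planeLines.1 h
  obtain ⟨-, -, hσ'⟩ := mem_planeLines.1 h'
  have key : ∀ x, OnLine b.1 x → x = x (π 0) • node₁ π := fun x hx =>
    eq_smul_node₁_of_inPlane (Or.inl ⟨rfl, rfl⟩) (hσ x hx) (hσ' x hx)
  refine (isLine_iff.1 hl).1 ?_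
  rw [key v hl.onLine_left, key w hl.onLine_right]
  have := wedge_combo (node₁ π) 0 (v (π 0)) 0 (w (π 0)) 0
  simpa using this

lemma exists_frame_of_mem {σ σ' : Syntheme} (hne : σ ≠ σ') (h : b ∈ planeLines σ)
    (h' : b ∈ planeLines σ') :
    ∃ π, σ = act π 0 ∧ σ' = act π 6 ∧ IsLine b.1 (node₁ π) (node₂ π) := by
  obtain ⟨π, rfl, rfl⟩ := exists_frame_of_meets hne (meets_of_mem h h')
  exact ⟨π, rfl, rfl, isLine_nodes h h'⟩

lemma mem_distinguished_of_nodes (h0 : b.2 = 0) {d d' : ℂ³} (hd : ∀ k, d k ^ 2 = 1)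
    (hd' : ∀ k, d' k ^ 2 = 1) (h : OnLine b.1 (place π (vec 0 d)))
    (h' : OnLine b.1 (place π (vec 0 d')))
    (hne : d 0 * d' 1 - d 1 * d' 0 ≠ 0 ∨ d 0 * d' 2 - d 2 * d' 0 ≠ 0) : b ∈ distinguished :=
  ⟨h0, _, _, isNode_vec π hd, isNode_vec π hd', h.isLine h' (wedge_node_ne π hne)⟩

lemma mem_distinguished_of_isLine (h0 : b.2 = 0) (h : IsLine b.1 (node₁ π) (node₂ π)) :
    b ∈ distinguished :=
  ⟨h0, _, _, isNode_vec π fun k => by fin_cases k <;> simp,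
    isNode_vec π fun k => by fin_cases k <;> simp, h⟩

lemma mem_distinguished_of_mem {σ σ' : Syntheme} (hne : σ ≠ σ') (h : b ∈ planeLines σ)
    (h' : b ∈ planeLines σ') : b ∈ distinguished := by
  obtain ⟨π, -, -, hl⟩ := exists_frame_of_mem hne h h'
  exact mem_distinguished_of_isLine h.1 hl

lemma eq_or_eq_of_mem {κ σ σ' : Syntheme} (hne : σ ≠ σ') (h : b ∈ planeLines σ)
    (h' : b ∈ planeLines σ') (hκ : b ∈ planeLines κ) : κ = σ ∨ κ = σ' := by
  obtain ⟨π, rfl, rfl, hl⟩ := exists_frame_of_mem hne h h'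
  have := (mem_planeLines.1 hκ).2.2
  exact eq_or_eq_of_inPlane_nodes (act_apply π 0) (act_apply π 6) (this _ hl.onLine_left)
    (this _ hl.onLine_right)

end

lemma ncard_distinguished : distinguished.ncard = 45 := by
  have hex : ∀ p : Fin 15 × Fin 15, ∃ b : Base, p ∈ sharing →
      ∀ b', (b' ∈ planeLines (act 1 p.1) ∧ b' ∈ planeLines (act 1 p.2)) ↔ b' = b := by
    intro p
    by_cases hp : p ∈ sharing
    · obtain ⟨-, hlt, hs⟩ := Finset.mem_filter.1 hp
      obtain ⟨π, e1, e2⟩ := exists_frame_of_meets (fun e => hlt.ne (act_injective 1 e))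
        (meets_act.2 hs)
      refine ⟨(proj (wedge (node₁ π) (node₂ π)), 0), fun _ b' => ?_⟩
      rw [e1, e2]
      constructor
      · rintro ⟨h, h'⟩; exact Prod.ext (isLine_iff.1 (isLine_nodes h h')).2 h.1
      · rintro rfl
        have hl := isLine_iff.2 ⟨wedge_nodes_ne π, rfl⟩
        refine ⟨⟨rfl, _, _, inPlane_vec π _, inPlane_vec π _, hl⟩,
          ⟨rfl, _, _, inPlane_act.2 fun j => ?_, inPlane_act.2 fun j => ?_, hl⟩⟩ <;>
        · simp only [node₁, node₂, place_apply]; fin_cases j <;> simp [syn, vec]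
    · exact ⟨(proj (wedge (node₁ 1) (node₂ 1)), 0), fun h => absurd h hp⟩
  choose f hf using hex
  have himg : distinguished = f '' sharing := by
    ext b
    constructor
    · intro hb
      obtain ⟨σ, σ', hne, h, h'⟩ := exists_planes_of_distinguished hb
      obtain ⟨k, rfl⟩ := exists_act 1 σ
      obtain ⟨l, rfl⟩ := exists_act 1 σ'
      have hs := meets_act.1 (meets_of_mem h h')
      rcases lt_trichotomy k l with hkl | rfl | hkl
      · have hm : (k, l) ∈ sharing := Finset.mem_filter.2 ⟨Finset.mem_univ _, hkl, hs⟩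
        exact ⟨_, hm, ((hf _ hm b).1 ⟨h, h'⟩).symm⟩
      · exact absurd rfl hne
      · have hm : (l, k) ∈ sharing := Finset.mem_filter.2 ⟨Finset.mem_univ _, hkl,
          meets_act.1 (meets_of_mem h' h)⟩
        exact ⟨_, hm, ((hf _ hm b).1 ⟨h', h⟩).symm⟩
    · rintro ⟨p, hp, rfl⟩
      obtain ⟨h, h'⟩ := (hf p hp _).2 rfl
      exact mem_distinguished_of_mem
        (fun e => (Finset.mem_filter.1 hp).2.1.ne (act_injective 1 e)) h h'
  rw [himg, Set.ncard_image_of_injOn, Set.ncard_coe_finset, card_sharing]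
  intro p hp p' hp' he
  obtain ⟨h, h'⟩ := (hf p hp _).2 rfl
  obtain ⟨i, i'⟩ := (hf p' hp' _).2 he
  have hlt := (Finset.mem_filter.1 hp).2.1
  have hlt' := (Finset.mem_filter.1 hp').2.1
  have hne : act 1 p.1 ≠ act 1 p.2 := fun e => hlt.ne (act_injective 1 e)
  rcases eq_or_eq_of_mem hne h h' i with e | e <;> rcases eq_or_eq_of_mem hne h h' i' with e' | e' <;>
    have e := act_injective 1 e <;> have e' := act_injective 1 e'
  · omega
  · exact Prod.ext e.symm e'.symm
  · omega
  · omega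

lemma finite_distinguished : distinguished.Finite :=
  Set.finite_of_ncard_ne_zero (by rw [ncard_distinguished]; norm_num)

end Segre

/-! ## Complements of hyperplanes -/

lemma isPreconnected_offHyperplanes {V ι : Type*} [AddCommGroup V] [Module ℂ V]
    [TopologicalSpace V] [ContinuousAdd V] [ContinuousSMul ℂ V] [Countable ι]
    (f : ι → Dual ℂ V) : IsPreconnected {x | ∀ i, f i x ≠ 0} := by
  refine isPreconnected_of_forall_pair fun x hx y hy => ?_
  let A : Set ℂ := {c | ∀ i, f i (x + c • (y - x)) ≠ 0}
  have hA : Aᶜ.Countable := by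
    have : Aᶜ ⊆ ⋃ i, {-f i x / f i (y - x)} := by
      intro c hc
      simp only [A, Set.mem_compl_iff, Set.mem_ofPred_eq, not_forall, not_not] at hc
      obtain ⟨i, hi⟩ := hc
      rw [map_add, map_smul, smul_eq_mul] at hi
      have hne : f i (y - x) ≠ 0 := fun h => hx i (by rwa [h, mul_zero, add_zero] at hi)
      exact Set.mem_iUnion.2 ⟨i, by rw [Set.mem_singleton_iff, eq_div_iff hne]; grind⟩
    exact (Set.countable_iUnion fun i => Set.countable_singleton _).mono this
  have hc : IsConnected A := by
    have := hA.isConnected_compl_of_one_lt_rank (by rw [Complex.rank_real_complex]; norm_num)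
    rwa [compl_compl] at this
  refine ⟨(fun c => x + c • (y - x)) '' A, ?_, ⟨0, ?_, by simp⟩, ⟨1, ?_, by simp⟩,
    hc.isPreconnected.image _ (by fun_prop)⟩
  · rintro _ ⟨c, hc, rfl⟩; exact hc
  · intro i; simpa using hx i
  · intro i; simpa using hy i

namespace Segre

open ProjTop Table NodeChart

lemma eventually_add_mul_ne {a c : ℂ} (h : a ≠ 0 ∨ c ≠ 0) : ∀ᶠ s : ℂ in 𝓝[≠] 0, a + s * c ≠ 0 := by
  by_cases ha : a = 0
  · filter_upwards [self_mem_nhdsWithin] with s hs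
    rw [ha, zero_add]
    exact mul_ne_zero hs (h.resolve_left (not_not.2 ha))
  · have : ContinuousAt (fun s : ℂ => a + s * c) 0 := by fun_prop
    exact nhdsWithin_le_nhds (this.eventually_ne (by simpa using ha))

lemma mem_of_curve {C : Set Base} (hC : IsClosed C) {p : ℂ → PlückerSpace} (hp : Continuous p)
    (h0 : p 0 ≠ 0) (h : ∀ᶠ s in 𝓝[≠] 0, (proj (p s), (0 : ℂ)) ∈ C) : (proj (p 0), (0 : ℂ)) ∈ C := by
  have hc : ContinuousAt (fun s => ((proj (p s), (0 : ℂ)) : Base)) 0 :=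
    (ContinuousAt.comp (f := p) (continuousAt_proj h0) hp.continuousAt).prodMk continuousAt_const
  exact hC.mem_of_tendsto (hc.tendsto.mono_left nhdsWithin_le_nhds) h

lemma continuous_place (π : 𝔖₆) {P : Type*} [TopologicalSpace P]
    {s d : P → ℂ³} (hs : Continuous s) (hd : Continuous d) :
    Continuous fun p => place π (vec (s p) (d p)) := by
  refine continuous_pi fun i => ?_
  have hs' := fun k => (continuous_apply k).comp hs
  have hd' := fun k => (continuous_apply k).comp hd
  have : ∀ j, Continuous fun p => vec (s p) (d p) j := fun j => by
    fin_cases j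
    exacts [(hs' 0).add (hd' 0), (hs' 0).sub (hd' 0), (hs' 1).add (hd' 1), (hs' 1).sub (hd' 1),
      (hs' 2).add (hd' 2), (hs' 2).sub (hd' 2)]
  exact this _

section

variable {C : Set Base} (hC : IsClosed C) (π : 𝔖₆)
include hC

lemma mem_of_isClosed_of_general (h : ∀ l ξ, IsGeneral ξ →
      IsLine l (place π (uw ξ 0)) (place π (uw 0 (conjPar ξ))) → (l, (0 : ℂ)) ∈ C)
    {l : ℙ ℂ PlückerSpace} {d : ℂ³} (hl : IsLine l (node₁ π) (place π (vec 0 d))) :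
    (l, (0 : ℂ)) ∈ C := by
  -- directions with distinct coordinates
  have step : ∀ a : ℂ³, a 0 ≠ a 1 → a 1 ≠ a 2 → a 2 ≠ a 0 →
      (proj (wedge (node₁ π) (place π (vec 0 a))), (0 : ℂ)) ∈ C := by
    intro a h1 h2 h3
    let ξ : ℂ → ℂ³ := fun s k => 1 + s * a k
    let v : ℂ → ℂ⁶ := fun s => place π (vec
      ![s * (a 0 * (a 2 - a 1)), s * (a 1 * (a 0 - a 2)), s * (a 2 * (a 1 - a 0))]
      ![a 0 - a 1 - a 2 - s * (a 1 * a 2), a 1 - a 2 - a 0 - s * (a 2 * a 0),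
        a 2 - a 0 - a 1 - s * (a 0 * a 1)])
    have hv : ∀ s, place π (uw (ξ s) 0) + place π (uw 0 (conjPar (ξ s))) = s • v s := fun s => by
      have := place_combo π (uw (ξ s) 0) (uw 0 (conjPar (ξ s))) 1 1
      rw [one_smul, one_smul, uw_combo] at this
      rw [this, place_smul, vec_smul, uw]
      congr 2 <;> funext k <;> fin_cases k <;> simp [ξ, conjPar] <;> ring
    have hw : ∀ s, s • wedge (place π (uw (ξ s) 0)) (v s) =
        wedge (place π (uw (ξ s) 0)) (place π (uw 0 (conjPar (ξ s)))) := fun s => by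
      have e1 := wedge_combo (place π (uw (ξ s) 0)) (v s) 1 0 0 s
      have e2 := wedge_combo (place π (uw (ξ s) 0)) (place π (uw 0 (conjPar (ξ s)))) 1 0 1 1
      simp only [one_smul, zero_smul, zero_add, add_zero, one_mul, mul_zero, zero_mul, sub_zero] at e1 e2
      rw [← e1, ← hv, e2]
    have hz : uw (ξ 0) 0 = vec 0 ![1, 1, 1] := by
      rw [uw]; congr 1 <;> funext k <;> fin_cases k <;> simp [ξ]
    have e0 : wedge (place π (uw (ξ 0) 0)) (v 0) =
        (2 : ℂ) • wedge (node₁ π) (place π (vec 0 a)) := by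
      have := wedge_combo (node₁ π) (place π (vec 0 a)) 1 0 (-(a 0 + a 1 + a 2)) 2
      simp only [one_smul, zero_smul, zero_add, add_zero, one_mul, zero_mul, sub_zero] at this
      rw [← this, hz]
      simp only [v, node₁, place_combo, vec_combo]
      congr 3
      · funext k; fin_cases k <;> simp
      · funext k; fin_cases k <;> simp <;> ring
    have hne : wedge (node₁ π) (place π (vec 0 a)) ≠ 0 := wedge_node_ne π (Or.inl (by
      simpa [sub_eq_zero] using h1.symm))
    have hcont : Continuous fun s => wedge (place π (uw (ξ s) 0)) (v s) := by
      refine continuous_wedge.comp (Continuous.prodMk ?_ ?_)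
      · change Continuous fun s => place π (vec _ _)
        refine continuous_place π (continuous_pi fun k => ?_) (continuous_pi fun k => ?_) <;>
          fin_cases k <;> simp [ξ] <;> fun_prop
      · refine continuous_place π (continuous_pi fun k => ?_) (continuous_pi fun k => ?_) <;>
          fin_cases k <;> simp <;> fun_prop
    have hp0 : wedge (place π (uw (ξ 0) 0)) (v 0) ≠ 0 := by
      rw [e0]; exact smul_ne_zero two_ne_zero hne
    have := mem_of_curve hC hcont hp0 ?_
    · rwa [e0, proj_smul two_ne_zero] at this
    · filter_upwards [self_mem_nhdsWithin, eventually_add_mul_ne (c := a 0) (Or.inl one_ne_zero),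
        eventually_add_mul_ne (c := a 1) (Or.inl one_ne_zero),
        eventually_add_mul_ne (c := a 2) (Or.inl one_ne_zero),
        nhdsWithin_le_nhds (hcont.continuousAt.eventually_ne hp0)] with s hs n0 n1 n2 hws
      have hs' : s ≠ 0 := hs
      refine h _ (ξ s) ⟨⟨n0, n1, n2⟩, ?_, ?_, ?_⟩ (isLine_iff.2 ⟨?_, ?_⟩)
      · simpa [ξ, hs'] using h1
      · simpa [ξ, hs'] using h2
      · simpa [ξ, hs'] using h3
      · rw [← hw]; exact smul_ne_zero hs' hws
      · rw [← hw, proj_smul hs']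
  have hd := (isLine_iff.1 hl).1
  let a : ℂ → ℂ³ := fun s => ![d 0, d 1 + s * 1, d 2 + s * 2]
  have e0 : a 0 = d := by funext k; fin_cases k <;> simp [a]
  have hcont : Continuous fun s => wedge (node₁ π) (place π (vec 0 (a s))) := by
    refine continuous_wedge.comp (continuous_const.prodMk (continuous_place π continuous_const
      (continuous_pi fun k => ?_)))
    fin_cases k <;> simp [a] <;> fun_prop
  have := mem_of_curve hC hcont (by rwa [e0]) ?_
  · rwa [e0, ← (isLine_iff.1 hl).2] at this
  · filter_upwards [eventually_add_mul_ne (a := d 0 - d 1) (c := -1) (Or.inr (by norm_num)),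
      eventually_add_mul_ne (a := d 1 - d 2) (c := -1) (Or.inr (by norm_num)),
      eventually_add_mul_ne (a := d 2 - d 0) (c := 2) (Or.inr (by norm_num))] with s h1 h2 h3
    refine step _ ?_ ?_ ?_ <;> simp only [a, cons_val] <;> intro h
    exacts [h1 (by grind), h2 (by grind), h3 (by grind)]

omit hC in
/-- The linear forms on a plane that vanish at no node, with a non-zero last coefficient. -/
def freeForm (i : Fin 5) : Dual ℂ ℂ³ := Fintype.linearCombination ℂ
  ((![![0, 0, 1], ![1, 1, 1], ![1, 1, -1], ![1, -1, 1], ![1, -1, -1]] : Fin 5 → ℂ³) i)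

omit hC in
lemma free_iff {e : ℂ³} : (∀ i, freeForm i e ≠ 0) ↔ e 2 ≠ 0 ∧ e 0 + e 1 + e 2 ≠ 0 ∧
    e 0 + e 1 - e 2 ≠ 0 ∧ e 0 - e 1 + e 2 ≠ 0 ∧ e 0 - e 1 - e 2 ≠ 0 := by
  simp [freeForm, Fin.forall_fin_succ, Fintype.linearCombination_apply, Fin.sum_univ_three,
    sub_eq_add_neg]

lemma mem_of_isClosed_of_free
    (h : ∀ e, (∀ i, freeForm i e ≠ 0) → (proj (dualBivector π e), (0 : ℂ)) ∈ C)
    {b : Base} (hb : b ∈ planeLines (act π 0)) : b ∈ C := by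
  obtain ⟨h0, ⟨v, w, hl⟩, hσ⟩ := mem_planeLines.1 hb
  obtain ⟨hne, hp⟩ := isLine_iff.1 hl
  rw [eq_place_of_inPlane (hσ _ hl.onLine_left), eq_place_of_inPlane (hσ _ hl.onLine_right),
    wedge_vec] at hne hp
  set e : ℂ³ := ![_, _, _] with he
  have hcont : Continuous fun s : ℂ => dualBivector π (e + s • ![4, 2, 1]) := by
    unfold dualBivector
    simp only [Pi.add_apply, Pi.smul_apply]
    fun_prop
  have e0 : e + (0 : ℂ) • ![4, 2, 1] = e := by simp
  have := mem_of_curve hC hcont (by rwa [e0]) ?_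
  · rw [e0, ← hp, ← h0] at this; exact this
  · filter_upwards [eventually_add_mul_ne (a := e 2) (c := 1) (Or.inr (by norm_num)),
      eventually_add_mul_ne (a := e 0 + e 1 + e 2) (c := 7) (Or.inr (by norm_num)),
      eventually_add_mul_ne (a := e 0 + e 1 - e 2) (c := 5) (Or.inr (by norm_num)),
      eventually_add_mul_ne (a := e 0 - e 1 + e 2) (c := 3) (Or.inr (by norm_num)),
      eventually_add_mul_ne (a := e 0 - e 1 - e 2) (c := 1) (Or.inr (by norm_num))] with
      s n1 n2 n3 n4 n5
    refine h _ (free_iff.2 ⟨?_, ?_, ?_, ?_, ?_⟩) <;>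
      simp only [Pi.add_apply, Pi.smul_apply, smul_eq_mul, cons_val] <;> intro h
    exacts [n1 (by grind), n2 (by grind), n3 (by grind), n4 (by grind), n5 (by grind)]

end

lemma isGraphLine_of_free (π : 𝔖₆) {e : ℂ³}
    (h : ∀ i, freeForm i e ≠ 0) : IsGraphLine π (-e 0 / e 2) (-e 1 / e 2) (proj (dualBivector π e)) ∧
      (-e 0 / e 2 - -e 1 / e 2) ^ 2 ≠ 1 ∧ (-e 0 / e 2 + -e 1 / e 2) ^ 2 ≠ 1 := by
  obtain ⟨h0, h1, h2, h3, h4⟩ := free_iff.1 h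
  have hw := wedge_vec π ![1, 0, -e 0 / e 2] ![0, 1, -e 1 / e 2]
  have hne : wedge (place π (vec 0 ![1, 0, -e 0 / e 2])) (place π (vec 0 ![0, 1, -e 1 / e 2])) ≠ 0 :=
    wedge_node_ne π (Or.inl (by simp))
  have hs : dualBivector π e = e 2 • wedge (place π (vec 0 ![1, 0, -e 0 / e 2]))
      (place π (vec 0 ![0, 1, -e 1 / e 2])) := by
    rw [hw]
    simp only [dualBivector, cons_val, smul_add, smul_smul]
    congr 3 <;> field_simp <;> ring
  refine ⟨isLine_iff.2 ⟨hne, by rw [hs, proj_smul h0]⟩, ?_, ?_⟩ <;> intro h' <;> field_simp at h'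
  exacts [mul_ne_zero h3 h4 (by grind), mul_ne_zero h1 h2 (by grind)]

lemma place_mul_swap (π : 𝔖₆) (d : ℂ³) :
    place (π * swap 4 5) (vec 0 d) = place π (vec 0 ![d 0, d 1, -d 2]) ∧
    place (π * swap 2 3) (vec 0 d) = place π (vec 0 ![d 0, -d 1, d 2]) := by
  constructor <;> refine place_ext π fun j => ?_ <;>
    fin_cases j <;> simp [place, vec, Equiv.Perm.mul_def, Equiv.swap_apply_def]

lemma exists_isGraphLine_of_notMem {σ : Syntheme} {b : Base} (hb : b ∈ planeLines σ)
    (hd : b ∉ distinguished) : ∃ π g₁ g₂, σ = act π 0 ∧ IsGraphLine π g₁ g₂ b.1 ∧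
      (g₁ - g₂) ^ 2 ≠ 1 ∧ ((g₁ + g₂) ^ 2 ≠ 1 ∨ g₁ + g₂ = 1) := by
  obtain ⟨h0, hl, hσ⟩ := mem_planeLines.1 hb
  obtain ⟨π, g₁, g₂, rfl, hg⟩ := exists_isGraphLine hl hσ
  have hnot : ¬ ((g₁ - g₂) ^ 2 = 1 ∧ (g₁ + g₂) ^ 2 = 1) := fun ⟨h1, h2⟩ =>
    hd (mem_distinguished_of_nodes h0 (π := π) (d := ![1, 1, g₁ + g₂]) (d' := ![1, -1, g₁ - g₂])
      (fun k => by fin_cases k <;> simp [h2]) (fun k => by fin_cases k <;> simp [h1])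
      (hg.onLine_iff.2 (by simp)) (hg.onLine_iff.2 (by simp; ring)) (Or.inl (by norm_num)))
  have flip : ∀ π g₁ g₂, IsGraphLine π g₁ g₂ b.1 → (g₁ - g₂) ^ 2 ≠ 1 →
      ∃ π' g₁ g₂, act π 0 = act π' 0 ∧ IsGraphLine π' g₁ g₂ b.1 ∧
      (g₁ - g₂) ^ 2 ≠ 1 ∧ ((g₁ + g₂) ^ 2 ≠ 1 ∨ g₁ + g₂ = 1) := by
    intro π g₁ g₂ hg h1
    by_cases h2 : (g₁ + g₂) ^ 2 = 1
    · rcases sq_eq_one_iff.1 h2 with h | h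
      · exact ⟨π, g₁, g₂, rfl, hg, h1, Or.inr h⟩
      · refine ⟨π * swap 4 5, -g₁, -g₂, act_mul (by decide), ?_, ?_, Or.inr ?_⟩
        · rw [IsGraphLine, (place_mul_swap π _).1, (place_mul_swap π _).1]
          simpa [IsGraphLine] using hg
        · intro h'; exact h1 (by grind)
        · grind
    · exact ⟨π, g₁, g₂, rfl, hg, h1, Or.inl h2⟩
  by_cases h1 : (g₁ - g₂) ^ 2 = 1
  · have h2 : (g₁ + g₂) ^ 2 ≠ 1 := fun h => hnot ⟨h1, h⟩
    have hg' : IsGraphLine (π * swap 2 3) g₁ (-g₂) b.1 := by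
      rw [IsGraphLine, (place_mul_swap π _).2, (place_mul_swap π _).2]
      simp only [cons_val, neg_zero]
      refine IsLine.onLine_left hg |>.isLine (hg.onLine_iff.2 (by simp)) (wedge_node_ne π (Or.inl (by simp)))
    obtain ⟨π', g, g', e, h⟩ := flip _ _ _ hg' (by intro h'; exact h2 (by grind))
    exact ⟨π', g, g', (act_mul (by decide)).trans e, h⟩
  · exact flip π g₁ g₂ hg h1

end Segre

lemma IsClosedMap.isEmbedding_domRestrict {X X' : Type*} [TopologicalSpace X]
    [TopologicalSpace X'] {p : X → X'} (hc : Continuous p) (hp : IsClosedMap p) {Y A : Set X}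
    (hY : IsClosed Y) (hA : A ⊆ Y) (h : ∀ a ∈ A, ∀ y ∈ Y, p y = p a → y = a) :
    IsEmbedding (A.domRestrict p) := by
  refine ⟨Topology.isInducing_iff_nhds.2 fun a => le_antisymm
    (hc.comp continuous_subtype_val).continuousAt.tendsto.le_comap fun N hN => ?_,
    fun a b hab => Subtype.ext (h b.1 b.2 a.1 (hA a.2) hab)⟩
  obtain ⟨O, hON, hO, haO⟩ := mem_nhds_iff.1 (mem_nhds_subtype _ _ _ |>.1 hN |>.choose_spec.1)
  have hsub := (mem_nhds_subtype _ _ _ |>.1 hN).choose_spec.2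
  refine ⟨(p '' (Y \ O))ᶜ, ((hp _ (hY.sdiff hO)).isOpen_compl).mem_nhds ?_, fun b hb => hsub ?_⟩
  · rintro ⟨y, ⟨hy, hyO⟩, hya⟩; exact hyO (h a.1 a.2 y hy hya ▸ haO)
  · by_contra hbO; exact hb ⟨b.1, ⟨hA b.2, fun h => hbO (hON h)⟩, rfl⟩

lemma IsClosedMap.isPreconnected_of_image {X X' : Type*} [TopologicalSpace X]
    [TopologicalSpace X'] {p : X → X'} (hc : Continuous p) (hp : IsClosedMap p) {Y A : Set X}
    (hY : IsClosed Y) (hA : A ⊆ Y) (h : ∀ a ∈ A, ∀ y ∈ Y, p y = p a → y = a)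
    (hpre : IsPreconnected (p '' A)) : IsPreconnected A := by
  have h1 := (hp.isEmbedding_domRestrict hc hY hA h).isInducing
  have h2 : IsPreconnected (Set.univ : Set A) := by
    rw [← h1.isPreconnected_image, Set.image_univ, Set.range_domRestrict]
    exact hpre
  have := h2.image Subtype.val continuous_subtype_val.continuousOn
  rwa [Set.image_univ, Subtype.range_coe] at this

namespace Segre

open ProjTop Table NodeChart PlaneChart

lemma isClosedMap_fst : IsClosedMap (Prod.fst : Ambient → Base) := isClosedMap_fst_of_compactSpace

/-! ## Charts at the points over the planes -/

lemma mem_planeLines_iff {σ : Syntheme} {b : Base} :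
    b ∈ planeLines σ ↔ b.2 = 0 ∧ (∃ v w, IsLine b.1 v w) ∧ InPl σ b.1 := mem_planeLines

lemma onSegre_of_mem_planeLines {σ : Syntheme} {b : Base} (h : b ∈ planeLines σ) :
    OnSegre b.1 := onSegre_of_inPl (mem_planeLines.1 h).2.1 (mem_planeLines.1 h).2.2

lemma IsGraphLine.notMem_distinguished {π : 𝔖₆} {g₁ g₂ : ℂ} {b : Base}
    (h : IsGraphLine π g₁ g₂ b.1) (h1 : (g₁ - g₂) ^ 2 ≠ 1) (h2 : (g₁ + g₂) ^ 2 ≠ 1) :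
    b ∉ distinguished := by
  rintro ⟨-, q, r, hq, -, hl⟩
  have hin := h.inPl q hl.onLine_left
  have hon := hl.onLine_left
  obtain ⟨h0, s, -, -, hs⟩ := hq.eq_sign
  have hsq : ∀ i, q i ^ 2 = q 0 ^ 2 := fun i => by rw [hs i]; split_ifs <;> push_cast <;> ring
  rw [eq_place_of_inPlane hin, h.onLine_iff] at hon
  have hd : ∀ k, halfDiff π q k ^ 2 = q 0 ^ 2 := fun k => by
    rw [← hsq (π (evn k))]
    conv_rhs => rw [eq_place_of_inPlane hin, place_apply]
    fin_cases k <;> simp [evn, vec]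
  have e0 := hd 0
  have e1 := hd 1
  have e2 := hd 2
  have hn : halfDiff π q 0 ≠ 0 := fun h => h0 (by simpa [h] using e0.symm)
  rcases sq_eq_sq_iff_eq_or_eq_neg.1 (e1.trans e0.symm) with h3 | h3
  · refine h2 (mul_right_cancel₀ (pow_ne_zero 2 hn) ?_); rw [hon, h3] at e2; grind
  · refine h1 (mul_right_cancel₀ (pow_ne_zero 2 hn) ?_); rw [hon, h3] at e2; grind

/-- The data of a chart at a line that lies in one plane: the line passes through no node if `par`
is true, and through one node otherwise. -/
structure IsPlaneFrame (π : 𝔖₆) (g₁ g₂ : ℂ) (par : Bool) (b : Base) : Prop where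
  param : b.2 = 0
  line : IsGraphLine π g₁ g₂ b.1
  notMem : b ∉ distinguished
  sub_ne : (g₁ - g₂) ^ 2 ≠ 1
  add_ne : par = true → (g₁ + g₂) ^ 2 ≠ 1
  add_eq : par = false → g₁ + g₂ = 1

lemma exists_isPlaneFrame {σ : Syntheme} {b : Base} (hb : b ∈ planeLines σ)
    (hd : b ∉ distinguished) : ∃ π g₁ g₂ par, σ = act π 0 ∧ IsPlaneFrame π g₁ g₂ par b := by
  obtain ⟨π, g₁, g₂, hσ, hl, h1, h2⟩ := exists_isGraphLine_of_notMem hb hd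
  rcases h2 with h2 | h2
  exacts [⟨π, g₁, g₂, true, hσ, hb.1, hl, hd, h1, fun _ => h2, by simp⟩,
    ⟨π, g₁, g₂, false, hσ, hb.1, hl, hd, h1, by simp, fun _ => h2⟩]

def IsAdmissible (E : 𝒫₆) : Prop := E.IsHomogeneous 3 ∧ ∀ q : ℂ⁶, IsNode q → eval q E ≠ 0

namespace IsPlaneFrame

variable {E : 𝒫₆} (hE : IsAdmissible E)
  {π : 𝔖₆} {g₁ g₂ : ℂ} {par : Bool} {b : Base} (h : IsPlaneFrame π g₁ g₂ par b)
include h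

lemma mem_planeLines : b ∈ planeLines (act π 0) :=
  mem_planeLines_iff.2 ⟨h.param, ⟨_, _, h.line⟩, h.line.inPl⟩

lemma eq_act {κ : Syntheme} (hκ : b ∈ planeLines κ) : κ = act π 0 := by
  by_contra hne
  exact h.notMem (mem_distinguished_of_mem hne hκ h.mem_planeLines)

lemma not_inPlane (κ : Syntheme) (hκ : κ ≠ act π 0) :
    ¬ (InPlane κ (place π (vec 0 ![1, 0, g₁])) ∧ InPlane κ (place π (vec 0 ![0, 1, g₂]))) :=
  fun hκ' => hκ (h.eq_act ⟨h.param, _, _, hκ'.1, hκ'.2, h.line⟩)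

include hE in
lemma eq_zero (u : ℂ^5) (hu : ∀ α γ, form E π g₁ g₂ (0, u) α γ = 0)
    (hn : nrm par u = 0) : u = 0 := by
  have e1 := hu 1 0
  have e2 := hu 0 1
  have e3 := hu 1 1
  have e4 := hu 1 (-1)
  rw [form_zero] at e1 e2 e3 e4
  have u4 : u 4 = 0 := by
    cases par with
    | true => simpa [nrm] using hn
    | false =>
      have h0 := h.add_eq rfl
      have hE1 := hE.2 _ (isNode_vec π (d := ![1, 1, 1]) (fun k => by fin_cases k <;> simp))
      refine (mul_eq_zero.1 ?_).resolve_right hE1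
      rw [show (1 : ℂ) * g₁ + 1 * g₂ = 1 by grind] at e3
      grind
  simp only [u4, zero_mul, add_zero] at e1 e2 e3 e4
  have hm : u 0 + u 1 = u 2 + u 3 := by
    refine sub_eq_zero.1 ((mul_eq_zero.1 ?_).resolve_right (sub_ne_zero.2 h.sub_ne))
    grind
  have hp : u 0 + u 1 = 0 := by
    cases par with
    | true =>
      have : u 0 + u 1 + (u 2 + u 3) = 0 := by
        refine (mul_eq_zero.1 ?_).resolve_right (sub_ne_zero.2 (h.add_ne rfl))
        grind
      grind
    | false => simpa [nrm] using hn
  have u0 : u 0 = 0 := by grind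
  have u3 : u 3 = 0 := by grind
  funext j
  fin_cases j
  exacts [u0, (by linear_combination hp - u0 : u 1 = 0),
    (by linear_combination hp - hm - u3 : u 2 = 0), u3, u4]

include hE in
lemma exists_unknowns : ∃ u, eqs E π g₁ g₂ par (0, u) = 0 :=
  PlaneChart.exists_unknowns hE.1 (h.eq_zero hE)

variable {u : ℂ^5} (hu : eqs E π g₁ g₂ par (0, u) = 0)

def chart : ChartData E 5 := planeChart hE.1 (act_apply π 0) (h.eq_zero hE) h.not_inPlane hu

lemma chart_point : ((h.chart hE hu).point (0, u)).1 = b := by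
  refine Prod.ext ?_ ?_
  · have := ((h.chart hE hu).isLine (0, u))
    rw [isLine_iff] at this
    rw [this.2, (isLine_iff.1 h.line).2]
    exact congrArg proj (congrArg₂ wedge (vV_zero u) (vW_zero u))
  · change (0 : ℂ³) 0 * u 4 = b.2; simp [h.param]

lemma chart_spec {z : Ambient} (hz : z ∈ blowUp E) (hzb : z.1 = b)
    {g : ℂ³ → ℂ^5} (hg : (h.chart hE hu).IsSolution g) :
    (h.chart hE hu).point (0, u) = z ∧
      IsChartAt 3 (blowUp E) z fun x => (h.chart hE hu).point (x, g x) :=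
  planeChart_chart hE.1 (act_apply π 0) (h.eq_zero hE) h.not_inPlane hu hz
    (hzb.trans (h.chart_point hE hu).symm) hg

end IsPlaneFrame

section

variable {E : 𝒫₆} (hE : IsAdmissible E)
include hE

lemma eq_of_fst_eq {z z' : Ambient} (hz : z ∈ blowUp E) (hz' : z' ∈ blowUp E)
    (hd : z.1 ∉ distinguished) (h : z'.1 = z.1) : z' = z := by
  by_cases hp : ∃ σ, z.1 ∈ planeLines σ
  · obtain ⟨σ, hσ⟩ := hp
    obtain ⟨π, g₁, g₂, par, -, hf⟩ := exists_isPlaneFrame hσ hd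
    obtain ⟨u, hu⟩ := hf.exists_unknowns hE
    obtain ⟨g, hg⟩ := (hf.chart hE hu).exists_solution
    exact (hf.chart_spec hE hu hz' h hg).1.symm.trans (hf.chart_spec hE hu hz rfl hg).1
  · push Not at hp
    obtain ⟨v, w, hl⟩ := (mem_fanoFamily.1 (blowUp_fst hz)).1
    refine Prod.ext h (funext fun κ => ?_)
    rw [blowUp_snd hz (hp κ) hl, blowUp_snd hz' (h ▸ hp κ) (h ▸ hl), h]

lemma image_fst_blowUp : Prod.fst '' blowUp E = fanoFamily E := by
  refine Set.Subset.antisymm (by rintro _ ⟨z, hz, rfl⟩; exact blowUp_fst hz) fun b hb => ?_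
  by_cases hp : ∃ σ, b ∈ planeLines σ
  · obtain ⟨σ, hσ⟩ := hp
    obtain ⟨π, rfl⟩ := Segre.exists_frame σ
    refine mem_of_isClosed_of_free (isClosedMap_fst _ (isClosed_blowUp E)) π (fun e he => ?_) hσ
    obtain ⟨h1, h2, h3⟩ := isGraphLine_of_free π he
    have hf : IsPlaneFrame π _ _ true (proj (dualBivector π e), (0 : ℂ)) :=
      ⟨rfl, h1, h1.notMem_distinguished h2 h3, h2, fun _ => h3, by simp⟩
    obtain ⟨u, hu⟩ := hf.exists_unknowns hE
    obtain ⟨g, hg⟩ := (hf.chart hE hu).exists_solution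
    exact ⟨_, hg.point_zero, hf.chart_point hE hu⟩
  · push Not at hp; obtain ⟨z, hz, rfl⟩ := exists_graph hb hp; exact ⟨z, subset_closure hz, rfl⟩

end

/-! ## Local sections of the projection to the family -/

/-- The points of `S` near `w` depend holomorphically on their projections to the family. -/
def HasBaseSection (S : Set Ambient) (w : Ambient) : Prop :=
  ∃ (ι : Type) (_ : Fintype ι) (X : Base → ι → ℂ) (φ : (ι → ℂ) → Ambient),
    (∀ j, IsCoordinate (fun b => X b j) w.1) ∧
    (∀ c ∈ coords (X := Ambient), w ∈ c.1 → DifferentiableAt ℂ (c.2 ∘ φ) (X w.1)) ∧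
    ∀ᶠ w' in 𝓝[S] w, w' = φ (X w'.1)

lemma HasBaseSection.immersive_fst {S : Set Ambient} {k : ℕ} {ψ : ℂ^k → Ambient}
    {x : ℂ^k} (h : HasBaseSection S (ψ x)) (hhol : HolomorphicAt ψ x)
    (hc : ContinuousAt ψ x) (himm : ImmersiveAt ψ x) (hS : ∀ᶠ y in 𝓝 x, ψ y ∈ S) :
    ImmersiveAt (fun y => (ψ y).1) x := by
  obtain ⟨ι, _, X, φ, hX, hφ, hw⟩ := h
  intro v hv
  have h1 : ∀ j, DifferentiableAt ℂ (fun y => X (ψ y).1 j) x ∧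
      fderiv ℂ (fun y => X (ψ y).1 j) x v = 0 := by
    intro j
    obtain ⟨c, hcj, hdom, k, hk⟩ := hX j
    have e : (fun y => X (ψ y).1 j) = fun y => c.2 (ψ y).1 - k := by simp [hk]
    rw [e, fderiv_sub_const]
    exact ⟨((hhol _ (coords_fst hcj) hdom).differentiableAt).sub_const k, hv _ hcj hdom⟩
  have hd : DifferentiableAt ℂ (fun y => X (ψ y).1) x := differentiableAt_pi.2 fun j => (h1 j).1
  have hd0 : fderiv ℂ (fun y => X (ψ y).1) x v = 0 := by
    rw [fderiv_pi fun j => (h1 j).1]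
    funext j
    exact (h1 j).2
  refine himm v fun c hcc hcx => ?_
  have h4 : c.2 ∘ ψ =ᶠ[𝓝 x] (c.2 ∘ φ) ∘ fun y => X (ψ y).1 := by
    filter_upwards [(tendsto_nhdsWithin_iff.2 ⟨hc.tendsto, hS⟩).eventually hw] with y hy
    exact congrArg c.2 hy
  rw [h4.fderiv_eq, fderiv_comp x (hφ c hcc hcx) hd, ContinuousLinearMap.comp_apply, hd0, map_zero]

lemma hasBaseSection_of_chart {z : Ambient} {k : ℕ}
    {φ : ℂ^k → Ambient} {S : Set Ambient} {X : Base → ℂ^k}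
    (hX : ∀ j, IsCoordinate (fun b => X b j) z.1)
    (hhol : HolomorphicAt φ 0) (h0 : φ 0 = z) (hXz : X z.1 = 0)
    (hsec : ∀ᶠ x in 𝓝 0, X (φ x).1 = x)
    (hS : ∀ N ∈ 𝓝 (0 : ℂ^k), ∀ᶠ w in 𝓝[S] z, w ∈ φ '' N) : HasBaseSection S z := by
  refine ⟨Fin k, inferInstance, X, φ, hX, fun c hc hz => ?_, ?_⟩
  · rw [hXz]; exact (hhol c hc (h0 ▸ hz)).differentiableAt
  · filter_upwards [hS _ hsec] with w hw; obtain ⟨x, hx, rfl⟩ := hw; rw [show X (φ x).1 = x from hx]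

lemma IsChartAt.eventually_mem_image {Z : Set Ambient} {z : Ambient} {k : ℕ}
    {φ : ℂ^k → Ambient} (h : IsChartAt k Z z φ) (N : Set ℂ^k) (hN : N ∈ 𝓝 0) : ∀ᶠ w in 𝓝[Z] z, w ∈ φ '' N := by
  obtain ⟨V, hVN, hV⟩ := h N hN
  obtain ⟨O, hO, hVO⟩ := hV.image_open
  have hz : z ∈ Z ∩ O := hVO ▸ ⟨0, hV.zero_mem, hV.map_zero⟩
  filter_upwards [self_mem_nhdsWithin, nhdsWithin_le_nhds (hO.mem_nhds hz.2)] with w h1 h2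
  exact Set.image_mono hVN (hVO.symm ▸ ⟨h1, h2⟩)

end Segre

lemma IsHolomorphicChart.eq_zero_of_mem_closure {X : Type*} [TopologicalSpace X]
    [LocalCoordinates X] {k : ℕ} {Z A : Set X} {z : X} {φ : ℂ^k → X} {V : Set ℂ^k}
    (h : IsHolomorphicChart k Z z φ V) (hA : A ⊆ Z) {f : ℂ^k → ℂ} (hf : ContinuousOn f V)
    (H : ∀ x ∈ V, φ x ∈ A → f x = 0) : ∀ x ∈ V, φ x ∈ closure A → f x = 0 := by
  intro x hx hxA
  obtain ⟨O, hO, hVO⟩ := h.image_open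
  have h1 : (⟨x, hx⟩ : V) ∈ closure {y : V | φ y.1 ∈ A} := by
    rw [h.isEmbedding.isInducing.closure_eq_preimage_closure_image]
    have h2 : V.domRestrict φ '' {y : V | φ y.1 ∈ A} = O ∩ A := by
      ext y
      constructor
      · rintro ⟨w, hw, rfl⟩; exact ⟨(hVO ▸ Set.mem_image_of_mem φ w.2 : φ w ∈ Z ∩ O).2, hw⟩
      · rintro ⟨hyO, hyA⟩
        obtain ⟨w, hw, rfl⟩ : y ∈ φ '' V := hVO.symm ▸ ⟨hA hyA, hyO⟩
        exact ⟨⟨w, hw⟩, hyA, rfl⟩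
    rw [Set.mem_preimage, h2]
    exact hO.inter_closure ⟨(hVO ▸ Set.mem_image_of_mem φ hx : φ x ∈ Z ∩ O).2, hxA⟩
  have h3 : IsClosed {y : V | f y.1 = 0} :=
    isClosed_eq (continuousOn_iff_continuous_domRestrict.1 hf) continuous_const
  exact closure_minimal (fun (y : V) (hy : φ y ∈ A) => H y.1 y.2 hy) h3 h1

namespace Segre

open ProjTop Table NodeChart

lemma ChartData.mem_planeLines_iff {E : 𝒫₆} {m : ℕ} (D : ChartData E m)
    {p : Par m} {κ : Syntheme} (hg : D.gen κ p ≠ 0) :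
    (D.point p).1 ∈ planeLines κ ↔ D.lam κ p.1 = 0 :=
  ⟨fun h => by_contra fun h' => D.notMem_planeLines h' hg h, D.mem_planeLines⟩

lemma mem_delPezzoLines_iff {T : Total} {b : Base} : b ∈ delPezzoLines T ↔
    b.2 = 0 ∧ OnSegre b.1 ∧ ∀ σ ∈ T.1, MeetsPl σ b.1 := by
  rw [mem_delPezzoLines, OnSegre, and_assoc]
  rfl

lemma OnLine.exists_isLine {l : ℙ ℂ PlückerSpace} {x : ℂ⁶} (h : OnLine l x)
    (hx : x ≠ 0) : ∃ y, OnLine l y ∧ IsLine l x y := by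
  obtain ⟨v, w, hl, α, γ, rfl⟩ := h
  obtain ⟨h0, -⟩ := isLine_iff.1 hl
  by_cases hα : α = 0
  · refine ⟨v, hl.onLine_left, OnLine.isLine ⟨v, w, hl, α, γ, rfl⟩ hl.onLine_left ?_⟩
    have := wedge_combo v w α γ 1 0
    simp only [one_smul, zero_smul, add_zero] at this
    rw [this]
    refine smul_ne_zero ?_ h0
    rintro h1
    exact hx (by simp_all)
  · refine ⟨w, hl.onLine_right, OnLine.isLine ⟨v, w, hl, α, γ, rfl⟩ hl.onLine_right ?_⟩
    have := wedge_combo v w α γ 0 1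
    simp only [one_smul, zero_smul, zero_add] at this
    rw [this]
    exact smul_ne_zero (by simpa using hα) h0

lemma delPezzo_isLine {T : Total} {b : Base} (h : b ∈ delPezzoLines T) :
    ∃ v w, IsLine b.1 v w := (mem_delPezzoLines.1 h).2.1

/-! ## Frames at the points over the distinguished lines -/

/-- The numbering that exchanges the two nodes. -/
def flip (π : 𝔖₆) : 𝔖₆ := π * swap 4 5

lemma act_flip (π : 𝔖₆) : act (flip π) 0 = act π 0 ∧ act (flip π) 6 = act π 6 :=
  ⟨(act_mul (by decide)).symm, (act_mul (by decide)).symm⟩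

lemma node_flip (π : 𝔖₆) : node₁ (flip π) = node₂ π ∧ node₂ (flip π) = node₁ π := by
  simp only [flip, node₁, node₂, (place_mul_swap π _).1]
  simp

lemma actTot_flip_ne (π : 𝔖₆) : actTot (flip π) 2 ≠ actTot π 2 := by
  intro h
  have h1 : act (flip π) 1 ∈ (actTot π 2).1 := h ▸ (mem_actTot 1).2 (by decide)
  rw [flip, ← act_mul (k := 2) (l := 1) (π := π) (by decide), mem_actTot] at h1
  revert h1
  decide

lemma dual_nodes (π : 𝔖₆) : dotL (aVec π) (node₁ π) = 1 ∧ dotL (cVec π) (node₁ π) = 0 ∧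
    dotL (aVec π) (node₂ π) = 0 ∧ dotL (cVec π) (node₂ π) = 1 := by
  simp only [dotL_aVec, dotL_cVec, node₁, node₂, halfDiff_place]
  refine ⟨?_, ?_, ?_, ?_⟩ <;> simp <;> norm_num

lemma form_flip (π : 𝔖₆) (Z : (PlückerSpace × PlückerSpace)) : nA (flip π) Z = -nB π Z := by
  have hs : sumVec (flip π) 0 = sumVec π 0 ∧ sumVec (flip π) 1 = sumVec π 1 ∧
      diffVec (flip π) 0 = diffVec π 0 ∧ diffVec (flip π) 1 = diffVec π 1 ∧
      diffVec (flip π) 2 = - diffVec π 2 := by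
    refine ⟨?_, ?_, ?_, ?_, ?_⟩ <;> simp [flip, sumVec, diffVec, evn, odd, Equiv.swap_apply_def]
  have h1 : cVec (flip π) = aVec π := by simp only [aVec, cVec, hs, smul_neg, sub_neg_eq_add]
  have h2 : mL (flip π) = mL π := by simp only [mL, hs]
  simp [nA, nB, h1, h2, readFst, readSnd]

section

variable {E : 𝒫₆}

/-- The data of a chart at a point over a distinguished line. -/
structure IsNodeFrame (E : 𝒫₆) (π : 𝔖₆) (β : ℂ)
    (z : Ambient) : Prop where
  mem : z ∈ blowUp E
  param : z.1.2 = 0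
  line : IsLine z.1.1 (node₁ π) (node₂ π)
  ne : nA π (z.2 (act π 0)).rep ≠ 0
  eq : nB π (sect (nA π) (z.2 (act π 0))) = β

lemma isLine_normalized {l : ℙ ℂ PlückerSpace} {π : 𝔖₆}
    (h : IsLine l (node₁ π) (node₂ π)) : bracket (aVec π) (cVec π) l.rep ≠ 0 ∧
      lineFst (aVec π) (cVec π) l = node₁ π ∧ lineSnd (aVec π) (cVec π) l = node₂ π := by
  obtain ⟨d1, d2, d3, d4⟩ := dual_nodes π
  have hb : bracket (aVec π) (cVec π) l.rep ≠ 0 := by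
    rw [h.bracket_ne_zero, d1, d2, d3, d4]; norm_num
  exact ⟨hb, h.eq_normalized hb d1 d2 d3 d4⟩

variable (hE : IsAdmissible E)

include hE in
lemma eval_node (π : 𝔖₆) : eval (node₁ π) E ≠ 0 ∧ eval (node₂ π) E ≠ 0 :=
  ⟨hE.2 _ (isNode_vec π fun k => by fin_cases k <;> simp),
    hE.2 _ (isNode_vec π fun k => by fin_cases k <;> simp)⟩

include hE in
lemma isNodeFrame_or {z : Ambient} {π : 𝔖₆} (hz : z ∈ blowUp E) (h0 : z.1.2 = 0)
    (hl : IsLine z.1.1 (node₁ π) (node₂ π)) :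
    (∃ β, IsNodeFrame E π β z) ∨ IsNodeFrame E (flip π) 0 z := by
  by_cases hA : nA π (z.2 (act π 0)).rep = 0
  · right
    obtain ⟨N, hN⟩ := exists_dual_ne_zero (z.2 (act π 0)).rep_nonzero
    obtain ⟨hb, hV, hW⟩ := isLine_normalized hl
    obtain ⟨-, -, -, hne⟩ := nodeChart_fibre (σ := act π 0) (act_apply π 0)
      (eval_node hE π).2 hz hb hV hW hN
    have hfl : IsLine z.1.1 (node₁ (flip π)) (node₂ (flip π)) :=
      OnLine.isLine ((node_flip π).1 ▸ hl.onLine_right) ((node_flip π).2 ▸ hl.onLine_left)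
        (wedge_nodes_ne _)
    refine ⟨hz, h0, hfl, ?_, ?_⟩
    · rw [(act_flip π).1, form_flip, neg_ne_zero]
      intro hB
      refine hne ⟨?_, ?_⟩
      · rw [sect, map_smul, hA, smul_zero]
      · rw [sect, map_smul, hB, smul_zero]
    · rw [(act_flip π).1]
      have h2 : flip (flip π) = π := by rw [flip, flip, mul_assoc, Equiv.swap_mul_self, mul_one]
      have h3 := form_flip (flip π) (sect (nA (flip π)) (z.2 (act π 0)))
      rw [h2, sect, map_smul, hA, smul_zero] at h3
      exact neg_eq_zero.1 h3.symm
  · exact Or.inl ⟨_, hz, h0, hl, hA, rfl⟩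

include hE in
lemma exists_isNodeFrame {z : Ambient} {σ : Syntheme} (hz : z ∈ blowUp E)
    (hσ : z.1 ∈ planeLines σ) (hd : z.1 ∈ distinguished) :
    ∃ π β, σ = act π 0 ∧ IsNodeFrame E π β z := by
  obtain ⟨σ₁, σ₂, hne, h1, h2⟩ := exists_planes_of_distinguished hd
  obtain ⟨σ', hne', h'⟩ : ∃ σ', σ ≠ σ' ∧ z.1 ∈ planeLines σ' := by
    by_cases h : σ = σ₁
    exacts [⟨σ₂, h ▸ hne, h2⟩, ⟨σ₁, h, h1⟩]
  obtain ⟨π, rfl, -, hl⟩ := exists_frame_of_mem hne' hσ h'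
  rcases isNodeFrame_or hE hz hσ.1 hl with ⟨β, h⟩ | h
  exacts [⟨π, β, rfl, h⟩, ⟨flip π, 0, (act_flip π).1.symm, h⟩]

namespace IsNodeFrame

variable {π : 𝔖₆} {β : ℂ} {z : Ambient} (h : IsNodeFrame E π β z)

variable (π β) in
def chart : ChartData E 4 := nodeChart hE.1 (σ := act π 0) (σ' := act π 6) (act_apply π 0)
  (act_apply π 6) (eval_node hE π).1 (eval_node hE π).2 β

lemma lam_chart (κ : Syntheme) (x : ℂ³) : (chart hE π β).lam κ x =
    open Classical in if κ = act π 0 then x 0 else if κ = act π 6 then x 1 else 1 := rfl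

lemma act_ne (π : 𝔖₆) : act π 6 ≠ act π 0 := fun h =>
  absurd (act_injective π h) (by decide)

lemma eq_of_solution {x : ℂ} {u : ℂ^4} (hu : (chart hE π β).F (![0, 0, x], u) = 0) :
    24 * (β + x) + u 1 * eval (node₂ π) E = 0 := by
  have := (NodeChart.eqs_eq_zero hE.1 _).1 hu 0 1
  simp [NodeChart.form, NodeChart.vW_zero] at this
  grind

include h

lemma mem_planes : z.1 ∈ planeLines (act π 0) ∧ z.1 ∈ planeLines (act π 6) := by
  refine ⟨⟨h.param, _, _, ?_, ?_, h.line⟩, ⟨h.param, _, _, ?_, ?_, h.line⟩⟩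
  · exact inPlane_vec π _
  · exact inPlane_vec π _
  · rw [inPlane_act]; intro j; simp only [node₁, place_apply]; fin_cases j <;> simp [syn, vec]
  · rw [inPlane_act]; intro j; simp only [node₂, place_apply]; fin_cases j <;> simp [syn, vec]

lemma chart_spec {g : ℂ³ → ℂ^4} (hg : (chart hE π β).IsSolution g) :
    (chart hE π β).point (0, unk E π β) = z ∧
      IsChartAt 3 (blowUp E) z fun x => (chart hE π β).point (x, g x) := by
  obtain ⟨hb, hV, hW⟩ := isLine_normalized h.line
  exact nodeChart_chart hE.1 (act_apply π 0) (act_apply π 6) (eval_node hE π).1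
    (eval_node hE π).2 h.mem hb hV hW h.ne h.eq hg

end IsNodeFrame

/-! ## The components of the central fibre -/

include hE

lemma component_inl (σ : Syntheme) :
    component E (.inl σ) = {z ∈ blowUp E | z.1 ∈ planeLines σ} := by
  refine Set.Subset.antisymm (closure_minimal (fun z hz => ⟨hz.1, hz.2.1⟩)
    ((isClosed_blowUp E).inter ((isClosed_planeLines σ).preimage continuous_fst))) ?_
  rintro z ⟨hz, hσ⟩
  by_cases hd : z.1 ∈ distinguished
  swap
  · exact subset_closure ⟨hz, hσ, hd⟩
  obtain ⟨π, β, rfl, hf⟩ := exists_isNodeFrame hE hz hσ hd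
  set D := IsNodeFrame.chart hE π β with hD
  obtain ⟨g, hg⟩ := D.exists_solution
  have hpt := (hf.chart_spec hE hg).1
  have hcurve : Tendsto (fun s : ℂ => (![0, s, 0] : ℂ³)) (𝓝[≠] 0) (𝓝 0) := by
    refine tendsto_nhdsWithin_of_tendsto_nhds (tendsto_pi_nhds.2 fun k => ?_)
    fin_cases k
    exacts [tendsto_const_nhds, Filter.tendsto_id, tendsto_const_nhds]
  have h0 : D.point (0, g 0) = z := by rw [hg.2.1]; exact hpt
  refine mem_closure_of_tendsto (h0 ▸ hg.point.self_of_nhds.2.1.tendsto.comp hcurve) ?_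
  filter_upwards [hcurve.eventually hg.point, hcurve.eventually hg.eventually,
    self_mem_nhdsWithin] with s h1 h2 hs
  have hl : ∀ κ, D.lam κ ![0, s, 0] = 0 ↔ κ = act π 0 := fun κ => by
    rw [hD, IsNodeFrame.lam_chart]
    by_cases hκ : κ = act π 0
    · simp [hκ]
    · by_cases hκ' : κ = act π 6
      · simpa [hκ', IsNodeFrame.act_ne] using hs
      · simp [hκ, hκ']
  refine ⟨h1.2.2, D.mem_planeLines ((hl _).2 rfl), fun hd => ?_⟩
  obtain ⟨σ₁, σ₂, hne, e1, e2⟩ := exists_planes_of_distinguished hd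
  exact hne (((hl _).1 ((D.mem_planeLines_iff (h2.2.2 _)).1 e1)).trans
    ((hl _).1 ((D.mem_planeLines_iff (h2.2.2 _)).1 e2)).symm)

omit hE in
lemma notMem_distinguished_of_forall {b : Base} (h : ∀ κ, b ∉ planeLines κ) :
    b ∉ distinguished := fun hd => by
  obtain ⟨σ, -, -, h1, -⟩ := exists_planes_of_distinguished hd
  exact h σ h1

omit hE in
lemma general_mem {l : ℙ ℂ PlückerSpace} {π : 𝔖₆} {ξ : ℂ³}
    (hξ : IsGeneral ξ) (hl : IsLine l (place π (uw ξ 0)) (place π (uw 0 (conjPar ξ)))) :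
    (l, (0 : ℂ)) ∈ delPezzoLines (actTot π 2) ∧ ∀ κ, (l, (0 : ℂ)) ∉ planeLines κ := by
  refine ⟨mem_delPezzoLines_iff.2 ⟨rfl, onSegre_general hl, fun σ hσ => ?_⟩, fun κ hκ =>
    not_inPl_general hξ hl κ (mem_planeLines_iff.1 hκ).2.2⟩
  obtain ⟨k, rfl⟩ := exists_act π σ
  exact meetsPl_general hl k ((mem_actTot k).1 hσ)

omit hE in
lemma mem_image_core {T : Total} {b : Base} (hb : b ∈ delPezzoLines T) :
    b ∈ Prod.fst '' closure {z ∈ blowUp E | z.1 ∈ delPezzoLines T ∧ ∀ κ, z.1 ∉ planeLines κ} := by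
  obtain ⟨h0, hS, hT⟩ := mem_delPezzoLines_iff.1 hb
  by_cases hp : ∀ κ, b ∉ planeLines κ
  · have hF : b ∈ fanoFamily E := by
      have := hS.mem_fanoFamily (E := E)
      rwa [← h0] at this
    obtain ⟨z, hz, rfl⟩ := exists_graph hF hp
    exact ⟨z, subset_closure ⟨subset_closure hz, hb, hp⟩, rfl⟩
  · push Not at hp
    obtain ⟨κ, hκ⟩ := hp
    obtain ⟨π, rfl, rfl, hn⟩ := exists_frame_of_meetsPl (delPezzo_isLine hb)
      (mem_planeLines_iff.1 hκ).2.2 hT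
    obtain ⟨y, hy⟩ := hn.exists_isLine fun h => by simpa [node₁, place_eq_zero, vec_eq_zero] using h
    have hyp := (mem_planeLines_iff.1 hκ).2.2
    have hb' : b = (b.1, 0) := Prod.ext rfl h0
    rw [eq_place_of_inPlane (hyp y hy.1)] at hy
    rw [hb']
    refine mem_of_isClosed_of_general (isClosedMap_fst _ isClosed_closure) π (fun l ξ hξ hl => ?_)
      hy.2
    obtain ⟨h1, h2⟩ := general_mem hξ hl
    obtain ⟨z, hz, hzl⟩ := exists_graph ((onSegre_general hl).mem_fanoFamily (E := E)) h2
    exact ⟨z, subset_closure ⟨subset_closure hz, hzl ▸ h1, hzl ▸ h2⟩, hzl⟩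

lemma component_inr (T : Total) : component E (.inr T) =
    closure {z ∈ blowUp E | z.1 ∈ delPezzoLines T ∧ ∀ κ, z.1 ∉ planeLines κ} := by
  refine Set.Subset.antisymm (closure_minimal (fun z hz => ?_) isClosed_closure)
    (closure_mono fun z hz => ⟨hz.1, hz.2.1, notMem_distinguished_of_forall hz.2.2⟩)
  obtain ⟨z', hz', h⟩ := mem_image_core (E := E) hz.2.1
  have hzb : z' ∈ blowUp E := closure_minimal (fun y hy => hy.1) (isClosed_blowUp E) hz'
  rwa [← eq_of_fst_eq hE hz.1 hzb hz.2.2 h]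

omit hE in
lemma component_inr_subset {T : Total} {z : Ambient} (hz : z ∈ component E (.inr T)) :
    z ∈ blowUp E ∧ z.1 ∈ delPezzoLines T :=
  closure_minimal (t := {z | z ∈ blowUp E ∧ z.1 ∈ delPezzoLines T}) (fun y hy => ⟨hy.1, hy.2.1⟩)
    ((isClosed_blowUp E).inter ((isClosed_delPezzoLines T).preimage continuous_fst)) hz

lemma image_fst_component_inr (T : Total) : Prod.fst '' component E (.inr T) = delPezzoLines T := by
  refine Set.Subset.antisymm ?_ fun b hb => ?_
  · rintro _ ⟨z, hz, rfl⟩; exact (component_inr_subset hz).2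
  · rw [component_inr hE]; exact mem_image_core hb

lemma image_fst_component_inl (σ : Syntheme) : Prod.fst '' component E (.inl σ) = planeLines σ := by
  rw [component_inl hE]
  refine Set.Subset.antisymm (by rintro _ ⟨z, hz, rfl⟩; exact hz.2) fun b hb => ?_
  have hF := (onSegre_of_mem_planeLines hb).mem_fanoFamily (E := E)
  rw [← hb.1, ← image_fst_blowUp hE] at hF
  obtain ⟨z, hz, hzb⟩ := hF
  exact ⟨z, ⟨hz, hzb ▸ hb⟩, hzb⟩

omit hE in
lemma isClosed_component (i : Syntheme ⊕ Total) : IsClosed (component E i) := by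
  cases i <;> exact isClosed_closure

omit hE in
lemma component_subset {i : Syntheme ⊕ Total} {z : Ambient} (hz : z ∈ component E i) :
    z ∈ blowUp E ∧ z.1.2 = 0 := by
  have h1 : IsClosed {z : Ambient | z ∈ blowUp E ∧ z.1.2 = 0} := (isClosed_blowUp E).inter
    (isClosed_singleton.preimage (continuous_snd.comp continuous_fst : Continuous
      fun z : Ambient => z.1.2))
  cases i with
  | inl σ => exact closure_minimal (fun y hy => show y ∈ blowUp E ∧ y.1.2 = 0 from ⟨hy.1, hy.2.1.1⟩) h1 hz
  | inr T => exact closure_minimal (fun y hy => show y ∈ blowUp E ∧ y.1.2 = 0 from ⟨hy.1, hy.2.1.1⟩) h1 hz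

omit hE in
lemma mem_component_inr {z : Ambient} (hz : z ∈ blowUp E) (hd : z.1 ∉ distinguished) {T : Total} :
    z ∈ component E (.inr T) ↔ z.1 ∈ delPezzoLines T :=
  ⟨fun h => (component_inr_subset h).2, fun h => subset_closure ⟨hz, h, hd⟩⟩

lemma central_fibre : blowUp E ∩ (fun z => z.1.2) ⁻¹' {0} = ⋃ i, component E i := by
  refine Set.Subset.antisymm ?_ (Set.iUnion_subset fun i z hz => component_subset hz)
  rintro z ⟨hz, h0⟩
  by_cases hp : ∃ κ, z.1 ∈ planeLines κ
  · obtain ⟨κ, hκ⟩ := hp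
    exact Set.mem_iUnion.2 ⟨Sum.inl κ, by rw [component_inl hE]; exact ⟨hz, hκ⟩⟩
  · push Not at hp
    have hS := onSegre_of_mem (blowUp_fst hz) h0
    have hno : ∀ κ, ¬ InPl κ z.1.1 := fun κ h => hp κ (mem_planeLines_iff.2 ⟨h0, hS.1, h⟩)
    obtain ⟨π, h7, h12⟩ := hS.exists_frame hno
    obtain ⟨ξ, hξ, hl⟩ := hS.exists_general hno h7 h12
    have h1 := (general_mem hξ hl).1
    refine Set.mem_iUnion.2 ⟨Sum.inr (actTot π 2), (mem_component_inr hz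
      (notMem_distinguished_of_forall hp)).2 ?_⟩
    rwa [show z.1 = (z.1.1, 0) from Prod.ext rfl h0]

end

/-! ## Normal crossings -/

lemma hasDerivAt_line {k m : ℕ} {G : ℂ^k → ℂ^m} (hG : AnalyticAt ℂ G 0) (v : ℂ^k) (j : Fin m) :
    HasDerivAt (fun s : ℂ => G (s • v) j) (fderiv ℂ G 0 v j) 0 := by
  have h1 : HasDerivAt (fun s : ℂ => s • v) v 0 := by
    simpa using (hasDerivAt_id (0 : ℂ)).smul_const v
  have h2 : HasFDerivAt G (fderiv ℂ G 0) ((0 : ℂ) • v) := by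
    rw [zero_smul]; exact hG.differentiableAt.hasFDerivAt
  exact hasDerivAt_pi.1 (h2.comp_hasDerivAt 0 h1) j

lemma eq_zero_of_hasDerivAt_mul {c : ℂ} (h : HasDerivAt (fun s : ℂ => s * c) 0 0) : c = 0 :=
  (by simpa using (hasDerivAt_id (0 : ℂ)).mul_const c : HasDerivAt (fun s : ℂ => s * c) c 0).unique h

variable {E : 𝒫₆} (hE : IsAdmissible E)

include hE

lemma hasNormalCrossingChart_of_reparametrization {z : Ambient} {φ : ℂ³ → Ambient}
    (hφ : IsChartAt 3 (blowUp E) z φ)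
    {G : ℂ³ → ℂ³} (hG : AnalyticAt ℂ G 0) (hG0 : G 0 = 0)
    (hinj : ∀ v, (∀ j, HasDerivAt (fun s : ℂ => G (s • v) j) 0 0) → v = 0)
    (K : Finset (Fin 3)) (idx : Fin 3 → Syntheme ⊕ Total) (hidx : Set.InjOn idx K)
    (hz : ∀ i, z ∈ component E i ↔ ∃ k ∈ K, idx k = i)
    (h1 : ∀ᶠ x in 𝓝 0, (φ x).1.2 = ∏ k ∈ K, G x k)
    (h2 : ∀ k ∈ K, ∀ᶠ x in 𝓝 0, φ x ∈ component E (idx k) → G x k = 0) :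
    HasNormalCrossingChart (blowUp E) (fun z => z.1.2) (component E) z := by
  obtain ⟨H, hH, -, hH0, hGH, -, hφH⟩ := exists_reparametrization hφ hG hG0 fun v hv =>
    hinj v fun j => by simpa [hv] using hasDerivAt_line hG v j
  have hHt : Tendsto H (𝓝 0) (𝓝 0) := by simpa [ContinuousAt, hH0] using hH.continuousAt
  obtain ⟨c, -, e1, e2⟩ := hasNormalCrossingChart_of_finset (t := fun z : Ambient => z.1.2) hφH
    (isClosed_component (E := E)) K idx hidx hz
    (by filter_upwards [hGH, hHt.eventually h1] with x hx hx'
        rw [hx] at hx'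
        exact hx')
    (fun k hk => by
      filter_upwards [hGH, hHt.eventually (h2 k hk)] with x hx hx' h
      rw [← hx' h, hx])
  exact hasNormalCrossingChart_of_imp hφH isClosed_component (central_fibre hE) c e1 e2

lemma mem_component_inl {z : Ambient} (hz : z ∈ blowUp E) (σ : Syntheme) :
    z ∈ component E (.inl σ) ↔ z.1 ∈ planeLines σ := by
  rw [component_inl hE]
  exact ⟨fun h => h.2, fun h => ⟨hz, h⟩⟩

lemma eventually_eq_zero {z : Ambient} {φ : ℂ³ → Ambient}
    (hφ : IsChartAt 3 (blowUp E) z φ) {T : Total}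
    {f : ℂ³ → ℂ} (hf : ∀ᶠ x in 𝓝 0, ContinuousAt f x)
    (H : ∀ᶠ x in 𝓝 0, (φ x).1 ∈ delPezzoLines T → (∀ κ, (φ x).1 ∉ planeLines κ) → f x = 0) :
    ∀ᶠ x in 𝓝 0, φ x ∈ component E (.inr T) → f x = 0 := by
  obtain ⟨V, hVN, hV⟩ := hφ _ (hf.and H)
  filter_upwards [hV.isOpen.mem_nhds hV.zero_mem] with x hx
  rw [component_inr hE]
  exact hV.eq_zero_of_mem_closure (fun y hy => hy.1) (fun x hx => (hVN hx).1.continuousWithinAt)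
    (fun x hx hxA => (hVN hx).2 hxA.2.1 hxA.2.2) x hx

omit hE in
lemma mem_delPezzoLines_of_isLine {l : ℙ ℂ PlückerSpace} {π : 𝔖₆}
    {d : ℂ³} (h : IsLine l (node₁ π) (place π (vec 0 d))) :
    (l, (0 : ℂ)) ∈ delPezzoLines (actTot π 2) :=
  mem_of_isClosed_of_general (isClosed_delPezzoLines _) π (fun _ _ hξ hl => (general_mem hξ hl).1) h

lemma hasNormalCrossingChart_of_forall {z : Ambient} (hz : z ∈ blowUp E) (h0 : z.1.2 = 0)
    (hp : ∀ κ, z.1 ∉ planeLines κ) :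
    HasNormalCrossingChart (blowUp E) (fun z => z.1.2) (component E) z := by
  have hS := onSegre_of_mem (blowUp_fst hz) h0
  have hno : ∀ κ, ¬ InPl κ z.1.1 := fun κ h => hp κ (mem_planeLines_iff.2 ⟨h0, hS.1, h⟩)
  obtain ⟨π, h7, h12⟩ := hS.exists_frame hno
  obtain ⟨ξ, hξ, hl⟩ := hS.exists_general hno h7 h12
  obtain ⟨g, hg⟩ := (generalChart hE.1 π hξ).exists_solution
  have hzb : z.1 = ((generalChart hE.1 π hξ).point (0, 0)).1 := by
    refine Prod.ext ?_ h0
    rw [(isLine_iff.1 hl).2, (isLine_iff.1 ((generalChart hE.1 π hξ).isLine (0, 0))).2]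
    exact congrArg proj (congrArg₂ wedge GeneralChart.vV_zero.symm GeneralChart.vW_zero.symm)
  obtain ⟨-, hφ⟩ := generalChart_chart hE.1 π hξ hz hzb hg
  refine hasNormalCrossingChart_of_reparametrization hE hφ (G := id) analyticAt_id rfl
    (fun v hv => funext fun j => eq_zero_of_hasDerivAt_mul (hv j)) {0}
    (fun _ => Sum.inr (actTot π 2)) (by simp) (fun i => ?_) ?_ ?_
  · simp only [Finset.mem_singleton, exists_eq_left]
    cases i with
    | inl σ => simpa [mem_component_inl hE hz] using hp σ
    | inr T =>
      rw [mem_component_inr hz (notMem_distinguished_of_forall hp)]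
      constructor
      · intro h; rw [hS.eq_actTot hno (meetsPl_general hl) (mem_delPezzoLines_iff.1 h).2.2]
      · intro h
        rw [← Sum.inr_injective h, show z.1 = (z.1.1, 0) from Prod.ext rfl h0]
        exact (general_mem hξ hl).1
  · refine Filter.Eventually.of_forall fun x => ?_; rw [Finset.prod_singleton]; rfl
  · refine fun k hk => Filter.Eventually.of_forall fun x hx => ?_
    rw [Finset.mem_singleton.1 hk]
    exact (component_subset hx).2

omit hE in
lemma slope_eq_zero {π : 𝔖₆} {g₁ g₂ : ℂ} {g : ℂ³ → ℂ^5} (hga : AnalyticAt ℂ g 0) (hF : ∀ᶠ x in 𝓝 0,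
      (∀ α γ, PlaneChart.form E π g₁ g₂ (x, g x) α γ = 0) ∧ PlaneChart.nrm false (g x) = 1)
    (hg40 : g 0 4 = 0) (hadd : g₁ + g₂ = 1) (hsub : (g₁ - g₂) ^ 2 ≠ 1) {v : ℂ³}
    (v0 : v 0 = 0) (v1 : v 1 = 0) (hd : HasDerivAt (fun s : ℂ => g (s • v) 4) 0 0) : v 2 = 0 := by
  have hgl : ∀ j, HasDerivAt (fun s : ℂ => g (s • v) j) (fderiv ℂ g 0 v j) 0 :=
    hasDerivAt_line hga v
  set q : ℂ → ℂ := fun s => g (s • v) 0 + g (s • v) 1 + g (s • v) 2 + g (s • v) 3 with hq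
  have hqd := (((hgl 0).add (hgl 1)).add (hgl 2)).add (hgl 3)
  have hsd : HasDerivAt (fun s : ℂ => 1 - (1 + s * v 2) ^ 2) (-2 * v 2) 0 := by
    have := ((((hasDerivAt_id (0 : ℂ)).mul_const (v 2)).const_add 1).pow 2).const_sub 1
    simpa using this
  have hed : DifferentiableAt ℂ (fun s : ℂ => eval (place π (vec 0 ![1, 1, 1 + s * v 2])) E) 0 := by
    refine DifferentiableAt.comp (g := fun x => eval x E) 0
      (contDiff_eval E).contDiffAt.analyticAt.differentiableAt ?_
    refine (contDiff_place π (contDiff_vec (fun k => ?_)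
      fun k => ?_)).contDiffAt.analyticAt.differentiableAt
    · exact contDiff_const
    · fin_cases k <;> simp <;> fun_prop
  have hk := ((hqd.mul hsd).const_mul 6).add (hd.mul hed.hasDerivAt)
  have hk0 : HasDerivAt (fun _ : ℂ => (0 : ℂ)) 0 0 := hasDerivAt_const 0 0
  have h6 := hk.unique (hk0.congr_of_eventuallyEq ?_)
  · have hc := hF.self_of_nhds
    have e1 := hc.1 1 (-1)
    have e2 := hc.2
    rw [PlaneChart.form_zero] at e1
    simp only [PlaneChart.nrm, if_false, Bool.false_eq_true] at e2
    rw [hg40] at e1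
    have hm : g 0 0 + g 0 1 = g 0 2 + g 0 3 := by
      refine sub_eq_zero.1 ((mul_eq_zero.1 ?_).resolve_right (sub_ne_zero.2 hsub))
      grind
    simp at h6
    rw [hg40, zero_mul] at h6
    grind
  · filter_upwards [(tendsto_smul_zero v).eventually hF] with s hs
    have e3 := hs.1 1 1
    have hx : (s • v) 0 = 0 := by simp [v0]
    have hx1 : (s • v) 1 = 0 := by simp [v1]
    have hv' : (1 : ℂ) • PlaneChart.vV π g₁ (s • v, g (s • v)) + (1 : ℂ) •
        PlaneChart.vW π g₂ (s • v, g (s • v)) = place π (vec 0 ![1, 1, 1 + s * v 2]) := by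
      rw [PlaneChart.vV, PlaneChart.vW, place_combo, vec_combo]
      congr 2
      · simp [hx]
      · funext k; fin_cases k <;> simp [v1]; grind
    rw [PlaneChart.form, hv'] at e3
    simp only [hx, hx1, Pi.smul_apply, smul_eq_mul] at e3
    simp only [Pi.add_apply, Pi.mul_apply]
    have hz2 : g₂ = 1 - g₁ := by grind
    rw [hz2] at e3
    grind

omit hE in
lemma IsPlaneFrame.eq_of_mem_inr {π : 𝔖₆} {g₁ g₂ : ℂ} {par : Bool} {z : Ambient}
    (h : IsPlaneFrame π g₁ g₂ par z.1) (hz : z ∈ blowUp E) {T : Total}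
    (hm : z ∈ component E (.inr T)) : par = false ∧ T = actTot π 2 := by
  rw [mem_component_inr hz h.notMem] at hm
  obtain ⟨q, rfl⟩ := T.exists_actTot π
  have hn := node_of_meetsPl (delPezzo_isLine hm) h.line.inPl (mem_delPezzoLines_iff.1 hm).2.2
  simp only [h.line.onLine_iff] at hn
  have hs := h.sub_ne
  rcases hn with ⟨rfl, e⟩ | ⟨rfl, e⟩ | ⟨rfl, e⟩ | ⟨rfl, e⟩ <;> simp at e
  · refine ⟨?_, rfl⟩; by_contra hpar; exact h.add_ne (by simpa using hpar) (by rw [← e]; norm_num)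
  · cases par with
    | true => exact absurd (by rw [← e]; norm_num) (h.add_ne rfl)
    | false =>
      have := h.add_eq rfl
      rw [← e] at this
      norm_num at this
  exacts [absurd (by grind) hs, absurd (by grind) hs]

lemma IsPlaneFrame.hasNormalCrossingChart {π : 𝔖₆} {g₁ g₂ : ℂ} {par : Bool}
    {z : Ambient} (h : IsPlaneFrame π g₁ g₂ par z.1) (hz : z ∈ blowUp E) :
    HasNormalCrossingChart (blowUp E) (fun z => z.1.2) (component E) z := by
  obtain ⟨u, hu⟩ := h.exists_unknowns hE
  obtain ⟨g, hg⟩ := (h.chart hE hu).exists_solution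
  obtain ⟨hpt, hφ⟩ := h.chart_spec hE hu hz rfl hg
  have hlam : ∀ κ x, (h.chart hE hu).lam κ x =
    open Classical in if κ = act π 0 then x 0 else 1 := fun κ x => rfl
  have hF : ∀ᶠ x in 𝓝 0, (∀ α γ, PlaneChart.form E π g₁ g₂ (x, g x) α γ = 0) ∧
      PlaneChart.nrm par (g x) = 1 :=
    hg.eventually.mono fun x hx => (PlaneChart.eqs_eq_zero hE.1 (x, g x)).1 hx.1
  have ht : ∀ x, ((h.chart hE hu).point (x, g x)).1.2 = x 0 * g x 4 := fun x => rfl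
  have hinl : ∀ σ, z ∈ component E (.inl σ) ↔ σ = act π 0 := fun σ => by
    rw [mem_component_inl hE hz]
    exact ⟨h.eq_act, fun e => e ▸ h.mem_planeLines⟩
  have hσ : ∀ᶠ x in 𝓝 0, (h.chart hE hu).point (x, g x) ∈ component E (.inl (act π 0)) →
      x 0 = 0 := by
    filter_upwards [hg.point, hg.eventually] with x hx hx' hm
    rw [mem_component_inl hE hx.2.2, (h.chart hE hu).mem_planeLines_iff (hx'.2.2 _),
      hlam, if_pos rfl] at hm
    exact hm
  have hT := fun T => h.eq_of_mem_inr hz (T := T)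
  cases par with
  | true =>
    refine hasNormalCrossingChart_of_reparametrization hE hφ (G := id) analyticAt_id rfl
      (fun v hv => funext fun j => eq_zero_of_hasDerivAt_mul (hv j)) {0}
      (fun _ => Sum.inl (act π 0)) (by simp) (fun i => ?_) ?_ ?_
    · simp only [Finset.mem_singleton, exists_eq_left]
      cases i with
      | inl σ => rw [hinl, Sum.inl.injEq, eq_comm]
      | inr T => simpa using fun hm => absurd (hT T hm).1 (by simp)
    · filter_upwards [hF] with x hx
      have h4 : g x 4 = 1 := by simpa [PlaneChart.nrm] using hx.2
      rw [ht, h4, mul_one, Finset.prod_singleton]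
      rfl
    · intro k hk; rw [Finset.mem_singleton.1 hk]; exact hσ
  | false =>
    have hadd := h.add_eq rfl
    have hz' : z ∈ component E (.inr (actTot π 2)) := by
      have hon : OnLine z.1.1 (node₁ π) := h.line.onLine_iff.2 (by simpa using hadd.symm)
      obtain ⟨y, hy, hyl⟩ := hon.exists_isLine fun h => by
        simpa [node₁, place_eq_zero, vec_eq_zero] using h
      rw [mem_component_inr hz h.notMem, show z.1 = (z.1.1, 0) from Prod.ext rfl h.param]
      rw [eq_place_of_inPlane (h.line.inPl y hy)] at hyl
      exact mem_delPezzoLines_of_isLine hyl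
    have hg4 : ∀ᶠ x in 𝓝 0, (h.chart hE hu).point (x, g x) ∈
        component E (.inr (actTot π 2)) → g x 4 = 0 := by
      refine eventually_eq_zero hE hφ (f := fun x => g x 4) ?_ ?_
      · exact hg.eventually.mono fun x hx =>
          (continuous_apply (4 : Fin 5)).continuousAt.comp hx.2.1.continuousAt
      · filter_upwards [hg.eventually] with x hx hD hno
        have h1 := hno (act π 0)
        rw [(h.chart hE hu).mem_planeLines_iff (hx.2.2 _), hlam, if_pos rfl] at h1
        exact (mul_eq_zero.1 ((ht x).symm.trans hD.1)).resolve_left h1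
    have hg40 : g 0 4 = 0 := hg4.self_of_nhds (by rw [hg.2.1]; exact hpt.symm ▸ hz')
    have hga : AnalyticAt ℂ (fun x => g x 4) 0 := (analyticAt_pi_iff.1 hg.1) 4
    refine hasNormalCrossingChart_of_reparametrization hE hφ
      (analyticAt_vec (analyticAt_coord 0 _) hga (analyticAt_coord 1 _)) ?_ ?_ {0, 1}
      ![Sum.inl (act π 0), Sum.inr (actTot π 2), Sum.inl (act π 0)] ?_ (fun i => ?_) ?_ ?_
    · funext j; fin_cases j <;> simp [hg40]
    · intro v hv
      have v0 : v 0 = 0 := eq_zero_of_hasDerivAt_mul (hv 0)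
      have v1 : v 1 = 0 := eq_zero_of_hasDerivAt_mul (hv 2)
      exact vec_ext v0 v1 (slope_eq_zero hg.1 hF hg40 hadd h.sub_ne v0 v1 (hv 1))
    · rw [Finset.coe_pair, Set.injOn_pair]
      intro e
      cases e
    · simp only [Finset.mem_insert, Finset.mem_singleton, exists_eq_or_imp, exists_eq_left,
        cons_val]
      cases i with
      | inl σ => simp [hinl, eq_comm]
      | inr T =>
        simp only [reduceCtorEq, false_or, Sum.inr.injEq]
        exact ⟨fun hm => (hT T hm).2.symm, fun e => e ▸ hz'⟩
    · filter_upwards with x; rw [ht, Finset.prod_pair (by decide)]; rfl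
    · intro k hk
      rcases Finset.mem_insert.1 hk with rfl | hk
      · exact hσ
      · rw [Finset.mem_singleton.1 hk]; exact hg4

end Segre

namespace Segre

open ProjTop Table NodeChart

variable {E : 𝒫₆} (hE : IsAdmissible E)

namespace IsNodeFrame

section Solution

variable {π : 𝔖₆} {β : ℂ} {g : ℂ³ → ℂ^4} (hg : (chart hE π β).IsSolution g)
include hg

lemma par_zero : 24 * β + g 0 1 * eval (node₂ π) E = 0 := by
  have h := eq_of_solution hE (x := 0) (u := g 0) (π := π) (β := β)
    (by rw [show (![0, 0, 0] : ℂ³) = 0 by funext k; fin_cases k <;> rfl]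
        exact hg.eventually.self_of_nhds.1)
  rwa [add_zero] at h

lemma ne_of_notMem : ∀ᶠ x in 𝓝 0, (∀ κ, ((chart hE π β).point (x, g x)).1 ∉ planeLines κ) →
    x 0 ≠ 0 ∧ x 1 ≠ 0 := by
  filter_upwards [hg.eventually] with x hx h
  have h0 := h (act π 0)
  have h6 := h (act π 6)
  rw [(chart hE π β).mem_planeLines_iff (hx.2.2 _), lam_chart] at h0 h6
  simp [act_ne π] at h0 h6
  exact ⟨h0, h6⟩

lemma eventually_par {z : Ambient} (h : IsNodeFrame E π β z) (T : Total) : ∀ᶠ x in 𝓝 0,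
    (chart hE π β).point (x, g x) ∈ component E (.inr T) → g x 1 = 0 := by
  refine eventually_eq_zero hE (h.chart_spec hE hg).2 (f := fun x => g x 1) ?_ ?_
  · exact hg.eventually.mono fun x hx =>
      (continuous_apply (1 : Fin 4)).continuousAt.comp hx.2.1.continuousAt
  · filter_upwards [ne_of_notMem hE hg] with x hx hD hno
    exact (mul_eq_zero.1 (hD.1 : x 0 * x 1 * g x 1 = 0)).resolve_left
      (mul_ne_zero (hx hno).1 (hx hno).2)

lemma eventually_planes : ∀ᶠ x in 𝓝 0,
    ((chart hE π β).point (x, g x) ∈ component E (.inl (act π 0)) → x 0 = 0) ∧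
    ((chart hE π β).point (x, g x) ∈ component E (.inl (act π 6)) → x 1 = 0) := by
  filter_upwards [hg.point, hg.eventually] with x hx hx'
  rw [mem_component_inl hE hx.2.2, mem_component_inl hE hx.2.2,
    (chart hE π β).mem_planeLines_iff (hx'.2.2 _),
    (chart hE π β).mem_planeLines_iff (hx'.2.2 _), lam_chart, lam_chart]
  simp [act_ne π]

lemma analyticAt_par : AnalyticAt ℂ (fun x => g x 1) 0 := (analyticAt_pi_iff.1 hg.1) 1

lemma hasDerivAt_par {v : ℂ³} (v0 : v 0 = 0) (v1 : v 1 = 0)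
    (hd : HasDerivAt (fun s : ℂ => g (s • v) 1) 0 0) : v 2 = 0 := by
  have h1 : (fun s : ℂ => 24 * (β + s * v 2) + g (s • v) 1 * eval (node₂ π) E)
      =ᶠ[𝓝 0] fun _ => 0 := by
    filter_upwards [(tendsto_smul_zero v).eventually hg.eventually] with s hs
    refine eq_of_solution hE (u := g (s • v)) ?_
    rw [show (![0, 0, s * v 2] : ℂ³) = s • v by funext k; fin_cases k <;> simp [v0, v1]]
    exact hs.1
  have h2 := ((((hasDerivAt_id (0 : ℂ)).mul_const (v 2)).const_add β).const_mul 24).add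
    (hd.mul_const (eval (node₂ π) E))
  have h3 := (h2.congr_of_eventuallyEq h1.symm).unique (hasDerivAt_const 0 0)
  grind

lemma eq_zero_of_hasDerivAt {v : ℂ³} (hv : ∀ j, HasDerivAt
    (fun s : ℂ => ![(s • v) 0, (s • v) 1, g (s • v) 1] j) 0 0) : v = 0 :=
  have v0 : v 0 = 0 := eq_zero_of_hasDerivAt_mul (hv 0)
  have v1 : v 1 = 0 := eq_zero_of_hasDerivAt_mul (hv 1)
  vec_ext v0 v1 (hasDerivAt_par hE hg v0 v1 (hv 2))

end Solution

variable {π : 𝔖₆} {β : ℂ} {z : Ambient} (h : IsNodeFrame E π β z)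
include hE h

lemma notMem_inr_four : z ∉ component E (.inr (actTot π 4)) := by
  intro hm
  obtain ⟨g, hg⟩ := (chart hE π β).exists_solution
  obtain ⟨hpt, hφ⟩ := h.chart_spec hE hg
  have hV : Continuous (vV π) := contDiff_vV.continuous
  have hW : Continuous (vW π β) := contDiff_vW.continuous
  have hc : Continuous fun p : Par 4 => (p.1 1 * p.2 2 + 1) *
      (vW π β p (π 2) + vW π β p (π 5)) -
      (p.1 1 * p.2 3 + (β + p.1 2)) *
      (vV π p (π 2) + vV π p (π 5)) := by fun_prop
  have h1 := eventually_eq_zero hE hφ (T := actTot π 4) (f := fun x => (x 1 * g x 2 + 1) *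
      (vW π β (x, g x) (π 2) + vW π β (x, g x) (π 5)) -
      (x 1 * g x 3 + (β + x 2)) *
      (vV π (x, g x) (π 2) + vV π (x, g x) (π 5)))
    (hg.eventually.mono fun x hx => ContinuousAt.comp (f := fun x => (x, g x)) hc.continuousAt
      (continuousAt_id.prodMk hx.2.1.continuousAt)) ?_
  · have h2 := h1.self_of_nhds (by rw [hg.2.1]; exact hpt.symm ▸ hm)
    simp [vV, vW, vec] at h2
  · filter_upwards [ne_of_notMem hE hg] with x hx hD hno
    have h3 := (((chart hE π β).isLine (x, g x)).meets_iff _).1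
      ((mem_delPezzoLines_iff.1 hD).2.2 _ ((mem_actTot 2).2 (by decide)))
    have h4 := congrFun (congrFun h3 (π 0)) (π 2)
    have e0 : ∀ y, symm (act π 2) y (π 0) = y (π 0) + y (π 1) := fun y => by
      rw [symm, act_apply]; rfl
    have e2 : ∀ y, symm (act π 2) y (π 2) = y (π 2) + y (π 5) := fun y => by
      rw [symm, act_apply]; rfl
    have eV : vV π (x, g x) (π 0) + vV π (x, g x) (π 1) =
        2 * x 0 * (x 1 * g x 2 + 1) := by simp [vV, vec]; ring
    have eW : vW π β (x, g x) (π 0) + vW π β (x, g x) (π 1) =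
        2 * x 0 * (x 1 * g x 3 + (β + x 2)) := by simp [vW, vec]; ring
    simp only [wedge, e0, e2] at h4
    change (vV π (x, g x) (π 0) + vV π (x, g x) (π 1)) *
      (vW π β (x, g x) (π 2) + vW π β (x, g x) (π 5)) -
      (vV π (x, g x) (π 2) + vV π (x, g x) (π 5)) *
      (vW π β (x, g x) (π 0) + vW π β (x, g x) (π 1)) = 0 at h4
    rw [eV, eW] at h4
    refine (mul_eq_zero.1 ?_).resolve_left (mul_ne_zero two_ne_zero (hx hno).1)
    grind

lemma eq_of_mem_inr {T : Total} (hm : z ∈ component E (.inr T)) : T = actTot π 2 ∧ β = 0 := by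
  obtain ⟨g, hg⟩ := (chart hE π β).exists_solution
  have hpt := (h.chart_spec hE hg).1
  refine ⟨?_, ?_⟩
  · have hD := (component_inr_subset hm).2
    obtain ⟨q, rfl⟩ := T.exists_actTot π
    have hn := node_of_meetsPl (delPezzo_isLine hD) (mem_planeLines_iff.1 h.mem_planes.1).2.2
      (mem_delPezzoLines_iff.1 hD).2.2
    have hon : ∀ d : ℂ³, OnLine z.1.1 (place π (vec 0 d)) → d 0 = d 1 := by
      intro d hd
      obtain ⟨a, c, e⟩ := h.line.onLine_iff.1 hd
      rw [node₁, node₂, place_combo, vec_combo] at e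
      have e0 := congrFun e (π 0)
      have e2 := congrFun e (π 2)
      rw [place_apply, place_apply] at e0 e2
      simp [vec] at e0 e2
      rw [e0, e2]
    rcases hn with ⟨rfl, e⟩ | ⟨rfl, e⟩ | ⟨rfl, e⟩ | ⟨rfl, e⟩
    · rfl
    · exact absurd hm (h.notMem_inr_four hE)
    · have := hon _ e; norm_num at this
    · have := hon _ e; norm_num at this
  · have h1 := (eventually_par hE hg h T).self_of_nhds (by rw [hg.2.1]; exact hpt.symm ▸ hm)
    have h2 := par_zero hE hg
    rw [h1] at h2
    simpa using h2

lemma eq_of_frame {z' : Ambient} (h' : IsNodeFrame E π β z') : z = z' := by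
  obtain ⟨g, hg⟩ := (chart hE π β).exists_solution
  exact (h.chart_spec hE hg).1.symm.trans (h'.chart_spec hE hg).1

lemma mem_inr (hβ : β = 0) : z ∈ component E (.inr (actTot π 2)) := by
  have hD : z.1 ∈ delPezzoLines (actTot π 2) := by
    rw [show z.1 = (z.1.1, 0) from Prod.ext rfl h.param]
    exact mem_delPezzoLines_of_isLine h.line
  rw [← image_fst_component_inr hE] at hD
  obtain ⟨z', hz', e⟩ := hD
  rcases isNodeFrame_or (z := z') hE (component_subset hz').1 (component_subset hz').2
    (e ▸ h.line) with ⟨β', h'⟩ | h'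
  · obtain rfl := (h'.eq_of_mem_inr hE hz').2; subst hβ; exact h.eq_of_frame hE h' ▸ hz'
  · exact absurd (h'.eq_of_mem_inr hE hz').1.symm (actTot_flip_ne π)

lemma mem_inl_iff (σ : Syntheme) : z ∈ component E (.inl σ) ↔ σ = act π 0 ∨ σ = act π 6 := by
  rw [mem_component_inl hE h.mem]
  exact ⟨fun hσ => eq_or_eq_of_mem (act_ne π).symm h.mem_planes.1 h.mem_planes.2 hσ,
    by rintro (rfl | rfl); exacts [h.mem_planes.1, h.mem_planes.2]⟩

lemma hasNormalCrossingChart :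
    HasNormalCrossingChart (blowUp E) (fun z => z.1.2) (component E) z := by
  obtain ⟨g, hg⟩ := (chart hE π β).exists_solution
  obtain ⟨hpt, hφ⟩ := h.chart_spec hE hg
  have ht : ∀ x, ((chart hE π β).point (x, g x)).1.2 = x 0 * x 1 * g x 1 := fun x => rfl
  have hpl := eventually_planes hE hg
  have hga := analyticAt_par hE hg
  have hp : ∀ j : Fin 3, AnalyticAt ℂ (fun x : ℂ³ => x j) 0 := fun j => analyticAt_coord j _
  have h0 := par_zero hE hg
  have hne : Sum.inl (act π 0) ≠ (Sum.inl (act π 6) : Syntheme ⊕ Total) := fun e =>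
    act_ne π (Sum.inl_injective e).symm
  by_cases hβ : β = 0
  · refine hasNormalCrossingChart_of_reparametrization hE hφ
      (analyticAt_vec (hp 0) (hp 1) hga) ?_ (fun v => eq_zero_of_hasDerivAt hE hg) Finset.univ
      ![Sum.inl (act π 0), Sum.inl (act π 6), Sum.inr (actTot π 2)] ?_ (fun i => ?_) ?_ ?_
    · have : g 0 1 = 0 := by simpa [hβ, (eval_node hE π).2] using h0
      funext j; fin_cases j <;> simp [this]
    · intro a _ b _ hab
      fin_cases a <;> fin_cases b <;>
        first | rfl | exact absurd hab hne | exact absurd hab hne.symm | exact absurd hab nofun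
    · simp only [Finset.mem_univ, true_and, Fin.exists_fin_succ, Fin.succ_zero_eq_one,
        Fin.succ_one_eq_two, cons_val, IsEmpty.exists_iff, or_false]
      cases i with
      | inl σ => simp [h.mem_inl_iff hE, eq_comm]
      | inr T =>
        simp only [reduceCtorEq, false_or, Sum.inr.injEq]
        exact ⟨fun hm => (h.eq_of_mem_inr hE hm).1.symm, fun e => e ▸ h.mem_inr hE hβ⟩
    · filter_upwards with x; rw [ht, Fin.prod_univ_three]; rfl
    · intro k _
      fin_cases k
      exacts [hpl.mono fun x hx => hx.1, hpl.mono fun x hx => hx.2, eventually_par hE hg h _]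
  · have hg0 : g 0 1 ≠ 0 := fun e => hβ (by simpa [e] using h0)
    refine hasNormalCrossingChart_of_reparametrization hE hφ
      (analyticAt_vec (hp 0) ((hp 1).mul hga) (hp 2)) ?_ ?_ {0, 1}
      ![Sum.inl (act π 0), Sum.inl (act π 6), Sum.inl (act π 0)] ?_ (fun i => ?_) ?_ ?_
    · funext j; fin_cases j <;> simp
    · intro v hv
      have v1 : v 1 = 0 := by
        have h1 := (((hasDerivAt_id (0 : ℂ)).mul_const (v 1)).mul
          (hasDerivAt_line hg.1 v 1)).unique (hv 1)
        simpa [hg0] using h1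
      exact vec_ext (eq_zero_of_hasDerivAt_mul (hv 0)) v1 (eq_zero_of_hasDerivAt_mul (hv 2))
    · rw [Finset.coe_pair, Set.injOn_pair]; exact fun e => absurd e hne
    · simp only [Finset.mem_insert, Finset.mem_singleton, exists_eq_or_imp, exists_eq_left,
        cons_val]
      cases i with
      | inl σ => simp [h.mem_inl_iff hE, eq_comm]
      | inr T => simpa using fun hm => hβ (h.eq_of_mem_inr hE hm).2
    · filter_upwards with x; rw [ht, Finset.prod_pair (by decide), mul_assoc]; rfl
    · intro k hk
      rcases Finset.mem_insert.1 hk with rfl | hk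
      · exact hpl.mono fun x hx => hx.1
      · rw [Finset.mem_singleton.1 hk]
        refine hpl.mono fun x hx hm => ?_
        change x 1 * g x 1 = 0
        rw [hx.2 hm, zero_mul]

end IsNodeFrame

include hE

lemma hasNormalCrossingChart {z : Ambient} (hz : z ∈ blowUp E) (h0 : z.1.2 = 0) :
    HasNormalCrossingChart (blowUp E) (fun z => z.1.2) (component E) z := by
  by_cases hp : ∃ σ, z.1 ∈ planeLines σ
  · obtain ⟨σ, hσ⟩ := hp
    by_cases hd : z.1 ∈ distinguished
    · obtain ⟨π, β, -, h⟩ := exists_isNodeFrame hE hz hσ hd; exact h.hasNormalCrossingChart hE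
    · obtain ⟨π, g₁, g₂, par, -, h⟩ := exists_isPlaneFrame hσ hd
      exact h.hasNormalCrossingChart hE hz
  · push Not at hp; exact hasNormalCrossingChart_of_forall hE hz h0 hp

end Segre

namespace Segre

open ProjTop Table NodeChart IsNodeFrame

lemma HasBaseSection.mono {S S' : Set Ambient} {z : Ambient} (h : HasBaseSection S z)
    (hS : S' ⊆ S) : HasBaseSection S' z := by
  obtain ⟨ι, i, X, φ, h1, h2, h3⟩ := h
  exact ⟨ι, i, X, φ, h1, h2, h3.filter_mono (nhdsWithin_mono z hS)⟩

variable {E : 𝒫₆} (hE : IsAdmissible E)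

lemma hasBaseSection_of_forall {z : Ambient} (hz : z ∈ blowUp E) (hp : ∀ κ, z.1 ∉ planeLines κ) :
    HasBaseSection (blowUp E) z := by
  obtain ⟨a, c, hb⟩ := exists_bracket_ne_zero z.1.1
  have hl := blowUp_isLine hz hb
  let e := Fintype.equivFin ((Fin 6 × Fin 6) ⊕ Unit)
  let p : ℂ^_ → PlückerSpace := fun v i j => v (e (Sum.inl (i, j)))
  let t : ℂ^_ → ℂ := fun v => v (e (Sum.inr ()))
  let X : Base → ℂ^_ := fun b k =>
    Sum.elim (fun q : Fin 6 × Fin 6 => sect (bracket a c) b.1 q.1 q.2) (fun _ => b.2) (e.symm k)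
  have hpX : ∀ b, p (X b) = sect (bracket a c) b.1 := fun b => by funext i j; simp [p, X]
  have htX : ∀ b, t (X b) = b.2 := fun b => by simp [t, X]
  have key : ∀ y ∈ blowUp E, bracket a c y.1.1.rep ≠ 0 → ∀ κ, y.1 ∉ planeLines κ →
      generators κ (sect (bracket a c) y.1.1) y.1.2 ≠ 0 ∧
      y.2 κ = proj (generators κ (sect (bracket a c) y.1.1) y.1.2) := by
    intro y hy hby κ hκ
    have hly := blowUp_isLine hy hby
    obtain ⟨r, hr⟩ := (proj_eq_proj_iff (isLine_iff.1 hly).1 (sect_ne_zero _ hby)).1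
      ((isLine_iff.1 hly).2.symm.trans (proj_sect _ hby).symm)
    have hr0 : r ≠ 0 := fun h => (isLine_iff.1 hly).1 (by rw [← hr, h, zero_smul])
    have h1 := (generators_ne_zero_iff (σ := κ) hly).2 hκ
    rw [← hr, generators_smul] at h1
    exact ⟨(smul_ne_zero_iff.1 h1).2, by rw [blowUp_snd hy hκ hly, ← hr, generators_smul,
      proj_smul hr0]⟩
  have ha := fun k => analyticAt_coord k (X z.1)
  have hap : AnalyticAt ℂ p (X z.1) :=
    analyticAt_pi_iff.2 fun i => analyticAt_pi_iff.2 fun j => ha _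
  have hhol : HolomorphicAt (fun v => (((proj (p v), t v), fun κ => proj (generators κ (p v) (t v))) :
      Ambient)) (X z.1) := by
    refine holomorphicAt_prod.2 ⟨holomorphicAt_prod.2 ⟨holomorphicAt_proj hap ?_,
      holomorphicAt_complex.2 (ha _)⟩, holomorphicAt_pi.2 fun κ => holomorphicAt_proj ?_ ?_⟩
    · rw [hpX]; exact sect_ne_zero _ hb
    · refine AnalyticAt.prod ?_ ?_
      exacts [analyticAt_pi_iff.2 fun i => analyticAt_pi_iff.2 fun j => (ha _).add (ha _),
        (ha _).smul hap]
    · rw [hpX, htX]; exact (key z hz hb κ (hp κ)).1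
  refine ⟨_, inferInstance, X, _, fun k => ?_, fun c hc hzc => (hhol c hc ?_).differentiableAt, ?_⟩
  · obtain ⟨s, rfl⟩ := e.surjective k
    rcases s with ⟨i, j⟩ | u
    · exact ⟨_, coords_sect_base (bracket a c)
        ((LinearMap.proj j : Dual ℂ ℂ⁶).comp (LinearMap.proj i)), hb, 0, fun b => by simp [X]⟩
    · exact (isCoordinate_par _).congr 0 fun b => by simp [X]
  · convert! hzc using 1
    refine Prod.ext (Prod.ext ?_ (htX _)) (funext fun κ => ?_)
    · change proj (p (X z.1)) = _; rw [hpX]; exact proj_sect _ hb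
    · change proj (generators κ (p (X z.1)) (t (X z.1))) = _
      rw [hpX, htX]; exact (key z hz hb κ (hp κ)).2.symm
  · have hopen : ∀ κ, ∀ᶠ y : Ambient in 𝓝 z, y.1 ∉ planeLines κ := fun κ =>
      ((isClosed_planeLines κ).preimage continuous_fst).isOpen_compl.mem_nhds (hp κ)
    filter_upwards [self_mem_nhdsWithin, nhdsWithin_le_nhds (eventually_bracket' hb),
      nhdsWithin_le_nhds (Filter.eventually_all.2 hopen)] with y hy hby hpy
    refine Prod.ext (Prod.ext ?_ (htX _).symm) (funext fun κ => ?_)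
    · change _ = proj (p (X y.1)); rw [hpX]; exact (proj_sect _ hby).symm
    · change _ = proj (generators κ (p (X y.1)) (t (X y.1)))
      rw [hpX, htX]; exact (key y hy hby κ (hpy κ)).2

include hE

lemma hasBaseSection_blowUp {z : Ambient} (hz : z ∈ blowUp E) (hd : z.1 ∉ distinguished) :
    HasBaseSection (blowUp E) z := by
  by_cases hp : ∀ κ, z.1 ∉ planeLines κ
  · exact hasBaseSection_of_forall hz hp
  push Not at hp
  obtain ⟨σ, hσ⟩ := hp
  obtain ⟨π, g₁, g₂, par, -, h⟩ := exists_isPlaneFrame hσ hd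
  obtain ⟨u, hu⟩ := h.exists_unknowns hE
  obtain ⟨g, hg⟩ := (h.chart hE hu).exists_solution
  obtain ⟨hpt, hφ⟩ := h.chart_spec hE hu hz rfl hg
  have hb := (h.chart hE hu).bracket_ne (0, u)
  have hX := planeChart_readX hE.1 (act_apply π 0) (h.eq_zero hE) h.not_inPlane hu
  refine hasBaseSection_of_chart (X := PlaneChart.readX π g₁ g₂ par)
    (PlaneChart.readX_coords π g₁ g₂ par (by rw [← hpt]; exact hb))
    hg.point.self_of_nhds.1 (by rw [hg.2.1]; exact hpt) ?_
    (hg.eventually.mono fun x hx => hX _ hx.1) (IsChartAt.eventually_mem_image hφ)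
  rw [← hpt]
  exact hX (0, u) hu

lemma hasBaseSection_component_inr {z : Ambient} {T : Total} (hz : z ∈ component E (.inr T)) :
    HasBaseSection (component E (.inr T)) z := by
  have hsub : component E (.inr T) ⊆ blowUp E := fun y hy => (component_subset hy).1
  by_cases hd : z.1 ∈ distinguished
  swap
  · exact (hasBaseSection_blowUp hE (hsub hz) hd).mono hsub
  obtain ⟨σ, -, -, hσ, -⟩ := exists_planes_of_distinguished hd
  obtain ⟨π, β, -, h⟩ := exists_isNodeFrame hE (hsub hz) hσ hd
  obtain ⟨rfl, rfl⟩ := h.eq_of_mem_inr hE hz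
  obtain ⟨g, hg⟩ := (chart hE π 0).exists_solution
  obtain ⟨hpt, hφ⟩ := h.chart_spec hE hg
  have hG := analyticAt_vec (analyticAt_coord 0 _) (analyticAt_coord 1 _) (analyticAt_par hE hg)
  have hpar := h.eventually_par hE hg (actTot π 2)
  have hg0 : g 0 1 = 0 := hpar.self_of_nhds (by rw [hg.2.1]; exact hpt.symm ▸ hz)
  obtain ⟨H, hH, -, hH0, hGH, -, hφH⟩ := exists_reparametrization hφ hG
    (by funext j; fin_cases j <;> simp [hg0]) fun v hv =>
      eq_zero_of_hasDerivAt hE hg fun j => by simpa [hv] using hasDerivAt_line hG v j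
  obtain ⟨V, -, hV⟩ := hφH _ univ_mem
  let X : Base → ℂ^2 := fun b =>
    ![mL π (lineFst (aVec π) (cVec π) b.1), dL π (lineSnd (aVec π) (cVec π) b.1)]
  have hX : ∀ p, X ((chart hE π 0).point p).1 = ![p.1 0, p.1 1] := fun p => by
    have h1 := (nodeChart_readX hE.1 (act_apply π 0) (act_apply π 6) (eval_node hE π).1
      (eval_node hE π).2 (β := 0) p).1
    funext j
    fin_cases j
    exacts [congrFun h1 0, congrFun h1 1]
  have hXz : X z.1 = 0 := by rw [← hpt, hX]; funext j; fin_cases j <;> rfl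
  have hb := (isLine_normalized h.line).1
  let ι : ℂ^2 → ℂ³ := fun y => ![y 0, y 1, 0]
  have hι0 : ι 0 = 0 := by funext j; fin_cases j <;> rfl
  have hι : DifferentiableAt ℂ ι 0 := differentiableAt_pi.2 fun j => by
    fin_cases j
    exacts [differentiableAt_apply 0 0, differentiableAt_apply 1 0, differentiableAt_const 0]
  refine ⟨Fin 2, inferInstance, X, fun y => (chart hE π 0).point
    (H (ι y), g (H (ι y))), fun j => ?_, fun c hc hzc => ?_, ?_⟩
  · fin_cases j
    exacts [((isCoordinate_line hb (mL π) 0).congr 0 fun b => by simp [X]),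
      ((isCoordinate_line hb 0 (dL π)).congr 0 fun b => by simp [X])]
  · rw [hXz]
    refine DifferentiableAt.comp (g := c.2 ∘ (fun x => (chart hE π 0).point
      (x, g x)) ∘ H) (f := ι) 0 ?_ hι
    rw [hι0]
    exact (hV.holomorphic 0 hV.zero_mem c hc (hV.map_zero ▸ hzc)).differentiableAt
  · have hHt : Tendsto H (𝓝 0) (𝓝 0) := by simpa [ContinuousAt, hH0] using hH.continuousAt
    have := (IsChartAt.eventually_mem_image hφH _ (hGH.and (hHt.eventually hpar))).filter_mono
      (nhdsWithin_mono z hsub)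
    filter_upwards [this, self_mem_nhdsWithin] with w hw hwT
    obtain ⟨x, ⟨hx1, hx2⟩, rfl⟩ := hw
    have e2 : x 2 = 0 := by rw [← hx1]; exact hx2 hwT
    have e : ι (X ((chart hE π 0).point (H x, g (H x))).1) = x :=
      (congrArg ι (hX _)).trans (vec_ext (congrFun hx1 0) (congrFun hx1 1) e2.symm)
    exact congrArg (fun y => (chart hE π 0).point (H y, g (H y))) e.symm

end Segre

lemma isConnected_image_ne_zero {X : Type*} [TopologicalSpace X] {f : ℂ^2 → X}
    (hf : ContinuousOn f {v | v ≠ 0}) : IsConnected (f '' {v | v ≠ 0}) :=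
  (isConnected_compl_singleton_of_one_lt_rank (by
    rw [← Module.finrank_eq_rank, Nat.one_lt_cast, ← Module.finrank_mul_finrank ℝ ℂ]
    simp) 0).image f hf

namespace Segre

open ProjTop Table NodeChart

variable {E : 𝒫₆} (hE : IsAdmissible E)
include hE

/-! ## The fibres over the distinguished points -/

lemma eq_total {z : Ambient} {T T' : Total} (h : z ∈ component E (.inr T))
    (h' : z ∈ component E (.inr T')) : T = T' := by
  obtain ⟨hz, h0⟩ := component_subset h
  by_cases hp : ∃ σ, z.1 ∈ planeLines σ
  · obtain ⟨σ, hσ⟩ := hp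
    by_cases hd : z.1 ∈ distinguished
    · obtain ⟨π, β, -, hf⟩ := exists_isNodeFrame hE hz hσ hd
      rw [(hf.eq_of_mem_inr hE h).1, (hf.eq_of_mem_inr hE h').1]
    · obtain ⟨π, g₁, g₂, par, -, hf⟩ := exists_isPlaneFrame hσ hd
      rw [(hf.eq_of_mem_inr hz h).2, (hf.eq_of_mem_inr hz h').2]
  · push Not at hp
    have hS := onSegre_of_mem (blowUp_fst hz) h0
    have hno : ∀ κ, ¬ InPl κ z.1.1 := fun κ h => hp κ (mem_planeLines_iff.2 ⟨h0, hS.1, h⟩)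
    obtain ⟨π, h7, h12⟩ := hS.exists_frame hno
    obtain ⟨ξ, hξ, hl⟩ := hS.exists_general hno h7 h12
    have hm := fun T (h : z ∈ component E (.inr T)) => hS.eq_actTot hno (meetsPl_general hl)
      (mem_delPezzoLines_iff.1 (component_inr_subset h).2).2.2
    rw [hm T h, hm T' h']

lemma injOn_fst_component_inr {T : Total} : Set.InjOn Prod.fst (component E (.inr T)) := by
  intro z' hz' z hz h
  have hzb := (component_subset hz).1
  have hzb' := (component_subset hz').1
  by_cases hd : z.1 ∈ distinguished
  swap
  · exact eq_of_fst_eq hE hzb hzb' hd h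
  obtain ⟨σ, -, -, hσ, -⟩ := exists_planes_of_distinguished hd
  obtain ⟨π, β, -, hf⟩ := exists_isNodeFrame hE hzb hσ hd
  obtain ⟨rfl, rfl⟩ := hf.eq_of_mem_inr hE hz
  rcases isNodeFrame_or hE hzb' (h ▸ hf.param) (h ▸ hf.line) with ⟨β', h'⟩ | h'
  · obtain rfl := (h'.eq_of_mem_inr hE hz').2; exact h'.eq_of_frame hE hf
  · exact absurd (h'.eq_of_mem_inr hE hz').1.symm (actTot_flip_ne π)

lemma exists_isNodeFrame_of_isLine {b : Base} {π : 𝔖₆} (h0 : b.2 = 0)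
    (hl : IsLine b.1 (node₁ π) (node₂ π)) (β : ℂ) : ∃ z, z.1 = b ∧ IsNodeFrame E π β z := by
  set D := IsNodeFrame.chart hE π β with hD
  obtain ⟨g, hg⟩ := D.exists_solution
  obtain ⟨h1, h2⟩ := nodeChart_readX hE.1 (act_apply π 0) (act_apply π 6) (eval_node hE π).1
    (eval_node hE π).2 (β := β) (0, D.u₀)
  have e0 : (![0, 0, 0] : ℂ³) = 0 := by funext k; fin_cases k <;> rfl
  have e1 : D.V (0, D.u₀) = node₁ π := by rw [← vV_zero D.u₀ 0, e0]; rfl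
  have e2 : D.W (0, D.u₀) = node₂ π := by rw [← vW_zero (β := β) D.u₀ 0, e0]; rfl
  have hline := D.isLine (0, D.u₀)
  rw [e1, e2] at hline
  have ht : (D.point (0, D.u₀)).1.2 = 0 := by change (0 : ℂ³) 0 * (0 : ℂ³) 1 * _ = _; simp
  refine ⟨D.point (0, D.u₀), Prod.ext ?_ (ht.trans h0.symm), hg.point_zero, ht, hline, h2, ?_⟩
  · rw [(isLine_iff.1 hline).2, (isLine_iff.1 hl).2]
  · exact sub_eq_zero.1 (congrFun h1 2)

/-- The coordinate on the fibre over a distinguished point. -/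
def fibreCoord (π : 𝔖₆) (z : Ambient) : ℙ ℂ ℂ^2 :=
  proj ![nA π (z.2 (act π 0)).rep, nB π (z.2 (act π 0)).rep]

omit hE in
lemma IsNodeFrame.fibreCoord_eq {π : 𝔖₆} {β : ℂ} {z : Ambient}
    (h : IsNodeFrame E π β z) : fibreCoord π z = proj ![1, β] := by
  rw [fibreCoord, ← h.eq, ← proj_smul (v := ![1, _]) h.ne]
  congr 1
  simp [sect, h.ne]

omit hE in
lemma IsNodeFrame.fibreCoord_flip {π : 𝔖₆} {z : Ambient}
    (h : IsNodeFrame E (flip π) 0 z) : nB π (z.2 (act π 0)).rep ≠ 0 ∧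
      fibreCoord π z = proj ![0, 1] := by
  have h1 := h.ne
  have h2 := h.eq
  have h3 := form_flip (flip π) (z.2 (act π 0)).rep
  have hff : flip (flip π) = π := by rw [flip, flip, mul_assoc, Equiv.swap_mul_self, mul_one]
  rw [(act_flip π).1, form_flip, neg_ne_zero] at h1
  rw [(act_flip π).1, sect, map_smul, form_flip, smul_eq_mul, mul_eq_zero] at h2
  have h4 := h2.resolve_left (inv_ne_zero (neg_ne_zero.2 h1))
  rw [hff, h4, neg_zero] at h3
  refine ⟨h1, ?_⟩
  rw [fibreCoord, h3, ← proj_smul (v := ![0, 1]) h1]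
  simp

omit hE in
lemma isCompact_inter_fst {S : Set Ambient} (hS : IsClosed S) {K : Set Base} (hK : IsCompact K) :
    IsCompact (S ∩ Prod.fst ⁻¹' K) := by
  have : S ∩ Prod.fst ⁻¹' K = S ∩ K ×ˢ Set.univ := by ext z; simp
  rw [this]
  exact (hK.prod isCompact_univ).inter_left hS

lemma fibre_homeomorph {b : Base} (hb : b ∈ distinguished) :
    Nonempty ({z ∈ blowUp E | z.1 = b} ≃ₜ ℙ ℂ ℂ^2) := by
  obtain ⟨σ, σ', hne, hσ, hσ'⟩ := exists_planes_of_distinguished hb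
  obtain ⟨π, rfl, rfl, hl⟩ := exists_frame_of_mem hne hσ hσ'
  have hor : ∀ z : {z ∈ blowUp E | z.1 = b},
      (∃ β, IsNodeFrame E π β z) ∨ IsNodeFrame E (flip π) 0 z.1 := fun ⟨z, hz, e⟩ =>
    isNodeFrame_or hE hz (e ▸ hb.1) (e ▸ hl)
  have hlf : IsLine b.1 (node₁ (flip π)) (node₂ (flip π)) :=
    OnLine.isLine ((node_flip π).1 ▸ hl.onLine_right) ((node_flip π).2 ▸ hl.onLine_left)
      (wedge_nodes_ne _)
  have hv : ∀ β : ℂ, (![1, β] : ℂ^2) ≠ 0 := fun β h => one_ne_zero (congrFun h 0)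
  have hv' : (![0, 1] : ℂ^2) ≠ 0 := fun h => one_ne_zero (congrFun h 1)
  have hn1 : ∀ β : ℂ, proj ![1, β] ≠ proj (![0, 1] : ℂ^2) := fun β h => by
    obtain ⟨r, hr⟩ := (proj_eq_proj_iff (hv β) hv').1 h
    simpa using congrFun hr 0
  let f : {z ∈ blowUp E | z.1 = b} → ℙ ℂ ℂ^2 := fun z => fibreCoord π z
  have hf : Continuous f := by
    refine continuous_iff_continuousAt.2 fun z => ?_
    obtain ⟨N, hN⟩ := exists_dual_ne_zero (z.1.2 (act π 0)).rep_nonzero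
    have h1 : ContinuousAt (fun y : {z ∈ blowUp E | z.1 = b} => sect N (y.1.2 (act π 0))) z :=
      ContinuousAt.comp (f := fun y : {z ∈ blowUp E | z.1 = b} => y.1.2 (act π 0))
        (continuousAt_sect N hN)
        ((continuous_apply _).comp (continuous_snd.comp continuous_subtype_val)).continuousAt
    have hL : Continuous fun Z => ![nA π Z, nB π Z] := by
      refine continuous_pi fun k => ?_
      fin_cases k
      exacts [continuous_dual (nA π), continuous_dual (nB π)]
    have h0 : ![nA π (z.1.2 (act π 0)).rep, nB π (z.1.2 (act π 0)).rep] ≠ 0 := fun h => by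
      rcases hor z with ⟨β, h'⟩ | h'
      exacts [h'.ne (congrFun h 0), h'.fibreCoord_flip.1 (congrFun h 1)]
    have hs : ∀ y : Ambient, ![nA π (sect N (y.2 (act π 0))), nB π (sect N (y.2 (act π 0)))] =
        (N (y.2 (act π 0)).rep)⁻¹ • ![nA π (y.2 (act π 0)).rep, nB π (y.2 (act π 0)).rep] :=
      fun y => by simp [sect]
    refine ((continuousAt_proj (v := ![nA π (sect N (z.1.2 (act π 0))),
      nB π (sect N (z.1.2 (act π 0)))]) ?_).comp
        (f := fun y : {z ∈ blowUp E | z.1 = b} => ![nA π (sect N (y.1.2 (act π 0))),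
          nB π (sect N (y.1.2 (act π 0)))]) (hL.continuousAt.comp h1)).congr ?_
    · rw [hs]; exact smul_ne_zero (inv_ne_zero hN) h0
    · filter_upwards [continuous_subtype_val.continuousAt.eventually (eventually_dual_ne_zero hN)]
        with y hy
      exact (congrArg proj (hs y)).trans (proj_smul (inv_ne_zero hy))
  have hbij : Function.Bijective f := by
    refine ⟨fun z z' h => Subtype.ext ?_, fun x => ?_⟩
    · change fibreCoord π z = fibreCoord π z' at h
      rcases hor z with ⟨β, h1⟩ | h1 <;> rcases hor z' with ⟨β', h2⟩ | h2
      · rw [h1.fibreCoord_eq, h2.fibreCoord_eq] at h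
        obtain ⟨r, hr⟩ := (proj_eq_proj_iff (hv β) (hv β')).1 h
        have e1 : r = 1 := by simpa using congrFun hr 0
        have e2 : β' = β := by simpa [e1] using congrFun hr 1
        exact h1.eq_of_frame hE (e2 ▸ h2)
      · rw [h1.fibreCoord_eq, h2.fibreCoord_flip.2] at h; exact absurd h (hn1 β)
      · rw [h1.fibreCoord_flip.2, h2.fibreCoord_eq] at h; exact absurd h.symm (hn1 β')
      · exact h1.eq_of_frame hE h2
    · have hx : x.rep = ![x.rep 0, x.rep 1] := by funext k; fin_cases k <;> rfl
      have hx' : x = proj ![x.rep 0, x.rep 1] := by conv_lhs => rw [← proj_rep x, hx]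
      by_cases h0 : x.rep 0 = 0
      · obtain ⟨z, hz, h⟩ := exists_isNodeFrame_of_isLine hE hb.1 hlf 0
        refine ⟨⟨z, h.mem, hz⟩, h.fibreCoord_flip.2.trans ?_⟩
        have h1 : x.rep 1 ≠ 0 := fun h1 => x.rep_nonzero (by
          rw [hx, h0, h1]; funext k; fin_cases k <;> rfl)
        conv_rhs => rw [hx', h0]
        rw [ ← proj_smul (v := ![0, 1]) h1]
        simp
      · obtain ⟨z, hz, h⟩ := exists_isNodeFrame_of_isLine hE hb.1 hl (x.rep 1 / x.rep 0)
        refine ⟨⟨z, h.mem, hz⟩, h.fibreCoord_eq.trans ?_⟩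
        conv_rhs => rw [hx']
        rw [← proj_smul (v := ![1, _]) h0]
        simp [mul_div_cancel₀ _ h0]
  have : CompactSpace {z ∈ blowUp E | z.1 = b} := isCompact_iff_compactSpace.1
    (isCompact_inter_fst (isClosed_blowUp E) (isCompact_singleton (x := b)))
  exact ⟨(show Continuous (Equiv.ofBijective f hbij) from hf).homeoOfEquivCompactToT2⟩

omit hE in
lemma eq_of_mem_planeLines {σ σ' : Syntheme} (hne : σ ≠ σ') {b b' : Base}
    (h : b ∈ planeLines σ ∧ b ∈ planeLines σ') (h' : b' ∈ planeLines σ ∧ b' ∈ planeLines σ') :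
    b' = b := by
  obtain ⟨π, rfl, rfl, hl⟩ := exists_frame_of_mem hne h.1 h.2
  refine Prod.ext ?_ (h'.1.1.trans h.1.1.symm)
  rw [(isLine_iff.1 hl).2, (isLine_iff.1 (isLine_nodes h'.1 h'.2)).2]

lemma inter_inl {σ σ' : Syntheme} (hne : σ ≠ σ') {b : Base}
    (h : b ∈ planeLines σ ∧ b ∈ planeLines σ') :
    component E (.inl σ) ∩ component E (.inl σ') = {z ∈ blowUp E | z.1 = b} := by
  rw [component_inl hE, component_inl hE]
  refine Set.Subset.antisymm (fun z hz => ⟨hz.1.1, eq_of_mem_planeLines hne h ⟨hz.1.2, hz.2.2⟩⟩) ?_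
  rintro z ⟨hz, rfl⟩
  exact ⟨⟨hz, h.1⟩, hz, h.2⟩

lemma isConnected_fibre {b : Base} (hb : b ∈ distinguished) :
    IsConnected {z ∈ blowUp E | z.1 = b} := by
  obtain ⟨e⟩ := fibre_homeomorph hE hb
  have h1 := isConnected_image_ne_zero (f := proj) continuousOn_proj
  rw [Set.eq_univ_of_forall (s := proj '' _) fun x => ⟨x.rep, x.rep_nonzero, proj_rep x⟩] at h1
  have h2 := h1.image (fun x => (e.symm x).1)
    (continuous_subtype_val.comp e.symm.continuous).continuousOn
  convert! h2
  ext z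
  constructor
  · exact fun hz => ⟨e ⟨z, hz⟩, trivial, by simp⟩
  · rintro ⟨x, -, rfl⟩; exact (e.symm x).2

end Segre

namespace Segre

open ProjTop Table NodeChart

variable {E : 𝒫₆} (hE : IsAdmissible E)
include hE

/-! ## Connectedness of the components and of their intersections -/

lemma isConnected_strictTransform {C D : Set Base} (hC : IsConnected C)
    (hF : ∀ b ∈ C, OnSegre b.1 ∧ b.2 = 0 ∧ b ∉ distinguished) (hCD : C ⊆ D)
    (hDC : ∀ K, IsClosed K → C ⊆ K → D ⊆ K) : IsConnected (strictTransform E D) := by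
  set A := {z ∈ blowUp E | z.1 ∈ C} with hA
  have himg : C ⊆ Prod.fst '' A := fun b hb => by
    have h := (hF b hb).1.mem_fanoFamily (E := E)
    rw [← (hF b hb).2.1, ← image_fst_blowUp hE] at h
    obtain ⟨z, hz, h⟩ := h
    exact ⟨z, ⟨hz, h ▸ hb⟩, h⟩
  have hpre : IsPreconnected A := by
    refine isClosedMap_fst.isPreconnected_of_image continuous_fst (isClosed_blowUp E)
      (fun z hz => hz.1) (fun a ha y hy h => eq_of_fst_eq hE ha.1 hy (hF _ ha.2).2.2 h) ?_
    convert! hC.isPreconnected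
    exact Set.Subset.antisymm (by rintro _ ⟨z, hz, rfl⟩; exact hz.2) himg
  have hne : A.Nonempty := by
    obtain ⟨b, hb⟩ := hC.nonempty
    obtain ⟨z, hz, -⟩ := himg hb
    exact ⟨z, hz⟩
  refine (IsConnected.subset_closure ⟨hne, hpre⟩
    (fun z hz => subset_closure ⟨hz.1, hCD hz.2, (hF _ hz.2).2.2⟩)
    (closure_minimal (fun z hz => ?_) isClosed_closure))
  obtain ⟨z', hz', h⟩ := hDC _ (isClosedMap_fst _ isClosed_closure)
    (himg.trans (Set.image_mono subset_closure)) hz.2.1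
  exact eq_of_fst_eq hE hz.1 (closure_minimal (fun z hz => hz.1) (isClosed_blowUp E) hz')
    hz.2.2 h ▸ hz'

lemma isConnected_component_inl (σ : Syntheme) : IsConnected (component E (.inl σ)) := by
  obtain ⟨π, rfl⟩ := Segre.exists_frame σ
  have hfr : ∀ e, (∀ i, freeForm i e ≠ 0) → IsPlaneFrame π (-e 0 / e 2) (-e 1 / e 2) true
      (proj (dualBivector π e), (0 : ℂ)) := fun e he => by
    obtain ⟨h1, h2, h3⟩ := isGraphLine_of_free π he
    exact ⟨rfl, h1, h1.notMem_distinguished h2 h3, h2, fun _ => h3, by simp⟩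
  have hc : IsConnected {e : ℂ³ | ∀ i, freeForm i e ≠ 0} :=
    ⟨⟨![0, 0, 1], free_iff.2 (by simp)⟩, isPreconnected_offHyperplanes freeForm⟩
  refine isConnected_strictTransform hE
    (C := (fun e => (proj (dualBivector π e), (0 : ℂ))) '' {e | ∀ i, freeForm i e ≠ 0})
    (hc.image _ fun e he => ?_) ?_ ?_ fun K hK hCK b hb =>
        mem_of_isClosed_of_free hK π (fun e he => hCK ⟨e, he, rfl⟩) hb
  · refine ContinuousAt.continuousWithinAt (ContinuousAt.prodMk ?_ continuousAt_const)
    refine ContinuousAt.comp (f := dualBivector π) (continuousAt_proj fun h0 => ?_)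
      (Continuous.continuousAt ?_)
    · have h2 := (free_iff.1 he).1
      have h3 := wedge_vec π ![1, 0, -e 0 / e 2] ![0, 1, -e 1 / e 2]
      have h4 : ![1, 0, -e 0 / e 2] 0 * ![0, 1, -e 1 / e 2] 1 -
        ![1, 0, -e 0 / e 2] 1 * ![0, 1, -e 1 / e 2] 0 ≠ 0 := by simp
      refine wedge_node_ne π (Or.inl h4) ?_
      rw [h3]
      have h5 : dualBivector π ((e 2)⁻¹ • e) = (e 2)⁻¹ • dualBivector π e := by
        simp only [dualBivector, Pi.smul_apply, smul_eq_mul, smul_add, smul_smul]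
      rw [h0, smul_zero] at h5
      convert! h5 using 2
      funext k
      fin_cases k <;> simp <;> field_simp
    · unfold dualBivector; fun_prop
  · rintro _ ⟨e, he, rfl⟩
    exact ⟨onSegre_of_mem_planeLines (hfr e he).mem_planeLines, rfl, (hfr e he).notMem⟩
  · rintro _ ⟨e, he, rfl⟩; exact (hfr e he).mem_planeLines

omit hE in
/-- The linear forms on the parameters of the lines that lie in no plane. -/
def generalForm (i : Fin 6) : Dual ℂ ℂ³ := Fintype.linearCombination ℂ
  ((![![1, 0, 0], ![0, 1, 0], ![0, 0, 1], ![1, -1, 0], ![0, 1, -1], ![-1, 0, 1]] : Fin 6 → ℂ³) i)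

omit hE in
lemma isGeneral_iff {ξ : ℂ³} : (∀ i, generalForm i ξ ≠ 0) ↔ IsGeneral ξ := by
  simp [generalForm, IsGeneral, Fin.forall_fin_succ, Fintype.linearCombination_apply,
    Fin.sum_univ_three, ← sub_eq_add_neg, neg_add_eq_sub, sub_eq_zero, and_assoc]

lemma isConnected_component_inr (T : Total) : IsConnected (component E (.inr T)) := by
  obtain ⟨σ, hσ, -⟩ := Total.exists_notMem T T
  obtain ⟨π, -, rfl⟩ := exists_frame_of_notMem hσ
  let f : ℂ³ → Base := fun ξ =>
    (proj (wedge (place π (uw ξ 0)) (place π (uw 0 (conjPar ξ)))), 0)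
  have hw : ∀ ξ, IsGeneral ξ → wedge (place π (uw ξ 0)) (place π (uw 0 (conjPar ξ))) ≠ 0 := by
    intro ξ hξ
    have h := ((generalChart hE.1 π hξ).isLine (0, 0))
    have h1 := (isLine_iff.1 h).1
    rwa [show (generalChart hE.1 π hξ).V (0, 0) = _ from GeneralChart.vV_zero,
      show (generalChart hE.1 π hξ).W (0, 0) = _ from GeneralChart.vW_zero] at h1
  have hfl : ∀ ξ, IsGeneral ξ → IsLine (f ξ).1 (place π (uw ξ 0)) (place π (uw 0 (conjPar ξ))) :=
    fun ξ hξ => isLine_iff.2 ⟨hw ξ hξ, rfl⟩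
  have hmem : ∀ {b : Base}, b ∈ delPezzoLines (actTot π 2) → (∀ κ, b ∉ planeLines κ) →
      b ∈ f '' {ξ | IsGeneral ξ} := fun {b} hb hp => by
    obtain ⟨h0, hS, hT⟩ := mem_delPezzoLines_iff.1 hb
    obtain ⟨ξ, hξ, hl⟩ := hS.exists_general (fun κ h => hp κ (mem_planeLines_iff.2 ⟨h0, hS.1, h⟩))
      (hT _ ((mem_actTot 7).2 (by decide))) (hT _ ((mem_actTot 12).2 (by decide)))
    exact ⟨ξ, hξ, Prod.ext (isLine_iff.1 hl).2.symm h0.symm⟩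
  refine isConnected_strictTransform hE (C := f '' {ξ | IsGeneral ξ})
    (IsConnected.image ?_ f fun ξ hξ => ?_) ?_ ?_ fun K hK hCK b hb => ?_
  · refine ⟨⟨![1, 2, 3], by norm_num [IsGeneral, show (![1, 2, 3] : ℂ³) 2 = 3 from rfl]⟩, ?_⟩
    simpa only [isGeneral_iff] using isPreconnected_offHyperplanes generalForm
  · refine ContinuousAt.continuousWithinAt (ContinuousAt.prodMk ?_ continuousAt_const)
    refine ContinuousAt.comp (f := fun ξ => wedge (place π (uw ξ 0)) (place π (uw 0 (conjPar ξ))))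
      (continuousAt_proj (hw ξ hξ)) (continuous_wedge.comp (f := fun ξ => (_, _))
        (Continuous.prodMk ?_ ?_)).continuousAt
    · refine continuous_place π ?_ ?_ <;> fun_prop
    · refine continuous_place π ?_ ?_ <;> unfold conjPar <;> fun_prop
  · rintro _ ⟨ξ, hξ, rfl⟩
    exact ⟨onSegre_general (hfl ξ hξ), rfl,
      notMem_distinguished_of_forall (general_mem hξ (hfl ξ hξ)).2⟩
  · rintro _ ⟨ξ, hξ, rfl⟩; exact (general_mem hξ (hfl ξ hξ)).1
  · obtain ⟨z, hz, rfl⟩ := mem_image_core (E := E) hb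
    exact closure_minimal (t := Prod.fst ⁻¹' K) (fun y hy => hCK (hmem hy.2.1 hy.2.2))
      (hK.preimage continuous_fst) hz

omit hE in
lemma wedge_node₁_ne (π : 𝔖₆) {v : ℂ^2} (hv : v ≠ 0) :
    wedge (node₁ π) (place π (vec 0 ![v 0, v 1, 0])) ≠ 0 := by
  refine wedge_node_ne π ?_
  by_contra h
  simp at h
  refine hv (funext fun k => ?_)
  fin_cases k
  exacts [h.2, (sub_eq_zero.1 h.1).trans h.2]

omit hE in
lemma planeLines_inter_delPezzoLines (π : 𝔖₆) :
    planeLines (act π 0) ∩ delPezzoLines (actTot π 2) = (fun v : ℂ^2 =>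
      (proj (wedge (node₁ π) (place π (vec 0 ![v 0, v 1, 0]))), (0 : ℂ))) '' {v | v ≠ 0} := by
  ext b
  constructor
  · rintro ⟨hb, hD⟩
    have hP := (mem_planeLines_iff.1 hb).2.2
    have hn : OnLine b.1 (node₁ π) := by
      rcases node_of_meetsPl (delPezzo_isLine hD) hP (mem_delPezzoLines_iff.1 hD).2.2 with
        h | h | h | h
      · exact h.2
      all_goals exact absurd h.1 (by decide)
    obtain ⟨y, hy, hl⟩ := hn.exists_isLine fun h => by simp [node₁, place_eq_zero, vec_eq_zero] at h
    set d := halfDiff π y with hd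
    have hyd := eq_place_of_inPlane (hP y hy)
    have e : place π (vec 0 ![d 0 - d 2, d 1 - d 2, 0]) = (-d 2) • node₁ π + (1 : ℂ) • y := by
      conv_rhs => rw [hyd, node₁, place_combo, vec_combo]
      congr 2
      · simp
      · funext k; fin_cases k <;> simp [hd] <;> ring
    have hw : wedge (node₁ π) (place π (vec 0 ![d 0 - d 2, d 1 - d 2, 0])) = wedge (node₁ π) y := by
      have := wedge_combo (node₁ π) y 1 0 (-d 2) 1
      simpa [e] using this
    refine ⟨![d 0 - d 2, d 1 - d 2], fun h => (isLine_iff.1 hl).1 ?_, Prod.ext ?_ hb.1.symm⟩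
    · rw [← hw, show d 0 - d 2 = 0 from congrFun h 0, show d 1 - d 2 = 0 from congrFun h 1,
        (place_eq_zero π).2 (vec_eq_zero.2 ⟨rfl, by funext k; fin_cases k <;> rfl⟩)]
      funext i j
      simp [wedge]
    · exact (congrArg proj hw).trans (isLine_iff.1 hl).2.symm
  · rintro ⟨v, hv, rfl⟩
    have hl : IsLine (proj (wedge (node₁ π) (place π (vec 0 ![v 0, v 1, 0])))) (node₁ π)
        (place π (vec 0 ![v 0, v 1, 0])) :=
      isLine_iff.2 ⟨wedge_node₁_ne π hv, rfl⟩
    exact ⟨⟨rfl, _, _, inPlane_vec π _, inPlane_vec π _, hl⟩, mem_delPezzoLines_of_isLine hl⟩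

end Segre

lemma HasNormalCrossingChart.eq_empty_of_four {X ι : Type*} [TopologicalSpace X]
    [LocalCoordinates X] {Y : Set X} {t : X → ℂ} {S : ι → Set X} {i j k l : ι}
    (h : ∀ z ∈ S i, HasNormalCrossingChart Y t S z) (hij : i ≠ j) (hik : i ≠ k) (hil : i ≠ l)
    (hjk : j ≠ k) (hjl : j ≠ l) (hkl : k ≠ l) : S i ∩ S j ∩ S k ∩ S l = ∅ := by
  refine Set.eq_empty_of_forall_notMem fun z ⟨⟨⟨hi, hj⟩, hk⟩, hl⟩ => ?_
  obtain ⟨_, _, c, _⟩ := h z hi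
  have hc : ∀ {a b : ι} (ha : z ∈ S a) (hb : z ∈ S b), a ≠ b → c ⟨a, ha⟩ ≠ c ⟨b, hb⟩ :=
    fun _ _ hab e => hab (congrArg Subtype.val (c.injective e))
  exact (by decide : ∀ a b c d : Fin 3, ¬ (a ≠ b ∧ a ≠ c ∧ a ≠ d ∧ b ≠ c ∧ b ≠ d ∧ c ≠ d)) _ _ _ _
    ⟨hc hi hj hij, hc hi hk hik, hc hi hl hil, hc hj hk hjk, hc hj hl hjl, hc hk hl hkl⟩

namespace Segre

open ProjTop Table NodeChart

variable {E : 𝒫₆} (hE : IsAdmissible E)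
include hE

lemma isConnected_inter_inl {σ σ' : Syntheme} (hne : σ ≠ σ') :
    component E (.inl σ) ∩ component E (.inl σ') = ∅ ∨
      IsConnected (component E (.inl σ) ∩ component E (.inl σ')) := by
  rcases Set.eq_empty_or_nonempty (component E (.inl σ) ∩ component E (.inl σ')) with
    h | ⟨z, h1, h2⟩
  · exact Or.inl h
  have hz := (component_subset h1).1
  rw [mem_component_inl hE hz] at h1 h2
  rw [inter_inl hE hne ⟨h1, h2⟩]
  exact Or.inr (isConnected_fibre hE (mem_distinguished_of_mem hne h1 h2))

lemma isConnected_inter_inr (σ : Syntheme) (T : Total) :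
    component E (.inl σ) ∩ component E (.inr T) = ∅ ∨
      IsConnected (component E (.inl σ) ∩ component E (.inr T)) := by
  rcases Set.eq_empty_or_nonempty (component E (.inl σ) ∩ component E (.inr T)) with
    h | hne
  · exact Or.inl h
  refine Or.inr ⟨hne, ?_⟩
  obtain ⟨z, h1, h2⟩ := hne
  have hz := (component_subset h1).1
  rw [mem_component_inl hE hz] at h1
  obtain ⟨-, hD⟩ := component_inr_subset h2
  obtain ⟨π, rfl, rfl, -⟩ := exists_frame_of_meetsPl (delPezzo_isLine hD)
    (mem_planeLines_iff.1 h1).2.2 (mem_delPezzoLines_iff.1 hD).2.2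
  refine isClosedMap_fst.isPreconnected_of_image continuous_fst
    (isClosed_component (E := E) (Sum.inr (actTot π 2))) (fun z hz => hz.2)
    (fun a ha y hy h => injOn_fst_component_inr hE hy ha.2 h) ?_
  have himg : Prod.fst '' (component E (.inl (act π 0)) ∩ component E (.inr (actTot π 2))) =
      planeLines (act π 0) ∩ delPezzoLines (actTot π 2) := by
    rw [component_inl hE, ← image_fst_component_inr hE]
    refine Set.Subset.antisymm ?_ ?_
    · rintro _ ⟨y, hy, rfl⟩; exact ⟨hy.1.2, y, hy.2, rfl⟩
    · rintro _ ⟨hb, y, hy, rfl⟩; exact ⟨y, ⟨⟨(component_subset hy).1, hb⟩, hy⟩, rfl⟩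
  rw [himg, planeLines_inter_delPezzoLines]
  refine (isConnected_image_ne_zero fun v hv => ContinuousAt.continuousWithinAt
    (ContinuousAt.prodMk ?_ continuousAt_const)).isPreconnected
  refine ContinuousAt.comp (f := fun v : ℂ^2 => wedge (node₁ π)
    (place π (vec 0 ![v 0, v 1, 0]))) (continuousAt_proj (wedge_node₁_ne π hv))
    (continuous_wedge.comp (f := fun v => (_, _)) (continuous_const.prodMk
      (continuous_place π ?_ ?_))).continuousAt <;> fun_prop

lemma isConnected_inter {i j : Syntheme ⊕ Total} (hij : i ≠ j) :
    component E i ∩ component E j = ∅ ∨ IsConnected (component E i ∩ component E j) := by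
  rcases i with σ | T <;> rcases j with σ' | T'
  · exact isConnected_inter_inl hE fun h => hij (congrArg _ h)
  · exact isConnected_inter_inr hE σ T'
  · rw [Set.inter_comm]
    exact isConnected_inter_inr hE σ' T
  · exact Or.inl (Set.eq_empty_of_forall_notMem fun z hz =>
      hij (congrArg _ (eq_total hE hz.1 hz.2)))

lemma eq_of_mem_three {σ σ' : Syntheme} (hne : σ ≠ σ') {T : Total} {z z' : Ambient}
    (h : z ∈ component E (.inl σ) ∧ z ∈ component E (.inl σ') ∧ z ∈ component E (.inr T))
    (h' : z' ∈ component E (.inl σ) ∧ z' ∈ component E (.inl σ') ∧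
      z' ∈ component E (.inr T)) : z = z' := by
  rw [component_inl hE, component_inl hE] at h h'
  exact injOn_fst_component_inr hE h.2.2 h'.2.2
    (eq_of_mem_planeLines hne ⟨h'.1.2, h'.2.1.2⟩ ⟨h.1.2, h.2.1.2⟩)

lemma subsingleton_inter {i j k : Syntheme ⊕ Total} (hij : i ≠ j) (hik : i ≠ k) (hjk : j ≠ k) :
    (component E i ∩ component E j ∩ component E k).Subsingleton := by
  rintro z ⟨⟨hi, hj⟩, hk⟩ z' ⟨⟨hi', hj'⟩, hk'⟩
  rcases i with σ | T <;> rcases j with σ' | T' <;> rcases k with σ'' | T''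
  · rw [component_inl hE] at hi hj hk
    rcases eq_or_eq_of_mem (fun h => hij (congrArg _ h)) hi.2 hj.2 hk.2 with h | h
    exacts [absurd (congrArg _ h.symm) hik, absurd (congrArg _ h.symm) hjk]
  exacts [eq_of_mem_three hE (fun h => hij (congrArg _ h)) ⟨hi, hj, hk⟩ ⟨hi', hj', hk'⟩,
    eq_of_mem_three hE (fun h => hik (congrArg _ h)) ⟨hi, hk, hj⟩ ⟨hi', hk', hj'⟩,
    absurd (congrArg _ (eq_total hE hj hk)) hjk,
    eq_of_mem_three hE (fun h => hjk (congrArg _ h)) ⟨hj, hk, hi⟩ ⟨hj', hk', hi'⟩,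
    absurd (congrArg _ (eq_total hE hi hk)) hik,
    absurd (congrArg _ (eq_total hE hi hj)) hij,
    absurd (congrArg _ (eq_total hE hi hj)) hij]

lemma isConnected_iUnion_component : IsConnected (⋃ i, component E i) := by
  have hedge : ∀ {σ : Syntheme} {T : Total}, σ ∉ T.1 →
      (component E (.inl σ) ∩ component E (.inr T)).Nonempty := fun {σ T} h => by
    obtain ⟨π, rfl, rfl⟩ := exists_frame_of_notMem h
    obtain ⟨z, -, hf⟩ := exists_isNodeFrame_of_isLine hE
      (b := (proj (wedge (node₁ π) (node₂ π)), 0)) rfl (isLine_iff.2 ⟨wedge_nodes_ne π, rfl⟩) 0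
    exact ⟨z, (hf.mem_inl_iff hE _).2 (Or.inl rfl), hf.mem_inr hE rfl⟩
  let R : Syntheme ⊕ Total → Syntheme ⊕ Total → Prop := fun i j =>
    (component E i ∩ component E j).Nonempty
  have hTT : ∀ T T' : Total, Relation.ReflTransGen R (Sum.inr T) (Sum.inr T') := fun T T' => by
    obtain ⟨σ, h, h'⟩ := Total.exists_notMem T T'
    refine (Relation.ReflTransGen.single (b := Sum.inl σ) ?_).tail (hedge h')
    exact (hedge h).imp fun _ h => ⟨h.2, h.1⟩
  have : Nonempty (Syntheme ⊕ Total) := ⟨Sum.inl (act 1 0)⟩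
  refine IsConnected.iUnion_of_reflTransGen (fun i => ?_) fun i j => ?_
  · rcases i with σ | T
    exacts [isConnected_component_inl hE σ, isConnected_component_inr hE T]
  · change Relation.ReflTransGen R i j
    have hi : ∃ T, Relation.ReflTransGen R i (Sum.inr T) := by
      rcases i with σ | T
      · obtain ⟨T, hT⟩ := exists_total_notMem σ; exact ⟨T, .single (hedge hT)⟩
      · exact ⟨T, .refl⟩
    have hj : ∃ T, Relation.ReflTransGen R (Sum.inr T) j := by
      rcases j with σ | T
      · obtain ⟨T, hT⟩ := exists_total_notMem σ
        exact ⟨T, .single ((hedge hT).imp fun _ h => ⟨h.2, h.1⟩)⟩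
      · exact ⟨T, .refl⟩
    obtain ⟨T, hT⟩ := hi
    obtain ⟨T', hT'⟩ := hj
    exact (hT.trans (hTT T T')).trans hT'

lemma exists_isSemistableDegeneration_blowUp : ∃ ε₀ > 0, ∀ ε, 0 < ε → ε ≤ ε₀ →
    IsSemistableDegeneration ε (blowUpOver E ε) (fun z => z.1.2) (component E) := by
  refine exists_isSemistableDegeneration (continuous_snd.comp continuous_fst) (fun K hK => ?_)
    (central_fibre hE)
    (central_fibre hE ▸ isConnected_iUnion_component hE) isClosed_component
    (fun i => ?_) (fun z => hasNormalCrossingChart hE)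
    (fun i j => isConnected_inter hE) (fun i j k => subsingleton_inter hE)
    (fun i j k l => HasNormalCrossingChart.eq_empty_of_four fun z hz =>
      hasNormalCrossingChart hE (component_subset hz).1 (component_subset hz).2)
  · convert! isCompact_inter_fst (isClosed_blowUp E) (isCompact_univ.prod hK) using 2
    ext z
    simp
  · rcases i with σ | T
    exacts [isConnected_component_inl hE σ, isConnected_component_inr hE T]

/-! ## The projection to the family -/

lemma isComplexSubmanifold_delPezzoLines (T : Total) : IsComplexSubmanifold 2 (delPezzoLines T) := by
  intro b hb
  rw [← image_fst_component_inr hE] at hb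
  obtain ⟨z, hz, rfl⟩ := hb
  obtain ⟨φ, U, h⟩ := isComplexSubmanifold_component (central_fibre hE)
    (fun z => hasNormalCrossingChart hE) (Sum.inr T) z hz
  have hhol : ∀ x ∈ U, HolomorphicAt (Prod.fst ∘ φ) x := fun x hx =>
    (holomorphicAt_prod.1 (h.holomorphic x hx)).1
  refine ⟨Prod.fst ∘ φ, U, h.push subset_rfl (fun x hx => h.mapsTo hx)
    (isClosedMap_fst.isEmbedding_domRestrict continuous_fst (isClosed_component _) subset_rfl
      fun a ha y hy e => injOn_fst_component_inr hE hy ha e)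
    ⟨Set.univ, isOpen_univ, by rw [Set.inter_univ, image_fst_component_inr hE]⟩
    hhol fun x hx => ?_⟩
  exact (hasBaseSection_component_inr hE (h.mapsTo hx)).immersive_fst (h.holomorphic x hx)
    (h.continuousAt hx) (h.immersive x hx)
    ((h.isOpen.eventually_mem hx).mono fun y hy => h.mapsTo hy)

lemma exists_isHolomorphicChart_fst {ε : ℝ} {z : Ambient}
    (hY : IsComplexSubmanifold 3 (blowUpOver E ε)) (hz : z ∈ blowUpOver E ε)
    (hd : z.1 ∉ distinguished) : ∃ φ U, IsHolomorphicChart 3 (blowUpOver E ε) z φ U ∧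
      IsHolomorphicChart 3 (fanoFamily E) z.1 (fun x => (φ x).1) U := by
  obtain ⟨φ, U₀, h₀⟩ := hY z hz
  set O : Set Base := {b | ‖b.2‖ < ε ∧ b ∉ distinguished} with hO
  have hOo : IsOpen O := (isOpen_lt continuous_snd.norm continuous_const).inter
    finite_distinguished.isClosed.isOpen_compl
  have h := h₀.inter_open (hOo.preimage continuous_fst) ⟨hz.2, hd⟩ rfl
  set U := U₀ ∩ φ ⁻¹' (Prod.fst ⁻¹' O)
  have h' : IsHolomorphicChart 3 (blowUpOver E ε) z φ U :=
    h₀.restrict h.isOpen Set.inter_subset_left h.zero_mem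
  refine ⟨φ, U, h', ?_⟩
  refine h.push (p := Prod.fst) subset_rfl (fun x hx => h.mapsTo hx)
    (isClosedMap_fst.isEmbedding_domRestrict continuous_fst (isClosed_blowUp E)
      (fun y hy => hy.1.1) fun a ha y hy e => eq_of_fst_eq hE ha.1.1 hy ha.2.2 e)
    ⟨O, hOo, ?_⟩ (fun x hx => (holomorphicAt_prod.1 (h.holomorphic x hx)).1) fun x hx => ?_
  · rw [← image_fst_blowUp hE]
    refine Set.Subset.antisymm ?_ ?_
    · rintro _ ⟨y, hy, rfl⟩; exact ⟨⟨y, hy.1.1, rfl⟩, hy.2⟩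
    · rintro _ ⟨⟨y, hy, rfl⟩, hyO⟩; exact ⟨y, ⟨⟨hy, hyO.1⟩, hyO⟩, rfl⟩
  · exact (hasBaseSection_blowUp hE (h'.mapsTo hx).1 hx.2.2).immersive_fst
      (h.holomorphic x hx) (h.continuousAt hx) (h.immersive x hx)
      ((h.isOpen.eventually_mem hx).mono fun y hy => (h'.mapsTo hy).1)

lemma isSmallBlowUp {ε : ℝ} (hY : IsComplexSubmanifold 3 (blowUpOver E ε)) : IsSmallBlowUp E ε where
  maps_to z hz := blowUp_fst hz.1
  isomorphism b hb hε hd := by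
    rw [← image_fst_blowUp hE] at hb
    obtain ⟨z, hz, rfl⟩ := hb
    exact ⟨z, ⟨hz, hε⟩, rfl, fun z' hz' h => eq_of_fst_eq hE hz hz'.1 hd h,
      exists_isHolomorphicChart_fst hE hY ⟨hz, hε⟩ hd⟩
  card_distinguished := ncard_distinguished
  exceptional_line b hb := by
    refine ⟨?_, fibre_homeomorph hE hb⟩
    obtain ⟨σ, σ', hne, hσ, hσ'⟩ := exists_planes_of_distinguished hb
    rw [← inter_inl hE hne ⟨hσ, hσ'⟩]
    exact isComplexSubmanifold_inter (central_fibre hE)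
      (fun z => hasNormalCrossingChart hE) fun h => hne (Sum.inl_injective h)
  planes σ := ⟨image_fst_component_inl hE σ, fun z hz h =>
    (mem_component_inl hE hz σ).2 h.1⟩
  delPezzo T := ⟨isComplexSubmanifold_delPezzoLines hE T,
    fun z hz => (component_inr_subset hz).2, injOn_fst_component_inr hE,
    (image_fst_component_inr hE T).symm.subset⟩

end Segre

end

theorem mainTheorem5 (E : MvPolynomial (Fin 6) ℂ) (hE : E.IsHomogeneous 3)
    (hnode : ∀ q : Fin 6 → ℂ, Segre.IsNode q → MvPolynomial.eval q E ≠ 0) :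
    ∃ ε : ℝ, 0 < ε ∧ Segre.IsSmallBlowUp E ε ∧
      IsSemistableDegeneration ε (Segre.blowUpOver E ε) (fun z => z.1.2)
        (Segre.component E) := by
  obtain ⟨ε, hε, h⟩ := Segre.exists_isSemistableDegeneration_blowUp ⟨hE, hnode⟩
  have hd := h ε hε le_rfl
  exact ⟨ε, hε, Segre.isSmallBlowUp ⟨hE, hnode⟩ hd.smooth_total, hd⟩
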